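/- **Formulas.** Formulas of light linear logic (LLL) are built from literals $\alpha,\alpha^\bot$, the constants $1,\bot$, and $\otimes$, $⅋$, $\&$, $\oplus$, $!$, $?$, $\$$, $\forall$, $\exists$; negation is defined by De Morgan duality ($\$$ is self-dual). A *general $\oplus$-formula* $F_\oplus(A_1,\dots,A_p)$ ($p\ge 1$) is a formula built from $A_1,\dots,A_p$, each used once, by $\oplus$. **Nets.** A net consists of formula occurrences and links, each with a weight; a weight is a product of literals $p$, $\neg p$ over eigenweights, the empty product being $1$. An occurrence may be the conclusion of several links. Boxes contain nets; the vertices and eigenweights of the contents are local to the box. **Simple proof nets** are defined inductively; eigenweights and eigenvariables are always chosen distinct, and the eigenvariables do not occur elsewhere. (i) An axiom link with conclusions $A,A^\bot$; a link with conclusion $1$. (ii) From nets with conclusions $\Gamma,A$ and $\Delta,A^\bot$: a cut, with conclusions $\Gamma,\Delta$. From $\Gamma,A$ and $\Delta,B$: a $\otimes$-link, with conclusions $\Gamma,\Delta,A\otimes B$. (iii) From one net: a link $\bot$; a $⅋$-link; a $\oplus_1$- or $\oplus_2$-link; a $\forall$-link (the eigenvariable not occurring in the other conclusions); an $\exists$-link;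 a weakening link with conclusion $?A$; a contraction link from $n\ge 2$ premises $?A$ to $?A$. (iv) From nets with conclusions $\Gamma,A$ and $\Gamma,B$: a $\&$-link with a new eigenweight $p$ and conclusions $\Gamma,A\&B$; the occurrences of $\Gamma$ are shared and keep weight $1$, everything else in the first (second) net is multiplied by $p$ (by $\neg p$). (v) From a net with conclusions $F_\oplus(A_1,\dots,A_p),B$: a $!$-box with conclusions $?A_1,\dots,?A_p,!B$. (vi) From a net whose conclusions are any list of general $\oplus$-formulas and formulas $B_1,\dots,B_q$: a $\$$-box with conclusions $?A$ for every leaf $A$ of the general $\oplus$-formulas, and $\$B_1,\dots,\$B_q$. **Lazy cut elimination.** A cut is *ready* if it has weight $1$ and each of its two premises is the conclusion of exactly one link. One step $\Theta_1\to_{\rm lazy}\Theta_2$ is one of the following, in $\Theta_1$ or inside a box of $\Theta_1$ (at any depth). 1. A ready cut against an axiom is removed, the two remaining occurrences being identified. 2. A ready cut $1/\bot$ is removed; a ready cut $\otimes/⅋$ is replaced by two cuts. 3. A ready cut $\&/\oplus_1$ (resp. $\&/\oplus_2$): the eigenweight of the $\&$-link is set to $1$ (resp. $0$), everything that gets weight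 $0$ is deleted, and the premise that remains is cut against the premise of the $\oplus$-link. 4. A ready cut $\forall/\exists$: the witness is substituted for the eigenvariable everywhere, and the premises are cut. 5. A ready cut $\$/\$$ between two $\$$-boxes: the boxes are merged, with the cut moved inside. 6. A ready cut of the conclusion $!A$ of a $!$-box against a weakening link: both are replaced by weakening links on the auxiliary doors of the box. 7. *Contraction* (including $!$-$!$ and $!$-$\$$). A $!$-box with contents $\Theta_0$, whose conclusions are $F_\oplus(B_1,\dots,B_p)$ and $A$, is cut by a ready cut of its conclusion $!A$ against $?A^\bot$. Here $?A^\bot$ is either an auxiliary door of a box or the conclusion of a contraction link, of weight $1$, all of whose premises are auxiliary doors of $!$-boxes and $\$$-boxes; all these boxes have weight $1$. Call these auxiliary doors the *cut doors*. In each of these boxes, every general $\oplus$-formula having a cut door among its doors must be obtained, inside the box, by a *$\oplus$-chain*: a sequence of $\oplus$-links of weight $1$ from one leaf occurrence down to the general $\oplus$-formula. The chain is *non-fake* if the door of this leaf is a cut door, and *fake* otherwise. In the contractum each such chain is removed. If it is fake, the general $\oplus$-formula is replaced by its starting leaf alone. If it is non-fake, the starting leaf $A^\bot$ is cut, inside the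 box, with the conclusion $A$ of a fresh copy of $\Theta_0$, and the general $\oplus$-formula is replaced by the copy's $F_\oplus(B_1,\dots,B_p)$. The doors of the removed leaves that are not cut doors become conclusions of weakening links outside the box; the cut doors disappear. Finally, the $!$-box being gone, for each $r$ all the new doors $?B_r$, together with any finite number of weakening links on $?B_r$, are contracted to the old occurrence $?B_r$: by a contraction link if there are at least two of them; if there is exactly one, it is the old occurrence itself; if there are none, the old occurrence is introduced by weakening. 8. *Fusion*: a contraction link one of whose premises is the conclusion of exactly one link, itself a contraction link of the same weight, is merged with it. *c-w*: a premise of a contraction link that is the conclusion of exactly one link, a weakening link of the same weight, is deleted together with that weakening link; if then only one premise remains, it is identified with the conclusion and the contraction link is removed. **Theorem.** Let $\Theta_1$ be a simple proof net. If $\Theta_1\to_{\rm lazy}\Theta_2$, then $\Theta_2$ is also a simple proof net. -/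

import Mathlib

namespace LLL

/-! ## Formulas -/

/-- Formulas of light linear logic with `n` dangling bound propositional variables.  A literal is a
variable (sign `true`) or its negation (sign `false`); `lit` is a free variable named by a natural
number, `blit` refers to the `i`-th enclosing quantifier.  Genuine formulas are those with `n = 0`. -/
inductive Fm : ℕ → Type
  | lit {n : ℕ} (sign : Bool) (x : ℕ) : Fm n
  | blit {n : ℕ} (sign : Bool) (i : Fin n) : Fm n
  | one {n : ℕ} : Fm n
  | bot {n : ℕ} : Fm n
  | tensor {n : ℕ} (A B : Fm n) : Fm n
  | par {n : ℕ} (A B : Fm n) : Fm n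
  | wth {n : ℕ} (A B : Fm n) : Fm n
  | plus {n : ℕ} (A B : Fm n) : Fm n
  | bang {n : ℕ} (A : Fm n) : Fm n
  | quest {n : ℕ} (A : Fm n) : Fm n
  | neu {n : ℕ} (A : Fm n) : Fm n
  | all {n : ℕ} (A : Fm (n + 1)) : Fm n
  | ex {n : ℕ} (A : Fm (n + 1)) : Fm n
  deriving DecidableEq

abbrev Formula : Type := Fm 0

namespace Fm

/-- Linear negation. -/
def neg : {n : ℕ} → Fm n → Fm n
  | _, lit s x => lit (!s) x
  | _, blit s i => blit (!s) i
  | _, one => bot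
  | _, bot => one
  | _, tensor A B => par A.neg B.neg
  | _, par A B => tensor A.neg B.neg
  | _, wth A B => plus A.neg B.neg
  | _, plus A B => wth A.neg B.neg
  | _, bang A => quest A.neg
  | _, quest A => bang A.neg
  | _, neu A => neu A.neg
  | _, all A => ex A.neg
  | _, ex A => all A.neg

/-- `A.signed s` is `A` or its negation. -/
def signed {n : ℕ} (A : Fm n) (s : Bool) : Fm n := if s then A else A.neg

/-- Renaming of bound-variable indices. -/
def ren : {m n : ℕ} → (Fin m → Fin n) → Fm m → Fm n
  | _, _, _, lit s x => lit s x
  | _, _, f, blit s i => blit s (f i)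
  | _, _, _, one => one
  | _, _, _, bot => bot
  | _, _, f, tensor A B => tensor (A.ren f) (B.ren f)
  | _, _, f, par A B => par (A.ren f) (B.ren f)
  | _, _, f, wth A B => wth (A.ren f) (B.ren f)
  | _, _, f, plus A B => plus (A.ren f) (B.ren f)
  | _, _, f, bang A => bang (A.ren f)
  | _, _, f, quest A => quest (A.ren f)
  | _, _, f, neu A => neu (A.ren f)
  | _, _, f, all A => all (A.ren (Fin.cases 0 fun i => (f i).succ))
  | _, _, f, ex A => ex (A.ren (Fin.cases 0 fun i => (f i).succ))

/-- Simultaneous substitution of formulas for the dangling bound variables. -/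
def bind : {m n : ℕ} → (Fin m → Fm n) → Fm m → Fm n
  | _, _, _, lit s x => lit s x
  | _, _, f, blit s i => (f i).signed s
  | _, _, _, one => one
  | _, _, _, bot => bot
  | _, _, f, tensor A B => tensor (A.bind f) (B.bind f)
  | _, _, f, par A B => par (A.bind f) (B.bind f)
  | _, _, f, wth A B => wth (A.bind f) (B.bind f)
  | _, _, f, plus A B => plus (A.bind f) (B.bind f)
  | _, _, f, bang A => bang (A.bind f)
  | _, _, f, quest A => quest (A.bind f)
  | _, _, f, neu A => neu (A.bind f)
  | _, _, f, all A => all (A.bind (Fin.cases (blit true 0) fun i => (f i).ren Fin.succ))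
  | _, _, f, ex A => ex (A.bind (Fin.cases (blit true 0) fun i => (f i).ren Fin.succ))

/-- `A.inst B` is `A[B/X]`, for the body `A` of a quantified formula. -/
def inst (A : Fm 1) (B : Formula) : Formula := A.bind fun _ => B

/-- Simultaneous substitution of formulas for the free variables. -/
def fsub (φ : ℕ → Formula) : {n : ℕ} → Fm n → Fm n
  | _, lit s x => ((φ x).ren Fin.elim0).signed s
  | _, blit s i => blit s i
  | _, one => one
  | _, bot => bot
  | _, tensor A B => tensor (A.fsub φ) (B.fsub φ)
  | _, par A B => par (A.fsub φ) (B.fsub φ)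
  | _, wth A B => wth (A.fsub φ) (B.fsub φ)
  | _, plus A B => plus (A.fsub φ) (B.fsub φ)
  | _, bang A => bang (A.fsub φ)
  | _, quest A => quest (A.fsub φ)
  | _, neu A => neu (A.fsub φ)
  | _, all A => all (A.fsub φ)
  | _, ex A => ex (A.fsub φ)

/-- The free variables of a formula. -/
def vars : {n : ℕ} → Fm n → Set ℕ
  | _, lit _ x => {x}
  | _, blit _ _ => ∅
  | _, one => ∅
  | _, bot => ∅
  | _, tensor A B => A.vars ∪ B.vars
  | _, par A B => A.vars ∪ B.vars
  | _, wth A B => A.vars ∪ B.vars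
  | _, plus A B => A.vars ∪ B.vars
  | _, bang A => A.vars
  | _, quest A => A.vars
  | _, neu A => A.vars
  | _, all A => A.vars
  | _, ex A => A.vars

end Fm

/-- The free variable `x` as a formula. -/
def var (x : ℕ) : Formula := Fm.lit true x

/-! ## Formula occurrences, weights, general plus-formulas -/

/-- A formula occurrence: a vertex of a net together with the formula it carries. -/
structure Occ where
  id : ℕ
  fml : Formula
  deriving DecidableEq

/-- A weight: a boolean product of literals `p` (`(p, true)`) and `¬ p` (`(p, false)`) over
eigenweights `p`.  The empty product is the weight `1`. -/
abbrev Weight : Type := Finset (ℕ × Bool)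

/-- The weight `1`. -/
abbrev unit : Weight := ∅

/-- A general plus-formula `F⊕(A₁, …, A_p)` with `p ≥ 1`: a binary tree of `⊕` whose leaves are
`A₁, …, A_p`.  It occurs at the border of a box, so each leaf `A` also records the vertex of the
auxiliary door `?A` that belongs to it. -/
inductive PTree : Type
  | leaf (door : ℕ) (A : Formula) : PTree
  | node (l r : PTree) : PTree

namespace PTree

/-- The formula that a general plus-formula denotes. -/
def fml : PTree → Formula
  | leaf _ A => A
  | node l r => Fm.plus l.fml r.fml

/-- The auxiliary doors `?A₁, …, ?A_p`. -/
def doors : PTree → List Occ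
  | leaf x A => [⟨x, Fm.quest A⟩]
  | node l r => l.doors ++ r.doors

/-- Renaming of the door vertices and substitution in the leaves. -/
def map (i : ℕ → ℕ) (φ : ℕ → Formula) : PTree → PTree
  | leaf x A => leaf (i x) (A.fsub φ)
  | node l r => node (l.map i φ) (r.map i φ)

end PTree

/-! ## Links and nets -/

/-- The two kinds of boxes. -/
inductive Kind : Type
  | bang
  | neutral

def Kind.app : Kind → Formula → Formula
  | Kind.bang, A => Fm.bang A
  | Kind.neutral, A => Fm.neu A

/-- A box whose contents have type `β`.  `(r, t) ∈ aux` says that the conclusion of the contents at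
vertex `r` is the general plus-formula `t`; outside, it is replaced by the doors of `t`.
`(a, c) ∈ main` says that the conclusion `a` of the contents becomes, outside, the vertex `c` with
the formula `!a` or `$a`. -/
structure Box (β : Type) where
  kind : Kind
  content : β
  aux : Multiset (ℕ × PTree)
  main : Multiset (Occ × ℕ)

namespace Box

variable {β γ : Type}

/-- The auxiliary doors of a box. -/
def auxDoors (b : Box β) : Multiset Occ := b.aux.bind fun q => (q.2.doors : Multiset Occ)

/-- The principal doors of a box. -/
def mainDoors (b : Box β) : Multiset Occ :=
  b.main.map fun q => ⟨q.2, b.kind.app q.1.fml⟩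

/-- The conclusions of a box, seen from outside. -/
def outer (b : Box β) : Multiset Occ := b.auxDoors + b.mainDoors

/-- The conclusions that the contents of the box must have. -/
def inner (b : Box β) : Multiset Occ :=
  b.aux.map (fun q => ⟨q.1, q.2.fml⟩) + b.main.map Prod.fst

/-- Action on a box of a renaming `i` of the vertices outside, a substitution `φ`, and an action `g`
on the contents that does not change their vertices. -/
def map (i : ℕ → ℕ) (φ : ℕ → Formula) (g : β → γ) (b : Box β) : Box γ where
  kind := b.kind
  content := g b.content
  aux := b.aux.map fun q => (q.1, q.2.map i φ)
  main := b.main.map fun q => (⟨q.1.id, q.1.fml.fsub φ⟩, i q.2)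

end Box

/-- Links, with their premises first and their conclusions last.  `β` is the type of the contents of
boxes; `wth p` carries its eigenweight, `all x` its eigenvariable and `ex B` its witness. -/
inductive Link (β : Type) : Type
  | ax (a b : Occ) : Link β
  | cut (a b : Occ) : Link β
  | one (c : Occ) : Link β
  | bot (c : Occ) : Link β
  | tensor (a b c : Occ) : Link β
  | par (a b c : Occ) : Link β
  | wth (p : ℕ) (a b c : Occ) : Link β
  | plus₁ (a c : Occ) : Link β
  | plus₂ (b c : Occ) : Link β
  | all (x : ℕ) (a c : Occ) : Link β
  | ex (B : Formula) (a c : Occ) : Link β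
  | weak (c : Occ) : Link β
  | contr (as : Multiset Occ) (c : Occ) : Link β
  | box (b : Box β) : Link β

/-- Action of a renaming of vertices and of a substitution on an occurrence. -/
def Occ.map (i : ℕ → ℕ) (φ : ℕ → Formula) (a : Occ) : Occ := ⟨i a.id, a.fml.fsub φ⟩

namespace Link

variable {β γ : Type}

/-- The conclusions of a link. -/
def concls : Link β → Multiset Occ
  | ax a b => {a, b}
  | cut _ _ => 0
  | one c => {c}
  | bot c => {c}
  | tensor _ _ c => {c}
  | par _ _ c => {c}
  | wth _ _ _ c => {c}
  | plus₁ _ c => {c}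
  | plus₂ _ c => {c}
  | all _ _ c => {c}
  | ex _ _ c => {c}
  | weak c => {c}
  | contr _ c => {c}
  | box b => b.outer

/-- The link is the cut between `a` and `b` (in either order). -/
def IsCut (l : Link β) (a b : Occ) : Prop := l = cut a b ∨ l = cut b a

/-- The link is the axiom with conclusions `a` and `b` (in either order). -/
def IsAx (l : Link β) (a b : Occ) : Prop := l = ax a b ∨ l = ax b a

/-- The eigenweights of a link: one for a `&`-link, none otherwise. -/
def eigenweights : Link β → Set ℕ
  | wth p _ _ _ => {p}
  | _ => ∅

/-- The eigenvariables bound by a link or inside it, given those inside the contents of boxes. -/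
def evars (ev : β → Set ℕ) : Link β → Set ℕ
  | all x _ _ => {x}
  | box b => ev b.content
  | _ => ∅

/-- The variables that a link mentions besides those of its premises and conclusions. -/
def vars (v : β → Set ℕ) : Link β → Set ℕ
  | all x _ _ => {x}
  | ex B _ _ => B.vars
  | box b => v b.content
  | _ => ∅

/-- Action on a link of a renaming `i` of vertices, a renaming `w` of eigenweights, a renaming `e` of
eigenvariables, a substitution `φ` and an action `g` on the contents of boxes. -/
def map (i w e : ℕ → ℕ) (φ : ℕ → Formula) (g : β → γ) : Link β → Link γ
  | ax a b => ax (a.map i φ) (b.map i φ)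
  | cut a b => cut (a.map i φ) (b.map i φ)
  | one c => one (c.map i φ)
  | bot c => bot (c.map i φ)
  | tensor a b c => tensor (a.map i φ) (b.map i φ) (c.map i φ)
  | par a b c => par (a.map i φ) (b.map i φ) (c.map i φ)
  | wth p a b c => wth (w p) (a.map i φ) (b.map i φ) (c.map i φ)
  | plus₁ a c => plus₁ (a.map i φ) (c.map i φ)
  | plus₂ b c => plus₂ (b.map i φ) (c.map i φ)
  | all x a c => all (e x) (a.map i φ) (c.map i φ)
  | ex B a c => ex (B.fsub φ) (a.map i φ) (c.map i φ)
  | weak c => weak (c.map i φ)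
  | contr as c => contr (as.map (Occ.map i φ)) (c.map i φ)
  | box b => box (b.map i φ g)

end Link

/-- A net whose boxes have contents in `β`: weighted formula occurrences, weighted links and
conclusions.  The same occurrence may be the conclusion of several links. -/
structure PreNet (β : Type) where
  forms : Multiset (Occ × Weight)
  links : Multiset (Link β × Weight)
  concl : Multiset Occ

/-- Contents of boxes: nothing at level `0`, nets whose boxes have contents of level `d` at level
`d + 1`. -/
def Con : ℕ → Type
  | 0 => Empty
  | d + 1 => PreNet (Con d)

/-- Nets of depth at most `d`, the depth being the maximal nesting of boxes. -/
abbrev Net (d : ℕ) : Type := PreNet (Con d)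

namespace PreNet

variable {β γ : Type}

/-- The vertices of a net (outside its boxes; the contents of a box have their own vertices). -/
def ids (N : PreNet β) : Set ℕ := {n | ∃ f ∈ N.forms, f.1.id = n}

/-- The eigenweights of a net (outside its boxes; the contents of a box have their own). -/
def eigenweights (N : PreNet β) : Set ℕ := {p | ∃ l ∈ N.links, p ∈ l.1.eigenweights}

def evarsWith (ev : β → Set ℕ) (N : PreNet β) : Set ℕ := {x | ∃ l ∈ N.links, x ∈ l.1.evars ev}

def varsWith (v : β → Set ℕ) (N : PreNet β) : Set ℕ :=
  {x | (∃ f ∈ N.forms, x ∈ f.1.fml.vars) ∨ ∃ l ∈ N.links, x ∈ l.1.vars v}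

/-- Action of renamings and substitutions on a net; the eigenweights occurring in the weights are
renamed too. -/
def mapWith (i w e : ℕ → ℕ) (φ : ℕ → Formula) (g : β → γ) (N : PreNet β) : PreNet γ where
  forms := N.forms.map fun f => (f.1.map i φ, f.2.image (Prod.map w id))
  links := N.links.map fun l => (l.1.map i w e φ g, l.2.image (Prod.map w id))
  concl := N.concl.map (Occ.map i φ)

end PreNet

/-- The eigenvariables, at any depth. -/
def Con.evars : (d : ℕ) → Con d → Set ℕ
  | 0 => fun _ => ∅
  | d + 1 => fun N => PreNet.evarsWith (Con.evars d) N

/-- All variables, at any depth. -/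
def Con.vars : (d : ℕ) → Con d → Set ℕ
  | 0 => fun _ => ∅
  | d + 1 => fun N => PreNet.varsWith (Con.vars d) N

/-- Renaming of eigenvariables and substitution in the contents of a box. -/
def Con.map (e : ℕ → ℕ) (φ : ℕ → Formula) : (d : ℕ) → Con d → Con d
  | 0 => fun x => x
  | d + 1 => fun N => PreNet.mapWith id id e φ (Con.map e φ d) N

namespace Net

variable {d : ℕ}

/-- The eigenvariables of a net, including those inside its boxes. -/
def evars (N : Net d) : Set ℕ := N.evarsWith (Con.evars d)

/-- The variables occurring in a net, including those inside its boxes. -/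
def vars (N : Net d) : Set ℕ := N.varsWith (Con.vars d)

/-- Renaming of the vertices (by `i`) and eigenweights (by `w`) of a net and of its eigenvariables at
any depth (by `e`), together with a substitution `φ` for the free variables of its formulas. -/
def map (i w e : ℕ → ℕ) (φ : ℕ → Formula) (N : Net d) : Net d :=
  N.mapWith i w e φ (Con.map e φ d)

/-- Two nets have no vertices and no eigenweights in common, and no eigenvariable of one occurs in the
other. -/
def Apart (M N : Net d) : Prop :=
  Disjoint M.ids N.ids ∧ Disjoint M.eigenweights N.eigenweights ∧
    Disjoint (evars M) (vars N) ∧ Disjoint (vars M) (evars N)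

/-- `c` is a new vertex, carrying a formula in which no eigenvariable of `N` occurs. -/
def Fresh (c : Occ) (N : Net d) : Prop := c.id ∉ N.ids ∧ Disjoint c.fml.vars (evars N)

end Net

/-- The variables of the formulas in a multiset of conclusions. -/
def conclVars (Γ : Multiset Occ) : Set ℕ := {x | ∃ a ∈ Γ, x ∈ a.fml.vars}

/-- Give weight `1` to every item. -/
def atUnit {α : Type} (s : Multiset α) : Multiset (α × Weight) := s.map fun a => (a, unit)

/-- Multiply all weights by the literal `q`. -/
def scale {α : Type} (q : ℕ × Bool) (s : Multiset (α × Weight)) : Multiset (α × Weight) :=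
  s.map fun a => (a.1, insert q a.2)

/-- Give the value `1` to the literal `q`: items whose weight contains the opposite literal become `0`
and disappear, and `q` is deleted from the other weights. -/
def restrict {α : Type} (q : ℕ × Bool) (s : Multiset (α × Weight)) : Multiset (α × Weight) :=
  (s.filter fun a => (q.1, !q.2) ∉ a.2).map fun a => (a.1, a.2.erase q)

/-- Add to a net a link `l` of weight `1` with the single conclusion `c`, replacing the conclusions
by `Γ` together with `c`. -/
def PreNet.extend {β : Type} (N : PreNet β) (l : Link β) (c : Occ) (Γ : Multiset Occ) : PreNet β :=
  ⟨(c, unit) ::ₘ N.forms, (l, unit) ::ₘ N.links, c ::ₘ Γ⟩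

/-! ## Simple proof nets -/

/-- Simple proof nets, defined inductively. -/
inductive Simple : {d : ℕ} → Net d → Prop
  | ax {d : ℕ} (a b : Occ) (hab : a.id ≠ b.id) (hf : b.fml = a.fml.neg) :
      Simple (⟨atUnit {a, b}, {(Link.ax a b, unit)}, {a, b}⟩ : Net d)
  | cut {d : ℕ} {M N : Net d} {Γ Δ : Multiset Occ} (a b : Occ) (hM : Simple M) (hN : Simple N)
      (hap : Net.Apart M N) (ha : M.concl = a ::ₘ Γ) (hb : N.concl = b ::ₘ Δ)
      (hf : b.fml = a.fml.neg) :
      Simple (⟨M.forms + N.forms, (Link.cut a b, unit) ::ₘ (M.links + N.links), Γ + Δ⟩ : Net d)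
  | one {d : ℕ} (c : Occ) (hf : c.fml = Fm.one) :
      Simple (⟨atUnit {c}, {(Link.one c, unit)}, {c}⟩ : Net d)
  | bot {d : ℕ} {N : Net d} (c : Occ) (hN : Simple N) (hc : Net.Fresh c N) (hf : c.fml = Fm.bot) :
      Simple (N.extend (Link.bot c) c N.concl)
  | tensor {d : ℕ} {M N : Net d} {Γ Δ : Multiset Occ} (a b c : Occ) (hM : Simple M)
      (hN : Simple N) (hap : Net.Apart M N) (ha : M.concl = a ::ₘ Γ) (hb : N.concl = b ::ₘ Δ)
      (hcM : Net.Fresh c M) (hcN : Net.Fresh c N) (hf : c.fml = Fm.tensor a.fml b.fml) :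
      Simple (⟨(c, unit) ::ₘ (M.forms + N.forms),
        (Link.tensor a b c, unit) ::ₘ (M.links + N.links), c ::ₘ (Γ + Δ)⟩ : Net d)
  | par {d : ℕ} {N : Net d} {Γ : Multiset Occ} (a b c : Occ) (hN : Simple N)
      (h : N.concl = a ::ₘ b ::ₘ Γ) (hc : Net.Fresh c N) (hf : c.fml = Fm.par a.fml b.fml) :
      Simple (N.extend (Link.par a b c) c Γ)
  /-- The context `Γ` is shared: its occurrences are the common vertices of the two nets, and keep
  the weight `1`; everything else in the two nets is multiplied by `p` and by `¬ p`. -/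
  | wth {d : ℕ} {M N : Net d} {Γ : Multiset Occ} {F G : Multiset (Occ × Weight)} (p : ℕ)
      (a b c : Occ) (hM : Simple M) (hN : Simple N) (ha : M.concl = a ::ₘ Γ)
      (hb : N.concl = b ::ₘ Γ) (hF : M.forms = atUnit Γ + F) (hG : N.forms = atUnit Γ + G)
      (hFG : ∀ f ∈ F, ∀ g ∈ G, f.1.id ≠ g.1.id)
      (hw : Disjoint M.eigenweights N.eigenweights)
      (hpM : p ∉ M.eigenweights) (hpN : p ∉ N.eigenweights)
      (hMN : Disjoint (Net.evars M) (Net.vars N)) (hNM : Disjoint (Net.vars M) (Net.evars N))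
      (hcM : Net.Fresh c M) (hcN : Net.Fresh c N) (hf : c.fml = Fm.wth a.fml b.fml) :
      Simple (⟨(c, unit) ::ₘ (atUnit Γ + scale (p, true) F + scale (p, false) G),
        (Link.wth p a b c, unit) ::ₘ (scale (p, true) M.links + scale (p, false) N.links),
        c ::ₘ Γ⟩ : Net d)
  | plus₁ {d : ℕ} {N : Net d} {Γ : Multiset Occ} (a c : Occ) (B : Formula) (hN : Simple N)
      (h : N.concl = a ::ₘ Γ) (hc : Net.Fresh c N) (hf : c.fml = Fm.plus a.fml B) :
      Simple (N.extend (Link.plus₁ a c) c Γ)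
  | plus₂ {d : ℕ} {N : Net d} {Γ : Multiset Occ} (b c : Occ) (A : Formula) (hN : Simple N)
      (h : N.concl = b ::ₘ Γ) (hc : Net.Fresh c N) (hf : c.fml = Fm.plus A b.fml) :
      Simple (N.extend (Link.plus₂ b c) c Γ)
  | all {d : ℕ} {N : Net d} {Γ : Multiset Occ} (x : ℕ) (a c : Occ) (A : Fm 1) (hN : Simple N)
      (h : N.concl = a ::ₘ Γ) (hc : Net.Fresh c N) (hf : c.fml = Fm.all A)
      (ha : a.fml = A.inst (var x)) (hxA : x ∉ A.vars) (hxΓ : x ∉ conclVars Γ)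
      (hxN : x ∉ Net.evars N) :
      Simple (N.extend (Link.all x a c) c Γ)
  | ex {d : ℕ} {N : Net d} {Γ : Multiset Occ} (B : Formula) (a c : Occ) (A : Fm 1)
      (hN : Simple N) (h : N.concl = a ::ₘ Γ) (hc : Net.Fresh c N) (hf : c.fml = Fm.ex A)
      (ha : a.fml = A.inst B) (hB : Disjoint B.vars (Net.evars N)) :
      Simple (N.extend (Link.ex B a c) c Γ)
  | weak {d : ℕ} {N : Net d} (c : Occ) (A : Formula) (hN : Simple N) (hc : Net.Fresh c N)
      (hf : c.fml = Fm.quest A) :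
      Simple (N.extend (Link.weak c) c N.concl)
  | contr {d : ℕ} {N : Net d} {Γ : Multiset Occ} (as : Multiset Occ) (c : Occ) (A : Formula)
      (hN : Simple N) (h : N.concl = as + Γ) (has : 2 ≤ Multiset.card as)
      (hfa : ∀ a ∈ as, a.fml = Fm.quest A) (hf : c.fml = Fm.quest A) (hc : Net.Fresh c N) :
      Simple (N.extend (Link.contr as c) c Γ)
  /-- A `!`-box has contents with the two conclusions `F⊕(A₁, …, A_p)` and `B`; a `$`-box has
  contents with any list of general plus-formulas and any list of other conclusions. -/
  | box {d : ℕ} {N : Net d} (k : Kind) (aux : Multiset (ℕ × PTree)) (main : Multiset (Occ × ℕ))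
      (hN : Simple N) (h : N.concl = Box.inner (⟨k, N, aux, main⟩ : Box (Con (d + 1))))
      (hk : k = Kind.bang → Multiset.card aux = 1 ∧ Multiset.card main = 1)
      (hid : ((Box.outer (⟨k, N, aux, main⟩ : Box (Con (d + 1)))).map Occ.id).Nodup) :
      Simple (⟨atUnit (Box.outer (⟨k, N, aux, main⟩ : Box (Con (d + 1)))),
        {(Link.box ⟨k, N, aux, main⟩, unit)},
        Box.outer (⟨k, N, aux, main⟩ : Box (Con (d + 1)))⟩ : Net (d + 1))

/-! ## Lazy cut elimination -/

/-- The cut between `a` and `b` is ready: it has weight `1` and both of its premises are the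
conclusion of exactly one link. -/
def Ready {d : ℕ} (N : Net d) (k : Link (Con d)) (a b : Occ) : Prop :=
  k.IsCut a b ∧ (k, unit) ∈ N.links ∧
    N.links.countP (fun l => a ∈ l.1.concls) = 1 ∧ N.links.countP (fun l => b ∈ l.1.concls) = 1

/-- Rename the vertex `m` to `n`. -/
def moveId (m n : ℕ) : ℕ → ℕ := fun x => if x = m then n else x

/-- Rename the vertex `m` to `n` in links. -/
def moveLinks {d : ℕ} (m n : ℕ) (L : Multiset (Link (Con d) × Weight)) :
    Multiset (Link (Con d) × Weight) :=
  L.map fun l => (l.1.map (moveId m n) id id var id, l.2)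

/-- Several occurrences `xs` of one formula are contracted to the occurrence `z`, by means of the
weighted links `L`; `F` are the weighted occurrences involved.  There is nothing to contract if
`xs` is `z` itself, and `z` is introduced by weakening if `xs` is empty. -/
inductive Gather {d : ℕ} : Multiset Occ → Occ → Multiset (Link (Con d) × Weight) →
    Multiset (Occ × Weight) → Prop
  | none (z : Occ) : Gather 0 z {(Link.weak z, unit)} {(z, unit)}
  | single (z : Occ) : Gather {z} z 0 {(z, unit)}
  | many (xs : Multiset Occ) (z : Occ) (h : 2 ≤ Multiset.card xs) :
      Gather xs z {(Link.contr xs z, unit)} ((z, unit) ::ₘ atUnit xs)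

/-- `Chain t r x A u L F`: there is a chain of `⊕`-links of weight `1` from the leaf `A` (with door
`x`) of the general plus-formula `t`, at the vertex `u`, down to `t`, at the vertex `r`.  `L` are the
links of the chain and `F` the occurrences strictly below the leaf. -/
inductive Chain {d : ℕ} : PTree → ℕ → ℕ → Formula → ℕ → Multiset (Link (Con d) × Weight) →
    Multiset (Occ × Weight) → Prop
  | leaf (x : ℕ) (A : Formula) (r : ℕ) : Chain (PTree.leaf x A) r x A r 0 0
  | left {s t : PTree} {v x u : ℕ} {A : Formula} {L : Multiset (Link (Con d) × Weight)}
      {F : Multiset (Occ × Weight)} (r : ℕ) (h : Chain s v x A u L F) :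
      Chain (PTree.node s t) r x A u
        ((Link.plus₁ ⟨v, s.fml⟩ ⟨r, (PTree.node s t).fml⟩, unit) ::ₘ L)
        ((⟨r, (PTree.node s t).fml⟩, unit) ::ₘ F)
  | right {s t : PTree} {v x u : ℕ} {A : Formula} {L : Multiset (Link (Con d) × Weight)}
      {F : Multiset (Occ × Weight)} (r : ℕ) (h : Chain t v x A u L F) :
      Chain (PTree.node s t) r x A u
        ((Link.plus₂ ⟨v, t.fml⟩ ⟨r, (PTree.node s t).fml⟩, unit) ::ₘ L)
        ((⟨r, (PTree.node s t).fml⟩, unit) ::ₘ F)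

/-- A copy of the contents of a box: a renaming of its auxiliary doors and the copied net. -/
structure Copy (d : ℕ) where
  door : ℕ → ℕ
  net : Net d

/-- Let `Θ₀` be the contents of a `!`-box, with conclusions the general plus-formula `t₀` (at the
vertex `r₀`) and `a₀`.  `Absorb Θ₀ r₀ t₀ a₀ Θ aux X Θ' aux' W cs` says how this box is absorbed by a
box with contents `Θ` and general plus-formulas `aux`, of which the auxiliary doors `X` were
connected with the `!`-box.  The new box has contents `Θ'` and general plus-formulas `aux'`, the
auxiliary doors `W` are now to be introduced by weakening, and `cs` are the copies of `Θ₀` used.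
* A general plus-formula none of whose doors is in `X` is left alone.
* Any other must come from a `⊕`-chain, which is removed.
  * If the chain is fake, that is, starts from a leaf whose door is not in `X`, then only this door
    of the general plus-formula is kept.
  * If the chain is non-fake, that is, starts from a leaf whose door is in `X`, then this leaf is cut
    against a copy of `Θ₀`, and the doors of (a copy of) `t₀` are new auxiliary doors. -/
inductive Absorb {d : ℕ} (Θ₀ : Net d) (r₀ : ℕ) (t₀ : PTree) (a₀ : Occ) :
    Net d → Multiset (ℕ × PTree) → Multiset Occ → Net d → Multiset (ℕ × PTree) →
      Multiset Occ → List (Copy d) → Prop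
  | nil (Θ : Net d) : Absorb Θ₀ r₀ t₀ a₀ Θ 0 0 Θ 0 0 []
  | keep {Θ Θ' : Net d} {aux aux' : Multiset (ℕ × PTree)} {X W : Multiset Occ}
      {cs : List (Copy d)} (r : ℕ) (t : PTree)
      (h : Absorb Θ₀ r₀ t₀ a₀ Θ aux X Θ' aux' W cs) :
      Absorb Θ₀ r₀ t₀ a₀ Θ ((r, t) ::ₘ aux) X Θ' ((r, t) ::ₘ aux') W cs
  | fake {Θ : Net d} {aux aux' : Multiset (ℕ × PTree)} {X W : Multiset Occ}
      {cs : List (Copy d)} {F FC : Multiset (Occ × Weight)}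
      {L LC : Multiset (Link (Con d) × Weight)} {Γ J V : Multiset Occ} (r : ℕ) (t : PTree)
      (x u : ℕ) (A : Formula)
      (h : Absorb Θ₀ r₀ t₀ a₀ Θ aux X ⟨FC + F, LC + L, ⟨r, t.fml⟩ ::ₘ Γ⟩ aux' W cs)
      (hchain : Chain t r x A u LC FC)
      (hJ : J ≠ 0) (hdoors : (t.doors : Multiset Occ) = J + ⟨x, Fm.quest A⟩ ::ₘ V) :
      Absorb Θ₀ r₀ t₀ a₀ Θ ((r, t) ::ₘ aux) (J + X) ⟨F, L, ⟨u, A⟩ ::ₘ Γ⟩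
        ((u, PTree.leaf x A) ::ₘ aux') (V + W) cs
  | nonfake {Θ Θc : Net d} {aux aux' : Multiset (ℕ × PTree)} {X W : Multiset Occ}
      {cs : List (Copy d)} {F FC : Multiset (Occ × Weight)}
      {L LC : Multiset (Link (Con d) × Weight)} {Γ J V : Multiset Occ} (r : ℕ) (t : PTree)
      (x u : ℕ) (A : Formula) (door : ℕ → ℕ) (i w e : Equiv.Perm ℕ)
      (h : Absorb Θ₀ r₀ t₀ a₀ Θ aux X ⟨FC + F, LC + L, ⟨r, t.fml⟩ ::ₘ Γ⟩ aux' W cs)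
      (hchain : Chain t r x A u LC FC)
      (hdoors : (t.doors : Multiset Occ) = ⟨x, Fm.quest A⟩ ::ₘ J + V)
      (hcopy : Θc = Θ₀.map i w e (fun y => var (e y)))
      (hfix : ∀ y ∈ Net.vars Θ₀, y ∉ Net.evars Θ₀ → e y = y)
      (hid : Disjoint Θc.ids (⟨FC + F, LC + L, ⟨r, t.fml⟩ ::ₘ Γ⟩ : Net d).ids)
      (hew : Disjoint Θc.eigenweights
        (⟨FC + F, LC + L, ⟨r, t.fml⟩ ::ₘ Γ⟩ : Net d).eigenweights) :
      Absorb Θ₀ r₀ t₀ a₀ Θ ((r, t) ::ₘ aux) (⟨x, Fm.quest A⟩ ::ₘ J + X)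
        ⟨F + Θc.forms, (Link.cut ⟨u, A⟩ ⟨i a₀.id, a₀.fml⟩, unit) ::ₘ (L + Θc.links),
          ⟨i r₀, t₀.fml⟩ ::ₘ Γ⟩
        ((i r₀, t₀.map door var) ::ₘ aux') (V + W) (⟨door, Θc⟩ :: cs)

/-- The `!`-box is absorbed by each box of a list, through at least one auxiliary door of each. -/
inductive AbsorbAll {d : ℕ} (Θ₀ : Net d) (r₀ : ℕ) (t₀ : PTree) (a₀ : Occ) :
    List (Box (Con (d + 1))) → Multiset Occ → List (Box (Con (d + 1))) → Multiset Occ →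
      List (Copy d) → Prop
  | nil : AbsorbAll Θ₀ r₀ t₀ a₀ [] 0 [] 0 []
  | cons {bs bs' : List (Box (Con (d + 1)))} {Xs Ws X W : Multiset Occ} {css cs : List (Copy d)}
      {Θ Θ' : Net d} {aux aux' : Multiset (ℕ × PTree)} (k : Kind) (main : Multiset (Occ × ℕ))
      (h : AbsorbAll Θ₀ r₀ t₀ a₀ bs Xs bs' Ws css)
      (hb : Absorb Θ₀ r₀ t₀ a₀ Θ aux X Θ' aux' W cs) (hX : X ≠ 0) :
      AbsorbAll Θ₀ r₀ t₀ a₀ (⟨k, Θ, aux, main⟩ :: bs) (X + Xs) (⟨k, Θ', aux', main⟩ :: bs')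
        (W + Ws) (cs ++ css)

/-- For every old auxiliary door `z` of the copied box, the corresponding doors of the copies, and
possibly some weakening links `ws`, are contracted to `z`. -/
inductive Merge {d : ℕ} (cs : List (Copy d)) : List Occ →
    Multiset (Link (Con (d + 1)) × Weight) → Multiset (Occ × Weight) → Prop
  | nil : Merge cs [] 0 0
  | cons {zs : List Occ} {L L₁ : Multiset (Link (Con (d + 1)) × Weight)}
      {F F₁ : Multiset (Occ × Weight)} (z : Occ) (ws : Multiset Occ)
      (h : Merge cs zs L F) (hws : ∀ y ∈ ws, y.fml = z.fml)
      (hg : Gather (((cs.map fun q => (⟨q.door z.id, z.fml⟩ : Occ)) : Multiset Occ) + ws)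
        z L₁ F₁) :
      Merge cs (z :: zs) (L₁ + atUnit (ws.map Link.weak) + L) (F₁ + F)

/-- One step of lazy cut elimination. -/
inductive LazyStep : {d : ℕ} → Net d → Net d → Prop
  | ax {d : ℕ} {F : Multiset (Occ × Weight)} {L : Multiset (Link (Con d) × Weight)}
      {Γ : Multiset Occ} (k l : Link (Con d)) (x y z : Occ) (hl : l.IsAx x y) (hxz : x.id ≠ z.id)
      (hr : Ready ⟨(y, unit) ::ₘ (z, unit) ::ₘ F, (k, unit) ::ₘ (l, unit) ::ₘ L, Γ⟩ k y z) :
      LazyStep ⟨(y, unit) ::ₘ (z, unit) ::ₘ F, (k, unit) ::ₘ (l, unit) ::ₘ L, Γ⟩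
        ⟨F, moveLinks z.id x.id L, Γ⟩
  | unit {d : ℕ} {N : Net d} {F : Multiset (Occ × Weight)} {L : Multiset (Link (Con d) × Weight)}
      (k : Link (Con d)) (c z : Occ) (hr : Ready N k c z)
      (hF : N.forms = (c, unit) ::ₘ (z, unit) ::ₘ F)
      (hL : N.links = (k, unit) ::ₘ (Link.one c, unit) ::ₘ (Link.bot z, unit) ::ₘ L) :
      LazyStep N ⟨F, L, N.concl⟩
  | tensor {d : ℕ} {N : Net d} {F : Multiset (Occ × Weight)}
      {L : Multiset (Link (Con d) × Weight)} (k : Link (Con d)) (a b c x y z : Occ)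
      (hr : Ready N k c z) (hF : N.forms = (c, unit) ::ₘ (z, unit) ::ₘ F)
      (hL : N.links = (k, unit) ::ₘ (Link.tensor a b c, unit) ::ₘ (Link.par x y z, unit) ::ₘ L) :
      LazyStep N ⟨F, (Link.cut a x, unit) ::ₘ (Link.cut b y, unit) ::ₘ L, N.concl⟩
  | plus₁ {d : ℕ} {N : Net d} {F : Multiset (Occ × Weight)}
      {L : Multiset (Link (Con d) × Weight)} (k : Link (Con d)) (p : ℕ) (a b c x z : Occ)
      (hr : Ready N k c z) (hF : N.forms = (c, unit) ::ₘ (z, unit) ::ₘ F)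
      (hL : N.links = (k, unit) ::ₘ (Link.wth p a b c, unit) ::ₘ (Link.plus₁ x z, unit) ::ₘ L) :
      LazyStep N ⟨restrict (p, true) F, (Link.cut a x, unit) ::ₘ restrict (p, true) L, N.concl⟩
  | plus₂ {d : ℕ} {N : Net d} {F : Multiset (Occ × Weight)}
      {L : Multiset (Link (Con d) × Weight)} (k : Link (Con d)) (p : ℕ) (a b c x z : Occ)
      (hr : Ready N k c z) (hF : N.forms = (c, unit) ::ₘ (z, unit) ::ₘ F)
      (hL : N.links = (k, unit) ::ₘ (Link.wth p a b c, unit) ::ₘ (Link.plus₂ x z, unit) ::ₘ L) :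
      LazyStep N ⟨restrict (p, false) F, (Link.cut b x, unit) ::ₘ restrict (p, false) L, N.concl⟩
  /-- The witness `B` is substituted for the eigenvariable `v` in the whole net. -/
  | quant {d : ℕ} {N : Net d} {F : Multiset (Occ × Weight)}
      {L : Multiset (Link (Con d) × Weight)} (k : Link (Con d)) (v : ℕ) (B : Formula)
      (a c x z : Occ) (hr : Ready N k c z) (hF : N.forms = (c, unit) ::ₘ (z, unit) ::ₘ F)
      (hL : N.links = (k, unit) ::ₘ (Link.all v a c, unit) ::ₘ (Link.ex B x z, unit) ::ₘ L) :
      LazyStep N (Net.map id id id (Function.update var v B)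
        ⟨F, (Link.cut a x, unit) ::ₘ L, N.concl⟩)
  /-- Two `$`-boxes are merged; vertices and eigenweights of the second are renamed apart. -/
  | neutral {d : ℕ} {N : Net (d + 1)} {F : Multiset (Occ × Weight)}
      {L : Multiset (Link (Con (d + 1)) × Weight)} (k : Link (Con (d + 1))) (Θ₁ Θ₂ Θ₃ : Net d)
      (aux₁ aux₂ : Multiset (ℕ × PTree)) (main₁ main₂ : Multiset (Occ × ℕ)) (a x : Occ) (c z : ℕ)
      (Γ₁ Γ₂ : Multiset Occ) (i w : Equiv.Perm ℕ)
      (hr : Ready N k ⟨c, Fm.neu a.fml⟩ ⟨z, Fm.neu x.fml⟩)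
      (hF : N.forms = (⟨c, Fm.neu a.fml⟩, unit) ::ₘ (⟨z, Fm.neu x.fml⟩, unit) ::ₘ F)
      (hL : N.links = (k, unit) ::ₘ
        (Link.box ⟨Kind.neutral, Θ₁, aux₁, (a, c) ::ₘ main₁⟩, unit) ::ₘ
        (Link.box ⟨Kind.neutral, Θ₂, aux₂, (x, z) ::ₘ main₂⟩, unit) ::ₘ L)
      (h₁ : Θ₁.concl = a ::ₘ Γ₁) (h₂ : Θ₂.concl = x ::ₘ Γ₂)
      (h₃ : Θ₃ = Θ₂.map i w id var)
      (hid : Disjoint Θ₁.ids Θ₃.ids) (hew : Disjoint Θ₁.eigenweights Θ₃.eigenweights) :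
      LazyStep N ⟨F, (Link.box ⟨Kind.neutral,
          (⟨Θ₁.forms + Θ₃.forms,
            (Link.cut a ⟨i x.id, x.fml⟩, unit) ::ₘ (Θ₁.links + Θ₃.links),
            Γ₁ + Γ₂.map fun y => ⟨i y.id, y.fml⟩⟩ : Net d),
          aux₁ + aux₂.map (fun q => (i q.1, q.2)),
          main₁ + main₂.map (fun q => (⟨i q.1.id, q.1.fml⟩, q.2))⟩, unit) ::ₘ L, N.concl⟩
  | weak {d : ℕ} {N : Net (d + 1)} {F : Multiset (Occ × Weight)}
      {L : Multiset (Link (Con (d + 1)) × Weight)} (k : Link (Con (d + 1))) (Θ₀ : Net d)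
      (r₀ : ℕ) (t₀ : PTree) (a₀ : Occ) (c : ℕ) (z : Occ)
      (hr : Ready N k ⟨c, Fm.bang a₀.fml⟩ z)
      (hF : N.forms = (⟨c, Fm.bang a₀.fml⟩, unit) ::ₘ (z, unit) ::ₘ F)
      (hL : N.links = (k, unit) ::ₘ
        (Link.box ⟨Kind.bang, Θ₀, {(r₀, t₀)}, {(a₀, c)}⟩, unit) ::ₘ (Link.weak z, unit) ::ₘ L) :
      LazyStep N ⟨F, atUnit ((t₀.doors : Multiset Occ).map Link.weak) + L, N.concl⟩
  /-- The contraction rule: a `!`-box is cut against the contraction `z` of auxiliary doors `xs` of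
  `!`-boxes and `$`-boxes `bs`.  The case where `xs` is the single door `z` is included.  The new
  vertices are distinct from each other and from the old ones, and so are the eigenvariables of the
  copies. -/
  | contr {d : ℕ} {N : Net (d + 1)} {F Fz F' : Multiset (Occ × Weight)}
      {L Lz L' : Multiset (Link (Con (d + 1)) × Weight)} (k : Link (Con (d + 1))) (Θ₀ : Net d)
      (r₀ : ℕ) (t₀ : PTree) (a₀ : Occ) (c : ℕ) (z : Occ) (xs W : Multiset Occ)
      (bs bs' : List (Box (Con (d + 1)))) (cs : List (Copy d))
      (hr : Ready N k ⟨c, Fm.bang a₀.fml⟩ z)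
      (hxs : xs ≠ 0) (hz : Gather xs z Lz Fz)
      (hF : N.forms = (⟨c, Fm.bang a₀.fml⟩, unit) ::ₘ (Fz + atUnit (t₀.doors : Multiset Occ) + F))
      (hL : N.links = (k, unit) ::ₘ
        (Link.box ⟨Kind.bang, Θ₀, {(r₀, t₀)}, {(a₀, c)}⟩, unit) ::ₘ
        (Lz + atUnit ((bs : Multiset (Box (Con (d + 1)))).map Link.box) + L))
      (habs : AbsorbAll Θ₀ r₀ t₀ a₀ bs xs bs' W cs)
      (hmerge : Merge cs t₀.doors L' F')
      (hid : ((F' + F).map fun f => f.1.id).Nodup)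
      (hev : ∀ q ∈ cs, Disjoint (Net.evars q.net) (Net.vars N))
      (hevs : cs.Pairwise fun q q' => Disjoint (Net.evars q.net) (Net.evars q'.net)) :
      LazyStep N ⟨F' + F,
        atUnit ((bs' : Multiset (Box (Con (d + 1)))).map Link.box) + atUnit (W.map Link.weak) +
          L' + L, N.concl⟩
  /-- Nested contraction links are merged. -/
  | fusion {d : ℕ} {N : Net d} {F : Multiset (Occ × Weight)}
      {L : Multiset (Link (Con d) × Weight)} (w : Weight) (x c : Occ) (xs ys : Multiset Occ)
      (hx : N.links.countP (fun l => x ∈ l.1.concls) = 1) (hF : N.forms = (x, w) ::ₘ F)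
      (hL : N.links = (Link.contr (x ::ₘ xs) c, w) ::ₘ (Link.contr ys x, w) ::ₘ L) :
      LazyStep N ⟨F, (Link.contr (ys + xs) c, w) ::ₘ L, N.concl⟩
  /-- A premise of a contraction link that comes from weakening is deleted. -/
  | cw {d : ℕ} {N : Net d} {F : Multiset (Occ × Weight)}
      {L : Multiset (Link (Con d) × Weight)} (w : Weight) (x c : Occ) (xs : Multiset Occ)
      (hx : N.links.countP (fun l => x ∈ l.1.concls) = 1) (hF : N.forms = (x, w) ::ₘ F)
      (hL : N.links = (Link.contr (x ::ₘ xs) c, w) ::ₘ (Link.weak x, w) ::ₘ L)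
      (hxs : 2 ≤ Multiset.card xs) :
      LazyStep N ⟨F, (Link.contr xs c, w) ::ₘ L, N.concl⟩
  /-- If only one premise `y` remains, then it takes the place of the conclusion `c`. -/
  | cw₁ {d : ℕ} {N : Net d} {F : Multiset (Occ × Weight)}
      {L : Multiset (Link (Con d) × Weight)} (w : Weight) (x y c : Occ)
      (hx : N.links.countP (fun l => x ∈ l.1.concls) = 1)
      (hF : N.forms = (x, w) ::ₘ (y, w) ::ₘ F)
      (hL : N.links = (Link.contr {x, y} c, w) ::ₘ (Link.weak x, w) ::ₘ L) :
      LazyStep N ⟨F, moveLinks y.id c.id L, N.concl⟩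
  /-- Reduction inside a box; new eigenvariables do not occur elsewhere. -/
  | box {d : ℕ} {N : Net (d + 1)} {Θ Θ' : Net d} {L : Multiset (Link (Con (d + 1)) × Weight)}
      (k : Kind) (aux : Multiset (ℕ × PTree)) (main : Multiset (Occ × ℕ)) (w : Weight)
      (hL : N.links = (Link.box ⟨k, Θ, aux, main⟩, w) ::ₘ L) (h : LazyStep Θ Θ')
      (hev : ∀ y ∈ Net.evars Θ', y ∉ Net.evars Θ → y ∉ Net.vars N) :
      LazyStep N ⟨N.forms, (Link.box ⟨k, Θ', aux, main⟩, w) ::ₘ L, N.concl⟩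

end LLL

set_option linter.unusedSimpArgs false

namespace LLL

/-! ### Formulas: negation, renaming, substitution and free variables -/

namespace Fm

/-! A simple proof net is the image of a derivation, but it does not remember the order of the
rules. The proof recovers, for each redex, a derivation in which the links involved are introduced
by neighbouring rules; the reduction is then an ordinary key case of sequent-calculus cut
elimination, and the rules that followed are applied again to the result.

The recovery rests on contexts. If a link has weight `1`, then no `&`-rule was applied after it,
because such a rule puts a literal into the weight of every link above it. Hence the net is a subnet
`S` ending with the rule of that link, surrounded by the links of a linear context (`Hole`,
`Simple.hole`). The context consumes some conclusions `K` of `S` and merely keeps the others. The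
decisive property is `Hole.plug`: any simple net that still offers `K`, whose names do not clash
with the context, may replace `S`, even if its kept conclusions are different. The kept conclusions
must avoid the eigenvariables of the context, and the new net may not introduce any of them.

For a ready cut, this locates first the cut, between nets `M` and `T`. A premise `a` of the cut is a
conclusion of `M`, and being ready means that it comes from one link only, so this link lies in `M`.
The context of this link inside `M` keeps `a`, hence does not interact with the cut and may be
applied after it (`Hole.cut_comm`). Doing this on both sides, `Simple.ready` exhibits the net as a
linear context around a cut of two subnets that end with the two given links. The axiom, unit,
multiplicative, additive and quantifier cuts, `$`/`$`, and a box against weakening are then local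
replacements with the same conclusions. Readiness is indispensable here: a premise shared by several
links could not be traced to a single rule.

Fusion, c-w and reduction inside a box occur at any weight. There the surrounding rules may include
`&`, and `WideHole` describes the subnet multiplied by its weight. Its conclusions must be left as
they are, since `&` may share them; the reductions in question do respect this.

For the contraction step, let `T` be the net whose conclusions include all the cut doors. Each
absorbing box has weight `1` and sits in a linear context that keeps its cut doors, so they may be
exchanged for the doors coming from copies (`Simple.exchange_box`, `AbsorbAll.replace`). Inside the
box, a `⊕`-chain ending in a conclusion can be stripped off (`Simple.remove_chain`) and its leaf cut
against a renamed copy of the `!`-box contents (`Absorb.simple`). Contracting and weakening the new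
doors gives back the old ones (`Merge.simple`), so the result has the conclusions of the original
cut and fits into its context.

Reduction inside boxes forces a stronger induction hypothesis (`LazyStep.simple`): a step also
preserves conclusions, and every new variable is an eigenvariable of the reduct. Throughout, names
are controlled by the invariants `Wf` and by `Simple.map`, the stability of simple nets under
injective renaming and capture-free substitution. -/

theorem neg_neg : ∀ {n : ℕ} (A : Fm n), A.neg.neg = A
  | _, lit s x => by simp [neg]
  | _, blit s i => by simp [neg]
  | _, one => rfl
  | _, bot => rfl
  | _, tensor A B => by simp [neg, neg_neg A, neg_neg B]
  | _, par A B => by simp [neg, neg_neg A, neg_neg B]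
  | _, wth A B => by simp [neg, neg_neg A, neg_neg B]
  | _, plus A B => by simp [neg, neg_neg A, neg_neg B]
  | _, bang A => by simp [neg, neg_neg A]
  | _, quest A => by simp [neg, neg_neg A]
  | _, neu A => by simp [neg, neg_neg A]
  | _, all A => by simp [neg, neg_neg A]
  | _, ex A => by simp [neg, neg_neg A]

theorem eq_neg_comm {n : ℕ} {A B : Fm n} (h : A = B.neg) : B = A.neg := by rw [h, neg_neg]

theorem vars_neg : ∀ {n : ℕ} (A : Fm n), A.neg.vars = A.vars
  | _, lit s x => rfl
  | _, blit s i => rfl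
  | _, one => rfl
  | _, bot => rfl
  | _, tensor A B => by simp [neg, vars, vars_neg A, vars_neg B]
  | _, par A B => by simp [neg, vars, vars_neg A, vars_neg B]
  | _, wth A B => by simp [neg, vars, vars_neg A, vars_neg B]
  | _, plus A B => by simp [neg, vars, vars_neg A, vars_neg B]
  | _, bang A => by simp [neg, vars, vars_neg A]
  | _, quest A => by simp [neg, vars, vars_neg A]
  | _, neu A => by simp [neg, vars, vars_neg A]
  | _, all A => by simp [neg, vars, vars_neg A]
  | _, ex A => by simp [neg, vars, vars_neg A]

theorem signed_not {n : ℕ} (A : Fm n) (s : Bool) : A.signed (!s) = (A.signed s).neg := by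
  cases s <;> simp [signed, neg_neg]

theorem vars_signed {n : ℕ} (A : Fm n) (s : Bool) : (A.signed s).vars = A.vars := by
  cases s <;> simp [signed, vars_neg]

theorem ren_neg : ∀ {m n : ℕ} (f : Fin m → Fin n) (A : Fm m), A.neg.ren f = (A.ren f).neg
  | _, _, f, lit s x => rfl
  | _, _, f, blit s i => rfl
  | _, _, _, one => rfl
  | _, _, _, bot => rfl
  | _, _, f, tensor A B => by simp [neg, ren, ren_neg f A, ren_neg f B]
  | _, _, f, par A B => by simp [neg, ren, ren_neg f A, ren_neg f B]
  | _, _, f, wth A B => by simp [neg, ren, ren_neg f A, ren_neg f B]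
  | _, _, f, plus A B => by simp [neg, ren, ren_neg f A, ren_neg f B]
  | _, _, f, bang A => by simp [neg, ren, ren_neg f A]
  | _, _, f, quest A => by simp [neg, ren, ren_neg f A]
  | _, _, f, neu A => by simp [neg, ren, ren_neg f A]
  | _, _, f, all A => by simp [neg, ren, ren_neg _ A]
  | _, _, f, ex A => by simp [neg, ren, ren_neg _ A]

theorem bind_neg : ∀ {m n : ℕ} (f : Fin m → Fm n) (A : Fm m), A.neg.bind f = (A.bind f).neg
  | _, _, f, lit s x => rfl
  | _, _, f, blit s i => by simp [neg, bind, signed_not]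
  | _, _, _, one => rfl
  | _, _, _, bot => rfl
  | _, _, f, tensor A B => by simp [neg, bind, bind_neg f A, bind_neg f B]
  | _, _, f, par A B => by simp [neg, bind, bind_neg f A, bind_neg f B]
  | _, _, f, wth A B => by simp [neg, bind, bind_neg f A, bind_neg f B]
  | _, _, f, plus A B => by simp [neg, bind, bind_neg f A, bind_neg f B]
  | _, _, f, bang A => by simp [neg, bind, bind_neg f A]
  | _, _, f, quest A => by simp [neg, bind, bind_neg f A]
  | _, _, f, neu A => by simp [neg, bind, bind_neg f A]
  | _, _, f, all A => by simp [neg, bind, bind_neg _ A]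
  | _, _, f, ex A => by simp [neg, bind, bind_neg _ A]

theorem inst_neg (A : Fm 1) (B : Formula) : A.neg.inst B = (A.inst B).neg := bind_neg _ A

theorem fsub_neg (φ : ℕ → Formula) : ∀ {n : ℕ} (A : Fm n), A.neg.fsub φ = (A.fsub φ).neg
  | _, lit s x => by simp [neg, fsub, signed_not]
  | _, blit s i => rfl
  | _, one => rfl
  | _, bot => rfl
  | _, tensor A B => by simp [neg, fsub, fsub_neg φ A, fsub_neg φ B]
  | _, par A B => by simp [neg, fsub, fsub_neg φ A, fsub_neg φ B]
  | _, wth A B => by simp [neg, fsub, fsub_neg φ A, fsub_neg φ B]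
  | _, plus A B => by simp [neg, fsub, fsub_neg φ A, fsub_neg φ B]
  | _, bang A => by simp [neg, fsub, fsub_neg φ A]
  | _, quest A => by simp [neg, fsub, fsub_neg φ A]
  | _, neu A => by simp [neg, fsub, fsub_neg φ A]
  | _, all A => by simp [neg, fsub, fsub_neg φ A]
  | _, ex A => by simp [neg, fsub, fsub_neg φ A]

theorem vars_ren : ∀ {m n : ℕ} (f : Fin m → Fin n) (A : Fm m), (A.ren f).vars = A.vars
  | _, _, f, lit s x => rfl
  | _, _, f, blit s i => rfl
  | _, _, _, one => rfl
  | _, _, _, bot => rfl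
  | _, _, f, tensor A B => by simp [ren, vars, vars_ren f A, vars_ren f B]
  | _, _, f, par A B => by simp [ren, vars, vars_ren f A, vars_ren f B]
  | _, _, f, wth A B => by simp [ren, vars, vars_ren f A, vars_ren f B]
  | _, _, f, plus A B => by simp [ren, vars, vars_ren f A, vars_ren f B]
  | _, _, f, bang A => by simp [ren, vars, vars_ren f A]
  | _, _, f, quest A => by simp [ren, vars, vars_ren f A]
  | _, _, f, neu A => by simp [ren, vars, vars_ren f A]
  | _, _, f, all A => by simp [ren, vars, vars_ren _ A]
  | _, _, f, ex A => by simp [ren, vars, vars_ren _ A]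

theorem mem_vars_fsub (φ : ℕ → Formula) (x : ℕ) : ∀ {n : ℕ} (A : Fm n),
    x ∈ (A.fsub φ).vars ↔ ∃ y ∈ A.vars, x ∈ (φ y).vars
  | _, lit s y => by simp [fsub, vars, vars_signed, vars_ren]
  | _, blit s i => by simp [fsub, vars]
  | _, one => by simp [fsub, vars]
  | _, bot => by simp [fsub, vars]
  | _, tensor A B => by
    simp [fsub, vars, mem_vars_fsub φ x A, mem_vars_fsub φ x B, or_and_right, exists_or]
  | _, par A B => by
    simp [fsub, vars, mem_vars_fsub φ x A, mem_vars_fsub φ x B, or_and_right, exists_or]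
  | _, wth A B => by
    simp [fsub, vars, mem_vars_fsub φ x A, mem_vars_fsub φ x B, or_and_right, exists_or]
  | _, plus A B => by
    simp [fsub, vars, mem_vars_fsub φ x A, mem_vars_fsub φ x B, or_and_right, exists_or]
  | _, bang A => by simp [fsub, vars, mem_vars_fsub φ x A]
  | _, quest A => by simp [fsub, vars, mem_vars_fsub φ x A]
  | _, neu A => by simp [fsub, vars, mem_vars_fsub φ x A]
  | _, all A => by simp [fsub, vars, mem_vars_fsub φ x A]
  | _, ex A => by simp [fsub, vars, mem_vars_fsub φ x A]

theorem fsub_congr {φ ψ : ℕ → Formula} : ∀ {n : ℕ} {A : Fm n}, (∀ x ∈ A.vars, φ x = ψ x) →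
    A.fsub φ = A.fsub ψ
  | _, lit s y, h => by simp [fsub, h y rfl]
  | _, blit s i, _ => rfl
  | _, one, _ => rfl
  | _, bot, _ => rfl
  | _, tensor A B, h => by
    simp [fsub, fsub_congr fun x hx => h x (Or.inl hx), fsub_congr fun x hx => h x (Or.inr hx)]
  | _, par A B, h => by
    simp [fsub, fsub_congr fun x hx => h x (Or.inl hx), fsub_congr fun x hx => h x (Or.inr hx)]
  | _, wth A B, h => by
    simp [fsub, fsub_congr fun x hx => h x (Or.inl hx), fsub_congr fun x hx => h x (Or.inr hx)]
  | _, plus A B, h => by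
    simp [fsub, fsub_congr fun x hx => h x (Or.inl hx), fsub_congr fun x hx => h x (Or.inr hx)]
  | _, bang A, h => by simp [fsub, fsub_congr (A := A) h]
  | _, quest A, h => by simp [fsub, fsub_congr (A := A) h]
  | _, neu A, h => by simp [fsub, fsub_congr (A := A) h]
  | _, all A, h => by simp [fsub, fsub_congr (A := A) h]
  | _, ex A, h => by simp [fsub, fsub_congr (A := A) h]

theorem fsub_var : ∀ {n : ℕ} (A : Fm n), A.fsub var = A
  | _, lit s x => by cases s <;> rfl
  | _, blit s i => rfl
  | _, one => rfl
  | _, bot => rfl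
  | _, tensor A B => by simp [fsub, fsub_var A, fsub_var B]
  | _, par A B => by simp [fsub, fsub_var A, fsub_var B]
  | _, wth A B => by simp [fsub, fsub_var A, fsub_var B]
  | _, plus A B => by simp [fsub, fsub_var A, fsub_var B]
  | _, bang A => by simp [fsub, fsub_var A]
  | _, quest A => by simp [fsub, fsub_var A]
  | _, neu A => by simp [fsub, fsub_var A]
  | _, all A => by simp [fsub, fsub_var A]
  | _, ex A => by simp [fsub, fsub_var A]

theorem fsub_eq_self {φ : ℕ → Formula} {n : ℕ} {A : Fm n} (h : ∀ x ∈ A.vars, φ x = var x) :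
    A.fsub φ = A := (fsub_congr h).trans (fsub_var A)

theorem ren_signed {m n : ℕ} (f : Fin m → Fin n) (A : Fm m) (s : Bool) :
    (A.signed s).ren f = (A.ren f).signed s := by
  cases s <;> simp [signed, ren_neg]

theorem bind_signed {m n : ℕ} (f : Fin m → Fm n) (A : Fm m) (s : Bool) :
    (A.signed s).bind f = (A.bind f).signed s := by
  cases s <;> simp [signed, bind_neg]

theorem fsub_signed {n : ℕ} (φ : ℕ → Formula) (A : Fm n) (s : Bool) :
    (A.signed s).fsub φ = (A.fsub φ).signed s := by
  cases s <;> simp [signed, fsub_neg]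

theorem ren_ren : ∀ {m n k : ℕ} (f : Fin m → Fin n) (g : Fin n → Fin k) (A : Fm m),
    (A.ren f).ren g = A.ren (g ∘ f)
  | _, _, _, f, g, lit s x => rfl
  | _, _, _, f, g, blit s i => rfl
  | _, _, _, _, _, one => rfl
  | _, _, _, _, _, bot => rfl
  | _, _, _, f, g, tensor A B => by simp [ren, ren_ren f g A, ren_ren f g B]
  | _, _, _, f, g, par A B => by simp [ren, ren_ren f g A, ren_ren f g B]
  | _, _, _, f, g, wth A B => by simp [ren, ren_ren f g A, ren_ren f g B]
  | _, _, _, f, g, plus A B => by simp [ren, ren_ren f g A, ren_ren f g B]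
  | _, _, _, f, g, bang A => by simp [ren, ren_ren f g A]
  | _, _, _, f, g, quest A => by simp [ren, ren_ren f g A]
  | _, _, _, f, g, neu A => by simp [ren, ren_ren f g A]
  | _, _, _, f, g, all A => by
    simp only [ren, ren_ren _ _ A]; congr 2; funext i; cases i using Fin.cases <;> rfl
  | _, _, _, f, g, ex A => by
    simp only [ren, ren_ren _ _ A]; congr 2; funext i; cases i using Fin.cases <;> rfl

theorem bind_ren : ∀ {m n k : ℕ} (f : Fin m → Fin n) (g : Fin n → Fm k) (A : Fm m),
    (A.ren f).bind g = A.bind (g ∘ f)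
  | _, _, _, f, g, lit s x => rfl
  | _, _, _, f, g, blit s i => rfl
  | _, _, _, _, _, one => rfl
  | _, _, _, _, _, bot => rfl
  | _, _, _, f, g, tensor A B => by simp [ren, bind, bind_ren f g A, bind_ren f g B]
  | _, _, _, f, g, par A B => by simp [ren, bind, bind_ren f g A, bind_ren f g B]
  | _, _, _, f, g, wth A B => by simp [ren, bind, bind_ren f g A, bind_ren f g B]
  | _, _, _, f, g, plus A B => by simp [ren, bind, bind_ren f g A, bind_ren f g B]
  | _, _, _, f, g, bang A => by simp [ren, bind, bind_ren f g A]
  | _, _, _, f, g, quest A => by simp [ren, bind, bind_ren f g A]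
  | _, _, _, f, g, neu A => by simp [ren, bind, bind_ren f g A]
  | _, _, _, f, g, all A => by
    simp only [ren, bind, bind_ren _ _ A]; congr 2; funext i; cases i using Fin.cases <;> rfl
  | _, _, _, f, g, ex A => by
    simp only [ren, bind, bind_ren _ _ A]; congr 2; funext i; cases i using Fin.cases <;> rfl

theorem bind_blit : ∀ {m n : ℕ} (f : Fin m → Fin n) (A : Fm m),
    A.bind (fun i => blit true (f i)) = A.ren f
  | _, _, f, lit s x => rfl
  | _, _, f, blit s i => by cases s <;> rfl
  | _, _, _, one => rfl
  | _, _, _, bot => rfl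
  | _, _, f, tensor A B => by simp [ren, bind, bind_blit f A, bind_blit f B]
  | _, _, f, par A B => by simp [ren, bind, bind_blit f A, bind_blit f B]
  | _, _, f, wth A B => by simp [ren, bind, bind_blit f A, bind_blit f B]
  | _, _, f, plus A B => by simp [ren, bind, bind_blit f A, bind_blit f B]
  | _, _, f, bang A => by simp [ren, bind, bind_blit f A]
  | _, _, f, quest A => by simp [ren, bind, bind_blit f A]
  | _, _, f, neu A => by simp [ren, bind, bind_blit f A]
  | _, _, f, all A => by
    simp only [ren, bind, ← bind_blit _ A]
    congr 2; funext i; cases i using Fin.cases <;> rfl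
  | _, _, f, ex A => by
    simp only [ren, bind, ← bind_blit _ A]
    congr 2; funext i; cases i using Fin.cases <;> rfl

/-- A formula substituted for a free variable is closed and is carried under binders by `ren
Fin.elim0`; it has no index on which `bind` could act. This is the variable case of `fsub_bind`. -/
theorem ren_elim0_bind {m n : ℕ} (A : Formula) (f : Fin m → Fm n) :
    (A.ren Fin.elim0).bind f = A.ren Fin.elim0 := by
  rw [bind_ren, ← bind_blit]; congr 1; funext i; exact i.elim0

theorem ren_elim0_ren {m n : ℕ} (A : Formula) (f : Fin m → Fin n) :
    (A.ren Fin.elim0).ren f = A.ren Fin.elim0 := by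
  rw [ren_ren]; congr 1; funext i; exact i.elim0

theorem fsub_ren (φ : ℕ → Formula) : ∀ {m n : ℕ} (f : Fin m → Fin n) (A : Fm m),
    (A.ren f).fsub φ = (A.fsub φ).ren f
  | _, _, f, lit s x => by simp [ren, fsub, ren_signed, ren_elim0_ren]
  | _, _, f, blit s i => rfl
  | _, _, _, one => rfl
  | _, _, _, bot => rfl
  | _, _, f, tensor A B => by simp [fsub, ren, fsub_ren φ f A, fsub_ren φ f B]
  | _, _, f, par A B => by simp [fsub, ren, fsub_ren φ f A, fsub_ren φ f B]
  | _, _, f, wth A B => by simp [fsub, ren, fsub_ren φ f A, fsub_ren φ f B]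
  | _, _, f, plus A B => by simp [fsub, ren, fsub_ren φ f A, fsub_ren φ f B]
  | _, _, f, bang A => by simp [fsub, ren, fsub_ren φ f A]
  | _, _, f, quest A => by simp [fsub, ren, fsub_ren φ f A]
  | _, _, f, neu A => by simp [fsub, ren, fsub_ren φ f A]
  | _, _, f, all A => by simp [fsub, ren, fsub_ren φ _ A]
  | _, _, f, ex A => by simp [fsub, ren, fsub_ren φ _ A]

/-- The two kinds of substitution act on different variables and the values of `φ` have no dangling
indices, so they commute once `φ` has also been applied to the values of `f`. It follows that `∀`-
and `∃`-rules survive substitution. -/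
theorem fsub_bind (φ : ℕ → Formula) : ∀ {m n : ℕ} (f : Fin m → Fm n) (A : Fm m),
    (A.bind f).fsub φ = (A.fsub φ).bind fun i => (f i).fsub φ
  | _, _, f, lit s x => by simp [bind, fsub, bind_signed, ren_elim0_bind]
  | _, _, f, blit s i => by simp [bind, fsub, fsub_signed]
  | _, _, _, one => rfl
  | _, _, _, bot => rfl
  | _, _, f, tensor A B => by simp [fsub, bind, fsub_bind φ f A, fsub_bind φ f B]
  | _, _, f, par A B => by simp [fsub, bind, fsub_bind φ f A, fsub_bind φ f B]
  | _, _, f, wth A B => by simp [fsub, bind, fsub_bind φ f A, fsub_bind φ f B]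
  | _, _, f, plus A B => by simp [fsub, bind, fsub_bind φ f A, fsub_bind φ f B]
  | _, _, f, bang A => by simp [fsub, bind, fsub_bind φ f A]
  | _, _, f, quest A => by simp [fsub, bind, fsub_bind φ f A]
  | _, _, f, neu A => by simp [fsub, bind, fsub_bind φ f A]
  | _, _, f, all A => by
    simp only [fsub, bind, fsub_bind φ _ A]; congr 2; funext i
    cases i using Fin.cases <;> simp [fsub, fsub_ren]
  | _, _, f, ex A => by
    simp only [fsub, bind, fsub_bind φ _ A]; congr 2; funext i
    cases i using Fin.cases <;> simp [fsub, fsub_ren]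

theorem fsub_inst (φ : ℕ → Formula) (A : Fm 1) (B : Formula) :
    (A.inst B).fsub φ = (A.fsub φ).inst (B.fsub φ) := fsub_bind φ _ A

theorem ren_self : ∀ {n : ℕ} (A : Fm n) (f : Fin n → Fin n) (_ : ∀ i, f i = i), A.ren f = A
  | _, lit s x, _, _ => rfl
  | _, blit s i, f, h => by simp [ren, h]
  | _, one, _, _ => rfl
  | _, bot, _, _ => rfl
  | _, tensor A B, f, h => by simp [ren, ren_self A f h, ren_self B f h]
  | _, par A B, f, h => by simp [ren, ren_self A f h, ren_self B f h]
  | _, wth A B, f, h => by simp [ren, ren_self A f h, ren_self B f h]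
  | _, plus A B, f, h => by simp [ren, ren_self A f h, ren_self B f h]
  | _, bang A, f, h => by simp [ren, ren_self A f h]
  | _, quest A, f, h => by simp [ren, ren_self A f h]
  | _, neu A, f, h => by simp [ren, ren_self A f h]
  | _, all A, f, h => by
    refine congrArg all (ren_self A _ fun i => ?_)
    cases i using Fin.cases <;> simp [h]
  | _, ex A, f, h => by
    refine congrArg ex (ren_self A _ fun i => ?_)
    cases i using Fin.cases <;> simp [h]

theorem fsub_var_apply (φ : ℕ → Formula) (x : ℕ) : (var x).fsub φ = φ x := by
  simp [var, fsub, signed, ren_self]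

theorem vars_var (x : ℕ) : (var x).vars = {x} := rfl

/-- This makes the two premises dual after a `∀`/`∃` reduction: the eigenvariable occurs in the
premise of the `∀`-link only where the quantifier put it. -/
theorem inst_fsub_update {A : Fm 1} {x : ℕ} (hx : x ∉ A.vars) (B : Formula) :
    (A.inst (var x)).fsub (Function.update var x B) = A.inst B := by
  rw [fsub_inst, fsub_var_apply, Function.update_self, fsub_eq_self]
  intro y hy
  refine Function.update_of_ne ?_ _ _
  rintro rfl
  exact hx hy

end Fm

/-! ## Footprints -/

/-- The union of the sets `g a`, for `a` in a multiset. -/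
def supp {α : Type} (g : α → Set ℕ) (s : Multiset α) : Set ℕ := {x | ∃ a ∈ s, x ∈ g a}

/-- The union of the sets `g a`, for the weighted items `a` of a multiset. -/
def suppW {α : Type} (g : α → Set ℕ) (s : Multiset (α × Weight)) : Set ℕ :=
  {x | ∃ a ∈ s, x ∈ g a.1}

section supp
variable {α : Type} (g : α → Set ℕ)

theorem mem_supp {s : Multiset α} {x : ℕ} : x ∈ supp g s ↔ ∃ a ∈ s, x ∈ g a := Iff.rfl
theorem mem_suppW {s : Multiset (α × Weight)} {x : ℕ} : x ∈ suppW g s ↔ ∃ a ∈ s, x ∈ g a.1 :=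
  Iff.rfl

@[simp] theorem supp_zero : supp g 0 = ∅ := by ext; simp [supp]
@[simp] theorem suppW_zero : suppW g 0 = ∅ := by ext; simp [suppW]
@[simp] theorem supp_cons (a : α) (s : Multiset α) : supp g (a ::ₘ s) = g a ∪ supp g s := by
  ext; simp [supp]
@[simp] theorem suppW_cons (a : α × Weight) (s : Multiset (α × Weight)) :
    suppW g (a ::ₘ s) = g a.1 ∪ suppW g s := by
  ext; simp [suppW]
@[simp] theorem supp_add (s t : Multiset α) : supp g (s + t) = supp g s ∪ supp g t := by
  ext; simp [supp, or_and_right, exists_or]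
@[simp] theorem suppW_add (s t : Multiset (α × Weight)) :
    suppW g (s + t) = suppW g s ∪ suppW g t := by
  ext; simp only [suppW, Multiset.mem_add, or_and_right, exists_or]; rfl
@[simp] theorem supp_singleton (a : α) : supp g {a} = g a := by ext; simp [supp]
@[simp] theorem suppW_singleton (a : α × Weight) : suppW g {a} = g a.1 := by ext; simp [suppW]
@[simp] theorem suppW_atUnit (s : Multiset α) : suppW g (atUnit s) = supp g s := by
  ext; simp [suppW, supp, atUnit]
@[simp] theorem suppW_scale (q : ℕ × Bool) (s : Multiset (α × Weight)) :
    suppW g (scale q s) = suppW g s := by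
  ext; simp [suppW, scale]

theorem supp_mono {s t : Multiset α} (h : s ≤ t) : supp g s ⊆ supp g t :=
  fun _ ⟨a, ha, hx⟩ => ⟨a, Multiset.mem_of_le h ha, hx⟩
theorem suppW_mono {s t : Multiset (α × Weight)} (h : s ≤ t) : suppW g s ⊆ suppW g t :=
  fun _ ⟨a, ha, hx⟩ => ⟨a, Multiset.mem_of_le h ha, hx⟩
theorem subset_supp {s : Multiset α} {a : α} (h : a ∈ s) : g a ⊆ supp g s :=
  fun _ hx => ⟨a, h, hx⟩

end supp

section atUnit
variable {α : Type}

@[simp] theorem atUnit_zero : atUnit (0 : Multiset α) = 0 := rfl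
@[simp] theorem atUnit_cons (a : α) (s : Multiset α) :
    atUnit (a ::ₘ s) = (a, unit) ::ₘ atUnit s := by simp [atUnit]
@[simp] theorem atUnit_add (s t : Multiset α) : atUnit (s + t) = atUnit s + atUnit t := by
  simp [atUnit]
@[simp] theorem atUnit_singleton (a : α) : atUnit {a} = {(a, unit)} := by simp [atUnit]
theorem mem_atUnit {a : α × Weight} {s : Multiset α} : a ∈ atUnit s ↔ a.1 ∈ s ∧ a.2 = unit := by
  rcases a with ⟨a, w⟩; simp [atUnit, eq_comm]
theorem atUnit_mono {s t : Multiset α} (h : s ≤ t) : atUnit s ≤ atUnit t :=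
  Multiset.map_le_map h
@[simp] theorem atUnit_map {β : Type} (f : α → β) (s : Multiset α) :
    atUnit (s.map f) = (atUnit s).map (Prod.map f id) := by
  simp [atUnit]

end atUnit

/-- The vertex of an occurrence, as a set. -/
def oid (o : Occ) : Set ℕ := {o.id}
/-- The variables of an occurrence. -/
def ovar (o : Occ) : Set ℕ := o.fml.vars

@[simp] theorem mem_oid {o : Occ} {n : ℕ} : n ∈ oid o ↔ n = o.id := Iff.rfl

variable {d : ℕ}

abbrev fids (F : Multiset (Occ × Weight)) : Set ℕ := suppW oid F
abbrev fvars (F : Multiset (Occ × Weight)) : Set ℕ := suppW ovar F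
abbrev lew (L : Multiset (Link (Con d) × Weight)) : Set ℕ := suppW Link.eigenweights L
abbrev lev (L : Multiset (Link (Con d) × Weight)) : Set ℕ := suppW (Link.evars (Con.evars d)) L
abbrev lvars (L : Multiset (Link (Con d) × Weight)) : Set ℕ := suppW (Link.vars (Con.vars d)) L

theorem ids_eq (N : Net d) : N.ids = fids N.forms := by
  ext; simp [PreNet.ids, suppW, eq_comm]
theorem eigenweights_eq (N : Net d) : N.eigenweights = lew N.links := rfl
theorem evars_eq (N : Net d) : Net.evars N = lev N.links := rfl
theorem vars_eq (N : Net d) : Net.vars N = fvars N.forms ∪ lvars N.links := rfl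
theorem conclVars_eq (Γ : Multiset Occ) : conclVars Γ = supp ovar Γ := rfl

theorem Link.evars_subset_vars {β : Type} {ev v : β → Set ℕ} (h : ∀ b, ev b ⊆ v b)
    (l : Link β) : l.evars ev ⊆ l.vars v := by
  cases l <;> simp [Link.evars, Link.vars, h]

theorem Con.evars_subset_vars : ∀ (d : ℕ) (N : Con d), Con.evars d N ⊆ Con.vars d N
  | 0, N => N.elim
  | d + 1, N => by
    rintro x ⟨l, hl, hx⟩
    exact Or.inr ⟨l, hl, l.1.evars_subset_vars (Con.evars_subset_vars d) hx⟩

theorem lev_subset_lvars (L : Multiset (Link (Con d) × Weight)) : lev L ⊆ lvars L := by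
  rintro x ⟨l, hl, hx⟩
  exact ⟨l, hl, l.1.evars_subset_vars (Con.evars_subset_vars d) hx⟩

/-- Consequently, a net whose eigenvariables avoid all variables of another net has in particular
different eigenvariables. -/
theorem Net.evars_subset_vars (N : Net d) : Net.evars N ⊆ Net.vars N :=
  fun _ h => Or.inr (lev_subset_lvars _ h)

theorem Net.Apart.symm {M N : Net d} (h : Net.Apart M N) : Net.Apart N M :=
  ⟨h.1.symm, h.2.1.symm, h.2.2.2.symm, h.2.2.1.symm⟩

/-! ## Invariants of simple proof nets -/

/-- The premises of a link. -/
def Link.prems {β : Type} : Link β → Multiset Occ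
  | ax _ _ => 0
  | cut a b => {a, b}
  | one _ => 0
  | bot _ => 0
  | tensor a b _ => {a, b}
  | par a b _ => {a, b}
  | wth _ a b _ => {a, b}
  | plus₁ a _ => {a}
  | plus₂ b _ => {b}
  | all _ a _ => {a}
  | ex _ a _ => {a}
  | weak _ => 0
  | contr as _ => as
  | box _ => 0

/-- All occurrences that a link connects. -/
def Link.occs {β : Type} (l : Link β) : Multiset Occ := l.prems + l.concls

/-- The eigenweights mentioned by the weights of a multiset of weighted items. -/
def wts {α : Type} (s : Multiset (α × Weight)) : Set ℕ := {p | ∃ a ∈ s, ∃ b, (p, b) ∈ a.2}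

section wts
variable {α : Type}
@[simp] theorem wts_zero : wts (0 : Multiset (α × Weight)) = ∅ := by ext; simp [wts]
@[simp] theorem wts_cons (a : α × Weight) (s : Multiset (α × Weight)) :
    wts (a ::ₘ s) = {p | ∃ b, (p, b) ∈ a.2} ∪ wts s := by ext; simp [wts]
@[simp] theorem wts_add (s t : Multiset (α × Weight)) : wts (s + t) = wts s ∪ wts t := by
  ext; simp only [wts, Multiset.mem_add, or_and_right, exists_or]; rfl
@[simp] theorem wts_atUnit (s : Multiset α) : wts (atUnit s) = ∅ := by
  ext; simp [wts, atUnit]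
@[simp] theorem wts_singleton (a : α × Weight) :
    wts {a} = {p | ∃ b, (p, b) ∈ a.2} := by ext; simp [wts]
theorem wts_scale_subset (q : ℕ × Bool) (s : Multiset (α × Weight)) :
    wts (scale q s) ⊆ {q.1} ∪ wts s := by
  rintro p ⟨a, ha, b, hb⟩
  simp only [scale, Multiset.mem_map] at ha
  obtain ⟨a, ha, rfl⟩ := ha
  simp only [Finset.mem_insert] at hb
  rcases hb with h | h
  · left; simp [← h]
  · exact Or.inr ⟨a, ha, b, h⟩
end wts

/-- The basic invariants of simple proof nets. -/
structure Wf (N : Net d) : Prop where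
  nodup : (N.forms.map fun f => f.1.id).Nodup
  concl_le : atUnit N.concl ≤ N.forms
  form_concl : ∀ f ∈ N.forms, ∃ l ∈ N.links, f.1 ∈ l.1.concls
  occ_mem : ∀ l ∈ N.links, ∀ o ∈ l.1.occs, ∃ w, (o, w) ∈ N.forms
  wts_forms : wts N.forms ⊆ lew N.links
  wts_links : wts N.links ⊆ lew N.links
  concl_ev : Disjoint (supp ovar N.concl) (lev N.links)

theorem nodup_add_iff {F G : Multiset (Occ × Weight)} :
    ((F + G).map fun f => f.1.id).Nodup ↔ (F.map fun f => f.1.id).Nodup ∧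
      (G.map fun f => f.1.id).Nodup ∧ Disjoint (fids F) (fids G) := by
  rw [Multiset.map_add, Multiset.nodup_add, Set.disjoint_left, Multiset.disjoint_left]
  refine and_congr Iff.rfl (and_congr Iff.rfl ?_)
  simp only [Multiset.mem_map, mem_suppW, mem_oid]
  constructor
  · rintro h n ⟨a, ha, rfl⟩ ⟨b, hb, hab⟩
    exact h ⟨a, ha, rfl⟩ ⟨b, hb, hab.symm⟩
  · rintro h n ⟨a, ha, rfl⟩ ⟨b, hb, hab⟩
    exact h ⟨a, ha, rfl⟩ ⟨b, hb, hab.symm⟩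

theorem nodup_cons_iff {o : Occ × Weight} {G : Multiset (Occ × Weight)} :
    (((o ::ₘ G)).map fun f => f.1.id).Nodup ↔ o.1.id ∉ fids G ∧
      (G.map fun f => f.1.id).Nodup := by
  rw [Multiset.map_cons, Multiset.nodup_cons]
  refine and_congr (not_congr ?_) Iff.rfl
  simp [mem_suppW, eq_comm]

namespace Wf

theorem conclVars_subset {N : Net d} (h : Wf N) : supp ovar N.concl ⊆ fvars N.forms := by
  have := suppW_mono ovar h.concl_le
  simpa using this

/-- The two halves of a cut or a `⊗` before the link is added. Apartness supplies what neither half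
knows alone: the vertices differ, and the conclusions of each half avoid the eigenvariables of the
other. -/
theorem union {M N : Net d} {Γ Δ : Multiset Occ} (hM : Wf M) (hN : Wf N) (hap : Net.Apart M N)
    (hΓ : Γ ≤ M.concl) (hΔ : Δ ≤ N.concl) :
    Wf (⟨M.forms + N.forms, M.links + N.links, Γ + Δ⟩ : Net d) where
  nodup := by
    rw [nodup_add_iff]
    refine ⟨hM.nodup, hN.nodup, ?_⟩
    simpa only [ids_eq] using hap.1
  concl_le := by
    rw [atUnit_add]
    exact add_le_add ((atUnit_mono hΓ).trans hM.concl_le) ((atUnit_mono hΔ).trans hN.concl_le)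
  form_concl f hf := by
    rcases Multiset.mem_add.1 hf with hf | hf
    · obtain ⟨l, hl, h⟩ := hM.form_concl f hf
      exact ⟨l, Multiset.mem_add.2 (Or.inl hl), h⟩
    · obtain ⟨l, hl, h⟩ := hN.form_concl f hf
      exact ⟨l, Multiset.mem_add.2 (Or.inr hl), h⟩
  occ_mem l hl o ho := by
    rcases Multiset.mem_add.1 hl with hl | hl
    · obtain ⟨w, hw⟩ := hM.occ_mem l hl o ho
      exact ⟨w, Multiset.mem_add.2 (Or.inl hw)⟩
    · obtain ⟨w, hw⟩ := hN.occ_mem l hl o ho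
      exact ⟨w, Multiset.mem_add.2 (Or.inr hw)⟩
  wts_forms := by
    simp only [wts_add, suppW_add]
    exact Set.union_subset_union hM.wts_forms hN.wts_forms
  wts_links := by
    simp only [wts_add, suppW_add]
    exact Set.union_subset_union hM.wts_links hN.wts_links
  concl_ev := by
    have h1 := hM.concl_ev.mono_left (supp_mono ovar hΓ)
    have h2 := hN.concl_ev.mono_left (supp_mono ovar hΔ)
    have h3 := hap.2.2.2.mono_left
      (((supp_mono ovar hΓ).trans hM.conclVars_subset).trans Set.subset_union_left)
    have h4 := hap.symm.2.2.2.mono_left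
      (((supp_mono ovar hΔ).trans hN.conclVars_subset).trans Set.subset_union_left)
    simp only [supp_add, suppW_add, Set.disjoint_union_left, Set.disjoint_union_right]
    exact ⟨⟨h1, h4⟩, h3, h2⟩

theorem add_link {N : Net d} {Γ : Multiset Occ} (hN : Wf N) (l : Link (Con d)) (hΓ : Γ ≤ N.concl)
    (hp : ∀ o ∈ l.occs, ∃ w, (o, w) ∈ N.forms) (hev : Disjoint (supp ovar Γ) (l.evars (Con.evars d))) :
    Wf (⟨N.forms, (l, unit) ::ₘ N.links, Γ⟩ : Net d) where
  nodup := hN.nodup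
  concl_le := (atUnit_mono hΓ).trans hN.concl_le
  form_concl f hf := by
    obtain ⟨l, hl, h⟩ := hN.form_concl f hf
    exact ⟨l, Multiset.mem_cons_of_mem hl, h⟩
  occ_mem l' hl o ho := by
    rcases Multiset.mem_cons.1 hl with rfl | hl
    · exact hp o ho
    · exact hN.occ_mem l' hl o ho
  wts_forms := by
    simp only [suppW_cons]
    exact hN.wts_forms.trans Set.subset_union_right
  wts_links := by
    simp only [wts_cons, suppW_cons]
    intro p hp
    rcases hp with ⟨b, hb⟩ | hp
    · simp at hb
    · exact Or.inr (hN.wts_links hp)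
  concl_ev := by
    simp only [suppW_cons, Set.disjoint_union_right]
    exact ⟨hev, hN.concl_ev.mono_left (supp_mono ovar hΓ)⟩

theorem extend {N : Net d} {Γ : Multiset Occ} (hN : Wf N) (l : Link (Con d)) (c : Occ)
    (hΓ : Γ ≤ N.concl) (hc : Net.Fresh c N) (hl : l.concls = {c})
    (hp : ∀ o ∈ l.prems, o ∈ N.concl)
    (hev : Disjoint (supp ovar (c ::ₘ Γ)) (l.evars (Con.evars d))) : Wf (N.extend l c Γ) where
  nodup := by
    simp only [PreNet.extend]
    rw [nodup_cons_iff]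
    exact ⟨by rw [← ids_eq]; exact hc.1, hN.nodup⟩
  concl_le := by
    simp only [PreNet.extend, atUnit_cons]
    exact Multiset.cons_le_cons _ ((atUnit_mono hΓ).trans hN.concl_le)
  form_concl f hf := by
    rcases Multiset.mem_cons.1 hf with rfl | hf
    · exact ⟨(l, unit), Multiset.mem_cons_self _ _, by simp [hl]⟩
    obtain ⟨l, hl, h⟩ := hN.form_concl f hf
    exact ⟨l, Multiset.mem_cons_of_mem hl, h⟩
  occ_mem l' hl' o ho := by
    rcases Multiset.mem_cons.1 hl' with rfl | hl'
    · simp only [Link.occs, hl, Multiset.mem_add, Multiset.mem_singleton] at ho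
      rcases ho with ho | rfl
      · exact ⟨unit, Multiset.mem_cons_of_mem
          (Multiset.mem_of_le hN.concl_le (mem_atUnit.2 ⟨hp o ho, rfl⟩))⟩
      · exact ⟨unit, Multiset.mem_cons_self _ _⟩
    · obtain ⟨w, hw⟩ := hN.occ_mem l' hl' o ho
      exact ⟨w, Multiset.mem_cons_of_mem hw⟩
  wts_forms := by
    simp only [PreNet.extend, wts_cons, suppW_cons]
    rintro p (⟨b, hb⟩ | hp)
    · simp at hb
    · exact Or.inr (hN.wts_forms hp)
  wts_links := by
    simp only [PreNet.extend, wts_cons, suppW_cons]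
    rintro p (⟨b, hb⟩ | hp)
    · simp at hb
    · exact Or.inr (hN.wts_links hp)
  concl_ev := by
    simp only [PreNet.extend, suppW_cons, Set.disjoint_union_right]
    refine ⟨hev, ?_⟩
    simp only [supp_cons, Set.disjoint_union_left]
    exact ⟨hc.2, hN.concl_ev.mono_left (supp_mono ovar hΓ)⟩

theorem leaf (l : Link (Con d)) (hp : l.prems = 0) (hid : (l.concls.map Occ.id).Nodup)
    (hev : Disjoint (supp ovar l.concls) (l.evars (Con.evars d))) :
    Wf (⟨atUnit l.concls, {(l, unit)}, l.concls⟩ : Net d) where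
  nodup := by simpa [atUnit] using hid
  concl_le := le_rfl
  form_concl f hf := ⟨_, Multiset.mem_singleton_self _, (mem_atUnit.1 hf).1⟩
  occ_mem l' hl' o ho := by
    obtain rfl := Multiset.mem_singleton.1 hl'
    rw [Link.occs, hp, zero_add] at ho
    exact ⟨unit, mem_atUnit.2 ⟨ho, rfl⟩⟩
  wts_forms := by simp
  wts_links := by simp
  concl_ev := by simpa using hev

theorem mem_forms {N : Net d} (h : Wf N) {a : Occ} (ha : a ∈ N.concl) : (a, unit) ∈ N.forms :=
  Multiset.mem_of_le h.concl_le (mem_atUnit.2 ⟨ha, rfl⟩)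

end Wf

theorem PTree.supp_doors (t : PTree) : supp ovar (t.doors : Multiset Occ) = t.fml.vars := by
  induction t with
  | leaf x A => simp [PTree.doors, PTree.fml, ovar, Fm.vars]
  | node l r hl hr => simp [PTree.doors, PTree.fml, Fm.vars, ← hl, ← hr, ← Multiset.coe_add]

/-- Crossing the border of a box only removes `⊕` and adds `?`, `!` or `$`, none of which carries a
variable. So the eigenvariable condition on the conclusions passes from the contents to the box. -/
theorem Box.supp_outer {β : Type} (b : Box β) : supp ovar b.outer = supp ovar b.inner := by
  ext x
  have h1 : x ∈ supp ovar b.auxDoors ↔ x ∈ supp ovar (b.aux.map (fun q => (⟨q.1, q.2.fml⟩ : Occ))) := by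
    simp only [mem_supp, Box.auxDoors, Multiset.mem_bind, Multiset.mem_map]
    constructor
    · rintro ⟨o, ⟨q, hq, ho⟩, hx⟩
      refine ⟨_, ⟨q, hq, rfl⟩, ?_⟩
      change x ∈ q.2.fml.vars
      rw [← PTree.supp_doors]
      exact ⟨o, ho, hx⟩
    · rintro ⟨_, ⟨q, hq, rfl⟩, hx⟩
      change x ∈ q.2.fml.vars at hx
      rw [← PTree.supp_doors] at hx
      obtain ⟨o, ho, hx⟩ := hx
      exact ⟨o, ⟨q, hq, ho⟩, hx⟩
  have h2 : x ∈ supp ovar b.mainDoors ↔ x ∈ supp ovar (b.main.map Prod.fst) := by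
    have hk : ∀ A : Formula, (b.kind.app A).vars = A.vars := fun A => by
      cases b.kind <;> rfl
    simp [mem_supp, Box.mainDoors, ovar, hk]
  simp only [Box.outer, Box.inner, supp_add, Set.mem_union, h1, h2]

/-- These invariants are used in four ways: a vertex determines its occurrence and weight, every
occurrence has a link above it, a weight mentions only eigenweights of `&`-links present in the net,
and conclusions are free of eigenvariables. -/
theorem Simple.wf {N : Net d} (h : Simple N) : Wf N := by
  induction h with
  | @ax d a b hab hf =>
    exact Wf.leaf (Link.ax a b) rfl (by simpa [Link.concls, Multiset.insert_eq_cons] using hab)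
      (by simp [Link.evars])
  | @cut d M N Γ Δ a b hM hN hap ha hb hf ihM ihN =>
    refine ((ihM.union (Γ := M.concl) (Δ := N.concl) ihN hap le_rfl le_rfl).add_link (Γ := Γ + Δ)
      (Link.cut a b) ?_ ?_ ?_)
    · exact add_le_add (ha ▸ Multiset.le_cons_self _ _) (hb ▸ Multiset.le_cons_self _ _)
    · intro o ho
      simp only [Link.occs, Link.prems, Link.concls, add_zero, Multiset.insert_eq_cons,
        Multiset.mem_cons, Multiset.mem_singleton] at ho
      rcases ho with rfl | rfl
      · exact ⟨unit, Multiset.mem_add.2 (Or.inl (ihM.mem_forms (by simp [ha])))⟩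
      · exact ⟨unit, Multiset.mem_add.2 (Or.inr (ihN.mem_forms (by simp [hb])))⟩
    · simp [Link.evars]
  | @one d c hf => exact Wf.leaf (Link.one c) rfl (by simp [Link.concls]) (by simp [Link.evars])
  | @bot d N c hN hc hf ih =>
    exact ih.extend _ _ le_rfl hc rfl (by simp [Link.prems]) (by simp [Link.evars])
  | @tensor d M N Γ Δ a b c hM hN hap ha hb hcM hcN hf ihM ihN =>
    refine ((ihM.union (Γ := M.concl) (Δ := N.concl) ihN hap le_rfl le_rfl).extend (Γ := Γ + Δ)
      (Link.tensor a b c) c ?_ ?_ rfl ?_ ?_)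
    · exact add_le_add (ha ▸ Multiset.le_cons_self _ _) (hb ▸ Multiset.le_cons_self _ _)
    · constructor
      · simp only [ids_eq, suppW_add]
        simp only [← ids_eq]
        exact fun h => h.elim hcM.1 hcN.1
      · simp only [evars_eq, suppW_add, Set.disjoint_union_right]
        exact ⟨hcM.2, hcN.2⟩
    · simp [Link.prems, ha, hb]
    · simp [Link.evars]
  | @par d N Γ a b c hN h hc hf ih =>
    refine ih.extend _ _ ?_ hc rfl (by simp [Link.prems, h]) (by simp [Link.evars])
    rw [h]; exact (Multiset.le_cons_self _ _).trans (Multiset.le_cons_self _ _)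
  | @wth d M N Γ F G p a b c hM hN ha hb hF hG hFG hw hpM hpN hMN hNM hcM hcN hf ihM ihN =>
    have hM1 := ihM.nodup
    have hN1 := ihN.nodup
    rw [hF, nodup_add_iff] at hM1
    rw [hG, nodup_add_iff] at hN1
    have hcM1 := hcM.1
    have hcN1 := hcN.1
    simp only [ids_eq, hF, suppW_add] at hcM1
    simp only [ids_eq, hG, suppW_add] at hcN1
    have hs : ∀ (q : ℕ × Bool) (F : Multiset (Occ × Weight)),
        ((scale q F).map fun f => f.1.id) = F.map fun f => f.1.id := by
      intro q F; simp [scale]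
    refine ⟨?_, ?_, ?_, ?_, ?_, ?_, ?_⟩
    -- The shared occurrences are counted once. They differ from `F` and from `G` by the invariants
    -- of the two components, and `F` differs from `G` by `hFG`.
    · rw [nodup_cons_iff, nodup_add_iff, nodup_add_iff, hs, hs]
      simp only [suppW_add, suppW_scale, Set.disjoint_union_left]
      refine ⟨?_, ⟨hM1.1, hM1.2.1, hM1.2.2⟩, hN1.2.1, hN1.2.2, ?_⟩
      · rintro ((h | h) | h)
        · exact hcM1 (Or.inl h)
        · exact hcM1 (Or.inr h)
        · exact hcN1 (Or.inr h)
      · rw [Set.disjoint_left]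
        rintro n ⟨f, hf, hnf⟩ ⟨g, hg, hng⟩
        exact hFG f hf g hg (hnf.symm.trans hng)
    · rw [atUnit_cons, add_assoc]
      exact Multiset.cons_le_cons _ (Multiset.le_add_right _ _)
    · intro f hf
      have key1 : ∀ o w, (o, w) ∈ M.forms → ∃ l ∈ scale (p, true) M.links, o ∈ l.1.concls := by
        intro o w ho
        obtain ⟨l, hl, h⟩ := ihM.form_concl _ ho
        exact ⟨_, Multiset.mem_map_of_mem _ hl, h⟩
      have key2 : ∀ o w, (o, w) ∈ N.forms → ∃ l ∈ scale (p, false) N.links, o ∈ l.1.concls := by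
        intro o w ho
        obtain ⟨l, hl, h⟩ := ihN.form_concl _ ho
        exact ⟨_, Multiset.mem_map_of_mem _ hl, h⟩
      simp only [Multiset.mem_cons, Multiset.mem_add] at hf ⊢
      rcases hf with rfl | (hf | hf) | hf
      · exact ⟨_, Or.inl rfl, by simp [Link.concls]⟩
      · obtain ⟨l, hl, h⟩ := key1 f.1 f.2 (by rw [hF]; exact Multiset.mem_add.2 (Or.inl hf))
        exact ⟨l, Or.inr (Or.inl hl), h⟩
      · simp only [scale, Multiset.mem_map] at hf
        obtain ⟨f, hf, rfl⟩ := hf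
        obtain ⟨l, hl, h⟩ := key1 f.1 f.2 (by rw [hF]; exact Multiset.mem_add.2 (Or.inr hf))
        exact ⟨l, Or.inr (Or.inl hl), h⟩
      · simp only [scale, Multiset.mem_map] at hf
        obtain ⟨f, hf, rfl⟩ := hf
        obtain ⟨l, hl, h⟩ := key2 f.1 f.2 (by rw [hG]; exact Multiset.mem_add.2 (Or.inr hf))
        exact ⟨l, Or.inr (Or.inr hl), h⟩
    · have key1 : ∀ o w, (o, w) ∈ M.forms → ∃ w, (o, w) ∈ (c, unit) ::ₘ (atUnit Γ +
          scale (p, true) F + scale (p, false) G) := by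
        intro o w ho
        rw [hF, Multiset.mem_add] at ho
        rcases ho with ho | ho
        · exact ⟨w, by simp [ho]⟩
        · exact ⟨_, by
            simp only [Multiset.mem_cons, Multiset.mem_add]
            exact Or.inr (Or.inl (Or.inr (Multiset.mem_map_of_mem _ ho)))⟩
      have key2 : ∀ o w, (o, w) ∈ N.forms → ∃ w, (o, w) ∈ (c, unit) ::ₘ (atUnit Γ +
          scale (p, true) F + scale (p, false) G) := by
        intro o w ho
        rw [hG, Multiset.mem_add] at ho
        rcases ho with ho | ho
        · exact ⟨w, by simp [ho]⟩
        · exact ⟨_, by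
            simp only [Multiset.mem_cons, Multiset.mem_add]
            exact Or.inr (Or.inr (Multiset.mem_map_of_mem _ ho))⟩
      intro l hl o ho
      simp only [Multiset.mem_cons, Multiset.mem_add] at hl
      rcases hl with rfl | hl | hl
      · simp only [Link.occs, Link.prems, Link.concls, Multiset.insert_eq_cons, Multiset.mem_add,
          Multiset.mem_cons, Multiset.mem_singleton] at ho
        rcases ho with (rfl | rfl) | rfl
        · exact key1 _ _ (ihM.mem_forms (by simp [ha]))
        · exact key2 _ _ (ihN.mem_forms (by simp [hb]))
        · exact ⟨unit, by simp⟩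
      · simp only [scale, Multiset.mem_map] at hl
        obtain ⟨l, hl, rfl⟩ := hl
        obtain ⟨w, hw⟩ := ihM.occ_mem l hl o ho
        exact key1 _ _ hw
      · simp only [scale, Multiset.mem_map] at hl
        obtain ⟨l, hl, rfl⟩ := hl
        obtain ⟨w, hw⟩ := ihN.occ_mem l hl o ho
        exact key2 _ _ hw
    · have h1 := ihM.wts_forms
      have h2 := ihN.wts_forms
      rw [hF, wts_add] at h1
      rw [hG, wts_add] at h2
      simp only [wts_cons, wts_add, wts_atUnit, suppW_cons, suppW_add, suppW_scale,
        Link.eigenweights]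
      rintro q (⟨b, hb⟩ | (hq | hq) | hq)
      · simp at hb
      · simp at hq
      · rcases wts_scale_subset _ _ hq with hq | hq
        · exact Or.inl hq
        · exact Or.inr (Or.inl (h1 (Or.inr hq)))
      · rcases wts_scale_subset _ _ hq with hq | hq
        · exact Or.inl hq
        · exact Or.inr (Or.inr (h2 (Or.inr hq)))
    · simp only [wts_cons, wts_add, suppW_cons, suppW_add, suppW_scale, Link.eigenweights]
      rintro q (⟨b, hb⟩ | hq | hq)
      · simp at hb
      · rcases wts_scale_subset _ _ hq with hq | hq
        · exact Or.inl hq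
        · exact Or.inr (Or.inl (ihM.wts_links hq))
      · rcases wts_scale_subset _ _ hq with hq | hq
        · exact Or.inl hq
        · exact Or.inr (Or.inr (ihN.wts_links hq))
    · have h1 := ihM.concl_ev
      have h2 := ihN.concl_ev
      rw [ha, supp_cons, Set.disjoint_union_left] at h1
      rw [hb, supp_cons, Set.disjoint_union_left] at h2
      simp only [supp_cons, suppW_cons, suppW_add, suppW_scale, Set.disjoint_union_left,
        Set.disjoint_union_right, Link.evars]
      exact ⟨⟨Set.disjoint_empty _, Set.disjoint_empty _⟩, ⟨hcM.2, h1.2⟩, hcN.2, h2.2⟩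
  | @plus₁ d N Γ a c B hN h hc hf ih =>
    refine ih.extend _ _ ?_ hc rfl (by simp [Link.prems, h]) (by simp [Link.evars])
    rw [h]; exact Multiset.le_cons_self _ _
  | @plus₂ d N Γ b c B hN h hc hf ih =>
    refine ih.extend _ _ ?_ hc rfl (by simp [Link.prems, h]) (by simp [Link.evars])
    rw [h]; exact Multiset.le_cons_self _ _
  | @all d N Γ x a c A hN h hc hf ha hxA hxΓ hxN ih =>
    refine ih.extend _ _ ?_ hc rfl (by simp [Link.prems, h]) ?_
    · rw [h]; exact Multiset.le_cons_self _ _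
    · simp only [Link.evars, Set.disjoint_singleton_right, supp_cons, Set.mem_union, not_or]
      exact ⟨by rw [ovar, hf]; exact hxA, hxΓ⟩
  | @ex d N Γ B a c A hN h hc hf ha hB ih =>
    refine ih.extend _ _ ?_ hc rfl (by simp [Link.prems, h]) (by simp [Link.evars])
    rw [h]; exact Multiset.le_cons_self _ _
  | @weak d N c A hN hc hf ih =>
    exact ih.extend _ _ le_rfl hc rfl (by simp [Link.prems]) (by simp [Link.evars])
  | @contr d N Γ as c A hN h has hfa hf hc ih =>
    refine ih.extend _ _ ?_ hc rfl ?_ (by simp [Link.evars])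
    · rw [h]; exact Multiset.le_add_left _ _
    · intro o ho; rw [h]; exact Multiset.mem_add.2 (Or.inl ho)
  | @box d N k aux main hN h hk hid ih =>
    refine Wf.leaf (d := d + 1) (Link.box ⟨k, N, aux, main⟩) rfl hid ?_
    have := ih.concl_ev
    rw [h, ← Box.supp_outer] at this
    exact this

/-! ## Renaming and substitution -/

/-- The variables of the formulas substituted for the variables in a set. -/
def bvars (φ : ℕ → Formula) (V : Set ℕ) : Set ℕ := {x | ∃ y ∈ V, x ∈ (φ y).vars}

@[simp] theorem bvars_empty (φ : ℕ → Formula) : bvars φ ∅ = ∅ := by ext; simp [bvars]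
@[simp] theorem bvars_union (φ : ℕ → Formula) (U V : Set ℕ) :
    bvars φ (U ∪ V) = bvars φ U ∪ bvars φ V := by
  ext; simp [bvars, or_and_right, exists_or]
theorem bvars_mono (φ : ℕ → Formula) {U V : Set ℕ} (h : U ⊆ V) : bvars φ U ⊆ bvars φ V :=
  fun _ ⟨y, hy, hx⟩ => ⟨y, h hy, hx⟩
theorem vars_fsub (φ : ℕ → Formula) {n : ℕ} (A : Fm n) : (A.fsub φ).vars = bvars φ A.vars := by
  ext x; exact Fm.mem_vars_fsub φ x A

@[simp] theorem Occ.map_id (i : ℕ → ℕ) (φ : ℕ → Formula) (a : Occ) : (a.map i φ).id = i a.id := rfl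
@[simp] theorem Occ.map_fml (i : ℕ → ℕ) (φ : ℕ → Formula) (a : Occ) :
    (a.map i φ).fml = a.fml.fsub φ := rfl

theorem ovar_map (i : ℕ → ℕ) (φ : ℕ → Formula) (a : Occ) :
    ovar (a.map i φ) = bvars φ (ovar a) := vars_fsub φ a.fml

@[simp] theorem PTree.map_fml (i : ℕ → ℕ) (φ : ℕ → Formula) (t : PTree) :
    (t.map i φ).fml = t.fml.fsub φ := by
  induction t with
  | leaf x A => rfl
  | node l r hl hr => simp [PTree.map, PTree.fml, Fm.fsub, hl, hr]

theorem PTree.map_doors (i : ℕ → ℕ) (φ : ℕ → Formula) (t : PTree) :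
    (t.map i φ).doors = t.doors.map (Occ.map i φ) := by
  induction t with
  | leaf x A => rfl
  | node l r hl hr => simp [PTree.map, PTree.doors, hl, hr]

theorem Kind.app_fsub (k : Kind) (φ : ℕ → Formula) (A : Formula) :
    (k.app A).fsub φ = k.app (A.fsub φ) := by cases k <;> rfl

section Box
variable {β γ : Type} (i : ℕ → ℕ) (φ : ℕ → Formula) (g : β → γ) (b : Box β)

theorem Box.map_auxDoors : (b.map i φ g).auxDoors = b.auxDoors.map (Occ.map i φ) := by
  simp [Box.auxDoors, Box.map, Multiset.bind_map, Multiset.map_bind, PTree.map_doors]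

theorem Box.map_outer : (b.map i φ g).outer = b.outer.map (Occ.map i φ) := by
  rw [Box.outer, Box.map_auxDoors, Box.outer, Multiset.map_add]
  congr 1
  simp only [Box.mainDoors, Box.map, Multiset.map_map]
  refine Multiset.map_congr rfl fun q _ => ?_
  simp [Occ.map, Kind.app_fsub]

theorem Box.map_inner : (b.map i φ g).inner = b.inner.map (Occ.map id φ) := by
  simp only [Box.inner, Box.map, Multiset.map_add, Multiset.map_map]
  congr 1
  exact Multiset.map_congr rfl fun q _ => by simp [Occ.map]

end Box

section Link
variable {β γ : Type} (i w e : ℕ → ℕ) (φ : ℕ → Formula) (g : β → γ) (l : Link β)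

theorem Link.map_eigenweights : (l.map i w e φ g).eigenweights = w '' l.eigenweights := by
  cases l <;> simp [Link.map, Link.eigenweights]

variable {i w e φ g l}

theorem Link.map_evars {ev : β → Set ℕ} {ev' : γ → Set ℕ} (h : ∀ b, ev' (g b) = e '' ev b) :
    (l.map i w e φ g).evars ev' = e '' l.evars ev := by
  cases l <;> simp [Link.map, Link.evars, Box.map, h]

/-- The variable bound by a `∀`-link is renamed by `e` and is not touched by `φ`, whence the second
term of the bound. -/
theorem Link.map_vars {v : β → Set ℕ} {v' : γ → Set ℕ} {ev : β → Set ℕ}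
    (h : ∀ b, v' (g b) ⊆ bvars φ (v b) ∪ e '' ev b) :
    (l.map i w e φ g).vars v' ⊆ bvars φ (l.vars v) ∪ e '' l.evars ev := by
  cases l with
  | box b => exact h _
  | ex B a c => simp [Link.map, Link.vars, vars_fsub]
  | _ => simp [Link.map, Link.vars, Link.evars]

end Link

theorem Con.map_evars (e : ℕ → ℕ) (φ : ℕ → Formula) : ∀ (d : ℕ) (N : Con d),
    Con.evars d (Con.map e φ d N) = e '' Con.evars d N
  | 0, N => N.elim
  | d + 1, N => by
    ext x
    change x ∈ suppW (Link.evars (Con.evars d)) (Multiset.map _ N.links) ↔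
      x ∈ e '' suppW (Link.evars (Con.evars d)) N.links
    simp only [mem_suppW, Multiset.mem_map, Set.mem_image]
    constructor
    · rintro ⟨_, ⟨l, hl, rfl⟩, hx⟩
      rw [Link.map_evars (Con.map_evars e φ d)] at hx
      obtain ⟨y, hy, rfl⟩ := hx
      exact ⟨y, ⟨l, hl, hy⟩, rfl⟩
    · rintro ⟨y, ⟨l, hl, hy⟩, rfl⟩
      refine ⟨_, ⟨l, hl, rfl⟩, ?_⟩
      rw [Link.map_evars (Con.map_evars e φ d)]
      exact ⟨y, hy, rfl⟩

variable {d : ℕ}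

/-- Action of renamings and a substitution on a weighted occurrence. -/
def fmap (i w : ℕ → ℕ) (φ : ℕ → Formula) (f : Occ × Weight) : Occ × Weight :=
  (f.1.map i φ, f.2.image (Prod.map w id))

/-- Action of renamings and a substitution on a weighted link. -/
def lmap (i w e : ℕ → ℕ) (φ : ℕ → Formula) (l : Link (Con d) × Weight) : Link (Con d) × Weight :=
  (l.1.map i w e φ (Con.map e φ d), l.2.image (Prod.map w id))

section
variable (i w e : ℕ → ℕ) (φ : ℕ → Formula)

theorem Net.map_eq (N : Net d) : N.map i w e φ =
    ⟨N.forms.map (fmap i w φ), N.links.map (lmap i w e φ), N.concl.map (Occ.map i φ)⟩ := rfl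

theorem fids_map (F : Multiset (Occ × Weight)) : fids (F.map (fmap i w φ)) = i '' fids F := by
  ext x
  simp only [mem_suppW, Multiset.mem_map, Set.mem_image]
  constructor
  · rintro ⟨_, ⟨f, hf, rfl⟩, hx⟩
    exact ⟨f.1.id, ⟨f, hf, rfl⟩, hx.symm⟩
  · rintro ⟨_, ⟨f, hf, rfl⟩, rfl⟩
    exact ⟨_, ⟨f, hf, rfl⟩, rfl⟩

theorem fvars_map (F : Multiset (Occ × Weight)) :
    fvars (F.map (fmap i w φ)) = bvars φ (fvars F) := by
  ext x
  simp only [mem_suppW, Multiset.mem_map]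
  constructor
  · rintro ⟨_, ⟨f, hf, rfl⟩, hx⟩
    rw [fmap, ovar_map] at hx
    obtain ⟨y, hy, hx⟩ := hx
    exact ⟨y, ⟨f, hf, hy⟩, hx⟩
  · rintro ⟨y, ⟨f, hf, hy⟩, hx⟩
    refine ⟨_, ⟨f, hf, rfl⟩, ?_⟩
    rw [fmap, ovar_map]
    exact ⟨y, hy, hx⟩

theorem supp_ovar_map (Γ : Multiset Occ) :
    supp ovar (Γ.map (Occ.map i φ)) = bvars φ (supp ovar Γ) := by
  induction Γ using Multiset.induction_on with
  | empty => simp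
  | cons a s ih => simp [ih, ovar_map]

theorem lew_map (L : Multiset (Link (Con d) × Weight)) :
    lew (L.map (lmap i w e φ)) = w '' lew L := by
  ext x
  simp only [mem_suppW, Multiset.mem_map, Set.mem_image]
  constructor
  · rintro ⟨_, ⟨f, hf, rfl⟩, hx⟩
    rw [lmap, Link.map_eigenweights] at hx
    obtain ⟨y, hy, rfl⟩ := hx
    exact ⟨y, ⟨f, hf, hy⟩, rfl⟩
  · rintro ⟨y, ⟨f, hf, hy⟩, rfl⟩
    refine ⟨_, ⟨f, hf, rfl⟩, ?_⟩
    rw [lmap, Link.map_eigenweights]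
    exact ⟨y, hy, rfl⟩

theorem lev_map (L : Multiset (Link (Con d) × Weight)) :
    lev (L.map (lmap i w e φ)) = e '' lev L := by
  ext x
  simp only [mem_suppW, Multiset.mem_map, Set.mem_image]
  constructor
  · rintro ⟨_, ⟨f, hf, rfl⟩, hx⟩
    rw [lmap, Link.map_evars (Con.map_evars e φ d)] at hx
    obtain ⟨y, hy, rfl⟩ := hx
    exact ⟨y, ⟨f, hf, hy⟩, rfl⟩
  · rintro ⟨y, ⟨f, hf, hy⟩, rfl⟩
    refine ⟨_, ⟨f, hf, rfl⟩, ?_⟩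
    rw [lmap, Link.map_evars (Con.map_evars e φ d)]
    exact ⟨y, hy, rfl⟩

/-- The bound for the contents of boxes is a hypothesis, so that the same computation serves within
the recursion on depth in `Con.map_vars` and afterwards in `lvars_map`. -/
theorem lvars_map_of {L : Multiset (Link (Con d) × Weight)}
    (h : ∀ N : Con d, Con.vars d (Con.map e φ d N) ⊆ bvars φ (Con.vars d N) ∪ e '' Con.evars d N) :
    lvars (L.map (lmap i w e φ)) ⊆ bvars φ (lvars L) ∪ e '' lev L := by
  intro x
  simp only [mem_suppW, Multiset.mem_map]
  rintro ⟨_, ⟨l, hl, rfl⟩, hx⟩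
  rcases Link.map_vars h hx with ⟨y, hy, hx⟩ | ⟨y, hy, rfl⟩
  · exact Or.inl ⟨y, ⟨l, hl, hy⟩, hx⟩
  · exact Or.inr ⟨y, ⟨l, hl, hy⟩, rfl⟩

theorem Con.map_vars : ∀ (d : ℕ) (N : Con d),
    Con.vars d (Con.map e φ d N) ⊆ bvars φ (Con.vars d N) ∪ e '' Con.evars d N
  | 0, N => N.elim
  | d + 1, N => by
    change fvars (Multiset.map (fmap id id φ) N.forms) ∪
      lvars (Multiset.map (lmap id id e φ) N.links) ⊆ bvars φ (fvars N.forms ∪ lvars N.links) ∪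
        e '' lev N.links
    rw [fvars_map, bvars_union, Set.union_assoc]
    exact Set.union_subset_union le_rfl (lvars_map_of _ _ _ _ (Con.map_vars d))

theorem lvars_map (L : Multiset (Link (Con d) × Weight)) :
    lvars (L.map (lmap i w e φ)) ⊆ bvars φ (lvars L) ∪ e '' lev L :=
  lvars_map_of _ _ _ _ (Con.map_vars e φ d)

theorem Net.map_evars (N : Net d) : Net.evars (N.map i w e φ) = e '' Net.evars N :=
  lev_map i w e φ N.links

theorem Net.map_ids (N : Net d) : (N.map i w e φ).ids = i '' N.ids := by
  simp only [ids_eq, Net.map_eq, fids_map]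

theorem Net.map_eigenweights (N : Net d) :
    (N.map i w e φ).eigenweights = w '' N.eigenweights := lew_map i w e φ N.links

theorem Net.map_vars (N : Net d) :
    Net.vars (N.map i w e φ) ⊆ bvars φ (Net.vars N) ∪ e '' Net.evars N := by
  rw [vars_eq, vars_eq, evars_eq, bvars_union, Set.union_assoc]
  exact Set.union_subset_union (fvars_map i w φ N.forms).le (lvars_map i w e φ N.links)

theorem map_atUnit (Γ : Multiset Occ) :
    (atUnit Γ).map (fmap i w φ) = atUnit (Γ.map (Occ.map i φ)) := by
  simp only [atUnit, Multiset.map_map]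
  exact Multiset.map_congr rfl fun a _ => by simp [fmap]

theorem map_scale_forms (q : ℕ × Bool) (F : Multiset (Occ × Weight)) :
    (scale q F).map (fmap i w φ) = scale (w q.1, q.2) (F.map (fmap i w φ)) := by
  simp only [scale, Multiset.map_map]
  exact Multiset.map_congr rfl fun a _ => by simp [fmap, Finset.image_insert]; rfl

theorem map_scale_links (q : ℕ × Bool) (L : Multiset (Link (Con d) × Weight)) :
    (scale q L).map (lmap i w e φ) = scale (w q.1, q.2) (L.map (lmap i w e φ)) := by
  simp only [scale, Multiset.map_map]
  exact Multiset.map_congr rfl fun a _ => by simp [lmap, Finset.image_insert]; rfl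

end

/-- `φ` renames the variables in `E` by `e`, and captures no variable of `V`. -/
def SubstOk (e : ℕ → ℕ) (φ : ℕ → Formula) (E V : Set ℕ) : Prop :=
  ∀ x ∈ E, φ x = var (e x) ∧ ∀ y ∈ V, y ≠ x → e x ∉ (φ y).vars

namespace SubstOk
variable {e : ℕ → ℕ} {φ : ℕ → Formula} {E E' V V' : Set ℕ}

theorem mono (h : SubstOk e φ E V) (hE : E' ⊆ E) (hV : V' ⊆ V) : SubstOk e φ E' V' :=
  fun x hx => ⟨(h x (hE hx)).1, fun y hy => (h x (hE hx)).2 y (hV hy)⟩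

/-- Among the variables of `V`, only `x` itself could have an image mentioning `e x`, and `x` is not
in `V`. All freshness conditions of the rules are transported in this way. -/
theorem disjoint (h : SubstOk e φ E V) (hd : Disjoint E V) : Disjoint (e '' E) (bvars φ V) := by
  rw [Set.disjoint_left]
  rintro _ ⟨x, hx, rfl⟩ ⟨y, hy, hxy⟩
  refine (h x hx).2 y hy ?_ hxy
  rintro rfl
  exact Set.disjoint_left.1 hd hx hy

theorem image_subset (h : SubstOk e φ E V) : e '' E ⊆ bvars φ E := by
  rintro _ ⟨x, hx, rfl⟩
  exact ⟨x, hx, by rw [(h x hx).1]; exact rfl⟩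

/-- Where `φ` agrees with `e` on the eigenvariables, renamed eigenvariables are themselves images
under `φ`, so the extra term of `Net.map_vars` is absorbed. -/
theorem vars_map {w : ℕ → ℕ} {i : ℕ → ℕ} {N : Net d} (h : SubstOk e φ (Net.evars N) V) :
    Net.vars (N.map i w e φ) ⊆ bvars φ (Net.vars N) := by
  refine (Net.map_vars i w e φ N).trans (Set.union_subset le_rfl ?_)
  exact h.image_subset.trans (bvars_mono φ N.evars_subset_vars)

end SubstOk

theorem disjoint_image_of_injOn {f : ℕ → ℕ} {s t u : Set ℕ} (hf : Set.InjOn f u) (hs : s ⊆ u)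
    (ht : t ⊆ u) (h : Disjoint s t) : Disjoint (f '' s) (f '' t) :=
  Set.disjoint_left.2 fun _ ⟨_, hx, h₁⟩ ⟨_, hy, h₂⟩ =>
    Set.disjoint_left.1 h hx (hf (ht hy) (hs hx) (h₂.trans h₁.symm) ▸ hy)

theorem Net.Apart.map {M N : Net d} {i w e : ℕ → ℕ} {φ : ℕ → Formula} (h : Net.Apart M N)
    (hi : Set.InjOn i (M.ids ∪ N.ids)) (hw : Set.InjOn w (M.eigenweights ∪ N.eigenweights))
    (hφ : SubstOk e φ (Net.evars M ∪ Net.evars N) (Net.vars M ∪ Net.vars N)) :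
    Net.Apart (M.map i w e φ) (N.map i w e φ) := by
  have hM := hφ.mono (E' := Net.evars M) Set.subset_union_left (le_refl _)
  have hN := hφ.mono (E' := Net.evars N) Set.subset_union_right (le_refl _)
  refine ⟨?_, ?_, ?_, ?_⟩
  · simp only [Net.map_ids]
    exact disjoint_image_of_injOn hi Set.subset_union_left Set.subset_union_right h.1
  · simp only [Net.map_eigenweights]
    exact disjoint_image_of_injOn hw Set.subset_union_left Set.subset_union_right h.2.1
  · rw [Net.map_evars]
    exact ((hM.mono le_rfl Set.subset_union_right).disjoint h.2.2.1).mono_right hN.vars_map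
  · rw [Net.map_evars]
    exact (((hN.mono le_rfl Set.subset_union_left).disjoint h.2.2.2.symm).mono_right
      hM.vars_map).symm

theorem Net.Fresh.map {N : Net d} {c : Occ} {i w e : ℕ → ℕ} {φ : ℕ → Formula} {I V : Set ℕ}
    (h : Net.Fresh c N) (hi : Set.InjOn i I) (hcI : c.id ∈ I) (hNI : N.ids ⊆ I)
    (hφ : SubstOk e φ (Net.evars N) V) (hV : c.fml.vars ⊆ V) :
    Net.Fresh (c.map i φ) (N.map i w e φ) := by
  constructor
  · rw [Net.map_ids]
    rintro ⟨n, hn, h'⟩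
    exact h.1 (hi (hNI hn) hcI h' ▸ hn)
  · rw [Net.map_evars, Occ.map_fml, vars_fsub]
    exact ((hφ.mono le_rfl hV).disjoint h.2.symm).symm

theorem Net.extend_ids (N : Net d) (l : Link (Con d)) (c : Occ) (Γ : Multiset Occ) :
    PreNet.ids (N.extend l c Γ) = {c.id} ∪ N.ids := by
  simp only [ids_eq, PreNet.extend, suppW_cons]; rfl

theorem Net.extend_eigenweights (N : Net d) (l : Link (Con d)) (c : Occ) (Γ : Multiset Occ) :
    PreNet.eigenweights (N.extend l c Γ) = l.eigenweights ∪ N.eigenweights := by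
  simp only [eigenweights_eq, PreNet.extend, suppW_cons]

theorem Net.extend_evars (N : Net d) (l : Link (Con d)) (c : Occ) (Γ : Multiset Occ) :
    Net.evars (N.extend l c Γ) = l.evars (Con.evars d) ∪ Net.evars N := by
  simp only [evars_eq, PreNet.extend, suppW_cons]

theorem Net.extend_vars (N : Net d) (l : Link (Con d)) (c : Occ) (Γ : Multiset Occ) :
    Net.vars (N.extend l c Γ) = c.fml.vars ∪ l.vars (Con.vars d) ∪ Net.vars N := by
  simp only [vars_eq, PreNet.extend, suppW_cons, ovar]
  ext; simp only [Set.mem_union]; tauto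

theorem Net.extend_map (N : Net d) (l : Link (Con d)) (c : Occ) (Γ : Multiset Occ)
    (i w e : ℕ → ℕ) (φ : ℕ → Formula) : Net.map i w e φ (N.extend l c Γ) =
      (Net.map i w e φ N).extend (l.map i w e φ (Con.map e φ d)) (c.map i φ)
        (Γ.map (Occ.map i φ)) := by
  simp [Net.map_eq, PreNet.extend, fmap, lmap]

/-- What the conclusion of `Simple.map` needs of the premise of a rule that adds a link. -/
theorem extend_data {N : Net d} {l : Link (Con d)} {c : Occ} {Γ : Multiset Occ}
    {i w e : ℕ → ℕ} {φ : ℕ → Formula} (hc : Net.Fresh c N)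
    (hi : Set.InjOn i (PreNet.ids (N.extend l c Γ)))
    (hw : Set.InjOn w (PreNet.eigenweights (N.extend l c Γ)))
    (hφ : SubstOk e φ (Net.evars (N.extend l c Γ)) (Net.vars (N.extend l c Γ))) :
    Set.InjOn i N.ids ∧ Set.InjOn w N.eigenweights ∧ SubstOk e φ (Net.evars N) (Net.vars N) ∧
      Net.Fresh (c.map i φ) (N.map i w e φ) := by
  rw [Net.extend_ids] at hi
  rw [Net.extend_eigenweights] at hw
  rw [Net.extend_evars, Net.extend_vars] at hφ
  refine ⟨hi.mono Set.subset_union_right, hw.mono Set.subset_union_right,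
    hφ.mono Set.subset_union_right Set.subset_union_right,
    hc.map hi (Or.inl rfl) Set.subset_union_right
      (hφ.mono Set.subset_union_right le_rfl) fun x hx => Or.inl (Or.inl hx)⟩

/-- One induction covers all later uses: moving a vertex for an axiom cut or c-w, making fresh
copies of the contents of a box, and substituting a witness. Injectivity is needed only on names
that occur, and `SubstOk` keeps every eigenvariable condition true. -/
theorem Simple.map {N : Net d} (h : Simple N) : ∀ (i w e : ℕ → ℕ) (φ : ℕ → Formula),
    Set.InjOn i N.ids → Set.InjOn w N.eigenweights →
      SubstOk e φ (Net.evars N) (Net.vars N) → Simple (N.map i w e φ) := by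
  induction h with
  | @ax d a b hab hf =>
    intro i w e φ hi hw hφ
    have := Simple.ax (d := d) (a.map i φ) (b.map i φ)
      (fun h => hab (hi (by simp [ids_eq, Multiset.insert_eq_cons])
        (by simp [ids_eq, Multiset.insert_eq_cons]) h)) (by simp [hf, Fm.fsub_neg])
    simpa [Net.map_eq, fmap, lmap, Link.map, Multiset.insert_eq_cons] using this
  | @cut d M N Γ Δ a b hM hN hap ha hb hf ihM ihN =>
    intro i w e φ hi hw hφ
    have hi' : Set.InjOn i (M.ids ∪ N.ids) := by simpa [ids_eq] using hi
    have hw' : Set.InjOn w (M.eigenweights ∪ N.eigenweights) := by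
      simpa [eigenweights_eq, Link.eigenweights] using hw
    have hφ' : SubstOk e φ (Net.evars M ∪ Net.evars N) (Net.vars M ∪ Net.vars N) := by
      refine hφ.mono ?_ ?_ <;> intro x hx <;>
        simp only [evars_eq, vars_eq, suppW_add, suppW_cons, Set.mem_union] at hx ⊢ <;> tauto
    have := Simple.cut (a.map i φ) (b.map i φ)
      (ihM i w e φ (hi'.mono Set.subset_union_left) (hw'.mono Set.subset_union_left)
        (hφ'.mono Set.subset_union_left Set.subset_union_left))
      (ihN i w e φ (hi'.mono Set.subset_union_right) (hw'.mono Set.subset_union_right)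
        (hφ'.mono Set.subset_union_right Set.subset_union_right))
      (hap.map hi' hw' hφ') (Γ := Γ.map (Occ.map i φ)) (Δ := Δ.map (Occ.map i φ))
      (by simp [Net.map_eq, ha]) (by simp [Net.map_eq, hb]) (by simp [hf, Fm.fsub_neg])
    simpa [Net.map_eq, fmap, lmap, Link.map] using this
  | @one d c hf =>
    intro i w e φ hi hw hφ
    have := Simple.one (d := d) (c.map i φ) (by simp [hf, Fm.fsub])
    simpa [Net.map_eq, fmap, lmap, Link.map, Multiset.insert_eq_cons] using this
  | @bot d N c hN hc hf ih =>
    intro i w e φ hi hw hφ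
    obtain ⟨hi, hw, hφ, hc⟩ := extend_data hc hi hw hφ
    rw [Net.extend_map]
    exact Simple.bot _ (ih i w e φ hi hw hφ) hc (by simp [hf, Fm.fsub])
  | @tensor d M N Γ Δ a b c hM hN hap ha hb hcM hcN hf ihM ihN =>
    intro i w e φ hi hw hφ
    have hi1 : Set.InjOn i ({c.id} ∪ (M.ids ∪ N.ids)) := by
      simp only [ids_eq, suppW_add, suppW_cons] at hi
      simp only [ids_eq]; exact hi
    have hi' := hi1.mono (s₁ := M.ids ∪ N.ids) Set.subset_union_right
    have hw' : Set.InjOn w (M.eigenweights ∪ N.eigenweights) := by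
      simpa [eigenweights_eq, Link.eigenweights] using hw
    have hφ1 : SubstOk e φ (Net.evars M ∪ Net.evars N)
        (c.fml.vars ∪ (Net.vars M ∪ Net.vars N)) := by
      refine hφ.mono ?_ ?_ <;> intro x hx <;>
        simp only [evars_eq, vars_eq, suppW_add, suppW_cons, Set.mem_union, ovar] at hx ⊢ <;> tauto
    have hφ' := hφ1.mono le_rfl (V' := Net.vars M ∪ Net.vars N) Set.subset_union_right
    have := Simple.tensor (a.map i φ) (b.map i φ) (c.map i φ)
      (ihM i w e φ (hi'.mono Set.subset_union_left) (hw'.mono Set.subset_union_left)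
        (hφ'.mono Set.subset_union_left Set.subset_union_left))
      (ihN i w e φ (hi'.mono Set.subset_union_right) (hw'.mono Set.subset_union_right)
        (hφ'.mono Set.subset_union_right Set.subset_union_right))
      (hap.map hi' hw' hφ') (Γ := Γ.map (Occ.map i φ)) (Δ := Δ.map (Occ.map i φ))
      (by simp [Net.map_eq, ha]) (by simp [Net.map_eq, hb])
      (hcM.map hi1 (Or.inl rfl) (fun x hx => Or.inr (Or.inl hx))
        (hφ1.mono Set.subset_union_left le_rfl) Set.subset_union_left)
      (hcN.map hi1 (Or.inl rfl) (fun x hx => Or.inr (Or.inr hx))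
        (hφ1.mono Set.subset_union_right le_rfl) Set.subset_union_left)
      (by simp [hf, Fm.fsub])
    simpa [Net.map_eq, fmap, lmap, Link.map] using this
  | @par d N Γ a b c hN h hc hf ih =>
    intro i w e φ hi hw hφ
    obtain ⟨hi, hw, hφ, hc⟩ := extend_data hc hi hw hφ
    rw [Net.extend_map]
    exact Simple.par _ _ _ (ih i w e φ hi hw hφ) (by simp [Net.map_eq, h]) hc
      (by simp [hf, Fm.fsub])
  | @wth d M N Γ F G p a b c hM hN ha hb hF hG hFG hwd hpM hpN hMN hNM hcM hcN hf ihM ihN =>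
    intro i w e φ hi hw hφ
    have hi1 : Set.InjOn i ({c.id} ∪ (M.ids ∪ N.ids)) := by
      refine hi.mono fun x hx => ?_
      simp only [ids_eq, suppW_add, suppW_cons, suppW_scale, hF, hG, Set.mem_union] at hx ⊢
      simp only [Set.mem_singleton_iff, mem_oid] at hx ⊢
      tauto
    have hi' := hi1.mono (s₁ := M.ids ∪ N.ids) Set.subset_union_right
    have hw1 : Set.InjOn w ({p} ∪ (M.eigenweights ∪ N.eigenweights)) := by
      simpa only [eigenweights_eq, Link.eigenweights, suppW_add, suppW_cons, suppW_scale] using hw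
    have hw' := hw1.mono (s₁ := M.eigenweights ∪ N.eigenweights) Set.subset_union_right
    have hφ1 : SubstOk e φ (Net.evars M ∪ Net.evars N)
        (c.fml.vars ∪ (Net.vars M ∪ Net.vars N)) := by
      refine hφ.mono ?_ ?_ <;> intro x hx <;>
        simp only [evars_eq, vars_eq, suppW_add, suppW_cons, suppW_scale, hF, hG, Set.mem_union,
          ovar] at hx ⊢ <;> tauto
    have hφ' := hφ1.mono le_rfl (V' := Net.vars M ∪ Net.vars N) Set.subset_union_right
    have hp : ∀ {M' : Net d}, M'.eigenweights ⊆ M.eigenweights ∪ N.eigenweights →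
        p ∉ M'.eigenweights → w p ∉ (M'.map i w e φ).eigenweights := by
      intro M' hM' hp
      rw [Net.map_eigenweights]
      rintro ⟨q, hq, hqp⟩
      exact hp (hw1 (Or.inr (hM' hq)) (Or.inl rfl) hqp ▸ hq)
    have := Simple.wth (w p) (a.map i φ) (b.map i φ) (c.map i φ)
      (ihM i w e φ (hi'.mono Set.subset_union_left) (hw'.mono Set.subset_union_left)
        (hφ'.mono Set.subset_union_left Set.subset_union_left))
      (ihN i w e φ (hi'.mono Set.subset_union_right) (hw'.mono Set.subset_union_right)
        (hφ'.mono Set.subset_union_right Set.subset_union_right))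
      (Γ := Γ.map (Occ.map i φ)) (F := F.map (fmap i w φ)) (G := G.map (fmap i w φ))
      (by simp [Net.map_eq, ha]) (by simp [Net.map_eq, hb])
      (by simp [Net.map_eq, hF, map_atUnit]) (by simp [Net.map_eq, hG, map_atUnit])
      (by
        intro f hf g hg
        simp only [Multiset.mem_map] at hf hg
        obtain ⟨f, hf, rfl⟩ := hf
        obtain ⟨g, hg, rfl⟩ := hg
        intro h
        refine hFG f hf g hg (hi' (Or.inl ?_) (Or.inr ?_) h)
        · rw [ids_eq, hF]; exact ⟨f, Multiset.mem_add.2 (Or.inr hf), rfl⟩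
        · rw [ids_eq, hG]; exact ⟨g, Multiset.mem_add.2 (Or.inr hg), rfl⟩)
      (by
        simp only [Net.map_eigenweights]
        exact disjoint_image_of_injOn hw' Set.subset_union_left Set.subset_union_right hwd)
      (hp Set.subset_union_left hpM) (hp Set.subset_union_right hpN)
      (by
        rw [Net.map_evars]
        exact ((hφ'.mono Set.subset_union_left Set.subset_union_right).disjoint hMN).mono_right
          (hφ'.mono Set.subset_union_right le_rfl).vars_map)
      (by
        rw [Net.map_evars]
        exact (((hφ'.mono Set.subset_union_right Set.subset_union_left).disjoint
          hNM.symm).mono_right (hφ'.mono Set.subset_union_left le_rfl).vars_map).symm)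
      (hcM.map hi1 (Or.inl rfl) (fun x hx => Or.inr (Or.inl hx))
        (hφ1.mono Set.subset_union_left le_rfl) Set.subset_union_left)
      (hcN.map hi1 (Or.inl rfl) (fun x hx => Or.inr (Or.inr hx))
        (hφ1.mono Set.subset_union_right le_rfl) Set.subset_union_left)
      (by simp [hf, Fm.fsub])
    simp only [Net.map_eq, Multiset.map_cons, Multiset.map_add, map_atUnit, map_scale_forms,
      map_scale_links] at this ⊢
    exact this
  | @plus₁ d N Γ a c B hN h hc hf ih =>
    intro i w e φ hi hw hφ
    obtain ⟨hi, hw, hφ, hc⟩ := extend_data hc hi hw hφ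
    rw [Net.extend_map]
    exact Simple.plus₁ _ _ (B.fsub φ) (ih i w e φ hi hw hφ) (by simp [Net.map_eq, h]) hc
      (by simp [hf, Fm.fsub])
  | @plus₂ d N Γ b c B hN h hc hf ih =>
    intro i w e φ hi hw hφ
    obtain ⟨hi, hw, hφ, hc⟩ := extend_data hc hi hw hφ
    rw [Net.extend_map]
    exact Simple.plus₂ _ _ (B.fsub φ) (ih i w e φ hi hw hφ) (by simp [Net.map_eq, h]) hc
      (by simp [hf, Fm.fsub])
  | @all d N Γ x a c A hN h hc hf ha hxA hxΓ hxN ih =>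
    intro i w e φ hi hw hφ
    obtain ⟨hi, hw, hφ', hc⟩ := extend_data hc hi hw hφ
    rw [Net.extend_map]
    rw [Net.extend_evars, Net.extend_vars] at hφ
    -- The eigenvariable of the link is itself one of the variables controlled by `SubstOk`: it is
    -- sent to `e x`, and no other variable acquires `e x`.
    have hx := hφ x (Or.inl rfl)
    have hΓ : supp ovar Γ ⊆ Net.vars N := fun y hy =>
      Or.inl (hN.wf.conclVars_subset (by rw [h, supp_cons]; exact Or.inr hy))
    refine Simple.all _ _ _ (A.fsub φ) (ih i w e φ hi hw hφ') (by simp [Net.map_eq, h]) hc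
      (by simp [hf, Fm.fsub]) (by simp [ha, Fm.fsub_inst, Fm.fsub_var_apply, hx.1]) ?_ ?_ ?_
    · rw [vars_fsub]
      rintro ⟨y, hy, hxy⟩
      refine hx.2 y (Or.inl (Or.inl (by rw [hf]; exact hy))) ?_ hxy
      rintro rfl; exact hxA hy
    · rw [conclVars_eq, supp_ovar_map]
      rintro ⟨y, hy, hxy⟩
      refine hx.2 y (Or.inr (hΓ hy)) ?_ hxy
      rintro rfl; exact hxΓ hy
    · rw [Net.map_evars]
      rintro ⟨y, hy, hxy⟩
      refine hx.2 y (Or.inr (N.evars_subset_vars hy)) ?_ ?_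
      · rintro rfl; exact hxN hy
      · rw [(hφ' y hy).1, hxy]; exact rfl
  | @ex d N Γ B a c A hN h hc hf ha hB ih =>
    intro i w e φ hi hw hφ
    obtain ⟨hi, hw, hφ', hc⟩ := extend_data hc hi hw hφ
    rw [Net.extend_map]
    rw [Net.extend_evars, Net.extend_vars] at hφ
    refine Simple.ex _ _ _ (A.fsub φ) (ih i w e φ hi hw hφ') (by simp [Net.map_eq, h]) hc
      (by simp [hf, Fm.fsub]) (by simp [ha, Fm.fsub_inst]) ?_
    rw [Net.map_evars, vars_fsub]
    exact ((hφ.mono Set.subset_union_right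
      (fun y hy => Or.inl (Or.inr hy))).disjoint hB.symm).symm
  | @weak d N c A hN hc hf ih =>
    intro i w e φ hi hw hφ
    obtain ⟨hi, hw, hφ, hc⟩ := extend_data hc hi hw hφ
    rw [Net.extend_map]
    exact Simple.weak _ (A.fsub φ) (ih i w e φ hi hw hφ) hc (by simp [hf, Fm.fsub])
  | @contr d N Γ as c A hN h has hfa hf hc ih =>
    intro i w e φ hi hw hφ
    obtain ⟨hi, hw, hφ, hc⟩ := extend_data hc hi hw hφ
    rw [Net.extend_map]
    refine Simple.contr _ _ (A.fsub φ) (ih i w e φ hi hw hφ) (by simp [Net.map_eq, h])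
      (by simpa using has) ?_ (by simp [hf, Fm.fsub]) hc
    intro o ho
    obtain ⟨o', ho', rfl⟩ := Multiset.mem_map.1 ho
    simp [hfa o' ho', Fm.fsub]
  | @box d N k aux main hN h hk hid ih =>
    intro i w e φ hi hw hφ
    have hφ' : SubstOk e φ (Net.evars N) (Net.vars N) := by
      refine hφ.mono ?_ ?_
      · intro x hx
        exact ⟨_, Multiset.mem_singleton_self _, hx⟩
      · intro x hx
        exact Or.inr ⟨_, Multiset.mem_singleton_self _, hx⟩
    let b : Box (Con (d + 1)) := ⟨k, N, aux, main⟩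
    have ho : (b.map i φ (Con.map e φ (d + 1))).outer = b.outer.map (Occ.map i φ) :=
      Box.map_outer _ _ _ _
    have h1 := Simple.box k (aux.map fun q => (q.1, q.2.map i φ))
      (main.map fun q => (⟨q.1.id, q.1.fml.fsub φ⟩, i q.2))
      -- Vertices and eigenweights are local to a box, so the contents are renamed only in their
      -- variables.
      (ih id id e φ Function.injective_id.injOn Function.injective_id.injOn hφ')
      (by
        rw [Net.map_eq, h]
        exact (Box.map_inner i φ (Con.map e φ (d + 1)) b).symm)
      (by simpa using hk)
      (by
        change ((b.map i φ (Con.map e φ (d + 1))).outer.map Occ.id).Nodup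
        rw [ho, Multiset.map_map]
        have : b.outer.map (Occ.id ∘ Occ.map i φ) = (b.outer.map Occ.id).map i := by
          rw [Multiset.map_map]; rfl
        rw [this]
        refine Multiset.Nodup.map_on ?_ hid
        intro x hx y hy hxy
        obtain ⟨o, ho, rfl⟩ := Multiset.mem_map.1 hx
        obtain ⟨o', ho', rfl⟩ := Multiset.mem_map.1 hy
        have hm : ∀ o ∈ b.outer, o.id ∈ fids (atUnit b.outer) := fun o ho =>
          ⟨(o, unit), mem_atUnit.2 ⟨ho, rfl⟩, rfl⟩
        rw [ids_eq] at hi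
        exact hi (hm o ho) (hm o' ho') hxy)
    have h2 : Simple (⟨atUnit (b.map i φ (Con.map e φ (d + 1))).outer,
      {(Link.box (b.map i φ (Con.map e φ (d + 1))), unit)},
        (b.map i φ (Con.map e φ (d + 1))).outer⟩ : Net (d + 1)) := h1
    rw [ho] at h2
    have h3 : (⟨atUnit (b.outer.map (Occ.map i φ)),
        {(Link.box (b.map i φ (Con.map e φ (d + 1))), unit)},
        b.outer.map (Occ.map i φ)⟩ : Net (d + 1)) =
        Net.map i w e φ ⟨atUnit b.outer, {(Link.box b, unit)}, b.outer⟩ := by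
      rw [Net.map_eq]
      simp only [map_atUnit, Multiset.map_singleton]
      simp [lmap, Link.map]
    rw [h3] at h2
    exact h2

/-! ### What a renaming or a substitution leaves fixed -/

theorem Occ.map_self {i : ℕ → ℕ} {φ : ℕ → Formula} {a : Occ} (hi : i a.id = a.id)
    (hφ : ∀ x ∈ ovar a, φ x = var x) : a.map i φ = a := by
  rcases a with ⟨n, A⟩
  simp only [Occ.map, Occ.mk.injEq]
  exact ⟨hi, Fm.fsub_eq_self hφ⟩

theorem Multiset.map_eq_self {α : Type*} {f : α → α} {s : Multiset α} (h : ∀ a ∈ s, f a = a) :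
    s.map f = s := (Multiset.map_congr rfl h).trans (Multiset.map_id' s)

theorem PTree.map_self {i : ℕ → ℕ} {φ : ℕ → Formula} {t : PTree}
    (h : ∀ o ∈ t.doors, Occ.map i φ o = o) : t.map i φ = t := by
  induction t with
  | leaf x A =>
    have := h ⟨x, Fm.quest A⟩ (by simp [PTree.doors])
    simp only [Occ.map, Occ.mk.injEq, Fm.fsub, Fm.quest.injEq] at this
    simp [PTree.map, this]
  | node l r hl hr =>
    simp only [PTree.doors, List.mem_append] at h
    simp [PTree.map, hl fun o ho => h o (Or.inl ho), hr fun o ho => h o (Or.inr ho)]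

theorem Box.map_self {β : Type} {i : ℕ → ℕ} {φ : ℕ → Formula} {g : β → β} {b : Box β}
    (h : ∀ o ∈ b.outer, Occ.map i φ o = o) (hg : g b.content = b.content) : b.map i φ g = b := by
  rcases b with ⟨k, N, aux, main⟩
  simp only [Box.map, Box.mk.injEq, true_and]
  refine ⟨hg, Multiset.map_eq_self ?_, Multiset.map_eq_self ?_⟩
  · intro q hq
    refine Prod.ext rfl (PTree.map_self fun o ho => h o ?_)
    exact Multiset.mem_add.2 (Or.inl (Multiset.mem_bind.2 ⟨q, hq, ho⟩))
  · intro q hq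
    have := h ⟨q.2, k.app q.1.fml⟩
      (Multiset.mem_add.2 (Or.inr (Multiset.mem_map.2 ⟨q, hq, rfl⟩)))
    simp only [Occ.map, Occ.mk.injEq, Kind.app_fsub] at this
    refine Prod.ext ?_ this.1
    have h2 := this.2
    rcases q with ⟨⟨n, A⟩, m⟩
    simp only [Occ.mk.injEq, true_and]
    cases k <;> simpa [Kind.app] using h2

theorem Link.map_self {β : Type} {i w e : ℕ → ℕ} {φ : ℕ → Formula} {g : β → β} {l : Link β}
    {ev v : β → Set ℕ} (ho : ∀ o ∈ l.occs, Occ.map i φ o = o)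
    (hw : ∀ p ∈ l.eigenweights, w p = p)
    (he : ∀ x ∈ l.evars ev, e x = x) (hφ : ∀ x ∈ l.vars v, φ x = var x)
    (hg : ∀ b, l = Link.box b → g b.content = b.content) : l.map i w e φ g = l := by
  cases l with
  | box b =>
    simp only [Link.map, Link.box.injEq]
    exact Box.map_self (fun o h => ho o (by simpa [Link.occs, Link.prems, Link.concls] using h))
      (hg b rfl)
  | contr as c =>
    simp only [Link.occs, Link.prems, Link.concls, Multiset.mem_add, Multiset.mem_singleton] at ho
    simp only [Link.map, Link.contr.injEq]
    exact ⟨Multiset.map_eq_self fun a ha => ho a (Or.inl ha), ho c (Or.inr rfl)⟩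
  | ex B a c =>
    simp only [Link.occs, Link.prems, Link.concls, Multiset.mem_add, Multiset.mem_singleton] at ho
    simp only [Link.map, Link.ex.injEq]
    exact ⟨Fm.fsub_eq_self hφ, ho _ (Or.inl rfl), ho _ (Or.inr rfl)⟩
  | all x a c =>
    simp only [Link.occs, Link.prems, Link.concls, Multiset.mem_add, Multiset.mem_singleton] at ho
    simp only [Link.map, Link.all.injEq]
    exact ⟨he x rfl, ho _ (Or.inl rfl), ho _ (Or.inr rfl)⟩
  | wth p a b c =>
    simp only [Link.occs, Link.prems, Link.concls, Multiset.insert_eq_cons, Multiset.mem_add,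
      Multiset.mem_cons, Multiset.mem_singleton] at ho
    simp only [Link.map, Link.wth.injEq]
    exact ⟨hw p rfl, ho _ (by simp), ho _ (by simp), ho _ (by simp)⟩
  | _ =>
    simp only [Link.occs, Link.prems, Link.concls, Multiset.insert_eq_cons, Multiset.mem_add,
      Multiset.mem_cons, Multiset.mem_singleton] at ho
    simp [Link.map, ho]

/-- The box may be used in a simple proof net. -/
inductive SimpleBox : {d : ℕ} → Box (Con d) → Prop
  | mk {d : ℕ} {N : Net d} (k : Kind) (aux : Multiset (ℕ × PTree)) (main : Multiset (Occ × ℕ))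
      (hN : Simple N) (h : N.concl = Box.inner (⟨k, N, aux, main⟩ : Box (Con (d + 1))))
      (hk : k = Kind.bang → Multiset.card aux = 1 ∧ Multiset.card main = 1)
      (hid : ((Box.outer (⟨k, N, aux, main⟩ : Box (Con (d + 1)))).map Occ.id).Nodup) :
      SimpleBox (⟨k, N, aux, main⟩ : Box (Con (d + 1)))

variable {d : ℕ}

/-- Only the box rule creates box links; the other rules keep them, and `&` changes nothing but
their weights. This gives access to the contents of a box without knowing where the box sits. -/
theorem Simple.boxes {N : Net d} (h : Simple N) : ∀ b w, (Link.box b, w) ∈ N.links →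
    SimpleBox b := by
  induction h with
  | ax | one => intro b w h; simp at h
  | @cut d M N Γ Δ a b hM hN hap ha hb hf ihM ihN =>
    intro b w h
    simp only [Multiset.mem_cons, Multiset.mem_add, Prod.mk.injEq, reduceCtorEq, false_and,
      false_or] at h
    exact h.elim (ihM b w) (ihN b w)
  | @tensor d M N Γ Δ a b c hM hN hap ha hb hcM hcN hf ihM ihN =>
    intro b w h
    simp only [Multiset.mem_cons, Multiset.mem_add, Prod.mk.injEq, reduceCtorEq, false_and,
      false_or] at h
    exact h.elim (ihM b w) (ihN b w)
  | @wth d M N Γ F G p a b c hM hN ha hb hF hG hFG hwd hpM hpN hMN hNM hcM hcN hf ihM ihN =>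
    intro b w h
    simp only [Multiset.mem_cons, Multiset.mem_add, Prod.mk.injEq, reduceCtorEq, false_and,
      false_or, scale, Multiset.mem_map] at h
    rcases h with ⟨l, hl, h⟩ | ⟨l, hl, h⟩ <;> replace h := h.1
    · exact ihM b l.2 (h ▸ hl)
    · exact ihN b l.2 (h ▸ hl)
  | @box d N k aux main hN h hk hid ih =>
    intro b w hb
    have := Multiset.mem_singleton.1 hb
    obtain rfl := Link.box.inj (congrArg Prod.fst this)
    exact SimpleBox.mk k aux main hN h hk hid
  | bot _ _ _ _ ih | par _ _ _ _ _ _ _ ih | plus₁ _ _ _ _ _ _ _ ih | plus₂ _ _ _ _ _ _ _ ih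
  | all _ _ _ _ _ _ _ _ _ _ _ _ ih | ex _ _ _ _ _ _ _ _ _ _ ih | weak _ _ _ _ _ ih
  | contr _ _ _ _ _ _ _ _ _ ih =>
    intro b w h
    simp only [PreNet.extend, Multiset.mem_cons, Prod.mk.injEq, reduceCtorEq, false_and,
      false_or] at h
    exact ih b w h

theorem weight_map_id (w : Weight) : w.image (Prod.map id id) = w := by simp

theorem fmap_self {i : ℕ → ℕ} {φ : ℕ → Formula} {f : Occ × Weight}
    (h : f.1.map i φ = f.1) : fmap i id φ f = f := by
  simp [fmap, h]

theorem Con.map_self_var : ∀ (d : ℕ) (N : Con d), Con.map id var d N = N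
  | 0, _ => rfl
  | d + 1, ⟨F, L, Γ⟩ => by
    have ho : ∀ o : Occ, o.map id var = o := fun o => Occ.map_self rfl fun _ _ => rfl
    refine (PreNet.mk.injEq _ _ _ _ _ _).mpr ⟨?_, ?_, ?_⟩
    · exact Multiset.map_eq_self fun f _ => fmap_self (ho _)
    · refine Multiset.map_eq_self fun l _ => ?_
      exact Prod.ext (Link.map_self (ev := fun _ => ∅) (v := fun _ => ∅) (fun o _ => ho o)
        (fun _ _ => rfl) (fun _ _ => rfl) (fun _ _ => rfl)
        (fun b _ => Con.map_self_var d b.content)) (weight_map_id _)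
    · exact Multiset.map_eq_self fun o _ => ho o

theorem lmap_self_var {i : ℕ → ℕ} {l : Link (Con d) × Weight} (h : ∀ o ∈ l.1.occs, i o.id = o.id) :
    lmap i id id var l = l := by
  exact Prod.ext (Link.map_self (ev := fun _ => ∅) (v := fun _ => ∅)
    (fun o ho => Occ.map_self (h o ho) fun _ _ => rfl) (fun _ _ => rfl) (fun _ _ => rfl)
    (fun _ _ => rfl) fun b _ => Con.map_self_var d b.content) (weight_map_id _)

/-- The trivial renaming is the identity on contents of boxes, so moving a vertex is an instance of
the general action and `Simple.map` applies to it. -/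
theorem moveLinks_eq (m n : ℕ) (L : Multiset (Link (Con d) × Weight)) :
    moveLinks m n L = L.map (lmap (moveId m n) id id var) := by
  refine Multiset.map_congr rfl fun l _ => ?_
  simp only [lmap, weight_map_id]
  congr 2
  funext N
  exact (Con.map_self_var d N).symm

/-- A substitution that fixes the variables of a net fixes its links. -/
theorem Simple.lmap_self {φ : ℕ → Formula} : ∀ {d : ℕ} {N : Net d}, Simple N →
    (∀ x ∈ Net.vars N, φ x = var x) → Net.map id id id φ N = N
  | d, N, hN, hφ => by
    have ho : ∀ o w, (o, w) ∈ N.forms → Occ.map id φ o = o := fun o w h =>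
      Occ.map_self rfl fun x hx => hφ x (Or.inl ⟨_, h, hx⟩)
    rw [Net.map_eq]
    rcases N with ⟨F, L, Γ⟩
    simp only [PreNet.mk.injEq]
    refine ⟨Multiset.map_eq_self fun f hf => fmap_self (ho _ _ hf),
      Multiset.map_eq_self fun l hl => ?_, Multiset.map_eq_self fun o h => ?_⟩
    · refine Prod.ext (Link.map_self (ev := Con.evars d) (v := Con.vars d) ?_ (fun _ _ => rfl)
        (fun _ _ => rfl) (fun x hx => hφ x (Or.inr ⟨_, hl, hx⟩)) ?_) (weight_map_id _)
      · intro o h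
        obtain ⟨w, hw⟩ := hN.wf.occ_mem l hl o h
        exact ho o w hw
      · intro b hb
        have h1 := hN.boxes b l.2 (hb ▸ hl)
        have h2 : ∀ x ∈ Con.vars d b.content, φ x = var x :=
          fun x hx => hφ x (Or.inr ⟨_, hl, by rw [hb]; exact hx⟩)
        cases h1 with
        | mk k aux main hN' h hk hid => exact Simple.lmap_self hN' h2
    · exact ho _ _ (hN.wf.mem_forms h)


/-! ## Linear contexts -/

/-- The net obtained by the cut link `k` between two nets; `Γ` and `Δ` are their other conclusions. -/
def cutNet (k : Link (Con d)) (M N : Net d) (Γ Δ : Multiset Occ) : Net d :=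
  ⟨M.forms + N.forms, (k, unit) ::ₘ (M.links + N.links), Γ + Δ⟩

theorem cutNet_comm (k : Link (Con d)) (M N : Net d) (Γ Δ : Multiset Occ) :
    cutNet k M N Γ Δ = cutNet k N M Δ Γ := by
  simp only [cutNet, add_comm]

/-- The orientation of a cut link is immaterial, because negation is involutive and `cutNet` is
symmetric. -/
theorem Simple.of_cut {k : Link (Con d)} {M N : Net d} {Γ Δ : Multiset Occ} {a b : Occ}
    (hk : k.IsCut a b) (hM : Simple M) (hN : Simple N) (hap : Net.Apart M N)
    (ha : M.concl = a ::ₘ Γ) (hb : N.concl = b ::ₘ Δ) (hf : b.fml = a.fml.neg) :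
    Simple (cutNet k M N Γ Δ) := by
  rcases hk with rfl | rfl
  · exact Simple.cut a b hM hN hap ha hb hf
  · rw [cutNet_comm]
    exact Simple.cut b a hN hM hap.symm hb ha (Fm.eq_neg_comm hf)

/-- The net consisting of the single link `l` and its conclusions. -/
def leafNet (l : Link (Con d)) : Net d := ⟨atUnit l.concls, {(l, unit)}, l.concls⟩

/-- The simple proof net `S` is obtained by the rule that introduces the link `l`. -/
def LastRule (S : Net d) : Link (Con d) → Prop
  | .ax a b => a.id ≠ b.id ∧ b.fml = a.fml.neg ∧ S = leafNet (.ax a b)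
  | .cut a b => ∃ (M N : Net d) (Γ Δ : Multiset Occ), Simple M ∧ Simple N ∧ Net.Apart M N ∧
      M.concl = a ::ₘ Γ ∧ N.concl = b ::ₘ Δ ∧ b.fml = a.fml.neg ∧
        S = cutNet (.cut a b) M N Γ Δ
  | .one c => c.fml = Fm.one ∧ S = leafNet (.one c)
  | .bot c => ∃ N : Net d, Simple N ∧ Net.Fresh c N ∧ c.fml = Fm.bot ∧
      S = N.extend (.bot c) c N.concl
  | .tensor a b c => ∃ (M N : Net d) (Γ Δ : Multiset Occ), Simple M ∧ Simple N ∧ Net.Apart M N ∧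
      M.concl = a ::ₘ Γ ∧ N.concl = b ::ₘ Δ ∧ Net.Fresh c M ∧ Net.Fresh c N ∧
        c.fml = Fm.tensor a.fml b.fml ∧ S = ⟨(c, unit) ::ₘ (M.forms + N.forms),
          (.tensor a b c, unit) ::ₘ (M.links + N.links), c ::ₘ (Γ + Δ)⟩
  | .par a b c => ∃ (N : Net d) (Γ : Multiset Occ), Simple N ∧ N.concl = a ::ₘ b ::ₘ Γ ∧
      Net.Fresh c N ∧ c.fml = Fm.par a.fml b.fml ∧ S = N.extend (.par a b c) c Γ
  | .wth p a b c => ∃ (M N : Net d) (Γ : Multiset Occ) (F G : Multiset (Occ × Weight)),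
      Simple M ∧ Simple N ∧ M.concl = a ::ₘ Γ ∧ N.concl = b ::ₘ Γ ∧ M.forms = atUnit Γ + F ∧
        N.forms = atUnit Γ + G ∧ p ∉ M.eigenweights ∧ p ∉ N.eigenweights ∧
          c.fml = Fm.wth a.fml b.fml ∧
            S = ⟨(c, unit) ::ₘ (atUnit Γ + scale (p, true) F + scale (p, false) G),
              (.wth p a b c, unit) ::ₘ (scale (p, true) M.links + scale (p, false) N.links),
                c ::ₘ Γ⟩
  | .plus₁ a c => ∃ (N : Net d) (Γ : Multiset Occ) (B : Formula), Simple N ∧ N.concl = a ::ₘ Γ ∧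
      Net.Fresh c N ∧ c.fml = Fm.plus a.fml B ∧ S = N.extend (.plus₁ a c) c Γ
  | .plus₂ b c => ∃ (N : Net d) (Γ : Multiset Occ) (A : Formula), Simple N ∧ N.concl = b ::ₘ Γ ∧
      Net.Fresh c N ∧ c.fml = Fm.plus A b.fml ∧ S = N.extend (.plus₂ b c) c Γ
  | .all x a c => ∃ (N : Net d) (Γ : Multiset Occ) (A : Fm 1), Simple N ∧ N.concl = a ::ₘ Γ ∧
      Net.Fresh c N ∧ c.fml = Fm.all A ∧ a.fml = A.inst (var x) ∧ x ∉ A.vars ∧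
        x ∉ conclVars Γ ∧ x ∉ Net.evars N ∧ S = N.extend (.all x a c) c Γ
  | .ex B a c => ∃ (N : Net d) (Γ : Multiset Occ) (A : Fm 1), Simple N ∧ N.concl = a ::ₘ Γ ∧
      Net.Fresh c N ∧ c.fml = Fm.ex A ∧ a.fml = A.inst B ∧ Disjoint B.vars (Net.evars N) ∧
        S = N.extend (.ex B a c) c Γ
  | .weak c => ∃ (N : Net d) (A : Formula), Simple N ∧ Net.Fresh c N ∧ c.fml = Fm.quest A ∧
      S = N.extend (.weak c) c N.concl
  | .contr as c => ∃ (N : Net d) (Γ : Multiset Occ) (A : Formula), Simple N ∧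
      N.concl = as + Γ ∧ 2 ≤ Multiset.card as ∧ (∀ a ∈ as, a.fml = Fm.quest A) ∧
        c.fml = Fm.quest A ∧ Net.Fresh c N ∧ S = N.extend (.contr as c) c Γ
  | .box b => SimpleBox b ∧ S = leafNet (.box b)

/-- `S'` may take the place of `S` next to the occurrences `F` and the links `L`. -/
structure Compat (S S' : Net d) (F : Multiset (Occ × Weight))
    (L : Multiset (Link (Con d) × Weight)) : Prop where
  ids : Disjoint (fids S'.forms) (fids F)
  ew : Disjoint (lew S'.links) (lew L)
  ev : Disjoint (lev S'.links) (fvars F ∪ lvars L)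
  va : ∀ v ∈ lev L, v ∈ Net.vars S' → v ∈ Net.vars S

theorem Compat.mono {S S' : Net d} {F F' : Multiset (Occ × Weight)}
    {L L' : Multiset (Link (Con d) × Weight)} (h : Compat S S' F L) (hF : F' ≤ F) (hL : L' ≤ L) :
    Compat S S' F' L' :=
  ⟨h.ids.mono_right (suppW_mono _ hF), h.ew.mono_right (suppW_mono _ hL),
    h.ev.mono_right (Set.union_subset_union (suppW_mono _ hF) (suppW_mono _ hL)),
    fun v hv => h.va v (suppW_mono _ hL hv)⟩

/-- The net `N` consists of the net `S` and a linear context, made of the occurrences `F` and the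
links `L`.  The context consumes the conclusions `K` of `S`, keeps its conclusions `P`, and has its
own conclusions `O`.  Nets that are compatible with the context may be plugged into it. -/
structure Hole (N S : Net d) (K P O : Multiset Occ) (F : Multiset (Occ × Weight))
    (L : Multiset (Link (Con d) × Weight)) : Prop where
  forms : N.forms = S.forms + F
  links : N.links = S.links + L
  concl_in : S.concl = K + P
  concl_out : N.concl = P + O
  concl_new : ∀ o ∈ O, ∃ w, (o, w) ∈ F
  ids : Disjoint (fids S.forms) (fids F)
  ew : Disjoint (lew S.links) (lew L)
  ev : Disjoint (lev S.links) (fvars F ∪ lvars L)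
  wts_forms : wts F ⊆ lew L
  wts_links : wts L ⊆ lew L
  occs : ∀ l ∈ L, ∀ o ∈ l.1.occs, o ∈ K ∨ ∃ w, (o, w) ∈ F
  concls : ∀ l ∈ L, ∀ o ∈ l.1.concls, ∃ w, (o, w) ∈ F
  concl_ev : Disjoint (supp ovar P) (lev L)
  plug : ∀ (S' : Net d) (P' : Multiset Occ), Simple S' → S'.concl = K + P' → Compat S S' F L →
    Disjoint (supp ovar P') (lev L) → Simple (⟨S'.forms + F, S'.links + L, P' + O⟩ : Net d)

/-- Riesz refinement, with overlap `a ∩ c`. It is needed because the conclusions of an intermediate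
net are split in two ways: kept or new for the inner context, consumed or kept for the outer one. -/
theorem Multiset.riesz {α : Type*} [DecidableEq α] {a b c e : Multiset α} (h : a + b = c + e) :
    ∃ w x y z, a = w + x ∧ b = y + z ∧ c = w + y ∧ e = x + z := by
  have hc : ∀ q, a.count q + b.count q = c.count q + e.count q := fun q => by
    simpa using congrArg (Multiset.count q) h
  refine ⟨a ∩ c, a - c, c - a, b - (c - a), ?_, ?_, ?_, ?_⟩ <;> ext q <;>
    simp only [Multiset.count_add, Multiset.count_inter, Multiset.count_sub] <;>
    have := hc q <;> omega

namespace Hole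

theorem refl (N : Net d) : Hole N N 0 N.concl 0 0 0 where
  forms := by simp
  links := by simp
  concl_in := by simp
  concl_out := by simp
  concl_new := by simp
  ids := by simp
  ew := by simp
  ev := by simp
  wts_forms := by simp
  wts_links := by simp
  occs := by simp
  concls := by simp
  concl_ev := by simp
  plug S' P' hS h _ _ := by
    rcases S' with ⟨F, L, Γ⟩
    simp only [zero_add] at h
    subst h
    simpa using hS

variable {N M S : Net d} {K P O K₁ P₁ O₁ K₂ P₂ O₂ : Multiset Occ}
  {F F₁ F₂ : Multiset (Occ × Weight)} {L L₁ L₂ : Multiset (Link (Con d) × Weight)}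

theorem vars_eq (h : Hole N S K P O F L) :
    Net.vars N = Net.vars S ∪ (fvars F ∪ lvars L) := by
  rw [LLL.vars_eq, LLL.vars_eq, h.forms, h.links]
  ext x
  simp only [suppW_add, Set.mem_union]
  tauto

/-- Plugging a net into the inner context gives a net compatible with the outer one; its kept
conclusions may again be different, which is why `plug` quantifies over them. -/
theorem trans (h₁ : Hole N M K₁ P₁ O₁ F₁ L₁) (h₂ : Hole M S K₂ P₂ O₂ F₂ L₂) :
    ∃ K P O, (K₂ ≤ K ∧ P ≤ P₂ ∧ O₁ ≤ O) ∧ Hole N S K P O (F₂ + F₁) (L₂ + L₁) := by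
  -- `kp` and `pp` are kept by the inner context and then consumed or kept by the outer one; `ko`
  -- and `po` are new in the inner context, then consumed or kept. The composite therefore consumes
  -- `K₂ + kp`, keeps `pp` and adds `po + O₁`, while `ko` stays internal.
  obtain ⟨kp, pp, ko, po, rfl, rfl, rfl, rfl⟩ :=
    Multiset.riesz (h₂.concl_out.symm.trans h₁.concl_in)
  have hid := h₁.ids
  have hew := h₁.ew
  have hev := h₁.ev
  have hs1 := h₁.concl_ev
  have hs2 := h₂.concl_ev
  simp only [h₂.forms, h₂.links, suppW_add, supp_add, Set.disjoint_union_left,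
    Set.disjoint_union_right] at hid hew hev hs1 hs2
  have hev2 := h₂.ev
  simp only [Set.disjoint_union_right] at hev2
  refine ⟨K₂ + kp, pp, po + O₁, ⟨Multiset.le_add_right _ _, Multiset.le_add_left _ _,
    Multiset.le_add_left _ _⟩, ?_⟩
  constructor
  · rw [h₁.forms, h₂.forms, add_assoc]
  · rw [h₁.links, h₂.links, add_assoc]
  · rw [h₂.concl_in, add_assoc]
  · rw [h₁.concl_out, add_assoc]
  · intro o ho
    rcases Multiset.mem_add.1 ho with ho | ho
    · obtain ⟨w, hw⟩ := h₂.concl_new o (Multiset.mem_add.2 (Or.inr ho))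
      exact ⟨w, Multiset.mem_add.2 (Or.inl hw)⟩
    · obtain ⟨w, hw⟩ := h₁.concl_new o ho
      exact ⟨w, Multiset.mem_add.2 (Or.inr hw)⟩
  · simp only [suppW_add, Set.disjoint_union_right]
    exact ⟨h₂.ids, hid.1⟩
  · simp only [suppW_add, Set.disjoint_union_right]
    exact ⟨h₂.ew, hew.1⟩
  · simp only [suppW_add, Set.disjoint_union_right]
    tauto
  · simp only [suppW_add, wts_add]
    exact Set.union_subset_union h₂.wts_forms h₁.wts_forms
  · simp only [suppW_add, wts_add]
    exact Set.union_subset_union h₂.wts_links h₁.wts_links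
  · intro l hl o ho
    simp only [Multiset.mem_add, exists_or] at hl ⊢
    rcases hl with hl | hl
    · rcases h₂.occs l hl o ho with h | h <;> tauto
    · rcases h₁.occs l hl o ho with h | h
      · rcases Multiset.mem_add.1 h with h | h
        · tauto
        · have := h₂.concl_new o (Multiset.mem_add.2 (Or.inl h)); tauto
      · tauto
  · intro l hl o ho
    simp only [Multiset.mem_add, exists_or] at hl ⊢
    rcases hl with hl | hl
    · exact Or.inl (h₂.concls l hl o ho)
    · exact Or.inr (h₁.concls l hl o ho)
  · simp only [suppW_add, Set.disjoint_union_right]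
    exact ⟨hs2.2, hs1.1⟩
  · intro S' P' hS' hc hcomp hP'
    simp only [suppW_add, Set.disjoint_union_right] at hP'
    have h := h₂.plug S' (kp + P') hS' (by rw [hc, add_assoc])
      (hcomp.mono (Multiset.le_add_right _ _) (Multiset.le_add_right _ _))
      (by simp only [supp_add, Set.disjoint_union_left]; exact ⟨hs2.1, hP'.1⟩)
    have hi := hcomp.ids
    have hw := hcomp.ew
    have he := hcomp.ev
    simp only [suppW_add, Set.disjoint_union_right] at hi hw he
    have h' := h₁.plug _ (P' + po) h ?_ ⟨?_, ?_, ?_, ?_⟩ ?_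
    · simpa only [add_assoc] using h'
    · simp only; abel
    · simp only [suppW_add, Set.disjoint_union_left]
      exact ⟨hi.2, hid.2⟩
    · simp only [suppW_add, Set.disjoint_union_left]
      exact ⟨hw.2, hew.2⟩
    · simp only [suppW_add, Set.disjoint_union_left, Set.disjoint_union_right]
      tauto
    -- An eigenvariable of the outer context that occurs in the plugged inner net comes either from
    -- the inner context, which was part of `M`, or from `S'`, where `va` traces it back to `S`.
    · intro v hv hv'
      rw [LLL.vars_eq] at hv'
      simp only [suppW_add, Set.mem_union] at hv'
      rw [h₂.vars_eq]
      have := hcomp.va v (by simp only [suppW_add]; exact Or.inr hv)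
      simp only [LLL.vars_eq, Set.mem_union] at this ⊢
      tauto
    · simp only [supp_add, Set.disjoint_union_left]
      exact ⟨hP'.2, hs1.2⟩

/-- The context that adds one link with one conclusion. -/
theorem extend {as Γ : Multiset Occ} {l : Link (Con d)} {c : Occ} (h : M.concl = as + Γ)
    (hc : Net.Fresh c M) (hp : l.prems = as) (hl : l.concls = {c}) (hw : l.eigenweights = ∅)
    (hv : Disjoint (lev M.links) (l.vars (Con.vars d)))
    (hΓ : Disjoint (supp ovar Γ) (l.evars (Con.evars d)))
    (rule : ∀ (M' : Net d) (Γ' : Multiset Occ), Simple M' → M'.concl = as + Γ' →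
      Net.Fresh c M' → Disjoint (lev M'.links) (l.vars (Con.vars d)) →
        Disjoint (supp ovar Γ') (l.evars (Con.evars d)) → Simple (M'.extend l c Γ')) :
    Hole (M.extend l c Γ) M as Γ {c} {(c, unit)} {(l, unit)} where
  forms := by simp only [PreNet.extend, ← Multiset.singleton_add, add_comm]
  links := by simp only [PreNet.extend, ← Multiset.singleton_add, add_comm]
  concl_in := h
  concl_out := by simp only [PreNet.extend, ← Multiset.singleton_add, add_comm]
  concl_new o ho := ⟨unit, by simpa using ho⟩
  ids := by
    simp only [suppW_singleton]
    rw [Set.disjoint_right]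
    rintro n rfl h
    exact hc.1 (by rw [ids_eq]; exact h)
  ew := by simp [hw]
  ev := by
    simp only [suppW_singleton, Set.disjoint_union_right]
    exact ⟨hc.2.symm, hv⟩
  wts_forms := by simp
  wts_links := by simp
  occs l' hl' o ho := by
    obtain rfl := Multiset.mem_singleton.1 hl'
    simp only [Link.occs, hp, hl, Multiset.mem_add, Multiset.mem_singleton] at ho
    exact ho.imp_right fun h => ⟨unit, by simp [h]⟩
  concls l' hl' o ho := by
    obtain rfl := Multiset.mem_singleton.1 hl'
    simp only [hl, Multiset.mem_singleton] at ho
    exact ⟨unit, by simp [ho]⟩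
  concl_ev := by simpa using hΓ
  plug S' P' hS hP hcomp hP' := by
    have h1 := hcomp.ids
    have h2 := hcomp.ev
    simp only [suppW_singleton, Set.disjoint_union_right] at h1 h2 hP'
    have := rule S' P' hS hP ⟨by rw [ids_eq]; exact fun h => Set.disjoint_left.1 h1 h rfl,
      h2.1.symm⟩ h2.2 hP'
    simpa only [PreNet.extend, ← Multiset.singleton_add, add_comm] using this

/-- The context that adds one link between two nets. -/
theorem binary {T : Net d} {Γ Δ C : Multiset Occ} {l : Link (Con d)} {a b : Occ} (hT : Simple T)
    (hM : Simple M) (ha : M.concl = a ::ₘ Γ) (hb : T.concl = b ::ₘ Δ) (hap : Net.Apart M T)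
    (hC : ∀ c ∈ C, Net.Fresh c M) (hp : ∀ o ∈ l.prems, o = a ∨ o = b) (hl : l.concls = C)
    (hw : l.eigenweights = ∅) (hv : l.vars (Con.vars d) = ∅) (he : l.evars (Con.evars d) = ∅)
    (rule : ∀ (M' : Net d) (Γ' : Multiset Occ), Simple M' → M'.concl = a ::ₘ Γ' →
      Net.Apart M' T → (∀ c ∈ C, Net.Fresh c M') →
        Simple (⟨M'.forms + (atUnit C + T.forms), M'.links + (l, unit) ::ₘ T.links,
          Γ' + (C + Δ)⟩ : Net d)) :
    Hole ⟨M.forms + (atUnit C + T.forms), M.links + (l, unit) ::ₘ T.links, Γ + (C + Δ)⟩ M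
      {a} Γ (C + Δ) (atUnit C + T.forms) ((l, unit) ::ₘ T.links) where
  forms := rfl
  links := rfl
  concl_in := by rw [ha, Multiset.singleton_add]
  concl_out := rfl
  concl_new o ho := by
    rcases Multiset.mem_add.1 ho with ho | ho
    · exact ⟨unit, Multiset.mem_add.2 (Or.inl (mem_atUnit.2 ⟨ho, rfl⟩))⟩
    · exact ⟨unit, Multiset.mem_add.2
        (Or.inr (hT.wf.mem_forms (by rw [hb]; exact Multiset.mem_cons_of_mem ho)))⟩
  ids := by
    simp only [suppW_add, suppW_atUnit, Set.disjoint_union_right]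
    constructor
    · rw [Set.disjoint_right]
      rintro n ⟨c, hc, rfl⟩ h
      exact (hC c hc).1 (by rw [ids_eq]; exact h)
    · simpa only [ids_eq] using hap.1
  ew := by
    simp only [suppW_cons, hw, Set.empty_union]
    exact hap.2.1
  ev := by
    simp only [suppW_add, suppW_cons, suppW_atUnit, hv, Set.empty_union, Set.disjoint_union_right]
    have := hap.2.2.1
    rw [LLL.evars_eq, LLL.vars_eq, Set.disjoint_union_right] at this
    refine ⟨⟨?_, this.1⟩, this.2⟩
    rw [Set.disjoint_right]
    rintro n ⟨c, hc, hn⟩ h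
    exact Set.disjoint_left.1 (hC c hc).2 hn h
  wts_forms := by
    simp only [wts_add, wts_atUnit, suppW_cons, hw, Set.empty_union]
    exact hT.wf.wts_forms
  wts_links := by
    simp only [wts_cons, suppW_cons, hw, Set.empty_union]
    rintro p (⟨b, hb⟩ | hp)
    · simp at hb
    · exact hT.wf.wts_links hp
  occs l' hl' o ho := by
    simp only [Multiset.mem_add, exists_or]
    rcases Multiset.mem_cons.1 hl' with rfl | hl'
    · simp only [Link.occs, Multiset.mem_add] at ho
      rcases ho with ho | ho
      · rcases hp o ho with rfl | rfl
        · exact Or.inl (Multiset.mem_singleton_self _)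
        · exact Or.inr (Or.inr ⟨unit, hT.wf.mem_forms (by simp [hb])⟩)
      · rw [hl] at ho
        exact Or.inr (Or.inl ⟨unit, mem_atUnit.2 ⟨ho, rfl⟩⟩)
    · exact Or.inr (Or.inr (hT.wf.occ_mem l' hl' o ho))
  concls l' hl' o ho := by
    simp only [Multiset.mem_add, exists_or]
    rcases Multiset.mem_cons.1 hl' with rfl | hl'
    · rw [hl] at ho
      exact Or.inl ⟨unit, mem_atUnit.2 ⟨ho, rfl⟩⟩
    · exact Or.inr (hT.wf.occ_mem l' hl' o (Multiset.mem_add.2 (Or.inr ho)))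
  concl_ev := by
    simp only [suppW_cons, he, Set.empty_union]
    have h := hM.wf.conclVars_subset
    rw [ha, supp_cons] at h
    exact hap.2.2.2.mono_left (fun x hx => Or.inl (h (Or.inr hx)))
  plug S' P' hS hP hcomp hP' := by
    have h1 := hcomp.ids
    have h2 := hcomp.ew
    have h3 := hcomp.ev
    have h4 := hcomp.va
    simp only [suppW_add, suppW_cons, suppW_atUnit, hw, hv, he, Set.empty_union,
      Set.disjoint_union_right] at h1 h2 h3 h4
    refine rule S' P' hS (by rw [hP, Multiset.singleton_add]) ⟨?_, h2, ?_, ?_⟩ ?_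
    · simpa only [ids_eq] using h1.2
    · rw [LLL.evars_eq, LLL.vars_eq, Set.disjoint_union_right]
      exact ⟨h3.1.2, h3.2⟩
    -- The condition `va` is made for this: the plugged net may bring new variables, but no
    -- eigenvariable of the other component `T` unless `M` already had it, which apartness excludes.
    · rw [Set.disjoint_left]
      intro v hv hv'
      exact Set.disjoint_left.1 hap.2.2.2 (h4 v hv' hv) hv'
    · intro c hc
      refine ⟨?_, ?_⟩
      · rw [ids_eq]
        exact fun h => Set.disjoint_left.1 h1.1 h ⟨c, hc, rfl⟩
      · exact (h3.1.1.mono_right (subset_supp ovar hc)).symm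

end Hole


/-- The link `l` of the net `N` is introduced by the last rule of a subnet. -/
def HasHole (N : Net d) (l : Link (Con d)) : Prop :=
  ∃ (S : Net d) (K P O : Multiset Occ) (F : Multiset (Occ × Weight))
    (L : Multiset (Link (Con d) × Weight)), LastRule S l ∧ Simple S ∧ Hole N S K P O F L

theorem HasHole.of_last {N : Net d} {l : Link (Con d)} (h : Simple N) (hl : LastRule N l) :
    HasHole N l := ⟨N, 0, N.concl, 0, 0, 0, hl, h, Hole.refl N⟩

theorem HasHole.lift {N M : Net d} {l : Link (Con d)} {K P O : Multiset Occ}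
    {F : Multiset (Occ × Weight)} {L : Multiset (Link (Con d) × Weight)} (hl : HasHole M l)
    (h : Hole N M K P O F L) : HasHole N l := by
  obtain ⟨S, K', P', O', F', L', h1, h2, h3⟩ := hl
  obtain ⟨K, P, O, -, h⟩ := h.trans h3
  exact ⟨S, _, _, _, _, _, h1, h2, h⟩

theorem binary_eq_left (M T : Net d) (C Γ Δ : Multiset Occ) (l : Link (Con d)) :
    (⟨atUnit C + (M.forms + T.forms), (l, unit) ::ₘ (M.links + T.links), C + (Γ + Δ)⟩ : Net d) =
      ⟨M.forms + (atUnit C + T.forms), M.links + (l, unit) ::ₘ T.links, Γ + (C + Δ)⟩ := by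
  simp only [Multiset.add_cons, add_left_comm]

theorem binary_eq_right (M T : Net d) (C Γ Δ : Multiset Occ) (l : Link (Con d)) :
    (⟨atUnit C + (T.forms + M.forms), (l, unit) ::ₘ (T.links + M.links), C + (Δ + Γ)⟩ : Net d) =
      ⟨M.forms + (atUnit C + T.forms), M.links + (l, unit) ::ₘ T.links, Γ + (C + Δ)⟩ := by
  rw [← binary_eq_left, add_comm T.forms, add_comm T.links, add_comm Δ]

theorem cutNet_eq_left (k : Link (Con d)) (M T : Net d) (Γ Δ : Multiset Occ) :
    cutNet k M T Γ Δ = ⟨M.forms + (atUnit 0 + T.forms), M.links + (k, unit) ::ₘ T.links,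
      Γ + (0 + Δ)⟩ := by
  rw [← binary_eq_left]
  simp [cutNet]

theorem Hole.cut {k : Link (Con d)} {M T : Net d} {Γ Δ : Multiset Occ} {a b : Occ}
    (hk : k.IsCut a b) (hM : Simple M) (hT : Simple T) (hap : Net.Apart M T)
    (ha : M.concl = a ::ₘ Γ) (hb : T.concl = b ::ₘ Δ) (hf : b.fml = a.fml.neg) :
    Hole (cutNet k M T Γ Δ) M {a} Γ (0 + Δ) (atUnit 0 + T.forms) ((k, unit) ::ₘ T.links) := by
  have hk' : k = Link.cut a b ∨ k = Link.cut b a := hk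
  rw [cutNet_eq_left]
  refine Hole.binary (a := a) (b := b) hT hM ha hb hap (by simp) ?_ ?_ ?_ ?_ ?_ ?_
  · rcases hk' with rfl | rfl <;> simp only [Link.prems, Multiset.insert_eq_cons,
      Multiset.mem_cons, Multiset.mem_singleton] <;> tauto
  · rcases hk' with rfl | rfl <;> rfl
  · rcases hk' with rfl | rfl <;> rfl
  · rcases hk' with rfl | rfl <;> rfl
  · rcases hk' with rfl | rfl <;> rfl
  · intro M' Γ' hM' hc hap' _
    rw [← cutNet_eq_left]
    exact Simple.of_cut hk hM' hT hap' hc hb hf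

/-- The net `N` comes from the net `M` by a `&`-rule that multiplies `M` by the literal `q`, except
for its conclusions `Γ`; `E` and `E'` are the other occurrences and links of `N`. -/
structure WthHole (N M : Net d) (q : ℕ × Bool) (Γ : Multiset Occ) (F E : Multiset (Occ × Weight))
    (E' : Multiset (Link (Con d) × Weight)) : Prop where
  mforms : M.forms = atUnit Γ + F
  forms : N.forms = scale q F + E
  links : N.links = scale q M.links + E'
  concl_mem : ∀ o ∈ N.concl, (o, unit) ∈ E
  shared_mem : ∀ o ∈ Γ, (o, unit) ∈ E
  shared_concl : ∀ o ∈ Γ, o ∈ M.concl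
  shared_nodup : (atUnit Γ).Nodup
  ids : Disjoint (fids F) (fids E)
  ew : Disjoint (lew M.links) (lew E')
  ew_mem : q.1 ∈ lew E'
  ev : Disjoint (lev M.links) (fvars E ∪ lvars E')
  occs : ∀ l ∈ E', ∀ o ∈ l.1.occs, o ∈ M.concl ∨ ∃ w, (o, w) ∈ E
  plug : ∀ (M' : Net d) (F' : Multiset (Occ × Weight)), Simple M' → M'.concl = M.concl →
    M'.forms = atUnit Γ + F' → Disjoint (fids F') (fids E) → Disjoint (lew M'.links) (lew E') →
      Disjoint (lev M'.links) (fvars E ∪ lvars E') →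
        (∀ v ∈ lev E', v ∈ Net.vars M' → v ∈ Net.vars M) →
          Simple (⟨scale q F' + E, scale q M'.links + E', N.concl⟩ : Net d)

/-- One statement for both components of a `&`-rule: `M` is the component that may be replaced, and
`T`, with its literal `q'`, becomes part of the context. The argument `rule` is the `&`-rule with
`T` fixed. The replacement must keep the shared occurrences, since `T` uses them too. -/
theorem WthHole.intro {N M T : Net d} {q q' : ℕ × Bool} {Γ : Multiset Occ}
    {F G : Multiset (Occ × Weight)} {a b c : Occ} {l₀ : Link (Con d)} (hM : Simple M)
    (hT : Simple T) (ha : M.concl = a ::ₘ Γ) (hb : T.concl = b ::ₘ Γ) (hF : M.forms = atUnit Γ + F)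
    (hG : T.forms = atUnit Γ + G) (hFG : ∀ f ∈ F, ∀ g ∈ G, f.1.id ≠ g.1.id)
    (hw : Disjoint M.eigenweights T.eigenweights) {p : ℕ} (hq : q.1 = p)
    (hpM : p ∉ M.eigenweights)
    (hMT : Disjoint (Net.evars M) (Net.vars T)) (hTM : Disjoint (Net.vars M) (Net.evars T))
    (hcM : Net.Fresh c M) (hcT : Net.Fresh c T) (hp : l₀.prems = {a, b}) (hc : l₀.concls = {c})
    (he : l₀.eigenweights = {p}) (hv : l₀.vars (Con.vars d) = ∅)
    (hv' : l₀.evars (Con.evars d) = ∅)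
    (hNF : N.forms = scale q F + (c, unit) ::ₘ (atUnit Γ + scale q' G))
    (hNL : N.links = scale q M.links + (l₀, unit) ::ₘ scale q' T.links) (hNc : N.concl = c ::ₘ Γ)
    (rule : ∀ (M' : Net d) (F' : Multiset (Occ × Weight)), Simple M' → M'.concl = a ::ₘ Γ →
      M'.forms = atUnit Γ + F' → (∀ f ∈ F', ∀ g ∈ G, f.1.id ≠ g.1.id) →
        Disjoint M'.eigenweights T.eigenweights → p ∉ M'.eigenweights →
          Disjoint (Net.evars M') (Net.vars T) → Disjoint (Net.vars M') (Net.evars T) →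
            Net.Fresh c M' → Simple (⟨scale q F' + (c, unit) ::ₘ (atUnit Γ + scale q' G),
              scale q M'.links + (l₀, unit) ::ₘ scale q' T.links, c ::ₘ Γ⟩ : Net d)) :
    WthHole N M q Γ F ((c, unit) ::ₘ (atUnit Γ + scale q' G))
      ((l₀, unit) ::ₘ scale q' T.links) where
  mforms := hF
  forms := hNF
  links := hNL
  concl_mem o ho := by
    rw [hNc, Multiset.mem_cons] at ho
    rcases ho with rfl | ho
    · exact Multiset.mem_cons_self _ _
    · exact Multiset.mem_cons_of_mem (Multiset.mem_add.2 (Or.inl (mem_atUnit.2 ⟨ho, rfl⟩)))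
  shared_mem o ho :=
    Multiset.mem_cons_of_mem (Multiset.mem_add.2 (Or.inl (mem_atUnit.2 ⟨ho, rfl⟩)))
  shared_concl o ho := by rw [ha]; exact Multiset.mem_cons_of_mem ho
  shared_nodup := by
    have hnd := hM.wf.nodup
    rw [hF, nodup_add_iff] at hnd
    exact hnd.1.of_map
  ids := by
    have hnd := hM.wf.nodup
    rw [hF, nodup_add_iff] at hnd
    have hc' := hcM.1
    rw [ids_eq, hF] at hc'
    simp only [suppW_cons, suppW_add, suppW_scale, Set.disjoint_union_right]
    refine ⟨?_, hnd.2.2.symm, ?_⟩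
    · rw [Set.disjoint_right]
      rintro n rfl hn
      exact hc' (by simp only [suppW_add]; exact Or.inr hn)
    · rw [Set.disjoint_left]
      rintro n ⟨f, hf, hn⟩ ⟨g, hg, hn'⟩
      exact hFG f hf g hg (hn.symm.trans hn')
  ew := by
    simp only [suppW_cons, suppW_scale, he, Set.disjoint_union_right]
    exact ⟨Set.disjoint_singleton_right.2 hpM, hw⟩
  ew_mem := by simp [he, hq]
  ev := by
    have h := hMT
    rw [LLL.evars_eq, LLL.vars_eq, hG] at h
    simp only [suppW_cons, suppW_add, suppW_scale, hv, Set.empty_union,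
      Set.disjoint_union_right] at h ⊢
    exact ⟨⟨hcM.2.symm, h.1.1, h.1.2⟩, h.2⟩
  occs l hl o ho := by
    rcases Multiset.mem_cons.1 hl with rfl | hl
    · simp only [Link.occs, hp, hc, Multiset.insert_eq_cons, Multiset.mem_add, Multiset.mem_cons,
        Multiset.mem_singleton] at ho
      rcases ho with (rfl | rfl) | rfl
      · exact Or.inl (by simp [ha])
      · right
        have h1 := hT.wf.mem_forms (by rw [hb]; simp : o ∈ T.concl)
        rw [hG] at h1
        rcases Multiset.mem_add.1 h1 with h1 | h1
        · exact ⟨unit, Multiset.mem_cons_of_mem (Multiset.mem_add.2 (Or.inl h1))⟩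
        · exact ⟨_, Multiset.mem_cons_of_mem (Multiset.mem_add.2
            (Or.inr (Multiset.mem_map.2 ⟨_, h1, rfl⟩)))⟩
      · exact Or.inr ⟨unit, Multiset.mem_cons_self _ _⟩
    · right
      obtain ⟨l', hl', rfl⟩ := Multiset.mem_map.1 hl
      obtain ⟨w, hw⟩ := hT.wf.occ_mem l' hl' o ho
      rw [hG] at hw
      rcases Multiset.mem_add.1 hw with h1 | h1
      · exact ⟨w, Multiset.mem_cons_of_mem (Multiset.mem_add.2 (Or.inl h1))⟩
      · exact ⟨_, Multiset.mem_cons_of_mem (Multiset.mem_add.2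
          (Or.inr (Multiset.mem_map.2 ⟨_, h1, rfl⟩)))⟩
  plug M' F' hM' hc' hF' hids hew hev hva := by
    simp only [suppW_cons, suppW_add, suppW_scale, suppW_atUnit, he, hv, hv', Set.empty_union,
      Set.disjoint_union_right, Set.disjoint_singleton_right] at hids hew hev hva
    rw [hNc]
    refine rule M' F' hM' (hc'.trans ha) hF' ?_ hew.2 hew.1 ?_ ?_ ⟨?_, hev.1.1.symm⟩
    · intro f hf g hg h
      exact Set.disjoint_left.1 hids.2.2 ⟨f, hf, rfl⟩ ⟨g, hg, h⟩
    · rw [LLL.evars_eq, LLL.vars_eq, hG]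
      simp only [suppW_add, suppW_atUnit, Set.disjoint_union_right]
      exact ⟨hev.1.2, hev.2⟩
    · rw [Set.disjoint_right]
      intro v hv hv'
      exact Set.disjoint_right.1 hTM hv (hva v hv hv')
    · rw [ids_eq, hF']
      simp only [suppW_add, suppW_atUnit]
      rintro (h | h)
      · refine hcM.1 ?_
        rw [ids_eq, hF]
        simp only [suppW_add, suppW_atUnit]
        exact Or.inl h
      · exact Set.disjoint_left.1 hids.1 h rfl

/-- Induction along the context of a link. -/
theorem Simple.link_induction {motive : ∀ {d : ℕ}, Net d → Link (Con d) × Weight → Prop}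
    (last : ∀ {d : ℕ} {N : Net d} {l : Link (Con d)}, Simple N → LastRule N l →
      motive N (l, unit))
    (lift : ∀ {d : ℕ} {N M : Net d} {K P O : Multiset Occ} {F : Multiset (Occ × Weight)}
      {L : Multiset (Link (Con d) × Weight)} {l : Link (Con d) × Weight}, Simple N → motive M l →
        Hole N M K P O F L → motive N l)
    (wth : ∀ {d : ℕ} {N M : Net d} {q : ℕ × Bool} {Γ : Multiset Occ}
      {F E : Multiset (Occ × Weight)} {E' : Multiset (Link (Con d) × Weight)}
        {l : Link (Con d) × Weight}, Simple N → motive M l → WthHole N M q Γ F E E' →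
          motive N (l.1, insert q l.2))
    {d : ℕ} {N : Net d} (h : Simple N) : ∀ l ∈ N.links, motive N l := by
  induction h with
  | @ax d a b hab hf =>
    intro l hl
    obtain rfl := Multiset.mem_singleton.1 hl
    exact last (.ax a b hab hf) ⟨hab, hf, rfl⟩
  | @one d c hf =>
    intro l hl
    obtain rfl := Multiset.mem_singleton.1 hl
    exact last (.one c hf) ⟨hf, rfl⟩
  | @cut d M N Γ Δ a b hM hN hap ha hb hf ihM ihN =>
    intro l hl
    simp only [Multiset.mem_cons, Multiset.mem_add] at hl
    rcases hl with rfl | hl | hl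
    · exact last (.cut a b hM hN hap ha hb hf) ⟨M, N, Γ, Δ, hM, hN, hap, ha, hb, hf, rfl⟩
    · exact lift (.cut a b hM hN hap ha hb hf) (ihM l hl) (Hole.cut (Or.inl rfl) hM hN hap ha hb hf)
    · have := Hole.cut (k := Link.cut a b) (Or.inr rfl) hN hM hap.symm hb ha (Fm.eq_neg_comm hf)
      rw [cutNet_comm] at this
      exact lift (.cut a b hM hN hap ha hb hf) (ihN l hl) this
  | @tensor d M N Γ Δ a b c hM hN hap ha hb hcM hcN hf ihM ihN =>
    intro l hl
    simp only [Multiset.mem_cons, Multiset.mem_add] at hl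
    rcases hl with rfl | hl | hl
    · exact last (.tensor a b c hM hN hap ha hb hcM hcN hf)
        ⟨M, N, Γ, Δ, hM, hN, hap, ha, hb, hcM, hcN, hf, rfl⟩
    · have := Hole.binary (l := Link.tensor a b c) (C := {c}) hN hM ha hb hap (by simpa using hcM)
        (by simp [Link.prems]) rfl rfl rfl rfl fun M' Γ' hM' hc hap' hc' => by
          rw [← binary_eq_left]
          simpa [Multiset.singleton_add] using
            Simple.tensor a b c hM' hN hap' hc hb (hc' c (by simp)) hcN hf
      rw [← binary_eq_left] at this
      simpa [Multiset.singleton_add] using lift (.tensor a b c hM hN hap ha hb hcM hcN hf) (ihM l hl) this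
    · have := Hole.binary (l := Link.tensor a b c) (C := {c}) hM hN hb ha hap.symm
        (by simpa using hcN) (by simp [Link.prems]) rfl rfl rfl rfl
          fun N' Γ' hN' hc hap' hc' => by
          rw [← binary_eq_right]
          simpa [Multiset.singleton_add] using
            Simple.tensor a b c hM hN' hap'.symm ha hc hcM (hc' c (by simp)) hf
      rw [← binary_eq_right] at this
      simpa [Multiset.singleton_add] using lift (.tensor a b c hM hN hap ha hb hcM hcN hf) (ihN l hl) this
  | @wth d M N Γ F G p a b c hM hN ha hb hF hG hFG hwd hpM hpN hMN hNM hcM hcN hf ihM ihN =>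
    have hS := Simple.wth p a b c hM hN ha hb hF hG hFG hwd hpM hpN hMN hNM hcM hcN hf
    intro l hl
    simp only [Multiset.mem_cons, Multiset.mem_add] at hl
    rcases hl with rfl | hl | hl
    · exact last hS ⟨M, N, Γ, F, G, hM, hN, ha, hb, hF, hG, hpM, hpN, hf, rfl⟩
    · obtain ⟨l', hl', rfl⟩ := Multiset.mem_map.1 hl
      refine wth hS (ihM l' hl') (WthHole.intro (q := (p, true)) (q' := (p, false))
        (l₀ := .wth p a b c) hM hN ha hb hF hG hFG hwd rfl
        hpM hMN hNM hcM hcN rfl rfl rfl rfl rfl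
        (by simp only [← Multiset.singleton_add]; abel)
        (by simp only [← Multiset.singleton_add]; abel) rfl ?_)
      intro M' F' hM' ha' hF' hFG' hw' hp' hMN' hNM' hc'
      convert Simple.wth p a b c hM' hN ha' hb hF' hG hFG' hw' hp' hpN hMN' hNM' hc' hcN hf using 2
      · simp only [← Multiset.singleton_add]; abel
      · simp only [← Multiset.singleton_add]; abel
    · obtain ⟨l', hl', rfl⟩ := Multiset.mem_map.1 hl
      -- The second component is the first with the nets and the two literals exchanged.
      refine wth hS (ihN l' hl') (WthHole.intro (q := (p, false)) (q' := (p, true))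
        (l₀ := .wth p a b c) hN hM hb ha hG hF (fun f hf g hg h => hFG g hg f hf h.symm) hwd.symm
        rfl hpN hNM.symm hMN.symm hcN hcM (Multiset.cons_swap a b 0) rfl rfl rfl rfl
        (by simp only [← Multiset.singleton_add]; abel)
        (by simp only [← Multiset.singleton_add]; abel) rfl ?_)
      intro M' F' hM' ha' hF' hFG' hw' hp' hMN' hNM' hc'
      convert Simple.wth p a b c hM hM' ha ha' hF hF' (fun f hf g hg h => hFG' g hg f hf h.symm)
        hw'.symm hpM hp' hNM'.symm hMN'.symm hcM hc' hf using 2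
      · simp only [← Multiset.singleton_add]; abel
      · simp only [← Multiset.singleton_add]; abel
  | @bot d N c hN hc hf ih =>
    intro l hl
    simp only [PreNet.extend, Multiset.mem_cons] at hl
    rcases hl with rfl | hl
    · exact last (.bot c hN hc hf) ⟨N, hN, hc, hf, rfl⟩
    · refine lift (.bot c hN hc hf) (ih l hl) (Hole.extend (as := 0) (zero_add _).symm hc rfl rfl rfl
        (Set.disjoint_empty _) (Set.disjoint_empty _) ?_)
      intro M' Γ' hM' hΓ hc' _ _
      rw [zero_add] at hΓ
      subst hΓ
      exact .bot c hM' hc' hf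
  | @par d N Γ a b c hN h hc hf ih =>
    intro l hl
    simp only [PreNet.extend, Multiset.mem_cons] at hl
    rcases hl with rfl | hl
    · exact last (.par a b c hN h hc hf) ⟨N, Γ, hN, h, hc, hf, rfl⟩
    · refine lift (.par a b c hN h hc hf) (ih l hl) (Hole.extend (as := {a, b})
        (by simp [h, Multiset.insert_eq_cons]) hc rfl rfl rfl
        (Set.disjoint_empty _) (Set.disjoint_empty _) ?_)
      intro M' Γ' hM' hΓ hc' _ _
      exact .par a b c hM' (by simp [hΓ, Multiset.insert_eq_cons]) hc' hf
  | @plus₁ d N Γ a c B hN h hc hf ih =>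
    intro l hl
    simp only [PreNet.extend, Multiset.mem_cons] at hl
    rcases hl with rfl | hl
    · exact last (.plus₁ a c B hN h hc hf) ⟨N, Γ, B, hN, h, hc, hf, rfl⟩
    · refine lift (.plus₁ a c B hN h hc hf) (ih l hl) (Hole.extend (as := {a}) (by simp [h]) hc rfl rfl rfl
        (Set.disjoint_empty _) (Set.disjoint_empty _) ?_)
      intro M' Γ' hM' hΓ hc' _ _
      exact .plus₁ a c B hM' (by simp [hΓ]) hc' hf
  | @plus₂ d N Γ b c A hN h hc hf ih =>
    intro l hl
    simp only [PreNet.extend, Multiset.mem_cons] at hl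
    rcases hl with rfl | hl
    · exact last (.plus₂ b c A hN h hc hf) ⟨N, Γ, A, hN, h, hc, hf, rfl⟩
    · refine lift (.plus₂ b c A hN h hc hf) (ih l hl) (Hole.extend (as := {b}) (by simp [h]) hc rfl rfl rfl
        (Set.disjoint_empty _) (Set.disjoint_empty _) ?_)
      intro M' Γ' hM' hΓ hc' _ _
      exact .plus₂ b c A hM' (by simp [hΓ]) hc' hf
  | @all d N Γ x a c A hN h hc hf ha hxA hxΓ hxN ih =>
    intro l hl
    simp only [PreNet.extend, Multiset.mem_cons] at hl
    rcases hl with rfl | hl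
    · exact last (.all x a c A hN h hc hf ha hxA hxΓ hxN)
        ⟨N, Γ, A, hN, h, hc, hf, ha, hxA, hxΓ, hxN, rfl⟩
    · refine lift (.all x a c A hN h hc hf ha hxA hxΓ hxN) (ih l hl) (Hole.extend (as := {a}) (by simp [h]) hc rfl rfl rfl
        (Set.disjoint_singleton_right.2 hxN) (Set.disjoint_singleton_right.2 hxΓ) ?_)
      intro M' Γ' hM' hΓ hc' h1 h2
      exact .all x a c A hM' (by simp [hΓ]) hc' hf ha hxA (Set.disjoint_singleton_right.1 h2)
        (Set.disjoint_singleton_right.1 h1)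
  | @ex d N Γ B a c A hN h hc hf ha hB ih =>
    intro l hl
    simp only [PreNet.extend, Multiset.mem_cons] at hl
    rcases hl with rfl | hl
    · exact last (.ex B a c A hN h hc hf ha hB) ⟨N, Γ, A, hN, h, hc, hf, ha, hB, rfl⟩
    · refine lift (.ex B a c A hN h hc hf ha hB) (ih l hl) (Hole.extend (as := {a}) (by simp [h]) hc rfl rfl rfl
        hB.symm (Set.disjoint_empty _) ?_)
      intro M' Γ' hM' hΓ hc' h1 _
      exact .ex B a c A hM' (by simp [hΓ]) hc' hf ha h1.symm
  | @weak d N c A hN hc hf ih =>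
    intro l hl
    simp only [PreNet.extend, Multiset.mem_cons] at hl
    rcases hl with rfl | hl
    · exact last (.weak c A hN hc hf) ⟨N, A, hN, hc, hf, rfl⟩
    · refine lift (.weak c A hN hc hf) (ih l hl) (Hole.extend (as := 0) (zero_add _).symm hc rfl rfl rfl
        (Set.disjoint_empty _) (Set.disjoint_empty _) ?_)
      intro M' Γ' hM' hΓ hc' _ _
      rw [zero_add] at hΓ
      subst hΓ
      exact .weak c A hM' hc' hf
  | @contr d N Γ as c A hN h has hfa hf hc ih =>
    intro l hl
    simp only [PreNet.extend, Multiset.mem_cons] at hl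
    rcases hl with rfl | hl
    · exact last (.contr as c A hN h has hfa hf hc)
        ⟨N, Γ, A, hN, h, has, hfa, hf, hc, rfl⟩
    · refine lift (.contr as c A hN h has hfa hf hc) (ih l hl) (Hole.extend (as := as) h hc rfl rfl rfl
        (Set.disjoint_empty _) (Set.disjoint_empty _) ?_)
      intro M' Γ' hM' hΓ hc' _ _
      exact .contr as c A hM' hΓ has hfa hf hc'
  | @box d N k aux main hN h hk hid ih =>
    intro l hl
    obtain rfl := Multiset.mem_singleton.1 hl
    exact last (.box k aux main hN h hk hid) ⟨.mk k aux main hN h hk hid, rfl⟩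

/-- Below a `&`-rule every weight contains a literal, so a link of weight `1` has only linear rules
after it, and the contexts of these rules compose. -/
theorem Simple.hole {N : Net d} (h : Simple N) (l : Link (Con d)) (hl : (l, unit) ∈ N.links) :
    HasHole N l :=
  Simple.link_induction (motive := fun N l => l.2 = unit → HasHole N l.1)
    (fun hN hl _ => .of_last hN hl) (fun _ h hole hl => (h hl).lift hole)
    (fun _ _ _ hl => absurd hl (Finset.insert_ne_empty _ _)) h (l, unit) hl rfl

theorem LastRule.mem {S : Net d} {l : Link (Con d)} (h : LastRule S l) : (l, unit) ∈ S.links := by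
  cases l with
  | ax | one =>
    simp only [LastRule] at h
    simp [h, leafNet]
  | box =>
    simp only [LastRule] at h
    rw [h.2]; exact Multiset.mem_singleton_self _
  | cut =>
    obtain ⟨M, N, Γ, Δ, -, -, -, -, -, -, rfl⟩ := h
    exact Multiset.mem_cons_self _ _
  | bot => obtain ⟨N, -, -, -, rfl⟩ := h; exact Multiset.mem_cons_self _ _
  | tensor =>
    obtain ⟨M, N, Γ, Δ, -, -, -, -, -, -, -, -, rfl⟩ := h
    exact Multiset.mem_cons_self _ _
  | par => obtain ⟨N, Γ, -, -, -, -, rfl⟩ := h; exact Multiset.mem_cons_self _ _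
  | wth =>
    obtain ⟨M, N, Γ, F, G, -, -, -, -, -, -, -, -, -, rfl⟩ := h
    exact Multiset.mem_cons_self _ _
  | plus₁ => obtain ⟨N, Γ, B, -, -, -, -, rfl⟩ := h; exact Multiset.mem_cons_self _ _
  | plus₂ => obtain ⟨N, Γ, B, -, -, -, -, rfl⟩ := h; exact Multiset.mem_cons_self _ _
  | all =>
    obtain ⟨N, Γ, B, -, -, -, -, -, -, -, -, rfl⟩ := h; exact Multiset.mem_cons_self _ _
  | ex => obtain ⟨N, Γ, B, -, -, -, -, -, -, rfl⟩ := h; exact Multiset.mem_cons_self _ _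
  | weak => obtain ⟨N, A, -, -, -, rfl⟩ := h; exact Multiset.mem_cons_self _ _
  | contr => obtain ⟨N, Γ, A, -, -, -, -, -, -, rfl⟩ := h; exact Multiset.mem_cons_self _ _

/-! ### Moving a ready cut up to the links of its premises -/

theorem Multiset.eq_of_countP_eq_one {α : Type*} {p : α → Prop} [DecidablePred p]
    {s : Multiset α} (h : s.countP p = 1) {x y : α} (hx : x ∈ s) (hy : y ∈ s) (hpx : p x)
    (hpy : p y) : x = y := by
  rw [Multiset.countP_eq_card_filter, Multiset.card_eq_one] at h
  obtain ⟨z, hz⟩ := h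
  have hx' := Multiset.mem_filter.2 ⟨hx, hpx⟩
  have hy' := Multiset.mem_filter.2 ⟨hy, hpy⟩
  rw [hz, Multiset.mem_singleton] at hx' hy'
  rw [hx', hy']

theorem Net.Apart.mono {M M' N : Net d} (h : Net.Apart M N) (hF : M'.forms ≤ M.forms)
    (hL : M'.links ≤ M.links) : Net.Apart M' N := by
  have h1 : M'.ids ⊆ M.ids := by
    rw [ids_eq, ids_eq]; exact suppW_mono oid hF
  exact ⟨h.1.mono_left h1, h.2.1.mono_left (suppW_mono _ hL), h.2.2.1.mono_left (suppW_mono _ hL),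
    h.2.2.2.mono_left (Set.union_subset_union (suppW_mono ovar hF)
      (suppW_mono (Link.vars (Con.vars d)) hL))⟩

namespace Hole
variable {N M S : Net d} {K P O : Multiset Occ} {F : Multiset (Occ × Weight)}
  {L : Multiset (Link (Con d) × Weight)}

theorem forms_le (h : Hole N S K P O F L) : S.forms ≤ N.forms :=
  h.forms ▸ Multiset.le_add_right _ _

theorem links_le (h : Hole N S K P O F L) : S.links ≤ N.links :=
  h.links ▸ Multiset.le_add_right _ _

/-- Conclusions added by the context lie on vertices of the context. Hence a conclusion of the whole
net that belongs to `S` has been kept, the criterion by which contexts are recognised as harmless.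
-/
theorem not_mem_out (h : Hole N S K P O F L) {o : Occ} {w : Weight} (ho : (o, w) ∈ S.forms) :
    o ∉ O := fun ho' => by
  obtain ⟨w', hw'⟩ := h.concl_new o ho'
  exact Set.disjoint_left.1 h.ids ⟨_, ho, rfl⟩ ⟨_, hw', rfl⟩

/-- A linear context commutes with a cut against a conclusion that it keeps. -/
theorem cut_comm {k : Link (Con d)} {T : Net d} {a b : Occ} {Γ Δ P' : Multiset Occ}
    (h : Hole M S K (a ::ₘ P') O F L) (hk : k.IsCut a b) (hT : Simple T) (hap : Net.Apart M T)
    (ha : M.concl = a ::ₘ Γ) (hb : T.concl = b ::ₘ Δ) :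
    Hole (cutNet k M T Γ Δ) (cutNet k S T (K + P') Δ) K (P' + Δ) O F L := by
  have hΓ : Γ = P' + O := by
    have := h.concl_out
    rwa [ha, Multiset.cons_add, Multiset.cons_inj_right] at this
  have hk0 : k.eigenweights = ∅ ∧ k.evars (Con.evars d) = ∅ ∧ k.vars (Con.vars d) = ∅ := by
    rcases hk with rfl | rfl <;> simp [Link.eigenweights, Link.evars, Link.vars]
  obtain ⟨a1, a2, a3, a4⟩ := hap
  simp only [ids_eq, eigenweights_eq, LLL.evars_eq, LLL.vars_eq, h.forms, h.links, suppW_add,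
    Set.disjoint_union_left, Set.disjoint_union_right] at a1 a2 a3 a4
  have hev := h.ev
  have hcev := h.concl_ev
  simp only [Set.disjoint_union_right, supp_cons, Set.disjoint_union_left] at hev hcev
  constructor
  · simp only [cutNet, h.forms]; abel
  · simp only [cutNet, h.links, Multiset.cons_add]; congr 1; abel
  · simp only [cutNet]; abel
  · simp only [cutNet, hΓ]; abel
  · exact h.concl_new
  · simp only [cutNet, suppW_add, Set.disjoint_union_left]
    exact ⟨h.ids, a1.2.symm⟩
  · simp only [cutNet, suppW_cons, hk0, Set.empty_union, suppW_add, Set.disjoint_union_left]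
    exact ⟨h.ew, a2.2.symm⟩
  · simp only [cutNet, suppW_cons, hk0, Set.empty_union, suppW_add, Set.disjoint_union_left,
      Set.disjoint_union_right]
    exact ⟨⟨hev.1, a4.1.2.symm⟩, hev.2, a4.2.2.symm⟩
  · exact h.wts_forms
  · exact h.wts_links
  · exact h.occs
  · exact h.concls
  · simp only [supp_add, Set.disjoint_union_left]
    refine ⟨hcev.2, ?_⟩
    have hΔ := hT.wf.conclVars_subset
    rw [hb, supp_cons] at hΔ
    exact (a3.1.2.mono_right fun x hx => hΔ (Or.inr hx)).symm
  · intro S' P'' hS' hc hcomp hP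
    refine h.plug S' P'' hS' hc ⟨hcomp.ids, hcomp.ew, hcomp.ev, fun v hv hv' => ?_⟩ hP
    have := hcomp.va v hv hv'
    simp only [cutNet, LLL.vars_eq, suppW_cons, hk0, Set.empty_union, suppW_add,
      Set.mem_union] at this ⊢
    -- Besides `S`, the cut contributes only variables of `T`. These are not eigenvariables of the
    -- context, which is part of `M`.
    rcases this with (h | h) | h | h
    · exact Or.inl h
    · exact absurd h (Set.disjoint_left.1 a3.1.2 hv)
    · exact Or.inr h
    · exact absurd h (Set.disjoint_left.1 a3.2.2 hv)

end Hole

theorem Link.IsCut.symm {β : Type} {k : Link β} {a b : Occ} (h : k.IsCut a b) : k.IsCut b a :=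
  Or.symm h

/-- A conclusion that is the conclusion of only one link is kept by the context of that link. -/
theorem Simple.hole_of_concl {M : Net d} {a : Occ} {l : Link (Con d)} {Γ : Multiset Occ}
    {L : Multiset (Link (Con d) × Weight)} (hM : Simple M) (hle : M.links ≤ L)
    (ha : M.concl = a ::ₘ Γ) (hc : L.countP (fun l => a ∈ l.1.concls) = 1) (hl : (l, unit) ∈ L)
    (hal : a ∈ l.concls) : ∃ (S : Net d) (K P' O : Multiset Occ) (F : Multiset (Occ × Weight))
      (L : Multiset (Link (Con d) × Weight)),
        LastRule S l ∧ Simple S ∧ Hole M S K (a ::ₘ P') O F L := by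
  obtain ⟨l', hl', hal'⟩ := hM.wf.form_concl _ (hM.wf.mem_forms (by rw [ha]; simp : a ∈ M.concl))
  have := Multiset.eq_of_countP_eq_one hc (Multiset.mem_of_le hle hl') hl hal' hal
  subst this
  obtain ⟨S, K, P, O, F, L, hlast, hS, hole⟩ := hM.hole l hl'
  -- The link `l` with conclusion `a` is in `S`, so `a` cannot be one of the conclusions that the
  -- context adds.
  have haP : a ∈ P := by
    have h1 : a ∈ P + O := by rw [← hole.concl_out, ha]; simp
    obtain ⟨w, hw⟩ := hS.wf.occ_mem _ hlast.mem a (Multiset.mem_add.2 (Or.inr hal))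
    exact (Multiset.mem_add.1 h1).resolve_right (hole.not_mem_out hw)
  obtain ⟨P', rfl⟩ := Multiset.exists_cons_of_mem haP
  exact ⟨S, K, P', O, F, L, hlast, hS, hole⟩

/-- A ready cut may be moved up to the link that introduces its first premise. -/
theorem Simple.ready_left {N : Net d} (hN : Simple N) {k l : Link (Con d)} {a b : Occ}
    (hr : Ready N k a b) (hl : (l, unit) ∈ N.links) (ha : a ∈ l.concls) :
    ∃ (S T : Net d) (Γ Δ K P O : Multiset Occ) (F : Multiset (Occ × Weight))
      (L : Multiset (Link (Con d) × Weight)), LastRule S l ∧ Simple S ∧ Simple T ∧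
        Net.Apart S T ∧ S.concl = a ::ₘ Γ ∧ T.concl = b ::ₘ Δ ∧ b.fml = a.fml.neg ∧
          Hole N (cutNet k S T Γ Δ) K P O F L := by
  obtain ⟨hk, hkN, hca, hcb⟩ := hr
  obtain ⟨S, K, P, O, F, L, hlast, hS, hole⟩ := hN.hole k hkN
  -- The cut link may be written in either order; the two nets are named so that `a` belongs to the
  -- first.
  have hcut : ∃ (M T : Net d) (Γ Δ : Multiset Occ), Simple M ∧ Simple T ∧ Net.Apart M T ∧
      M.concl = a ::ₘ Γ ∧ T.concl = b ::ₘ Δ ∧ b.fml = a.fml.neg ∧ S = cutNet k M T Γ Δ := by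
    rcases hk with rfl | rfl
    · exact hlast
    · obtain ⟨M, T, Γ, Δ, h1, h2, h3, h4, h5, h6, h7⟩ := hlast
      exact ⟨T, M, Δ, Γ, h2, h1, h3.symm, h5, h4, Fm.eq_neg_comm h6, h7.trans (cutNet_comm _ _ _ _ _)⟩
  clear hlast
  obtain ⟨M, T, Γ, Δ, hM, hT, hap, hcM, hcT, hf, rfl⟩ := hcut
  have hleM : M.links ≤ N.links := by
    refine le_trans ?_ hole.links_le
    exact (Multiset.le_add_right _ _).trans (Multiset.le_cons_self _ _)
  obtain ⟨S₁, K₁, P₁, O₁, F₁, L₁, hl₁, hS₁, hole₁⟩ := hM.hole_of_concl hleM hcM hca hl ha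
  -- The rules between `l` and the cut keep `a`, so the cut may be applied to `S₁` immediately and
  -- these rules afterwards.
  obtain ⟨_, _, _, -, h3⟩ := hole.trans (hole₁.cut_comm hk hT hap hcM hcT)
  exact ⟨S₁, T, _, _, _, _, _, _, _, hl₁, hS₁, hT, hap.mono hole₁.forms_le hole₁.links_le,
    by rw [hole₁.concl_in, Multiset.add_cons], hcT, hf, h3⟩

/-- A ready cut may be moved up to the links that introduce its premises. -/
theorem Simple.ready {N : Net d} (hN : Simple N) {k l₁ l₂ : Link (Con d)} {a b : Occ}
    (hr : Ready N k a b) (h₁ : (l₁, unit) ∈ N.links) (ha₁ : a ∈ l₁.concls)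
    (h₂ : (l₂, unit) ∈ N.links) (hb₂ : b ∈ l₂.concls) :
    ∃ (S₁ S₂ : Net d) (Γ₁ Γ₂ K P O : Multiset Occ) (F : Multiset (Occ × Weight))
      (L : Multiset (Link (Con d) × Weight)), LastRule S₁ l₁ ∧ LastRule S₂ l₂ ∧ Simple S₁ ∧
        Simple S₂ ∧ Net.Apart S₁ S₂ ∧ S₁.concl = a ::ₘ Γ₁ ∧ S₂.concl = b ::ₘ Γ₂ ∧
          b.fml = a.fml.neg ∧ Hole N (cutNet k S₁ S₂ Γ₁ Γ₂) K P O F L := by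
  obtain ⟨S₁, T, Γ, Δ, K, P, O, F, L, hl₁, hS₁, hT, hap, hc₁, hcT, hf, hole⟩ :=
    hN.ready_left hr h₁ ha₁
  have hleT : T.links ≤ N.links := by
    refine le_trans ?_ hole.links_le
    exact (Multiset.le_add_left _ _).trans (Multiset.le_cons_self _ _)
  obtain ⟨S₂, K₂, P₂, O₂, F₂, L₂, hl₂, hS₂, hole₂⟩ :=
    hT.hole_of_concl hleT hcT hr.2.2.2 h₂ hb₂
  have c₂ := hole₂.cut_comm (Link.IsCut.symm hr.1) hS₁ hap.symm hcT hc₁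
  rw [cutNet_comm k T, cutNet_comm k S₂] at c₂
  obtain ⟨_, _, _, -, h4⟩ := hole.trans c₂
  exact ⟨S₁, S₂, _, _, _, _, _, _, _, hl₁, hl₂, hS₁, hS₂,
    (hap.symm.mono hole₂.forms_le hole₂.links_le).symm, hc₁,
      by rw [hole₂.concl_in, Multiset.add_cons], hf, h4⟩


/-! ## Principal reductions -/

theorem Hole.replace {N S S' : Net d} {K P O : Multiset Occ} {F : Multiset (Occ × Weight)}
    {L : Multiset (Link (Con d) × Weight)} (h : Hole N S K P O F L) (hS : Simple S')
    (hc : S'.concl = S.concl) (hcomp : Compat S S' F L) :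
    Simple (⟨S'.forms + F, S'.links + L, N.concl⟩ : Net d) := by
  rw [h.concl_out]
  exact h.plug S' P hS (hc.trans h.concl_in) hcomp h.concl_ev

/-- Most reducts use only names of the redex, and then compatibility with the context is inherited.
-/
theorem Hole.replace_of_subset {N S S' : Net d} {K P O : Multiset Occ}
    {F : Multiset (Occ × Weight)} {L : Multiset (Link (Con d) × Weight)} (h : Hole N S K P O F L)
    (hS : Simple S') (hc : S'.concl = S.concl) (h1 : fids S'.forms ⊆ fids S.forms)
    (h2 : lew S'.links ⊆ lew S.links) (h3 : lev S'.links ⊆ lev S.links)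
    (h4 : Net.vars S' ⊆ Net.vars S) :
    Simple (⟨S'.forms + F, S'.links + L, N.concl⟩ : Net d) :=
  h.replace hS hc ⟨h.ids.mono_left h1, h.ew.mono_left h2, h.ev.mono_left h3, fun _ _ hv => h4 hv⟩

theorem Net.Apart.of_subset {M M' N : Net d} (h : Net.Apart M N)
    (h1 : fids M'.forms ⊆ fids M.forms) (h2 : lew M'.links ⊆ lew M.links)
    (h3 : lev M'.links ⊆ lev M.links) (h4 : Net.vars M' ⊆ Net.vars M) : Net.Apart M' N :=
  ⟨h.1.mono_left (by rw [ids_eq, ids_eq]; exact h1), h.2.1.mono_left h2, h.2.2.1.mono_left h3,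
    h.2.2.2.mono_left h4⟩

theorem Link.IsCut.free {k : Link (Con d)} {a b : Occ} (hk : k.IsCut a b) :
    k.eigenweights = ∅ ∧ k.evars (Con.evars d) = ∅ ∧ k.vars (Con.vars d) = ∅ := by
  rcases hk with rfl | rfl <;> simp [Link.eigenweights, Link.evars, Link.vars]

theorem Net.Apart.cutNet_right {k : Link (Con d)} {a b : Occ} {M N T : Net d}
    {Γ Δ : Multiset Occ} (hk : k.IsCut a b) (hN : Net.Apart M N) (hT : Net.Apart M T) :
    Net.Apart M (cutNet k N T Γ Δ) := by
  obtain ⟨a1, a2, a3, a4⟩ := hN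
  obtain ⟨b1, b2, b3, b4⟩ := hT
  simp only [Net.Apart, ids_eq, eigenweights_eq, evars_eq, vars_eq, cutNet, suppW_cons, hk.free,
    Set.empty_union, suppW_add, Set.disjoint_union_left, Set.disjoint_union_right] at *
  tauto

/-! ### Moving vertices, and the cut against an axiom -/

theorem bvars_var (V : Set ℕ) : bvars var V = V := by
  ext x; simp [bvars, Fm.vars_var]

theorem SubstOk.id_var (E V : Set ℕ) : SubstOk id var E V :=
  fun _ _ => ⟨rfl, fun _ _ hy h => hy h.symm⟩

theorem Simple.rename {N : Net d} (hN : Simple N) {i w : ℕ → ℕ} (hi : Set.InjOn i N.ids)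
    (hw : Set.InjOn w N.eigenweights) : Simple (N.map i w id var) :=
  hN.map i w id var hi hw (SubstOk.id_var _ _)

theorem Net.rename_vars (N : Net d) (i w : ℕ → ℕ) : Net.vars (N.map i w id var) ⊆ Net.vars N := by
  have := (SubstOk.id_var (Net.evars N) ∅).vars_map (N := N) (w := w) (i := i)
  rwa [bvars_var] at this

theorem Net.rename_evars (N : Net d) (i w : ℕ → ℕ) :
    Net.evars (N.map i w id var) = Net.evars N := by
  rw [Net.map_evars, Set.image_id]

theorem moveId_injOn {m n : ℕ} {s : Set ℕ} (h : n ∉ s) : Set.InjOn (moveId m n) s := by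
  intro x hx y hy hxy
  simp only [moveId] at hxy
  split_ifs at hxy with h1 h2 h2
  · rw [h1, h2]
  · exact absurd hy (hxy ▸ h)
  · exact absurd hx (hxy ▸ h)
  · exact hxy

theorem moveId_of_ne {m n x : ℕ} (h : x ≠ m) : moveId m n x = x := if_neg h

theorem Occ.rename_self {i : ℕ → ℕ} {o : Occ} (h : i o.id = o.id) : o.map i var = o :=
  Occ.map_self h fun _ _ => rfl

/-- If a net is renamed by moving the vertex of a conclusion `z`, only `z` changes. -/
theorem Simple.move_concl {T : Net d} {z x : Occ} {Δ : Multiset Occ} (hT : Simple T)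
    (hz : T.concl = z ::ₘ Δ) (hx : x.id ∉ T.ids) (hf : z.fml = x.fml) :
    ∃ T' : Net d, Simple T' ∧ T'.concl = x ::ₘ Δ ∧ T'.links = moveLinks z.id x.id T.links ∧
      (∃ G, T.forms = (z, unit) ::ₘ G ∧ T'.forms = (x, unit) ::ₘ G) ∧
      lew T'.links = lew T.links ∧ lev T'.links = lev T.links ∧ Net.vars T' ⊆ Net.vars T ∧
      ∀ o ∈ Δ, o.id ≠ z.id := by
  obtain ⟨G, hG⟩ := Multiset.exists_cons_of_mem
    (hT.wf.mem_forms (by rw [hz]; simp : z ∈ T.concl))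
  have hnd := hT.wf.nodup
  rw [hG, nodup_cons_iff] at hnd
  have hle := hT.wf.concl_le
  rw [hz, hG, atUnit_cons, Multiset.cons_le_cons_iff] at hle
  have hΔ : ∀ o ∈ Δ, o.id ≠ z.id := fun o ho h =>
    hnd.1 ⟨(o, unit), Multiset.mem_of_le hle (mem_atUnit.2 ⟨ho, rfl⟩), h.symm⟩
  have hzx : z.map (moveId z.id x.id) var = x := by
    rcases x with ⟨n, A⟩
    simp only [Occ.map, moveId, if_true, Fm.fsub_var, Occ.mk.injEq]
    exact ⟨trivial, hf⟩
  refine ⟨T.map (moveId z.id x.id) id id var,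
    hT.rename (moveId_injOn hx) Function.injective_id.injOn, ?_, ?_, ⟨G, hG, ?_⟩, ?_, ?_,
      Net.rename_vars _ _ _, hΔ⟩
  · rw [Net.map_eq, hz]
    simp only [Multiset.map_cons, hzx]
    congr 1
    exact Multiset.map_eq_self fun o ho => Occ.rename_self (moveId_of_ne (hΔ o ho))
  · rw [moveLinks_eq]; rfl
  · rw [Net.map_eq, hG]
    simp only [Multiset.map_cons, fmap, hzx, weight_map_id]
    congr 1
    exact Multiset.map_eq_self fun f hf => fmap_self (Occ.rename_self (moveId_of_ne fun h =>
      hnd.1 ⟨f, hf, h.symm⟩))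
  · have := Net.map_eigenweights (moveId z.id x.id) id id var T
    rwa [Set.image_id] at this
  · exact Net.rename_evars _ _ _

/-- The axiom is a whole subnet, so the key case is a cut between it and a net `T` with conclusion
`z`. Moving `z` to the vertex of `x` turns `T` into a net with the conclusions of this cut; the
vertex is free in `T` because `T` is apart from the axiom. -/
theorem Simple.step_ax {F : Multiset (Occ × Weight)} {L : Multiset (Link (Con d) × Weight)}
    {Γ : Multiset Occ} {k l : Link (Con d)} {x y z : Occ} (hl : l.IsAx x y) (hxz : x.id ≠ z.id)
    (hN : Simple (⟨(y, unit) ::ₘ (z, unit) ::ₘ F, (k, unit) ::ₘ (l, unit) ::ₘ L, Γ⟩ : Net d))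
    (hr : Ready ⟨(y, unit) ::ₘ (z, unit) ::ₘ F, (k, unit) ::ₘ (l, unit) ::ₘ L, Γ⟩ k y z) :
    Simple (⟨F, moveLinks z.id x.id L, Γ⟩ : Net d) := by
  obtain ⟨S, T, Γ₁, Δ, K, P, O, F', L', hlast, hS, hT, hap, hcS, hcT, hf, hole⟩ :=
    hN.ready_left hr (l := l) (by simp) (by rcases hl with rfl | rfl <;> simp [Link.concls])
  have hS' : S = ⟨{(y, unit), (x, unit)}, {(l, unit)}, {y, x}⟩ ∧ y.fml = x.fml.neg := by
    rcases hl with rfl | rfl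
    · obtain ⟨-, h, rfl⟩ := hlast
      refine ⟨?_, h⟩
      simp [leafNet, Link.concls, Multiset.insert_eq_cons, Multiset.cons_swap y x,
        ← Multiset.cons_zero, Multiset.cons_swap (y, unit)]
    · obtain ⟨-, h, rfl⟩ := hlast
      refine ⟨?_, Fm.eq_neg_comm h⟩
      simp [leafNet, Link.concls, Multiset.insert_eq_cons]
  obtain ⟨rfl, hy⟩ := hS'
  have hΓ₁ : Γ₁ = {x} := by
    simpa [Multiset.insert_eq_cons] using hcS.symm
  subst hΓ₁
  have hzf : z.fml = x.fml := by rw [hf, hy, Fm.neg_neg]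
  have hxT : x.id ∉ T.ids := by
    have := hap.1
    rw [ids_eq] at this
    exact Set.disjoint_left.1 this ⟨(x, unit), by simp, rfl⟩
  obtain ⟨T', hT', hcT', hLT, ⟨G, hG, hG'⟩, hew, hev, hva, hΔ⟩ :=
    hT.move_concl hcT hxT hzf
  have h := hole.replace_of_subset hT' (by rw [hcT']; simp [cutNet, Multiset.singleton_add])
    (by
      simp only [cutNet, hG, hG', suppW_cons, suppW_add, Multiset.insert_eq_cons, suppW_singleton]
      intro n
      simp +contextual only [Set.mem_union, true_or, or_true, or_imp, implies_true, and_self])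
    (by
      simp only [hew, cutNet, suppW_cons, suppW_add]
      intro n
      simp +contextual only [Set.mem_union, true_or, or_true, or_imp, implies_true, and_self])
    (by
      simp only [hev, cutNet, suppW_cons, suppW_add]
      intro n
      simp +contextual only [Set.mem_union, true_or, or_true, or_imp, implies_true, and_self])
    (by
      refine hva.trans ?_
      simp only [vars_eq, cutNet, suppW_cons, suppW_add]
      intro n
      simp +contextual only [Set.mem_union, true_or, or_true, or_imp, implies_true, and_self])
  have hF : F = T'.forms + F' := by
    have := hole.forms
    simp only [cutNet, hG, Multiset.insert_eq_cons, ← Multiset.singleton_add] at this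
    rw [hG', ← add_right_inj {(y, unit)}, ← add_right_inj {(z, unit)}]
    rw [← Multiset.singleton_add]
    rw [add_left_comm, this]
    abel
  have hL : L = T.links + L' := by
    have := hole.links
    simp only [cutNet, ← Multiset.singleton_add] at this
    rw [← add_right_inj {(l, unit)}, ← add_right_inj {(k, unit)}, this]
    abel
  have hL' : moveLinks z.id x.id L = T'.links + L' := by
    rw [hL, moveLinks_eq, Multiset.map_add, hLT, moveLinks_eq]
    congr 1
    -- The rule renames `z` in all remaining links, but the context never meets it: its links touch
    -- only conclusions of the cut, among which `z` is not, and vertices of its own.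
    refine Multiset.map_eq_self fun m hm => lmap_self_var fun o ho => moveId_of_ne ?_
    rcases hole.occs m hm o ho with h | ⟨w, h⟩
    · have h1 : o ∈ K + P := Multiset.mem_add.2 (Or.inl h)
      rw [← hole.concl_in] at h1
      simp only [cutNet, Multiset.mem_add, Multiset.mem_singleton] at h1
      rcases h1 with rfl | h1
      · exact hxz
      · exact hΔ o h1
    · intro hoz
      refine Set.disjoint_left.1 hole.ids ?_ ⟨_, h, rfl⟩
      simp only [cutNet, hG]
      exact ⟨(z, unit), by simp, hoz⟩
  rw [hF, hL']
  exact h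

/-! ### Units and multiplicatives -/

theorem Simple.step_unit {N : Net d} {F : Multiset (Occ × Weight)}
    {L : Multiset (Link (Con d) × Weight)} (hN : Simple N) {k : Link (Con d)} {c z : Occ}
    (hr : Ready N k c z) (hF : N.forms = (c, unit) ::ₘ (z, unit) ::ₘ F)
    (hL : N.links = (k, unit) ::ₘ (Link.one c, unit) ::ₘ (Link.bot z, unit) ::ₘ L) :
    Simple (⟨F, L, N.concl⟩ : Net d) := by
  obtain ⟨S₁, S₂, Γ₁, Γ₂, K, P, O, F', L', h₁, h₂, -, -, -, hc₁, hc₂, -, hole⟩ :=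
    hN.ready hr (l₁ := .one c) (l₂ := .bot z) (by simp [hL]) (by simp [Link.concls])
      (by simp [hL]) (by simp [Link.concls])
  obtain ⟨-, rfl⟩ := h₁
  obtain ⟨T, hT, -, -, rfl⟩ := h₂
  obtain rfl : Γ₁ = 0 := (Multiset.cons_inj_right c).1 hc₁.symm
  obtain rfl : Γ₂ = T.concl := by simpa [PreNet.extend] using hc₂.symm
  have hf := hole.forms
  have hl := hole.links
  rw [hF] at hf
  rw [hL] at hl
  have := hole.replace_of_subset hT (by simp [cutNet])
    (by
      simp only [cutNet, PreNet.extend, suppW_cons, suppW_add]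
      intro n
      simp +contextual only [Set.mem_union, true_or, or_true, or_imp, implies_true, and_self])
    (by
      simp only [cutNet, PreNet.extend, suppW_cons, suppW_add]
      intro n
      simp +contextual only [Set.mem_union, true_or, or_true, or_imp, implies_true, and_self])
    (by
      simp only [cutNet, PreNet.extend, suppW_cons, suppW_add]
      intro n
      simp +contextual only [Set.mem_union, true_or, or_true, or_imp, implies_true, and_self])
    (by
      simp only [vars_eq, cutNet, PreNet.extend, suppW_cons, suppW_add]
      intro n
      simp +contextual only [Set.mem_union, true_or, or_true, or_imp, implies_true, and_self])
  convert this using 2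
  · simpa [cutNet, leafNet, PreNet.extend, Link.concls, Multiset.cons_swap (z, _)] using hf
  · simpa [cutNet, leafNet, PreNet.extend, Link.concls,
      Multiset.cons_swap (Link.bot z, _)] using hl

theorem Simple.step_tensor {N : Net d} {F : Multiset (Occ × Weight)}
    {L : Multiset (Link (Con d) × Weight)} (hN : Simple N) {k : Link (Con d)} {a b c x y z : Occ}
    (hr : Ready N k c z) (hF : N.forms = (c, unit) ::ₘ (z, unit) ::ₘ F)
    (hL : N.links =
      (k, unit) ::ₘ (Link.tensor a b c, unit) ::ₘ (Link.par x y z, unit) ::ₘ L) :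
    Simple (⟨F, (Link.cut a x, unit) ::ₘ (Link.cut b y, unit) ::ₘ L, N.concl⟩ : Net d) := by
  obtain ⟨S₁, S₂, Γ₁, Γ₂, K, P, O, F', L', h₁, h₂, -, -, hap, hc₁, hc₂, hcz, hole⟩ :=
    hN.ready hr (l₁ := .tensor a b c) (l₂ := .par x y z) (by simp [hL]) (by simp [Link.concls])
      (by simp [hL]) (by simp [Link.concls])
  obtain ⟨M, M', Γ, Γ', hM, hM', hMM, hcM, hcM', -, -, hcf, rfl⟩ := h₁
  obtain ⟨T, Δ, hT, hcT, -, hzf, rfl⟩ := h₂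
  obtain rfl : Γ₁ = Γ + Γ' := by simpa using hc₁.symm
  obtain rfl : Γ₂ = Δ := by simpa [PreNet.extend] using hc₂.symm
  rw [hzf, hcf, Fm.neg] at hcz
  obtain ⟨hxf, hyf⟩ := Fm.par.inj hcz
  have hT₂ : ∀ {M : Net d}, Net.Apart M (T.extend (.par x y z) z Γ₂) → Net.Apart M T := fun h =>
    (h.symm.mono (Multiset.le_cons_self _ _) (Multiset.le_cons_self _ _)).symm
  have hapT : Net.Apart M T := hT₂ (hap.mono
    ((Multiset.le_add_right _ _).trans (Multiset.le_cons_self _ _))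
    ((Multiset.le_add_right _ _).trans (Multiset.le_cons_self _ _)))
  have hapT' : Net.Apart M' T := hT₂ (hap.mono
    ((Multiset.le_add_left _ _).trans (Multiset.le_cons_self _ _))
    ((Multiset.le_add_left _ _).trans (Multiset.le_cons_self _ _)))
  -- The two new cuts are nested: the net with conclusion `b` is cut against the premise of the
  -- `⅋`-link, and the net with conclusion `a` against the result.
  have h1 := Simple.cut b y hM' hT hapT' hcM' (Δ := x ::ₘ Γ₂)
    (by rw [hcT, Multiset.cons_swap]) hyf
  have h2 := Simple.cut a x hM h1 (hMM.cutNet_right (Or.inl rfl) hapT) hcM (Δ := Γ' + Γ₂)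
    (by simp [Multiset.add_cons]) hxf
  have hf := hole.forms
  have hl := hole.links
  rw [hF] at hf
  rw [hL] at hl
  have := hole.replace_of_subset h2 (by simp [cutNet, PreNet.extend, add_assoc])
    (by
      simp only [cutNet, PreNet.extend, suppW_cons, suppW_add]
      intro n
      simp +contextual only [Set.mem_union, true_or, or_true, or_imp, implies_true, and_self])
    (by
      simp only [cutNet, PreNet.extend, suppW_cons, suppW_add, Link.eigenweights]
      intro n
      simp +contextual only [Set.mem_union, true_or, or_true, or_imp, implies_true, and_self])
    (by
      simp only [cutNet, PreNet.extend, suppW_cons, suppW_add, Link.evars]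
      intro n
      simp +contextual only [Set.mem_union, true_or, or_true, or_imp, implies_true, and_self])
    (by
      simp only [vars_eq, cutNet, PreNet.extend, suppW_cons, suppW_add, Link.vars]
      intro n
      simp +contextual only [Set.mem_union, true_or, or_true, or_imp, implies_true, and_self])
  convert this using 2
  · simp only [cutNet, PreNet.extend, ← Multiset.singleton_add] at hf ⊢
    rw [← add_right_inj {(z, unit)}, ← add_right_inj {(c, unit)}, hf]
    abel
  · simp only [cutNet, PreNet.extend, ← Multiset.singleton_add] at hl ⊢
    rw [← add_right_inj {(Link.par x y z, unit)}, ← add_right_inj {(Link.tensor a b c, unit)},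
      ← add_right_inj {(k, unit)}]
    have : ∀ A B C D E F : Multiset (Link (Con d) × Weight),
      A + (B + (C + (D + (E + F)))) = (D + E) + (A + (B + (C + F))) := by intros; abel
    rw [this, hl]
    abel


/-! ### Additives: giving a value to an eigenweight -/

section restrict
variable {α : Type} (q : ℕ × Bool)

@[simp] theorem restrict_add (s t : Multiset (α × Weight)) :
    restrict q (s + t) = restrict q s + restrict q t := by
  simp [restrict]

theorem restrict_eq_self {s : Multiset (α × Weight)} (h : q.1 ∉ wts s) : restrict q s = s := by
  have h1 : ∀ a ∈ s, ∀ b, (q.1, b) ∉ a.2 := fun a ha b hb => h ⟨a, ha, b, hb⟩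
  rw [restrict, Multiset.filter_eq_self.2 fun a ha => h1 a ha _]
  refine Multiset.map_eq_self fun a ha => ?_
  rw [Finset.erase_eq_of_notMem (h1 a ha q.2)]

theorem restrict_scale {s : Multiset (α × Weight)} (h : q.1 ∉ wts s) :
    restrict q (scale q s) = s := by
  have h1 : ∀ a ∈ s, ∀ b, (q.1, b) ∉ a.2 := fun a ha b hb => h ⟨a, ha, b, hb⟩
  rw [restrict, Multiset.filter_eq_self.2, scale, Multiset.map_map]
  · refine Multiset.map_eq_self fun a ha => ?_
    simp only [Function.comp]
    rw [Finset.erase_insert (h1 a ha q.2)]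
  · intro a ha
    obtain ⟨a', ha', rfl⟩ := Multiset.mem_map.1 ha
    simp only [Finset.mem_insert, not_or]
    exact ⟨fun h => by simpa using congrArg Prod.snd h, h1 a' ha' _⟩

theorem restrict_scale_not (s : Multiset (α × Weight)) :
    restrict q (scale (q.1, !q.2) s) = 0 := by
  rw [restrict, Multiset.filter_eq_nil.2]
  · rfl
  · intro a ha
    obtain ⟨a, -, rfl⟩ := Multiset.mem_map.1 ha
    simp

end restrict

/-- The common part of the reductions of a cut between a `&`-link and a `⊕`-link: the component `M`
of the `&`-link is kept, and `C`, `C'` are deleted. -/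
theorem Simple.step_plus {N S₁ S₂ M T : Net d} {F F' C : Multiset (Occ × Weight)}
    {L L' C' : Multiset (Link (Con d) × Weight)} {k l l' : Link (Con d)} {q : ℕ × Bool}
    {Γ Δ K P O : Multiset Occ} {a x c z : Occ}
    (hole : Hole N (cutNet k S₁ S₂ Γ Δ) K P O F' L') (hM : Simple M) (hT : Simple T)
    (hap : Net.Apart S₁ S₂) (hS₂ : S₂ = T.extend l' z Δ) (hl : l.eigenweights = {q.1})
    (ha : M.concl = a ::ₘ Γ) (hx : T.concl = x ::ₘ Δ) (hf : x.fml = a.fml.neg)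
    {G : Multiset (Occ × Weight)} (hMF : M.forms = atUnit Γ + G)
    (hS₁F : S₁.forms = (c, unit) ::ₘ (atUnit Γ + scale q G + C))
    (hS₁L : S₁.links = (l, unit) ::ₘ (scale q M.links + C')) (hC : restrict q C = 0)
    (hC' : restrict q C' = 0) (hqM : q.1 ∉ lew M.links)
    (hF : N.forms = (c, unit) ::ₘ (z, unit) ::ₘ F)
    (hL : N.links = (k, unit) ::ₘ (l, unit) ::ₘ (l', unit) ::ₘ L) :
    Simple (⟨restrict q F, (Link.cut a x, unit) ::ₘ restrict q L, N.concl⟩ : Net d) := by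
  subst hS₂
  have hqS : q.1 ∈ lew S₁.links := by
    rw [hS₁L]; simp only [suppW_cons, hl]; exact Or.inl rfl
  -- Weights mention only eigenweights of their own part of the net. So `q.1` occurs in no weight of
  -- `M`, of `T` or of the context: restriction undoes `scale q` on the kept component and leaves
  -- the rest of the net alone.
  have hqG : q.1 ∉ wts G := fun h => hqM (hM.wf.wts_forms (by
    rw [hMF, wts_add]; exact Or.inr h))
  have hqML : q.1 ∉ wts M.links := fun h => hqM (hM.wf.wts_links h)
  have hqT : q.1 ∉ lew T.links := fun h =>
    Set.disjoint_left.1 hap.2.1 hqS ⟨_, Multiset.mem_cons_of_mem h.choose_spec.1,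
      h.choose_spec.2⟩
  have hqL : q.1 ∉ lew L' := Set.disjoint_left.1 hole.ew (by
    simp only [cutNet, suppW_cons, suppW_add]; exact Or.inr (Or.inl hqS))
  have hwF : ∀ {s : Multiset (Occ × Weight)}, q.1 ∉ wts s → restrict q s = s :=
    fun h => restrict_eq_self q h
  have hwL : ∀ {s : Multiset (Link (Con d) × Weight)}, q.1 ∉ wts s → restrict q s = s :=
    fun h => restrict_eq_self q h
  have e1 : F = atUnit Γ + scale q G + C + T.forms + F' := by
    have := hole.forms
    rw [hF] at this
    simp only [cutNet, hS₁F, PreNet.extend, ← Multiset.singleton_add] at this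
    rw [← add_right_inj {(z, unit)}, ← add_right_inj {(c, unit)}, this]
    abel
  have e2 : L = scale q M.links + C' + T.links + L' := by
    have := hole.links
    rw [hL] at this
    simp only [cutNet, hS₁L, PreNet.extend, ← Multiset.singleton_add] at this
    rw [← add_right_inj {(l', unit)}, ← add_right_inj {(l, unit)}, ← add_right_inj {(k, unit)}, this]
    abel
  have e3 : restrict q F = (M.forms + T.forms) + F' := by
    rw [e1]
    simp only [restrict_add, hC, restrict_scale q hqG, add_zero, hMF]
    rw [hwF (s := atUnit Γ) (by simp), hwF (s := T.forms) fun h => hqT (hT.wf.wts_forms h),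
      hwF (s := F') fun h => hqL (hole.wts_forms h)]
  have e4 : restrict q L = (M.links + T.links) + L' := by
    rw [e2]
    simp only [restrict_add, hC', restrict_scale q hqML, add_zero]
    rw [hwL (s := T.links) fun h => hqT (hT.wf.wts_links h),
      hwL (s := L') fun h => hqL (hole.wts_links h)]
  have hap' : Net.Apart M T := by
    have h1 : Net.Apart S₁ T :=
      (hap.symm.mono (Multiset.le_cons_self _ _) (Multiset.le_cons_self _ _)).symm
    refine h1.of_subset ?_ ?_ ?_ ?_
    · rw [hMF, hS₁F]; simp only [suppW_add, suppW_cons, suppW_scale]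
      intro n; simp +contextual only [Set.mem_union, true_or, or_true, or_imp, implies_true, and_self]
    · rw [hS₁L]; simp only [suppW_add, suppW_cons, suppW_scale]
      intro n; simp +contextual only [Set.mem_union, true_or, or_true, or_imp, implies_true, and_self]
    · rw [hS₁L]; simp only [suppW_add, suppW_cons, suppW_scale]
      intro n; simp +contextual only [Set.mem_union, true_or, or_true, or_imp, implies_true, and_self]
    · simp only [vars_eq, hMF, hS₁F, hS₁L, suppW_add, suppW_cons, suppW_scale]
      intro n; simp +contextual only [Set.mem_union, true_or, or_true, or_imp, implies_true, and_self]
  have h1 := Simple.cut a x hM hT hap' ha hx hf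
  have := hole.replace_of_subset h1 rfl
    (by
      simp only [cutNet, PreNet.extend, hMF, hS₁F, suppW_add, suppW_cons, suppW_scale]
      intro n; simp +contextual only [Set.mem_union, true_or, or_true, or_imp, implies_true, and_self])
    (by
      simp only [cutNet, PreNet.extend, hS₁L, suppW_add, suppW_cons, suppW_scale,
        Link.eigenweights, Set.empty_union]
      intro n; simp +contextual only [Set.mem_union, true_or, or_true, or_imp, implies_true, and_self])
    (by
      simp only [cutNet, PreNet.extend, hS₁L, suppW_add, suppW_cons, suppW_scale,
        Link.evars, Set.empty_union]
      intro n; simp +contextual only [Set.mem_union, true_or, or_true, or_imp, implies_true, and_self])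
    (by
      simp only [vars_eq, cutNet, PreNet.extend, hMF, hS₁F, hS₁L, suppW_add, suppW_cons,
        suppW_scale, Link.vars, Set.empty_union]
      intro n; simp +contextual only [Set.mem_union, true_or, or_true, or_imp, implies_true, and_self])
  rw [e3, e4]
  simpa [Multiset.cons_add] using this

theorem Simple.step_plus₁ {N : Net d} {F : Multiset (Occ × Weight)}
    {L : Multiset (Link (Con d) × Weight)} (hN : Simple N) {k : Link (Con d)} {p : ℕ}
    {a b c x z : Occ} (hr : Ready N k c z) (hF : N.forms = (c, unit) ::ₘ (z, unit) ::ₘ F)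
    (hL : N.links =
      (k, unit) ::ₘ (Link.wth p a b c, unit) ::ₘ (Link.plus₁ x z, unit) ::ₘ L) :
    Simple (⟨restrict (p, true) F, (Link.cut a x, unit) ::ₘ restrict (p, true) L,
      N.concl⟩ : Net d) := by
  obtain ⟨S₁, S₂, Γ₁, Γ₂, K, P, O, F', L', h₁, h₂, -, -, hap, hc₁, hc₂, hcz, hole⟩ :=
    hN.ready hr (l₁ := .wth p a b c) (l₂ := .plus₁ x z) (by simp [hL]) (by simp [Link.concls])
      (by simp [hL]) (by simp [Link.concls])
  obtain ⟨M, M', Γ, G, G', hM, hM', ha, hb, hG, hG', hp, hp', hcf, rfl⟩ := h₁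
  obtain ⟨T, Δ, B, hT, hx, -, hzf, rfl⟩ := h₂
  obtain rfl : Γ₁ = Γ := by simpa using hc₁.symm
  obtain rfl : Γ₂ = Δ := by simpa [PreNet.extend] using hc₂.symm
  rw [hzf, hcf, Fm.neg] at hcz
  exact Simple.step_plus (q := (p, true)) hole hM hT hap rfl rfl ha hx (Fm.plus.inj hcz).1
    hG rfl rfl (restrict_scale_not (p, true) _) (restrict_scale_not (p, true) _) hp hF hL

theorem Simple.step_plus₂ {N : Net d} {F : Multiset (Occ × Weight)}
    {L : Multiset (Link (Con d) × Weight)} (hN : Simple N) {k : Link (Con d)} {p : ℕ}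
    {a b c x z : Occ} (hr : Ready N k c z) (hF : N.forms = (c, unit) ::ₘ (z, unit) ::ₘ F)
    (hL : N.links =
      (k, unit) ::ₘ (Link.wth p a b c, unit) ::ₘ (Link.plus₂ x z, unit) ::ₘ L) :
    Simple (⟨restrict (p, false) F, (Link.cut b x, unit) ::ₘ restrict (p, false) L,
      N.concl⟩ : Net d) := by
  obtain ⟨S₁, S₂, Γ₁, Γ₂, K, P, O, F', L', h₁, h₂, -, -, hap, hc₁, hc₂, hcz, hole⟩ :=
    hN.ready hr (l₁ := .wth p a b c) (l₂ := .plus₂ x z) (by simp [hL]) (by simp [Link.concls])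
      (by simp [hL]) (by simp [Link.concls])
  obtain ⟨M, M', Γ, G, G', hM, hM', ha, hb, hG, hG', hp, hp', hcf, rfl⟩ := h₁
  obtain ⟨T, Δ, B, hT, hx, -, hzf, rfl⟩ := h₂
  obtain rfl : Γ₁ = Γ := by simpa using hc₁.symm
  obtain rfl : Γ₂ = Δ := by simpa [PreNet.extend] using hc₂.symm
  rw [hzf, hcf, Fm.neg] at hcz
  exact Simple.step_plus (q := (p, false)) (C := scale (p, true) G)
    (C' := scale (p, true) M.links) hole hM' hT hap rfl rfl hb hx
    (Fm.plus.inj hcz).2 hG' (by rw [add_right_comm]) (by rw [add_comm (scale (p, true) _)])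
    (restrict_scale_not (p, false) _) (restrict_scale_not (p, false) _) hp' hF hL

/-! ### Quantifiers -/

theorem Simple.lmap_fix {φ : ℕ → Formula} {N : Net d} (hN : Simple N)
    {l : Link (Con d) × Weight} (hl : l ∈ N.links)
    (ho : ∀ o ∈ l.1.occs, ∀ x ∈ ovar o, φ x = var x)
    (hφ : ∀ x ∈ l.1.vars (Con.vars d), φ x = var x) : lmap id id id φ l = l := by
  refine Prod.ext (Link.map_self (ev := Con.evars d) (v := Con.vars d)
    (fun o h => Occ.map_self rfl (ho o h)) (fun _ _ => rfl) (fun _ _ => rfl) hφ ?_)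
    (weight_map_id _)
  intro b hb
  have h1 := hN.boxes b l.2 (hb ▸ hl)
  have h2 : ∀ x ∈ Con.vars d b.content, φ x = var x := fun x hx => hφ x (by rw [hb]; exact hx)
  cases h1 with
  | mk k aux main hN' h hk hid => exact Simple.lmap_self hN' h2

/-- The eigenvariable `v` can occur only in the subnet above the `∀`-link: apartness excludes it
from the other side of the cut and the context condition from the surroundings. Substituting in the
whole net thus amounts to substituting in that subnet. That the conclusions are fixed is recorded
separately, for use inside boxes. -/
theorem Simple.step_quant {N : Net d} {F : Multiset (Occ × Weight)}
    {L : Multiset (Link (Con d) × Weight)} (hN : Simple N) {k : Link (Con d)} {v : ℕ}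
    {B : Formula} {a c x z : Occ} (hr : Ready N k c z)
    (hF : N.forms = (c, unit) ::ₘ (z, unit) ::ₘ F)
    (hL : N.links = (k, unit) ::ₘ (Link.all v a c, unit) ::ₘ (Link.ex B x z, unit) ::ₘ L) :
    Simple (Net.map id id id (Function.update var v B)
        (⟨F, (Link.cut a x, unit) ::ₘ L, N.concl⟩ : Net d)) ∧
      N.concl.map (Occ.map id (Function.update var v B)) = N.concl := by
  obtain ⟨S₁, S₂, Γ₁, Γ₂, K, P, O, F', L', h₁, h₂, -, -, hap, hc₁, hc₂, hcz, hole⟩ :=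
    hN.ready hr (l₁ := .all v a c) (l₂ := .ex B x z) (by simp [hL]) (by simp [Link.concls])
      (by simp [hL]) (by simp [Link.concls])
  obtain ⟨M, Γ, A, hM, ha, hcM, hcf, haf, hvA, hvΓ, hvM, rfl⟩ := h₁
  obtain ⟨T, Δ, A', hT, hx, hzT, hzf, hxf, hBT, rfl⟩ := h₂
  obtain rfl : Γ₁ = Γ := by simpa [PreNet.extend] using hc₁.symm
  obtain rfl : Γ₂ = Δ := by simpa [PreNet.extend] using hc₂.symm
  obtain rfl : A' = A.neg := by
    rw [hzf, hcf, Fm.neg] at hcz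
    exact Fm.ex.inj hcz
  set φ := Function.update var v B with hφ
  have hφv : ∀ {V : Set ℕ}, v ∉ V → ∀ y ∈ V, φ y = var y := by
    intro V hV y hy
    rw [hφ, Function.update_of_ne]
    rintro rfl; exact hV hy
  have hev : v ∈ lev (cutNet k (M.extend (.all v a c) c Γ₁) (T.extend (.ex B x z) z Γ₂)
      Γ₁ Γ₂).links := by
    simp only [cutNet, PreNet.extend, suppW_cons, suppW_add, Link.evars]
    exact Or.inr (Or.inl (Or.inl rfl))
  have hvS₁ : v ∈ Net.evars (M.extend (.all v a c) c Γ₁) := by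
    rw [Net.extend_evars]; exact Or.inl rfl
  have hvT : v ∉ Net.vars T := fun h => Set.disjoint_left.1 hap.2.2.1 hvS₁ (by
    rw [Net.extend_vars]; exact Or.inr h)
  have hvFL := Set.disjoint_left.1 hole.ev hev
  -- The witness is stored in the `∃`-link, so its variables count as variables of the second net,
  -- and apartness rules out capture in `M`.
  have hB : Disjoint B.vars (Net.evars M) := by
    have := hap.2.2.1
    rw [Net.extend_evars, Net.extend_vars] at this
    exact (this.mono Set.subset_union_right
      (Set.subset_union_left.trans' Set.subset_union_right)).symm
  have hcN : N.concl.map (Occ.map id φ) = N.concl := by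
    refine Multiset.map_eq_self fun o ho => Occ.map_self rfl (hφv fun h => ?_)
    refine Set.disjoint_left.1 hN.wf.concl_ev ⟨o, ho, h⟩ ?_
    rw [hole.links]
    simp only [suppW_add]
    exact Or.inl hev
  refine ⟨?_, hcN⟩
  -- the substituted premise
  have hM' : Simple (M.map id id id φ) := by
    refine hM.map id id id φ Function.injective_id.injOn Function.injective_id.injOn ?_
    intro y hy
    have hyv : y ≠ v := fun h => hvM (h ▸ hy)
    refine ⟨by rw [hφ, Function.update_of_ne hyv]; rfl, fun u _ huy hyu => ?_⟩
    rw [hφ] at hyu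
    by_cases huv : u = v
    · rw [huv, Function.update_self] at hyu
      exact Set.disjoint_left.1 hB hyu hy
    · rw [Function.update_of_ne huv] at hyu
      exact huy hyu.symm
  have hMc : (M.map id id id φ).concl = a.map id φ ::ₘ Γ₁ := by
    rw [Net.map_eq, ha]
    simp only [Multiset.map_cons]
    congr 1
    exact Multiset.map_eq_self fun o ho => Occ.map_self rfl (hφv fun h => hvΓ ⟨o, ho, h⟩)
  have hMvars : Net.vars (M.map id id id φ) ⊆ Net.vars M ∪ B.vars := by
    refine (Net.map_vars id id id φ M).trans (Set.union_subset ?_ ?_)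
    · rintro y ⟨u, hu, hy⟩
      by_cases huv : u = v
      · rw [huv, hφ, Function.update_self] at hy; exact Or.inr hy
      · rw [hφ, Function.update_of_ne huv] at hy
        obtain rfl : y = u := hy
        exact Or.inl hu
    · rw [Set.image_id]
      exact M.evars_subset_vars.trans Set.subset_union_left
  have hMids : fids (M.map id id id φ).forms = fids M.forms := by
    have := Net.map_ids id id id φ M
    rwa [Set.image_id, ids_eq, ids_eq] at this
  have hMew : lew (M.map id id id φ).links = lew M.links := by
    have := Net.map_eigenweights id id id φ M
    rwa [Set.image_id] at this
  have hMev : lev (M.map id id id φ).links = lev M.links := by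
    have := Net.map_evars id id id φ M
    rwa [Set.image_id] at this
  have hap₁ : Net.Apart M (T.extend (.ex B x z) z Γ₂) :=
    hap.mono (Multiset.le_cons_self _ _) (Multiset.le_cons_self _ _)
  have hap₂ : Net.Apart M T :=
    (hap₁.symm.mono (Multiset.le_cons_self _ _) (Multiset.le_cons_self _ _)).symm
  have hap' : Net.Apart (M.map id id id φ) T := by
    refine ⟨?_, ?_, ?_, ?_⟩
    · rw [ids_eq, hMids, ← ids_eq]; exact hap₂.1
    · rw [eigenweights_eq, hMew]; exact hap₂.2.1
    · rw [evars_eq, hMev]; exact hap₂.2.2.1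
    · exact (Set.disjoint_union_left.2 ⟨hap₂.2.2.2, hBT⟩).mono_left hMvars
  have hcut := Simple.cut (a.map id φ) x hM' hT hap' hMc hx (by
    rw [Occ.map_fml, haf, hxf, hφ, Fm.inst_fsub_update hvA, Fm.inst_neg])
  have := hole.replace_of_subset hcut rfl
    (by
      simp only [cutNet, PreNet.extend, suppW_add, suppW_cons, hMids]
      intro n; simp +contextual only [Set.mem_union, true_or, or_true, or_imp, implies_true, and_self])
    (by
      simp only [cutNet, PreNet.extend, suppW_add, suppW_cons, hMew, Link.eigenweights,
        Set.empty_union]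
      intro n; simp +contextual only [Set.mem_union, true_or, or_true, or_imp, implies_true, and_self])
    (by
      simp only [cutNet, PreNet.extend, suppW_add, suppW_cons, hMev, Link.evars, Set.empty_union]
      intro n; simp +contextual only [Set.mem_union, true_or, or_true, or_imp, implies_true, and_self])
    (by
      rw [vars_eq] at hMvars
      intro n hn
      have h1 := @hMvars n
      simp only [vars_eq, cutNet, PreNet.extend, suppW_add, suppW_cons, Link.vars,
        Set.empty_union, Set.mem_union] at hn h1 ⊢
      grind)
  have e1 : F = M.forms + T.forms + F' := by
    have := hole.forms
    rw [hF] at this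
    simp only [cutNet, PreNet.extend, ← Multiset.singleton_add] at this
    rw [← add_right_inj {(z, unit)}, ← add_right_inj {(c, unit)}, this]
    abel
  have e2 : L = M.links + T.links + L' := by
    have := hole.links
    rw [hL] at this
    simp only [cutNet, PreNet.extend, ← Multiset.singleton_add] at this
    rw [← add_right_inj {(Link.ex B x z, unit)}, ← add_right_inj {(Link.all v a c, unit)},
      ← add_right_inj {(k, unit)}, this]
    abel
  have hTφ := Simple.lmap_self hT (hφv hvT)
  have e3 : F.map (fmap id id φ) = (M.map id id id φ).forms + T.forms + F' := by
    rw [e1, Multiset.map_add, Multiset.map_add]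
    congr 1
    · congr 1
      exact congrArg PreNet.forms hTφ
    · exact Multiset.map_eq_self fun f hf => fmap_self
        (Occ.map_self rfl (hφv fun h => hvFL (Or.inl ⟨f, hf, h⟩)))
  have e4 : L.map (lmap id id id φ) = (M.map id id id φ).links + T.links + L' := by
    rw [e2, Multiset.map_add, Multiset.map_add]
    congr 1
    · congr 1
      exact congrArg PreNet.links hTφ
    · refine Multiset.map_eq_self fun l hl => hN.lmap_fix ?_ ?_
        (hφv fun h => hvFL (Or.inr ⟨l, hl, h⟩))
      · rw [hole.links]; exact Multiset.mem_add.2 (Or.inr hl)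
      · intro o ho
        refine hφv fun h => ?_
        -- A link of the context reaches only conclusions of the cut and occurrences of the context.
        -- None of these contains `v`.
        rcases hole.occs l hl o ho with h' | ⟨w, h'⟩
        · have h1 : o ∈ K + P := Multiset.mem_add.2 (Or.inl h')
          rw [← hole.concl_in] at h1
          rcases Multiset.mem_add.1 h1 with h1 | h1
          · exact hvΓ ⟨o, h1, h⟩
          · exact hvT (Or.inl (hT.wf.conclVars_subset
              (by rw [hx, supp_cons]; exact Or.inr ⟨o, h1, h⟩)))
        · exact hvFL (Or.inl ⟨_, h', h⟩)
  have e5 : x.map id φ = x := Occ.map_self rfl (hφv fun h => hvT (Or.inl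
    (hT.wf.conclVars_subset (by rw [hx, supp_cons]; exact Or.inl h))))
  rw [Net.map_eq]
  simp only [Multiset.map_cons, e3, e4, hcN]
  simp only [lmap, Link.map, e5, weight_map_id]
  simpa [Multiset.cons_add] using this


/-! ## Reductions of boxes -/

section Box
variable {β : Type} (k : Kind) (N : β) (aux : Multiset (ℕ × PTree)) (main : Multiset (Occ × ℕ))

theorem Box.outer_main_cons (q : Occ × ℕ) : Box.outer ⟨k, N, aux, q ::ₘ main⟩ =
    ⟨q.2, k.app q.1.fml⟩ ::ₘ Box.outer ⟨k, N, aux, main⟩ := by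
  simp [Box.outer, Box.auxDoors, Box.mainDoors]

theorem Box.inner_main_cons (q : Occ × ℕ) : Box.inner ⟨k, N, aux, q ::ₘ main⟩ =
    q.1 ::ₘ Box.inner ⟨k, N, aux, main⟩ := by
  simp [Box.inner]

theorem Box.outer_add {N' N'' : β} (aux' : Multiset (ℕ × PTree)) (main' : Multiset (Occ × ℕ))
    (i : ℕ → ℕ) : Box.outer ⟨k, N'', aux + aux'.map (fun q => (i q.1, q.2)),
      main + main'.map (fun q => (⟨i q.1.id, q.1.fml⟩, q.2))⟩ =
        Box.outer ⟨k, N, aux, main⟩ + Box.outer ⟨k, N', aux', main'⟩ := by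
  simp only [Box.outer, Box.auxDoors, Box.mainDoors, Multiset.add_bind, Multiset.map_add,
    Multiset.bind_map, Multiset.map_map, Function.comp_def]
  abel

theorem Box.inner_add {N' N'' : β} (aux' : Multiset (ℕ × PTree)) (main' : Multiset (Occ × ℕ))
    (i : ℕ → ℕ) : Box.inner ⟨k, N'', aux + aux'.map (fun q => (i q.1, q.2)),
      main + main'.map (fun q => (⟨i q.1.id, q.1.fml⟩, q.2))⟩ =
        Box.inner ⟨k, N, aux, main⟩ +
          (Box.inner ⟨k, N', aux', main'⟩).map fun o => ⟨i o.id, o.fml⟩ := by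
  simp only [Box.inner, Multiset.map_add, Multiset.map_map, Function.comp_def]
  abel

end Box

theorem nodup_atUnit {Γ : Multiset Occ} :
    ((atUnit Γ).map fun f => f.1.id).Nodup ↔ (Γ.map Occ.id).Nodup := by
  simp [atUnit, Multiset.map_map, Function.comp_def]

theorem leafNet_box (b : Box (Con d)) :
    leafNet (Link.box b) = ⟨atUnit b.outer, {(Link.box b, unit)}, b.outer⟩ := rfl

theorem leafNet_box_evars (b : Box (Con d)) :
    Net.evars (leafNet (Link.box b)) = Con.evars d b.content := by
  rw [evars_eq, leafNet_box]; exact suppW_singleton _ _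

theorem leafNet_box_vars (b : Box (Con d)) :
    Net.vars (leafNet (Link.box b)) = supp ovar b.outer ∪ Con.vars d b.content := by
  rw [vars_eq, leafNet_box]
  simp only [suppW_atUnit, suppW_singleton]
  rfl

theorem leafNet_box_eigenweights (b : Box (Con d)) :
    lew (leafNet (Link.box b)).links = ∅ := by
  simp [leafNet_box, Link.eigenweights]

theorem cutNet_vars {k : Link (Con d)} {a b : Occ} (hk : k.IsCut a b) (M N : Net d)
    (Γ Δ : Multiset Occ) : Net.vars (cutNet k M N Γ Δ) = Net.vars M ∪ Net.vars N := by
  simp only [vars_eq, cutNet, suppW_cons, suppW_add, hk.free]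
  ext n; simp only [Set.mem_union, Set.mem_empty_iff_false, false_or]; tauto

theorem cutNet_evars {k : Link (Con d)} {a b : Occ} (hk : k.IsCut a b) (M N : Net d)
    (Γ Δ : Multiset Occ) : Net.evars (cutNet k M N Γ Δ) = Net.evars M ∪ Net.evars N := by
  simp only [evars_eq, cutNet, suppW_cons, suppW_add, hk.free, Set.empty_union]

/-- A cut between two boxes may be replaced by a single box. -/
theorem Simple.merge_boxes {N : Net d} {F : Multiset (Occ × Weight)}
    {L : Multiset (Link (Con d) × Weight)} (hN : Simple N) {k : Link (Con d)}
    {b₁ b₂ b : Box (Con d)} {u v : Occ} {Δ₁ Δ₂ : Multiset Occ} (hr : Ready N k u v)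
    (hF : N.forms = (u, unit) ::ₘ (v, unit) ::ₘ F)
    (hL : N.links = (k, unit) ::ₘ (Link.box b₁, unit) ::ₘ (Link.box b₂, unit) ::ₘ L)
    (h₁ : b₁.outer = u ::ₘ Δ₁) (h₂ : b₂.outer = v ::ₘ Δ₂) (h : b.outer = Δ₁ + Δ₂)
    (hb : SimpleBox b₁ → SimpleBox b₂ → Net.Apart (leafNet (Link.box b₁)) (leafNet (Link.box b₂)) →
      v.fml = u.fml.neg → (b.outer.map Occ.id).Nodup → Simple (leafNet (Link.box b)))
    (hev : Con.evars d b.content ⊆ Con.evars d b₁.content ∪ Con.evars d b₂.content)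
    (hva : Con.vars d b.content ⊆ Con.vars d b₁.content ∪ Con.vars d b₂.content) :
    Simple (⟨F, (Link.box b, unit) ::ₘ L, N.concl⟩ : Net d) := by
  obtain ⟨S₁, S₂, Γ₁, Γ₂, K, P, O, F', L', ⟨hb₁, rfl⟩, ⟨hb₂, rfl⟩, -, -, hap, hc₁, hc₂, hcz,
    hole⟩ := hN.ready hr (l₁ := .box b₁) (l₂ := .box b₂) (by simp [hL]) (by simp [Link.concls, h₁])
      (by simp [hL]) (by simp [Link.concls, h₂])
  obtain rfl : Δ₁ = Γ₁ := by
    rw [leafNet_box, h₁] at hc₁; exact (Multiset.cons_inj_right _).1 hc₁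
  obtain rfl : Δ₂ = Γ₂ := by
    rw [leafNet_box, h₂] at hc₂; exact (Multiset.cons_inj_right _).1 hc₂
  have e1 : F = atUnit b.outer + F' := by
    have := hole.forms
    rw [hF] at this
    simp only [cutNet, leafNet_box, h₁, h₂, atUnit_cons] at this
    simp only [← Multiset.singleton_add] at this
    rw [← add_right_inj {(v, unit)}, ← add_right_inj {(u, unit)}, this, h]
    simp only [atUnit_add]
    abel
  have e2 : L = L' := by
    have := hole.links
    rw [hL] at this
    simp only [cutNet, leafNet_box, ← Multiset.singleton_add] at this
    rw [← add_right_inj {(Link.box b₂, unit)}, ← add_right_inj {(Link.box b₁, unit)},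
      ← add_right_inj {(k, unit)}, this]
    abel
  -- The doors of the new box are occurrences of `N`, so their vertices are distinct.
  have hnd := hN.wf.nodup
  rw [hF, e1, nodup_cons_iff, nodup_cons_iff, nodup_add_iff, nodup_atUnit] at hnd
  have := hole.replace_of_subset (hb hb₁ hb₂ hap hcz hnd.2.2.1) h
    (by
      simp only [cutNet, leafNet_box, h, h₁, h₂, suppW_atUnit, suppW_add, supp_add, supp_cons]
      intro n; simp +contextual only [Set.mem_union, true_or, or_true, or_imp, implies_true, and_self])
    (by rw [leafNet_box_eigenweights]; exact Set.empty_subset _)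
    (by
      rw [← evars_eq, ← evars_eq, cutNet_evars hr.1]
      simpa only [leafNet_box_evars] using hev)
    (by
      rw [cutNet_vars hr.1]
      simp only [leafNet_box_vars, h, h₁, h₂, supp_add, supp_cons]
      intro n hn
      have := @hva n
      simp only [Set.mem_union] at hn this ⊢
      grind)
  rw [e1, e2]
  simpa only [leafNet_box, ← Multiset.singleton_add] using this

/-- The new contents are a cut of the old ones. Their vertices and eigenweights are separated by the
renaming, but their eigenvariables need none: those of the two boxes are already apart, as the boxes
were the two sides of a cut. -/
theorem Simple.step_neutral {N : Net (d + 1)} {F : Multiset (Occ × Weight)}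
    {L : Multiset (Link (Con (d + 1)) × Weight)} (hN : Simple N) {k : Link (Con (d + 1))}
    {Θ₁ Θ₂ Θ₃ : Net d} {aux₁ aux₂ : Multiset (ℕ × PTree)} {main₁ main₂ : Multiset (Occ × ℕ)}
    {a x : Occ} {c z : ℕ} {Γ₁ Γ₂ : Multiset Occ} (i w : Equiv.Perm ℕ)
    (hr : Ready N k ⟨c, Fm.neu a.fml⟩ ⟨z, Fm.neu x.fml⟩)
    (hF : N.forms = (⟨c, Fm.neu a.fml⟩, unit) ::ₘ (⟨z, Fm.neu x.fml⟩, unit) ::ₘ F)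
    (hL : N.links = (k, unit) ::ₘ
      (Link.box ⟨Kind.neutral, Θ₁, aux₁, (a, c) ::ₘ main₁⟩, unit) ::ₘ
      (Link.box ⟨Kind.neutral, Θ₂, aux₂, (x, z) ::ₘ main₂⟩, unit) ::ₘ L)
    (h₁ : Θ₁.concl = a ::ₘ Γ₁) (h₂ : Θ₂.concl = x ::ₘ Γ₂) (h₃ : Θ₃ = Θ₂.map i w id var)
    (hid : Disjoint Θ₁.ids Θ₃.ids) (hew : Disjoint Θ₁.eigenweights Θ₃.eigenweights) :
    Simple (⟨F, (Link.box ⟨Kind.neutral,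
      (⟨Θ₁.forms + Θ₃.forms,
        (Link.cut a ⟨i x.id, x.fml⟩, unit) ::ₘ (Θ₁.links + Θ₃.links),
        Γ₁ + Γ₂.map fun y => ⟨i y.id, y.fml⟩⟩ : Net d),
      aux₁ + aux₂.map (fun q => (i q.1, q.2)),
      main₁ + main₂.map (fun q => (⟨i q.1.id, q.1.fml⟩, q.2))⟩, unit) ::ₘ L,
        N.concl⟩ : Net (d + 1)) := by
  have hocc : (fun y : Occ => (⟨i y.id, y.fml⟩ : Occ)) = Occ.map i var := by
    funext y; simp [Occ.map, Fm.fsub_var]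
  have hv₃ : Net.vars Θ₃ ⊆ Net.vars Θ₂ := h₃ ▸ Net.rename_vars _ _ _
  have he₃ : Net.evars Θ₃ = Net.evars Θ₂ := h₃ ▸ Net.rename_evars _ _ _
  change Simple (⟨F, (Link.box ⟨Kind.neutral, (cutNet (Link.cut a ⟨i x.id, x.fml⟩) Θ₁ Θ₃ Γ₁
    (Γ₂.map fun y => ⟨i y.id, y.fml⟩) : Net d), aux₁ + aux₂.map (fun q => (i q.1, q.2)),
      main₁ + main₂.map (fun q => (⟨i q.1.id, q.1.fml⟩, q.2))⟩, unit) ::ₘ L,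
        N.concl⟩ : Net (d + 1))
  refine hN.merge_boxes hr hF hL (Box.outer_main_cons (β := Con (d + 1)) _ _ _ _ _)
    (Box.outer_main_cons (β := Con (d + 1)) _ _ _ _ _) (Box.outer_add (β := Con (d + 1)) _ Θ₁ (N' := Θ₂) _ _ _ _ _)
    ?_ ?_ ?_
  · intro hb₁ hb₂ hap hf hnd
    cases hb₁ with | mk _ _ _ hΘ₁ h₁' _ _ => ?_
    cases hb₂ with | mk _ _ _ hΘ₂ h₂' _ _ => ?_
    have ha := hap.2.2
    simp only [leafNet_box_vars, leafNet_box_evars, Set.disjoint_union_left,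
      Set.disjoint_union_right] at ha
    replace h₁' := h₁.symm.trans (h₁'.trans (Box.inner_main_cons (β := Con (d + 1)) _ _ _ _ _))
    replace h₂' := h₂.symm.trans (h₂'.trans (Box.inner_main_cons (β := Con (d + 1)) _ _ _ _ _))
    rw [Multiset.cons_inj_right] at h₁' h₂'
    have hap' : Net.Apart Θ₁ Θ₃ :=
      ⟨hid, hew, ha.1.2.mono_right hv₃, he₃ ▸ ha.2.2⟩
    refine Simple.box Kind.neutral _ _ (Simple.cut a ⟨i x.id, x.fml⟩ hΘ₁
      (h₃ ▸ hΘ₂.rename i.injective.injOn w.injective.injOn) hap' h₁ ?_ (Fm.neu.inj hf)) ?_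
        (by simp) hnd
    · rw [h₃, hocc, Net.map_eq, h₂]
      simp [Occ.map, Fm.fsub_var]
    · refine Eq.trans ?_ (Box.inner_add (β := Con (d + 1)) _ Θ₁ (N' := Θ₂) _ _ _ _ _).symm
      rw [h₁', h₂']
      rfl
  · change Net.evars (cutNet _ Θ₁ Θ₃ _ _) ⊆ Net.evars Θ₁ ∪ Net.evars Θ₂
    rw [cutNet_evars (Or.inl rfl), he₃]
  · change Net.vars (cutNet _ Θ₁ Θ₃ _ _) ⊆ Net.vars Θ₁ ∪ Net.vars Θ₂
    rw [cutNet_vars (Or.inl rfl)]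
    exact Set.union_subset_union_right _ hv₃

/-! ### A box against weakening -/

theorem PTree.exists_quest {t : PTree} {o : Occ} (h : o ∈ t.doors) : ∃ A, o.fml = Fm.quest A := by
  induction t with
  | leaf x A => exact ⟨A, by simp [List.mem_singleton.1 h]⟩
  | node l r hl hr => exact (List.mem_append.1 h).elim hl hr

/-- The net `T` with weakening links for the occurrences `ds`. -/
def weakNet (ds : Multiset Occ) (T : Net d) : Net d :=
  ⟨atUnit ds + T.forms, atUnit (ds.map Link.weak) + T.links, ds + T.concl⟩

theorem supp_weak (ds : Multiset Occ) : supp Link.eigenweights (ds.map (Link.weak (β := Con d))) = ∅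
    ∧ supp (Link.evars (Con.evars d)) (ds.map Link.weak) = ∅ ∧
      supp (Link.vars (Con.vars d)) (ds.map Link.weak) = ∅ := by
  refine ⟨?_, ?_, ?_⟩ <;> ext x <;> simp [supp, Link.eigenweights, Link.evars, Link.vars]

theorem weakNet_evars (ds : Multiset Occ) (T : Net d) :
    Net.evars (weakNet ds T) = Net.evars T := by
  simp only [evars_eq, weakNet, suppW_add, suppW_atUnit, supp_weak, Set.empty_union]

theorem weakNet_ids (ds : Multiset Occ) (T : Net d) :
    (weakNet ds T).ids = supp oid ds ∪ T.ids := by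
  simp only [ids_eq, weakNet, suppW_add, suppW_atUnit]

theorem weakNet_eigenweights (ds : Multiset Occ) (T : Net d) :
    (weakNet ds T).eigenweights = T.eigenweights := by
  simp only [eigenweights_eq, weakNet, suppW_add, suppW_atUnit, supp_weak, Set.empty_union]

theorem weakNet_vars (ds : Multiset Occ) (T : Net d) :
    Net.vars (weakNet ds T) = supp ovar ds ∪ Net.vars T := by
  simp only [vars_eq, weakNet, suppW_add, suppW_atUnit, supp_weak, Set.empty_union, Set.union_assoc]

theorem Simple.weaken {T : Net d} (hT : Simple T) {ds : Multiset Occ}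
    (hq : ∀ o ∈ ds, ∃ A, o.fml = Fm.quest A) (hnd : (ds.map Occ.id).Nodup)
    (hid : Disjoint (supp oid ds) T.ids) (hev : Disjoint (supp ovar ds) (Net.evars T)) :
    Simple (weakNet ds T) := by
  induction ds using Multiset.induction with
  | empty => simpa [weakNet] using hT
  | cons o s ih =>
    simp only [Multiset.map_cons, Multiset.nodup_cons, supp_cons, Set.disjoint_union_left] at *
    have h := ih (fun o ho => hq o (Multiset.mem_cons_of_mem ho)) hnd.2 hid.2 hev.2
    obtain ⟨A, hA⟩ := hq o (Multiset.mem_cons_self _ _)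
    have := Simple.weak o A h (by
      refine ⟨?_, ?_⟩
      · rw [weakNet_ids]
        rintro (⟨a, ha, h'⟩ | h')
        · exact hnd.1 (Multiset.mem_map.2 ⟨a, ha, h'.symm⟩)
        · exact Set.disjoint_left.1 hid.1 rfl h'
      · rw [weakNet_evars]; exact hev.1) hA
    simpa [weakNet, PreNet.extend, Multiset.cons_add] using this

/-- A cut between a box and a weakening link may be replaced by weakening links. -/
theorem Simple.weaken_box {N : Net d} {F : Multiset (Occ × Weight)}
    {L : Multiset (Link (Con d) × Weight)} (hN : Simple N) {k : Link (Con d)} {b : Box (Con d)}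
    {u z : Occ} {ds : Multiset Occ} (hr : Ready N k u z)
    (hF : N.forms = (u, unit) ::ₘ (z, unit) ::ₘ F)
    (hL : N.links = (k, unit) ::ₘ (Link.box b, unit) ::ₘ (Link.weak z, unit) ::ₘ L)
    (hout : b.outer = u ::ₘ ds) (hq : ∀ o ∈ ds, ∃ A, o.fml = Fm.quest A) :
    Simple (⟨F, atUnit (ds.map Link.weak) + L, N.concl⟩ : Net d) := by
  obtain ⟨S₁, S₂, Δ₁, Δ₂, K, P, O, F', L', ⟨hb, rfl⟩, ⟨T, A, hT, hzT, hzA, rfl⟩, -, -, hap, hc₁,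
    hc₂, hcz, hole⟩ := hN.ready hr (l₁ := .box b)
      (l₂ := .weak z) (by simp [hL]) (by simp [Link.concls, hout]) (by simp [hL])
      (by simp [Link.concls])
  obtain rfl : ds = Δ₁ := by
    rw [leafNet_box, hout] at hc₁; exact (Multiset.cons_inj_right _).1 hc₁
  obtain rfl : Δ₂ = T.concl := by simpa [PreNet.extend] using hc₂.symm
  have e1 : F = atUnit ds + T.forms + F' := by
    have := hole.forms
    rw [hF] at this
    simp only [cutNet, leafNet_box, hout, PreNet.extend, atUnit_cons] at this
    simp only [← Multiset.singleton_add] at this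
    rw [← add_right_inj {(z, unit)}, ← add_right_inj {(u, unit)}, this]
    abel
  have e2 : L = T.links + L' := by
    have := hole.links
    rw [hL] at this
    simp only [cutNet, leafNet_box, PreNet.extend, ← Multiset.singleton_add] at this
    rw [← add_right_inj {(Link.weak z, unit)}, ← add_right_inj {(Link.box b, unit)},
      ← add_right_inj {(k, unit)}, this]
    abel
  have hnd := hN.wf.nodup
  rw [hF, e1, nodup_cons_iff, nodup_cons_iff, nodup_add_iff, nodup_add_iff, nodup_atUnit] at hnd
  simp only [suppW_atUnit] at hnd
  -- The formulas of the doors belong to the box, which is apart from the net that was weakened; so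
  -- the doors may be introduced by weakening there.
  have hev : Disjoint (supp ovar ds) (Net.evars T) := by
    have := hap.2.2.2
    rw [Net.extend_evars, vars_eq, leafNet_box, hout] at this
    refine this.mono (fun n hn => ?_) Set.subset_union_right
    simp only [suppW_atUnit, supp_cons]
    exact Or.inl (Or.inr hn)
  have hw := hT.weaken hq hnd.2.2.1.1 (by rw [ids_eq]; exact hnd.2.2.1.2.2) hev
  have := hole.replace_of_subset hw rfl
    (by
      rw [← ids_eq, weakNet_ids, ids_eq]
      simp only [cutNet, leafNet_box, hout, PreNet.extend, suppW_atUnit, suppW_add, suppW_cons,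
        supp_cons]
      intro n; simp +contextual only [Set.mem_union, true_or, or_true, or_imp, implies_true, and_self])
    (by
      rw [← eigenweights_eq, weakNet_eigenweights, eigenweights_eq]
      simp only [cutNet, PreNet.extend, suppW_add, suppW_cons]
      intro n; simp +contextual only [Set.mem_union, true_or, or_true, or_imp, implies_true, and_self])
    (by
      rw [← evars_eq, weakNet_evars, evars_eq]
      simp only [cutNet, PreNet.extend, suppW_add, suppW_cons]
      intro n; simp +contextual only [Set.mem_union, true_or, or_true, or_imp, implies_true, and_self])
    (by
      rw [weakNet_vars]
      simp only [vars_eq, cutNet, leafNet_box, hout, PreNet.extend, suppW_atUnit, suppW_add,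
        suppW_cons, supp_cons]
      intro n; simp +contextual only [Set.mem_union, true_or, or_true, or_imp, implies_true, and_self])
  rw [e1, e2, ← add_assoc]
  exact this

theorem Box.outer_bang {β : Type} (Θ₀ : β) (r₀ : ℕ) (t₀ : PTree) (a₀ : Occ) (c : ℕ) :
    Box.outer (⟨Kind.bang, Θ₀, {(r₀, t₀)}, {(a₀, c)}⟩ : Box β) =
      ⟨c, Fm.bang a₀.fml⟩ ::ₘ (t₀.doors : Multiset Occ) := by
  rw [← Multiset.singleton_add]
  simp [Box.outer, Box.auxDoors, Box.mainDoors, Kind.app, add_comm]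

theorem Simple.step_weak {N : Net (d + 1)} {F : Multiset (Occ × Weight)}
    {L : Multiset (Link (Con (d + 1)) × Weight)} (hN : Simple N) {k : Link (Con (d + 1))}
    {Θ₀ : Net d} {r₀ : ℕ} {t₀ : PTree} {a₀ : Occ} {c : ℕ} {z : Occ}
    (hr : Ready N k ⟨c, Fm.bang a₀.fml⟩ z)
    (hF : N.forms = (⟨c, Fm.bang a₀.fml⟩, unit) ::ₘ (z, unit) ::ₘ F)
    (hL : N.links = (k, unit) ::ₘ
      (Link.box ⟨Kind.bang, Θ₀, {(r₀, t₀)}, {(a₀, c)}⟩, unit) ::ₘ (Link.weak z, unit) ::ₘ L) :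
    Simple (⟨F, atUnit ((t₀.doors : Multiset Occ).map Link.weak) + L, N.concl⟩ : Net (d + 1)) :=
  hN.weaken_box hr hF hL (Box.outer_bang (β := Con (d + 1)) _ _ _ _ _)
    fun _ ho => PTree.exists_quest ho


/-! ## Contexts through `&`-links -/

section times
variable {α : Type}

/-- Multiply all weights by `w`. -/
def times (w : Weight) (s : Multiset (α × Weight)) : Multiset (α × Weight) :=
  s.map fun a => (a.1, w ∪ a.2)

@[simp] theorem times_zero (w : Weight) : times w (0 : Multiset (α × Weight)) = 0 := rfl
@[simp] theorem times_cons (w : Weight) (a : α × Weight) (s : Multiset (α × Weight)) :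
    times w (a ::ₘ s) = (a.1, w ∪ a.2) ::ₘ times w s := by simp [times]
@[simp] theorem times_add (w : Weight) (s t : Multiset (α × Weight)) :
    times w (s + t) = times w s + times w t := by simp [times]
@[simp] theorem times_singleton (w : Weight) (a : α × Weight) :
    times w {a} = {(a.1, w ∪ a.2)} := by simp [times]
@[simp] theorem times_unit (s : Multiset (α × Weight)) : times unit s = s := by simp [times]
@[simp] theorem scale_add (q : ℕ × Bool) (s t : Multiset (α × Weight)) :
    scale q (s + t) = scale q s + scale q t := by simp [scale]
theorem scale_times (q : ℕ × Bool) (w : Weight) (s : Multiset (α × Weight)) :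
    scale q (times w s) = times (insert q w) s := by
  simp [times, scale, Multiset.map_map, Function.comp_def, Finset.insert_union]
@[simp] theorem suppW_times (g : α → Set ℕ) (w : Weight) (s : Multiset (α × Weight)) :
    suppW g (times w s) = suppW g s := by
  ext; simp [suppW, times]
theorem mem_times {w : Weight} {s : Multiset (α × Weight)} {a : α × Weight} (h : a ∈ s) :
    (a.1, w ∪ a.2) ∈ times w s := Multiset.mem_map.2 ⟨a, h, rfl⟩

end times

/-- The net `N` contains the subnet `S`, multiplied by the weight `w`; only the conclusions of `S`
are not multiplied by `w`.  `F` are the other occurrences of `S`; `E` and `E'` are the other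
occurrences and links of `N`. -/
structure WideHole (N S : Net d) (w : Weight) (F E : Multiset (Occ × Weight))
    (E' : Multiset (Link (Con d) × Weight)) : Prop where
  sforms : S.forms = atUnit S.concl + F
  forms : N.forms = times w F + E
  links : N.links = times w S.links + E'
  concl_mem : ∀ o ∈ N.concl, (o, unit) ∈ E
  shared_mem : ∀ o ∈ S.concl, ∃ v, (o, v) ∈ E
  ew : Disjoint (lew S.links) (lew E')
  weight : ∀ q ∈ w, q.1 ∈ lew E'
  ev : Disjoint (lev S.links) (fvars E ∪ lvars E')
  occs : ∀ l ∈ E', ∀ o ∈ l.1.occs, ∃ v, (o, v) ∈ E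
  plug : ∀ (S' : Net d) (F' : Multiset (Occ × Weight)), Simple S' → S'.concl = S.concl →
    S'.forms = atUnit S'.concl + F' → Disjoint (fids F') (fids E) → Disjoint (lew S'.links) (lew E') →
      Disjoint (lev S'.links) (fvars E ∪ lvars E') →
        (∀ v ∈ lev E', v ∈ Net.vars S' → v ∈ Net.vars S) →
          Simple (⟨times w F' + E, times w S'.links + E', N.concl⟩ : Net d)

theorem Wf.weight_eq {N : Net d} (h : Wf N) {o : Occ} {v w : Weight} (hv : (o, v) ∈ N.forms)
    (hw : (o, w) ∈ N.forms) : v = w :=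
  congrArg Prod.snd (Multiset.inj_on_of_nodup_map h.nodup _ hv _ hw rfl)

namespace WideHole
variable {N M S : Net d} {w : Weight} {F E : Multiset (Occ × Weight)}
  {E' : Multiset (Link (Con d) × Weight)}

/-- The conclusions are assigned to the context from the start. A later `&` may share them or
multiply them, so their weight need not be that of the rest of the subnet. -/
theorem refl (hN : Simple N) : ∃ F, WideHole N N unit F (atUnit N.concl) 0 := by
  obtain ⟨F, hF⟩ := Multiset.le_iff_exists_add.1 hN.wf.concl_le
  refine ⟨F, hF, by rw [hF, times_unit, add_comm], by simp, fun o ho => mem_atUnit.2 ⟨ho, rfl⟩,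
    fun o ho => ⟨unit, mem_atUnit.2 ⟨ho, rfl⟩⟩, by simp, by simp, ?_, by simp, ?_⟩
  · simpa using hN.wf.concl_ev.symm
  · rintro ⟨F₁, L, Γ⟩ F' hS' rfl hF' - - - -
    simp only at hF'
    subst hF'
    simpa [add_comm] using hS'

theorem lift {K P O : Multiset Occ} {F₁ : Multiset (Occ × Weight)}
    {L : Multiset (Link (Con d) × Weight)} (hN : Simple N) (h : WideHole M S w F E E')
    (hole : Hole N M K P O F₁ L) : WideHole N S w F (E + F₁) (E' + L) := by
  have hid := hole.ids
  have hew := hole.ew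
  have hev := hole.ev
  simp only [h.forms, h.links, suppW_add, suppW_times, Set.disjoint_union_left,
    Set.disjoint_union_right] at hid hew hev
  have hev2 := h.ev
  simp only [Set.disjoint_union_right] at hev2
  refine ⟨h.sforms, by rw [hole.forms, h.forms, add_assoc], by rw [hole.links, h.links, add_assoc],
    ?_, ?_, ?_, ?_, ?_, ?_, ?_⟩
  · intro o ho
    have ho' := ho
    rw [hole.concl_out] at ho'
    rcases Multiset.mem_add.1 ho' with ho' | ho'
    · exact Multiset.mem_add.2 (Or.inl (h.concl_mem o (by
        rw [hole.concl_in]; exact Multiset.mem_add.2 (Or.inr ho'))))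
    · obtain ⟨v, hv⟩ := hole.concl_new o ho'
      -- `concl_new` finds the occurrence with an unknown weight; as a conclusion of `N` it also
      -- occurs with weight `1`, and a vertex has only one weight.
      have := hN.wf.weight_eq (o := o) (v := v) (w := unit)
        (by rw [hole.forms]; exact Multiset.mem_add.2 (Or.inr hv)) (hN.wf.mem_forms ho)
      subst this
      exact Multiset.mem_add.2 (Or.inr hv)
  · intro o ho
    obtain ⟨v, hv⟩ := h.shared_mem o ho
    exact ⟨v, Multiset.mem_add.2 (Or.inl hv)⟩
  · simp only [suppW_add, Set.disjoint_union_right]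
    exact ⟨h.ew, hew.1⟩
  · intro q hq
    simp only [suppW_add]
    exact Or.inl (h.weight q hq)
  · simp only [suppW_add, Set.disjoint_union_right]
    tauto
  · intro l hl o ho
    simp only [Multiset.mem_add, exists_or]
    rcases Multiset.mem_add.1 hl with hl | hl
    · exact Or.inl (h.occs l hl o ho)
    · rcases hole.occs l hl o ho with h' | h'
      · exact Or.inl ⟨unit, h.concl_mem o (by
          rw [hole.concl_in]; exact Multiset.mem_add.2 (Or.inl h'))⟩
      · exact Or.inr h'
  · intro S' F' hS' hc hF' hi hw he hva
    simp only [suppW_add, Set.disjoint_union_right] at hi hw he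
    have h1 := h.plug S' F' hS' hc hF' hi.1 hw.1 (Set.disjoint_union_right.2 ⟨he.1.1, he.2.1⟩)
      fun v hv => hva v (by simp only [suppW_add]; exact Or.inl hv)
    have := hole.replace h1 rfl ⟨?_, ?_, ?_, ?_⟩
    · simpa only [add_assoc] using this
    · simp only [suppW_add, suppW_times, Set.disjoint_union_left]
      exact ⟨hi.2, hid.2⟩
    · simp only [suppW_add, suppW_times, Set.disjoint_union_left]
      exact ⟨hw.2, hew.2⟩
    · simp only [suppW_add, suppW_times, Set.disjoint_union_left, Set.disjoint_union_right]
      tauto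
    · intro v hv hv'
      have h2 := hva v (by simp only [suppW_add]; exact Or.inr hv)
      have h3 : supp ovar S.concl ⊆ fvars E := by
        rintro n ⟨o, ho, hn⟩
        obtain ⟨v, hv⟩ := h.shared_mem o ho
        exact ⟨_, hv, hn⟩
      have h4 := @h3 v
      simp only [vars_eq, hF', h.sforms, h.forms, h.links, suppW_add, suppW_times, suppW_atUnit,
        Set.mem_union] at hv' h2 ⊢
      grind

/-- The shared occurrences of the `&`-rule are conclusions of `M` and therefore belong to the
context part `E`. So the private part of the subnet is multiplied as a whole, and only `E` has to be
split into what is shared and what is multiplied. -/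
theorem wth {q : ℕ × Bool} {Γ : Multiset Occ} {F₁ E₁ : Multiset (Occ × Weight)}
    {E₁' : Multiset (Link (Con d) × Weight)} (h : WideHole M S w F E E')
    (hole : WthHole N M q Γ F₁ E₁ E₁') :
    ∃ E₂, WideHole N S (insert q w) F E₂ (scale q E' + E₁') := by
  -- Membership suffices for inclusion of multisets here, because the shared occurrences are
  -- distinct.
  have hΓ : atUnit Γ ≤ E := by
    refine (Multiset.le_iff_subset hole.shared_nodup).2 fun o ho => ?_
    obtain ⟨o, v⟩ := o
    obtain ⟨h1, rfl⟩ := mem_atUnit.1 ho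
    exact h.concl_mem o (hole.shared_concl o h1)
  obtain ⟨E₀, rfl⟩ := Multiset.le_iff_exists_add.1 hΓ
  have hF₁ : F₁ = times w F + E₀ := by
    have := hole.mforms
    rw [h.forms, add_left_comm, add_right_inj] at this
    exact this.symm
  subst hF₁
  have hid := hole.ids
  have hew := hole.ew
  have hev := hole.ev
  have hev2 := h.ev
  have hsh : ∀ o v, (o, v) ∈ atUnit Γ + E₀ → ∃ v, (o, v) ∈ scale q E₀ + E₁ := by
    intro o v ho
    rcases Multiset.mem_add.1 ho with h1 | h1
    · exact ⟨unit, Multiset.mem_add.2 (Or.inr (hole.shared_mem o (mem_atUnit.1 h1).1))⟩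
    · exact ⟨_, Multiset.mem_add.2 (Or.inl (Multiset.mem_map.2 ⟨_, h1, rfl⟩))⟩
  have hΓE : supp oid Γ ⊆ fids E₁ ∧ supp ovar Γ ⊆ fvars E₁ :=
    ⟨fun n ⟨o, ho, hn⟩ => ⟨_, hole.shared_mem o ho, hn⟩,
      fun n ⟨o, ho, hn⟩ => ⟨_, hole.shared_mem o ho, hn⟩⟩
  simp only [h.links, suppW_add, suppW_times, suppW_atUnit, Set.disjoint_union_left,
    Set.disjoint_union_right] at hid hew hev hev2
  refine ⟨scale q E₀ + E₁, h.sforms, ?_, ?_, ?_, ?_, ?_, ?_, ?_, ?_, ?_⟩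
  · rw [hole.forms, scale_add, scale_times, add_assoc]
  · rw [hole.links, h.links, scale_add, scale_times, add_assoc]
  · exact fun o ho => Multiset.mem_add.2 (Or.inr (hole.concl_mem o ho))
  · intro o ho
    obtain ⟨v, hv⟩ := h.shared_mem o ho
    exact hsh o v hv
  · simp only [suppW_add, suppW_scale, Set.disjoint_union_right]
    exact ⟨h.ew, hew.1⟩
  · intro q' hq'
    simp only [suppW_add, suppW_scale]
    rcases Finset.mem_insert.1 hq' with rfl | hq'
    · exact Or.inr hole.ew_mem
    · exact Or.inl (h.weight q' hq')
  · simp only [suppW_add, suppW_scale, Set.disjoint_union_right]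
    tauto
  · intro l hl o ho
    rcases Multiset.mem_add.1 hl with hl | hl
    · obtain ⟨l', hl', rfl⟩ := Multiset.mem_map.1 hl
      obtain ⟨v, hv⟩ := h.occs l' hl' o ho
      exact hsh o v hv
    · rcases hole.occs l hl o ho with h' | ⟨v, hv⟩
      · exact hsh o _ (h.concl_mem o h')
      · exact ⟨v, Multiset.mem_add.2 (Or.inr hv)⟩
  · intro S' F' hS' hc hF' hi hw he hva
    simp only [suppW_add, suppW_scale, Set.disjoint_union_right] at hi hw he
    have h1 := h.plug S' F' hS' hc hF'
      (by
        simp only [suppW_add, suppW_atUnit, Set.disjoint_union_right]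
        exact ⟨hi.2.mono_right hΓE.1, hi.1⟩) hw.1
      (by
        simp only [suppW_add, suppW_atUnit, Set.disjoint_union_right]
        exact ⟨⟨he.1.2.mono_right hΓE.2, he.1.1⟩, he.2.1⟩)
      fun v hv => hva v (by simp only [suppW_add, suppW_scale]; exact Or.inl hv)
    have := hole.plug _ (times w F' + E₀) h1 rfl (by simp only; abel) ?_ ?_ ?_ ?_
    · simpa only [scale_add, scale_times, add_assoc] using this
    · simp only [suppW_add, suppW_times, Set.disjoint_union_left]
      exact ⟨hi.2, hid.2⟩
    · simp only [suppW_add, suppW_times, Set.disjoint_union_left]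
      exact ⟨hw.2, hew.2⟩
    · simp only [suppW_add, suppW_times, Set.disjoint_union_left, Set.disjoint_union_right]
      tauto
    · intro v hv hv'
      have h2 := hva v (by simp only [suppW_add]; exact Or.inr hv)
      have h3 : supp ovar S.concl ⊆ fvars (atUnit Γ + E₀) := by
        rintro n ⟨o, ho, hn⟩
        obtain ⟨v, hv⟩ := h.shared_mem o ho
        exact ⟨_, hv, hn⟩
      have h4 := @h3 v
      simp only [vars_eq, hF', h.sforms, h.forms, h.links, suppW_add, suppW_times, suppW_atUnit,
        Set.mem_union] at hv' h2 h4 ⊢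
      grind

end WideHole

/-- Every link of a simple proof net is introduced by the last rule of a subnet. -/
theorem Simple.wideHole {N : Net d} (hN : Simple N) : ∀ l ∈ N.links,
    ∃ (S : Net d) (F E : Multiset (Occ × Weight)) (E' : Multiset (Link (Con d) × Weight)),
      LastRule S l.1 ∧ Simple S ∧ WideHole N S l.2 F E E' := by
  refine Simple.link_induction (motive := fun {d} N l => ∃ (S : Net d)
    (F E : Multiset (Occ × Weight)) (E' : Multiset (Link (Con d) × Weight)),
      LastRule S l.1 ∧ Simple S ∧ WideHole N S l.2 F E E') ?_ ?_ ?_ hN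
  · intro d N l hN hl
    obtain ⟨F, h⟩ := WideHole.refl hN
    exact ⟨N, F, _, _, hl, hN, h⟩
  · rintro d N M K P O F L l hN ⟨S, F', E, E', h1, h2, h3⟩ hole
    exact ⟨S, F', _, _, h1, h2, h3.lift hN hole⟩
  · rintro d N M q Γ F E E' l hN ⟨S, F', E₁, E₁', h1, h2, h3⟩ hole
    obtain ⟨E₂, h⟩ := h3.wth hole
    exact ⟨S, F', _, _, h1, h2, h⟩


/-! ## Reductions of contraction links, reductions inside boxes -/

/-- The form needed for fusion and c-w: the conclusions stay the same, and `X` consists of the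
occurrences that disappear, which are therefore private and have weight `w` in `N`. -/
theorem WideHole.replace {N S S' : Net d} {w : Weight} {F G X E : Multiset (Occ × Weight)}
    {E' : Multiset (Link (Con d) × Weight)} (h : WideHole N S w G E E') (hN : Simple N)
    (hS' : Simple S') (hc : S'.concl = S.concl) (hX : S.forms = X + S'.forms)
    (h2 : lew S'.links ⊆ lew S.links) (h3 : lev S'.links ⊆ lev S.links)
    (h4 : Net.vars S' ⊆ Net.vars S) (hF : N.forms = times w X + F) :
    Simple (⟨F, times w S'.links + E', N.concl⟩ : Net d) := by
  obtain ⟨G', hG'⟩ := Multiset.le_iff_exists_add.1 hS'.wf.concl_le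
  have hG : G = X + G' := by
    have := h.sforms
    rw [hX, hG', hc, add_left_comm, add_right_inj] at this
    exact this.symm
  have hF' : F = times w G' + E := by
    have := h.forms
    rw [hF, hG, times_add, add_assoc, add_right_inj] at this
    exact this
  have hid : Disjoint (fids G) (fids E) := by
    have := hN.wf.nodup
    rw [h.forms, nodup_add_iff] at this
    simpa only [suppW_times] using this.2.2
  rw [hF']
  refine h.plug S' G' hS' hc hG' (hid.mono_left ?_) (h.ew.mono_left h2) (h.ev.mono_left h3)
    fun v _ hv => h4 hv
  rw [hG]
  simp only [suppW_add]
  exact Set.subset_union_right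

/-- A premise `x` of a contraction link that is the conclusion of a single link `l` of the same
weight. -/
theorem Simple.contr_premise {N : Net d} (hN : Simple N) {l : Link (Con d)} {w : Weight}
    {x c : Occ} {xs : Multiset Occ} (hx : N.links.countP (fun l => x ∈ l.1.concls) = 1)
    (hcN : (Link.contr (x ::ₘ xs) c, w) ∈ N.links) (hl : (l, w) ∈ N.links) (hxl : x ∈ l.concls) :
    ∃ (M R : Net d) (Γ K P O : Multiset Occ) (A : Formula) (G E F : Multiset (Occ × Weight))
      (E' L : Multiset (Link (Con d) × Weight)), Simple M ∧ LastRule R l ∧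
        M.concl = x ::ₘ xs + Γ ∧ (∀ a ∈ x ::ₘ xs, a.fml = Fm.quest A) ∧ c.fml = Fm.quest A ∧
          Net.Fresh c M ∧ WideHole N (M.extend (.contr (x ::ₘ xs) c) c Γ) w G E E' ∧
            Hole M R K (x ::ₘ P) O F L ∧ xs + Γ = P + O := by
  obtain ⟨S, G, E, E', ⟨M, Γ, A, hM, hc, -, hA, hcA, hcM, rfl⟩, hS, hole⟩ := hN.wideHole _ hcN
  have hxM : x ∈ M.concl := by rw [hc]; simp
  obtain ⟨⟨l', v⟩, hl', hxl'⟩ := hM.wf.form_concl _ (hM.wf.mem_forms hxM)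
  have hmem : (l', w ∪ v) ∈ N.links := by
    rw [hole.links]
    exact Multiset.mem_add.2 (Or.inl (mem_times (a := (l', v)) (Multiset.mem_cons_of_mem hl')))
  have heq := Multiset.eq_of_countP_eq_one hx hmem hl hxl' hxl
  simp only [Prod.mk.injEq] at heq
  obtain ⟨rfl, hv⟩ := heq
  -- The equation `w ∪ v = w` puts every literal of `v` into `w`, over an eigenweight of the
  -- context. But `v` is a weight of `M` and mentions only eigenweights of `M`, so it is empty; only
  -- linear rules separate the two links.
  have hv0 : v = unit := by
    refine Finset.eq_empty_of_forall_notMem fun q hq => ?_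
    have h1 : q ∈ w := by rw [← hv]; exact Finset.mem_union_right _ hq
    refine Set.disjoint_left.1 hole.ew ?_ (hole.weight q h1)
    simp only [PreNet.extend, suppW_cons]
    exact Or.inr (hM.wf.wts_links ⟨_, hl', q.2, hq⟩)
  subst hv0
  obtain ⟨R, K, P, O, F, L, hlast, hR, hole'⟩ := hM.hole l' hl'
  have hxP : x ∈ P := by
    have h1 : x ∈ P + O := by rw [← hole'.concl_out]; exact hxM
    obtain ⟨u, hu⟩ := hR.wf.occ_mem _ hlast.mem x (Multiset.mem_add.2 (Or.inr hxl'))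
    exact (Multiset.mem_add.1 h1).resolve_right (hole'.not_mem_out hu)
  obtain ⟨P', rfl⟩ := Multiset.exists_cons_of_mem hxP
  refine ⟨M, R, Γ, K, P', O, A, G, E, F, E', L, hM, hlast, hc, hA, hcA, hcM, hole, hole', ?_⟩
  have := hole'.concl_out
  rwa [hc, Multiset.cons_add, Multiset.cons_add, Multiset.cons_inj_right] at this

theorem Net.Fresh.of_subset {c : Occ} {M M' : Net d} (h : Net.Fresh c M)
    (h1 : fids M'.forms ⊆ fids M.forms) (h2 : lev M'.links ⊆ lev M.links) : Net.Fresh c M' :=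
  ⟨fun hc => h.1 (by rw [ids_eq] at hc ⊢; exact h1 hc), h.2.mono_right h2⟩

theorem Simple.step_fusion {N : Net d} (hN : Simple N) {F : Multiset (Occ × Weight)}
    {L : Multiset (Link (Con d) × Weight)} {w : Weight} {x c : Occ} {xs ys : Multiset Occ}
    (hx : N.links.countP (fun l => x ∈ l.1.concls) = 1) (hF : N.forms = (x, w) ::ₘ F)
    (hL : N.links = (Link.contr (x ::ₘ xs) c, w) ::ₘ (Link.contr ys x, w) ::ₘ L) :
    Simple (⟨F, (Link.contr (ys + xs) c, w) ::ₘ L, N.concl⟩ : Net d) := by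
  obtain ⟨M, R, Γ, K, P, O, A, G, E, F', E', L', hM, ⟨Q, Γ', B, hQ, hcQ, hys, hyB, hxB, -, rfl⟩,
    hcM, hA, hcA, hfr, wide, hole, hPO⟩ := hN.contr_premise hx (l := .contr ys x) (xs := xs)
      (c := c) (w := w) (by simp [hL]) (by simp [hL]) (by simp [Link.concls])
  obtain rfl : B = A := by
    have := hA x (Multiset.mem_cons_self _ _)
    rw [hxB] at this
    exact Fm.quest.inj this
  obtain rfl : Γ' = K + P := by
    have := hole.concl_in
    rw [PreNet.extend, Multiset.add_cons] at this
    exact (Multiset.cons_inj_right _).1 this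
  have hsub : fids Q.forms ⊆ fids (Q.extend (.contr ys x) x (K + P)).forms ∧
      lew Q.links ⊆ lew (Q.extend (.contr ys x) x (K + P)).links ∧
      lev Q.links ⊆ lev (Q.extend (.contr ys x) x (K + P)).links := by
    simp only [PreNet.extend, suppW_cons]
    exact ⟨Set.subset_union_right, Set.subset_union_right, Set.subset_union_right⟩
  -- The inner contraction is skipped: the linear context keeps `ys` where it kept `x`. This uses
  -- that the kept conclusions of a plugged net are arbitrary.
  have hM' := hole.plug Q (ys + P) hQ (by rw [hcQ, add_left_comm])
    ⟨hole.ids.mono_left hsub.1, hole.ew.mono_left hsub.2.1, hole.ev.mono_left hsub.2.2,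
      fun v _ hv => by rw [Net.extend_vars]; exact Or.inr hv⟩ (by
        have := hole.concl_ev
        simp only [supp_add, supp_cons, Set.disjoint_union_left] at this ⊢
        refine ⟨this.1.mono_left ?_, this.2⟩
        rintro n ⟨y, hy, hn⟩
        rw [ovar, hyB y hy] at hn
        rw [ovar, hxB]
        exact hn)
  have hMF : M.forms = (x, unit) ::ₘ (Q.forms + F') := by
    rw [hole.forms]; simp [PreNet.extend, Multiset.cons_add]
  have hML : M.links = (.contr ys x, unit) ::ₘ (Q.links + L') := by
    rw [hole.links]; simp [PreNet.extend, Multiset.cons_add]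
  have hS' := Simple.contr (ys + xs) c B hM' (Γ := Γ)
    (by simp only [add_assoc, hPO]) (by simp only [Multiset.card_add]; omega)
    (fun a ha => (Multiset.mem_add.1 ha).elim (hyB a)
      fun h => hA a (Multiset.mem_cons_of_mem h)) hcA
    (hfr.of_subset (by rw [hMF]; simp only [suppW_cons]; exact Set.subset_union_right)
      (by rw [hML]; simp only [suppW_cons]; exact Set.subset_union_right))
  have := wide.replace hN hS' rfl (X := {(x, unit)}) (F := F)
    (by simp only [PreNet.extend, hMF, ← Multiset.singleton_add]; abel)
    (by
      simp only [PreNet.extend, hML, suppW_cons, Link.eigenweights]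
      intro n; simp +contextual only [Set.mem_union, true_or, or_true, or_imp, implies_true, and_self])
    (by
      simp only [PreNet.extend, hML, suppW_cons, Link.evars]
      intro n; simp +contextual only [Set.mem_union, true_or, or_true, or_imp, implies_true, and_self])
    (by
      simp only [vars_eq, PreNet.extend, hMF, hML, suppW_cons, Link.vars]
      intro n; simp +contextual only [Set.mem_union, true_or, or_true, or_imp, implies_true, and_self])
    (by rw [hF]; simp)
  convert this using 2
  have h2 := wide.links
  rw [hL] at h2
  simp only [PreNet.extend, hML, times_cons, Finset.union_empty, Multiset.cons_add,
    Multiset.cons_inj_right] at h2 ⊢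
  exact h2

/-- The effect of removing a weakening link on a premise of a contraction link. -/
theorem Simple.cw_premise {N : Net d} (hN : Simple N) {w : Weight}
    {L : Multiset (Link (Con d) × Weight)} {x c : Occ} {xs : Multiset Occ}
    (hx : N.links.countP (fun l => x ∈ l.1.concls) = 1)
    (hL : N.links = (Link.contr (x ::ₘ xs) c, w) ::ₘ (Link.weak x, w) ::ₘ L) :
    ∃ (M M' : Net d) (Γ : Multiset Occ) (A : Formula) (G E : Multiset (Occ × Weight))
      (E' : Multiset (Link (Con d) × Weight)), Simple M' ∧ M'.concl = xs + Γ ∧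
        (∀ a ∈ xs, a.fml = Fm.quest A) ∧ c.fml = Fm.quest A ∧ Net.Fresh c M' ∧
          WideHole N (M.extend (.contr (x ::ₘ xs) c) c Γ) w G E E' ∧
            M.forms = (x, unit) ::ₘ M'.forms ∧ M.links = (.weak x, unit) ::ₘ M'.links ∧
              L = times w M'.links + E' := by
  obtain ⟨M, R, Γ, K, P, O, A, G, E, F', E', L', hM, ⟨Q, B, hQ, -, hxB, rfl⟩,
    hcM, hA, hcA, hfr, wide, hole, hPO⟩ := hN.contr_premise hx (l := .weak x) (xs := xs)
      (c := c) (w := w) (by simp [hL]) (by simp [hL]) (by simp [Link.concls])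
  have hcQ : Q.concl = K + P := by
    have := hole.concl_in
    rw [PreNet.extend, Multiset.add_cons] at this
    exact (Multiset.cons_inj_right _).1 this
  -- Without the weakening link, the context simply has `x` no longer among the conclusions that it
  -- keeps.
  have hM' := hole.plug Q P hQ hcQ
    ⟨hole.ids.mono_left (by simp only [PreNet.extend, suppW_cons]; exact Set.subset_union_right),
      hole.ew.mono_left (by simp only [PreNet.extend, suppW_cons]; exact Set.subset_union_right),
      hole.ev.mono_left (by simp only [PreNet.extend, suppW_cons]; exact Set.subset_union_right),
      fun v _ hv => by rw [Net.extend_vars]; exact Or.inr hv⟩ (by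
        have := hole.concl_ev
        simp only [supp_cons, Set.disjoint_union_left] at this
        exact this.2)
  have hMF : M.forms = (x, unit) ::ₘ (Q.forms + F') := by
    rw [hole.forms]; simp [PreNet.extend, Multiset.cons_add]
  have hML : M.links = (.weak x, unit) ::ₘ (Q.links + L') := by
    rw [hole.links]; simp [PreNet.extend, Multiset.cons_add]
  refine ⟨M, _, Γ, A, G, E, E', hM', hPO.symm, fun a ha => hA a (Multiset.mem_cons_of_mem ha), hcA,
    hfr.of_subset (by rw [hMF]; simp only [suppW_cons]; exact Set.subset_union_right)
      (by rw [hML]; simp only [suppW_cons]; exact Set.subset_union_right), wide, hMF, hML, ?_⟩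
  have h2 := wide.links
  rw [hL] at h2
  simpa only [PreNet.extend, hML, times_cons, Finset.union_empty, Multiset.cons_add,
    Multiset.cons_inj_right] using h2

theorem Simple.step_cw {N : Net d} (hN : Simple N) {F : Multiset (Occ × Weight)}
    {L : Multiset (Link (Con d) × Weight)} {w : Weight} {x c : Occ} {xs : Multiset Occ}
    (hx : N.links.countP (fun l => x ∈ l.1.concls) = 1) (hF : N.forms = (x, w) ::ₘ F)
    (hL : N.links = (Link.contr (x ::ₘ xs) c, w) ::ₘ (Link.weak x, w) ::ₘ L)
    (hxs : 2 ≤ Multiset.card xs) :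
    Simple (⟨F, (Link.contr xs c, w) ::ₘ L, N.concl⟩ : Net d) := by
  obtain ⟨M, M', Γ, A, G, E, E', hM', hcM', hA, hcA, hfr, wide, hMF, hML, rfl⟩ :=
    hN.cw_premise hx hL
  have hS' := Simple.contr xs c A hM' hcM' hxs hA hcA hfr
  have := wide.replace hN hS' rfl (X := {(x, unit)}) (F := F)
    (by simp only [PreNet.extend, hMF, ← Multiset.singleton_add]; abel)
    (by
      simp only [PreNet.extend, hML, suppW_cons, Link.eigenweights]
      intro n; simp +contextual only [Set.mem_union, true_or, or_true, or_imp, implies_true, and_self])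
    (by
      simp only [PreNet.extend, hML, suppW_cons, Link.evars]
      intro n; simp +contextual only [Set.mem_union, true_or, or_true, or_imp, implies_true, and_self])
    (by
      simp only [vars_eq, PreNet.extend, hMF, hML, suppW_cons, Link.vars]
      intro n; simp +contextual only [Set.mem_union, true_or, or_true, or_imp, implies_true, and_self])
    (by rw [hF]; simp)
  simpa [PreNet.extend, Multiset.cons_add] using this

theorem moveLinks_add (m n : ℕ) (L L' : Multiset (Link (Con d) × Weight)) :
    moveLinks m n (L + L') = moveLinks m n L + moveLinks m n L' := Multiset.map_add _ _ _

theorem moveLinks_times (m n : ℕ) (w : Weight) (L : Multiset (Link (Con d) × Weight)) :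
    moveLinks m n (times w L) = times w (moveLinks m n L) := by
  simp [moveLinks, times, Multiset.map_map, Function.comp_def]

theorem moveLinks_self {m n : ℕ} {L : Multiset (Link (Con d) × Weight)}
    (h : ∀ l ∈ L, ∀ o ∈ l.1.occs, o.id ≠ m) : moveLinks m n L = L := by
  rw [moveLinks_eq]
  exact Multiset.map_eq_self fun l hl => lmap_self_var fun o ho => moveId_of_ne (h l hl o ho)

/-- With one premise left, the contraction rule is dropped and `y` is moved to the vertex of `c`,
which is fresh above the contraction; this restores the conclusions that the context expects. -/
theorem Simple.step_cw₁ {N : Net d} (hN : Simple N) {F : Multiset (Occ × Weight)}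
    {L : Multiset (Link (Con d) × Weight)} {w : Weight} {x y c : Occ}
    (hx : N.links.countP (fun l => x ∈ l.1.concls) = 1)
    (hF : N.forms = (x, w) ::ₘ (y, w) ::ₘ F)
    (hL : N.links = (Link.contr {x, y} c, w) ::ₘ (Link.weak x, w) ::ₘ L) :
    Simple (⟨F, moveLinks y.id c.id L, N.concl⟩ : Net d) := by
  obtain ⟨M, M', Γ, A, G, E, E', hM', hcM', hA, hcA, hfr, wide, hMF, hML, rfl⟩ :=
    hN.cw_premise (xs := {y}) hx hL
  obtain ⟨M'', hM'', hcM'', hLM, ⟨G₁, hG, hG'⟩, hew, hev, hva, -⟩ :=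
    hM'.move_concl (z := y) (x := c) (Δ := Γ) hcM' hfr.1
      ((hA y (Multiset.mem_singleton_self _)).trans hcA.symm)
  have := wide.replace hN hM'' hcM'' (X := {(x, unit), (y, unit)}) (F := F)
    (by
      simp only [PreNet.extend, hMF, hG, hG', Multiset.insert_eq_cons, ← Multiset.singleton_add]
      abel)
    (by
      simp only [PreNet.extend, hML, hew, suppW_cons]
      intro n; simp +contextual only [Set.mem_union, true_or, or_true, or_imp, implies_true, and_self])
    (by
      simp only [PreNet.extend, hML, hev, suppW_cons]
      intro n; simp +contextual only [Set.mem_union, true_or, or_true, or_imp, implies_true, and_self])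
    (by
      refine hva.trans ?_
      simp only [vars_eq, PreNet.extend, hMF, hML, suppW_cons]
      intro n; simp +contextual only [Set.mem_union, true_or, or_true, or_imp, implies_true, and_self])
    (by rw [hF]; simp [Multiset.insert_eq_cons])
  rw [moveLinks_add, moveLinks_times, moveLinks_self (L := E'), ← hLM]
  · exact this
  · intro l hl o ho h
    obtain ⟨v, hv⟩ := wide.occs l hl o ho
    have hnd := hN.wf.nodup
    have h1 := wide.sforms
    simp only [PreNet.extend, atUnit_cons, Multiset.cons_add, Multiset.cons_inj_right] at h1
    -- Before it was contracted, `y` was a conclusion distinct from those in `Γ`, so it is private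
    -- to the subnet. The links of the context use only vertices of `E` and never meet it; moving
    -- `y` leaves them unchanged.
    have hyG : (y, unit) ∈ atUnit Γ + G := by rw [← h1, hMF, hG]; simp
    have hyΓ : (y, unit) ∉ atUnit Γ := fun h' => by
      have h2 := hM'.wf.nodup
      have h3 := hM'.wf.concl_le
      rw [hcM', Multiset.singleton_add, atUnit_cons, hG, Multiset.cons_le_cons_iff] at h3
      rw [hG, nodup_cons_iff] at h2
      exact h2.1 ⟨_, Multiset.mem_of_le h3 h', rfl⟩
    have hyG' := (Multiset.mem_add.1 hyG).resolve_left hyΓ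
    rw [wide.forms, nodup_add_iff] at hnd
    exact Set.disjoint_left.1 hnd.2.2 ⟨_, mem_times hyG', rfl⟩ ⟨_, hv, h.symm⟩

/-- A box may be replaced by a box with the same conclusions. -/
theorem Simple.replace_box {N : Net d} (hN : Simple N) {L : Multiset (Link (Con d) × Weight)}
    {b b' : Box (Con d)} {w : Weight} (hL : N.links = (Link.box b, w) ::ₘ L)
    (hout : b'.outer = b.outer) (hb : SimpleBox b → Simple (leafNet (Link.box b')))
    (hev : ∀ y ∈ Con.evars d b'.content, y ∉ Con.evars d b.content → y ∉ Net.vars N)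
    (hva : Con.vars d b'.content ⊆ Con.vars d b.content ∪ Con.evars d b'.content) :
    Simple (⟨N.forms, (Link.box b', w) ::ₘ L, N.concl⟩ : Net d) := by
  obtain ⟨S, G, E, E', ⟨hb₀, rfl⟩, hS, wide⟩ := hN.wideHole (Link.box b, w) (by simp [hL])
  have hG : G = 0 := by
    have := wide.sforms
    rw [leafNet_box] at this
    simpa using this.symm
  subst hG
  have hE : N.forms = E := by simpa using wide.forms
  have hE' : E' = L := by
    have := wide.links
    rw [hL, leafNet_box, times_singleton, Finset.union_empty, Multiset.singleton_add,
      Multiset.cons_inj_right] at this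
    exact this.symm
  subst hE'
  have hlev : lev (leafNet (Link.box b)).links = Con.evars d b.content := leafNet_box_evars b
  have hlev' : lev (leafNet (Link.box b')).links = Con.evars d b'.content := leafNet_box_evars b'
  have hvN : fvars E ∪ lvars E' ⊆ Net.vars N := by
    rw [vars_eq, hE, wide.links]
    simp only [suppW_add]
    exact Set.union_subset_union_right _ Set.subset_union_right
  -- Old eigenvariables of the contents avoid the context because the original box did; new ones do
  -- so by hypothesis.
  have hev' : Disjoint (lev (leafNet (Link.box b')).links) (fvars E ∪ lvars E') := by
    rw [hlev', Set.disjoint_left]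
    intro y hy hy'
    by_cases h : y ∈ Con.evars d b.content
    · exact Set.disjoint_left.1 wide.ev (hlev ▸ h) hy'
    · exact hev y hy h (hvN hy')
  have := wide.plug (leafNet (Link.box b')) 0 (hb hb₀) hout (by simp [leafNet_box]) (by simp)
    (by rw [leafNet_box_eigenweights]; exact Set.empty_disjoint _) hev' (by
      intro v hv hv'
      rw [leafNet_box_vars, hout] at hv'
      rw [leafNet_box_vars]
      rcases hv' with h | h
      · exact Or.inl h
      · rcases hva h with h | h
        · exact Or.inr h
        · exact absurd (Or.inr (lev_subset_lvars _ hv))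
            (Set.disjoint_left.1 hev' (by rw [hlev']; exact h)))
  rw [hE]
  simpa [leafNet_box] using this


/-! ## Absorption of a `!`-box by another box -/

/-- As `c` is a conclusion of the whole net, no later rule consumed it. The rule that introduced `c`
may be omitted and `a` carried down in its place; `hac` ensures that no eigenvariable condition is
violated on the way. -/
theorem Hole.unplug {M Q : Net d} {l : Link (Con d)} {a c : Occ} {Γ K P O : Multiset Occ}
    {F F' : Multiset (Occ × Weight)} {L L' : Multiset (Link (Con d) × Weight)}
    (hole : Hole M (Q.extend l c Γ) K P O F L) (hQ : Simple Q) (ha : Q.concl = a ::ₘ Γ)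
    (hac : a.fml.vars ⊆ c.fml.vars) {Δ : Multiset Occ} (hc : M.concl = c ::ₘ Δ)
    (hF : M.forms = (c, unit) ::ₘ F') (hL : M.links = (l, unit) ::ₘ L') :
    Simple (⟨F', L', a ::ₘ Δ⟩ : Net d) := by
  have hcP : c ∈ P := by
    have h1 : c ∈ P + O := by rw [← hole.concl_out, hc]; simp
    exact (Multiset.mem_add.1 h1).resolve_right
      (hole.not_mem_out (w := unit) (by simp [PreNet.extend]))
  obtain ⟨P, rfl⟩ := Multiset.exists_cons_of_mem hcP
  have hΓ : Γ = K + P := by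
    have := hole.concl_in
    rw [PreNet.extend, Multiset.add_cons] at this
    exact (Multiset.cons_inj_right _).1 this
  have hΔ : Δ = P + O := by
    have := hole.concl_out
    rw [hc, Multiset.cons_add] at this
    exact (Multiset.cons_inj_right _).1 this
  have hF' : F' = Q.forms + F := by
    have := hole.forms
    rw [hF, PreNet.extend, Multiset.cons_add] at this
    exact (Multiset.cons_inj_right _).1 this
  have hL' : L' = Q.links + L := by
    have := hole.links
    rw [hL, PreNet.extend, Multiset.cons_add] at this
    exact (Multiset.cons_inj_right _).1 this
  have := hole.plug Q (a ::ₘ P) hQ (by rw [ha, hΓ, Multiset.add_cons])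
    ⟨hole.ids.mono_left (by simp only [PreNet.extend, suppW_cons]; exact Set.subset_union_right),
      hole.ew.mono_left (by simp only [PreNet.extend, suppW_cons]; exact Set.subset_union_right),
      hole.ev.mono_left (by simp only [PreNet.extend, suppW_cons]; exact Set.subset_union_right),
      fun v _ hv => by rw [Net.extend_vars]; exact Or.inr hv⟩ (by
        have := hole.concl_ev
        simp only [supp_cons, Set.disjoint_union_left] at this ⊢
        exact ⟨this.1.mono_left hac, this.2⟩)
  rw [hF', hL', hΔ]
  simpa [Multiset.cons_add] using this

/-- A chain of `⊕`-links that ends in a conclusion may be removed. -/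
theorem Simple.remove_chain {t : PTree} {r x u : ℕ} {A : Formula} {FC F : Multiset (Occ × Weight)}
    {LC L : Multiset (Link (Con d) × Weight)} {Γ : Multiset Occ} (h : Chain t r x A u LC FC)
    (hM : Simple (⟨FC + F, LC + L, ⟨r, t.fml⟩ ::ₘ Γ⟩ : Net d)) :
    Simple (⟨F, L, ⟨u, A⟩ ::ₘ Γ⟩ : Net d) := by
  induction h with
  | leaf x A r => simpa [PTree.fml] using hM
  | @left s t v x u A L' F' r h ih =>
    obtain ⟨S, K, P, O, F₂, L₂, ⟨Q, Γ', B, hQ, hcQ, -, -, rfl⟩, -, hole⟩ :=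
      hM.hole (.plus₁ ⟨v, s.fml⟩ ⟨r, (PTree.node s t).fml⟩) (by simp)
    exact ih (hole.unplug hQ hcQ (fun _ h => Or.inl h) rfl (by simp [Multiset.cons_add])
      (by simp [Multiset.cons_add]))
  | @right s t v x u A L' F' r h ih =>
    obtain ⟨S, K, P, O, F₂, L₂, ⟨Q, Γ', B, hQ, hcQ, -, -, rfl⟩, -, hole⟩ :=
      hM.hole (.plus₂ ⟨v, t.fml⟩ ⟨r, (PTree.node s t).fml⟩) (by simp)
    exact ih (hole.unplug hQ hcQ (fun _ h => Or.inr h) rfl (by simp [Multiset.cons_add])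
      (by simp [Multiset.cons_add]))

/-- The conclusions inside a box that correspond to general plus-formulas. -/
def roots (aux : Multiset (ℕ × PTree)) : Multiset Occ := aux.map fun q => ⟨q.1, q.2.fml⟩

/-- The auxiliary doors for general plus-formulas. -/
def doors (aux : Multiset (ℕ × PTree)) : Multiset Occ :=
  aux.bind fun q => (q.2.doors : Multiset Occ)

@[simp] theorem roots_cons (q : ℕ × PTree) (aux : Multiset (ℕ × PTree)) :
    roots (q ::ₘ aux) = ⟨q.1, q.2.fml⟩ ::ₘ roots aux := by simp [roots]
@[simp] theorem doors_zero : doors 0 = 0 := by simp [doors]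
@[simp] theorem doors_cons (q : ℕ × PTree) (aux : Multiset (ℕ × PTree)) :
    doors (q ::ₘ aux) = q.2.doors + doors aux := by simp [doors]

/-- The new doors, for the old doors `ds`, that come from copies. -/
def newDoors (cs : List (Copy d)) (ds : Multiset Occ) : Multiset Occ :=
  (cs : Multiset (Copy d)).bind fun q => ds.map fun z => ⟨q.door z.id, z.fml⟩

@[simp] theorem newDoors_nil (ds : Multiset Occ) : newDoors ([] : List (Copy d)) ds = 0 := by
  simp [newDoors]
@[simp] theorem newDoors_cons (q : Copy d) (cs : List (Copy d)) (ds : Multiset Occ) :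
    newDoors (q :: cs) ds = (ds.map fun z => ⟨q.door z.id, z.fml⟩) + newDoors cs ds := by
  rw [newDoors, ← Multiset.cons_coe, Multiset.cons_bind]; rfl
@[simp] theorem newDoors_append (cs cs' : List (Copy d)) (ds : Multiset Occ) :
    newDoors (cs ++ cs') ds = newDoors cs ds + newDoors cs' ds := by
  rw [newDoors, ← Multiset.coe_add, Multiset.add_bind]; rfl

theorem newDoors_doors (q : Copy d) (t : PTree) :
    ((t.map q.door var).doors : Multiset Occ) =
      (t.doors : Multiset Occ).map fun z => ⟨q.door z.id, z.fml⟩ := by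
  rw [PTree.map_doors, ← Multiset.map_coe]
  refine Multiset.map_congr rfl fun z _ => ?_
  simp [Occ.map, Fm.fsub_var]

/-- The eigenvariables of copies. -/
def copyEvars (cs : List (Copy d)) : Set ℕ := {x | ∃ q ∈ cs, x ∈ Net.evars q.net}

@[simp] theorem copyEvars_nil : copyEvars ([] : List (Copy d)) = ∅ := by ext; simp [copyEvars]
@[simp] theorem copyEvars_cons (q : Copy d) (cs : List (Copy d)) :
    copyEvars (q :: cs) = Net.evars q.net ∪ copyEvars cs := by ext; simp [copyEvars]
@[simp] theorem copyEvars_append (cs cs' : List (Copy d)) :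
    copyEvars (cs ++ cs') = copyEvars cs ∪ copyEvars cs' := by
  ext; simp [copyEvars, or_and_right, exists_or]

/-- A copy of a net, with fresh eigenvariables. -/
theorem Simple.copy {Θ₀ : Net d} (h : Simple Θ₀) (i w e : Equiv.Perm ℕ)
    (hfix : ∀ y ∈ Net.vars Θ₀, y ∉ Net.evars Θ₀ → e y = y) :
    Simple (Θ₀.map i w e fun y => var (e y)) ∧
      (Θ₀.map i w e fun y => var (e y)).concl = Θ₀.concl.map (fun o => ⟨i o.id, o.fml⟩) ∧
        Net.vars (Θ₀.map i w e fun y => var (e y)) ⊆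
          Net.vars Θ₀ ∪ Net.evars (Θ₀.map i w e fun y => var (e y)) := by
  refine ⟨h.map i w e _ i.injective.injOn w.injective.injOn fun x _ =>
    ⟨rfl, fun y _ hyx hxy => hyx (e.injective hxy).symm⟩, ?_, ?_⟩
  · rw [Net.map_eq]
    refine Multiset.map_congr rfl fun o ho => ?_
    simp only [Occ.map, Occ.mk.injEq, true_and]
    -- The conclusions contain no eigenvariables, and `e` fixes all other variables of the net; so a
    -- copy has the same formulas as conclusions.
    refine Fm.fsub_eq_self fun y hy => ?_
    rw [hfix y (Or.inl (h.wf.conclVars_subset ⟨o, ho, hy⟩))]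
    exact fun hy' => Set.disjoint_left.1 h.wf.concl_ev ⟨o, ho, hy⟩ hy'
  · refine (Net.map_vars _ _ _ _ Θ₀).trans (Set.union_subset ?_ ?_)
    · rintro x ⟨y, hy, hx⟩
      obtain rfl : x = e y := hx
      by_cases hy' : y ∈ Net.evars Θ₀
      · right; rw [Net.map_evars]; exact ⟨y, hy', rfl⟩
      · left; rw [hfix y hy hy']; exact hy
    · rw [← Net.map_evars]; exact Set.subset_union_right

/-- The properties of the contents of a box that has absorbed a `!`-box. -/
theorem Absorb.simple {Θ₀ Θ Θ' : Net d} {r₀ : ℕ} {t₀ : PTree} {a₀ : Occ}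
    {aux aux' : Multiset (ℕ × PTree)} {X W : Multiset Occ} {cs : List (Copy d)}
    (h : Absorb Θ₀ r₀ t₀ a₀ Θ aux X Θ' aux' W cs) (h₀ : Simple Θ₀)
    (hc₀ : Θ₀.concl = {⟨r₀, t₀.fml⟩, a₀}) (hΘ : Simple Θ)
    (hev₀ : Disjoint (Net.evars Θ) (Net.vars Θ₀)) {R : Multiset Occ}
    (hc : Θ.concl = roots aux + R) (hX : ∀ x ∈ X, x.fml = Fm.quest a₀.fml.neg)
    (hcs : Disjoint (copyEvars cs) (Net.vars Θ)) (hcs₀ : Disjoint (copyEvars cs) (Net.vars Θ₀))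
    (hpw : cs.Pairwise fun q q' => Disjoint (Net.evars q.net) (Net.evars q'.net)) :
    Simple Θ' ∧ Θ'.concl = roots aux' + R ∧ Multiset.card aux' = Multiset.card aux ∧
      (∃ Rd, doors aux = X + W + Rd ∧ doors aux' = Rd + newDoors cs t₀.doors) ∧
      Net.evars Θ' ⊆ Net.evars Θ ∪ copyEvars cs ∧
      Net.vars Θ' ⊆ Net.vars Θ ∪ Net.vars Θ₀ ∪ copyEvars cs := by
  -- The head of `aux` is treated after its tail; until then its root counts among the untouched
  -- conclusions `R`. `Rd` collects the old doors that survive.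
  induction h generalizing R with
  | nil =>
    exact ⟨hΘ, hc, rfl, ⟨0, by simp, by simp⟩, Set.subset_union_left,
      fun x hx => Or.inl (Or.inl hx)⟩
  | @keep Θ' aux aux' X W cs r t h ih =>
    obtain ⟨h1, h2, h3, ⟨Rd, h4, h5⟩, h6, h7⟩ := ih (R := ⟨r, t.fml⟩ ::ₘ R)
      (by rw [hc, roots_cons, Multiset.cons_add, Multiset.add_cons]) hX hcs hcs₀ hpw
    refine ⟨h1, by rw [h2, roots_cons, Multiset.cons_add, Multiset.add_cons],
      by simp [h3], ⟨t.doors + Rd, ?_, ?_⟩, h6, h7⟩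
    · rw [doors_cons, h4]; abel
    · rw [doors_cons, h5, add_assoc]
  | @fake aux aux' X W cs F FC L LC Γ J V r t x u A h hchain hJ hdoors ih =>
    obtain ⟨h1, h2, h3, ⟨Rd, h4, h5⟩, h6, h7⟩ := ih (R := ⟨r, t.fml⟩ ::ₘ R)
      (by rw [hc, roots_cons, Multiset.cons_add, Multiset.add_cons])
      (fun x hx => hX x (Multiset.mem_add.2 (Or.inr hx))) hcs hcs₀ hpw
    rw [Multiset.add_cons, Multiset.cons_inj_right] at h2
    refine ⟨h1.remove_chain hchain, ?_, by simp [h3], ⟨⟨x, Fm.quest A⟩ ::ₘ Rd, ?_, ?_⟩,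
      Set.Subset.trans ?_ h6, Set.Subset.trans ?_ h7⟩
    · simp only [h2, roots_cons, PTree.fml, Multiset.cons_add]
    · rw [doors_cons, h4]
      simp only [hdoors, ← Multiset.singleton_add]; abel
    · rw [doors_cons, h5]
      simp only [PTree.doors, ← Multiset.singleton_add, Multiset.coe_singleton]; abel
    · simp only [evars_eq, suppW_add]; exact Set.subset_union_right
    · simp only [vars_eq, suppW_add]
      exact Set.union_subset_union Set.subset_union_right Set.subset_union_right
  | @nonfake Θc aux aux' X W cs F FC L LC Γ J V r t x u A door i w e h hchain hdoors hcopy hfix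
      hid hew ih =>
    rw [List.pairwise_cons] at hpw
    rw [copyEvars_cons, Set.disjoint_union_left] at hcs hcs₀
    obtain ⟨h1, h2, h3, ⟨Rd, h4, h5⟩, h6, h7⟩ := ih (R := ⟨r, t.fml⟩ ::ₘ R)
      (by rw [hc, roots_cons, Multiset.cons_add, Multiset.add_cons])
      (fun x hx => hX x (Multiset.mem_add.2 (Or.inr hx))) hcs.2 hcs₀.2 hpw.2
    rw [Multiset.add_cons, Multiset.cons_inj_right] at h2
    -- A cut door carries the dual of the principal formula of the `!`-box, so the leaf at the start
    -- of a non-fake chain is dual to the conclusion `a₀` of a copy.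
    have hA : A = a₀.fml.neg :=
      Fm.quest.inj (hX ⟨x, Fm.quest A⟩ (by simp))
    obtain ⟨hsc, hcc, hvc⟩ := h₀.copy i w e hfix
    rw [← hcopy] at hsc hcc hvc
    have hpd : Disjoint (copyEvars cs) (Net.evars Θc) :=
      Set.disjoint_left.2 fun y ⟨q, hq, hy⟩ hy' => Set.disjoint_left.1 (hpw.1 q hq) hy' hy
    have hM := h1.remove_chain hchain
    have hME : Net.evars (⟨F, L, ⟨u, A⟩ ::ₘ Γ⟩ : Net d) ⊆ Net.evars Θ ∪ copyEvars cs := by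
      refine Set.Subset.trans ?_ h6
      simp only [evars_eq, suppW_add]; exact Set.subset_union_right
    have hMV : Net.vars (⟨F, L, ⟨u, A⟩ ::ₘ Γ⟩ : Net d) ⊆
        Net.vars Θ ∪ Net.vars Θ₀ ∪ copyEvars cs := by
      refine Set.Subset.trans ?_ h7
      simp only [vars_eq, suppW_add]
      exact Set.union_subset_union Set.subset_union_right Set.subset_union_right
    -- The copied net has only old variables of `Θ₀` and its own eigenvariables, which are fresh for
    -- `Θ`, for `Θ₀` and for the copies already inserted; the old variables of `Θ₀` avoid the
    -- eigenvariables of `Θ` by `hev₀`.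
    have hap : Net.Apart (⟨F, L, ⟨u, A⟩ ::ₘ Γ⟩ : Net d) Θc := by
      refine ⟨hid.symm.mono_left ?_, hew.symm.mono_left ?_, ?_, ?_⟩
      · simp only [ids_eq, suppW_add]; exact Set.subset_union_right
      · simp only [eigenweights_eq, suppW_add]; exact Set.subset_union_right
      · refine Disjoint.mono hME hvc ?_
        simp only [Set.disjoint_union_left, Set.disjoint_union_right]
        exact ⟨⟨hev₀, hcs₀.2⟩, (hcs.1.mono_right (Net.evars_subset_vars Θ)).symm, hpd⟩
      · refine Disjoint.mono_left hMV ?_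
        simp only [Set.disjoint_union_left]
        exact ⟨⟨hcs.1.symm, hcs₀.1.symm⟩, hpd⟩
    have hS := Simple.cut ⟨u, A⟩ ⟨i a₀.id, a₀.fml⟩ hM hsc hap rfl
      (Δ := {⟨i r₀, t₀.fml⟩}) (by
        rw [hcc, hc₀]
        simp only [Multiset.insert_eq_cons, Multiset.map_cons, Multiset.map_singleton]
        exact Multiset.cons_swap _ _ _) (by simp only [hA, Fm.neg_neg])
    refine ⟨?_, ?_, by simp [h3], ⟨Rd, ?_, ?_⟩, ?_, ?_⟩
    · convert hS using 2
      rw [add_comm, Multiset.singleton_add]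
    · simp only [h2, roots_cons, PTree.map_fml, Fm.fsub_var, Multiset.cons_add]
    · rw [doors_cons, h4]
      simp only [hdoors]; abel
    · rw [doors_cons, h5, newDoors_cons]
      rw [newDoors_doors ⟨door, Θc⟩ t₀]
      abel
    · rw [copyEvars_cons]
      simp only [evars_eq, suppW_add, suppW_cons, Link.evars, Set.empty_union] at hME ⊢
      intro y hy
      have := @hME y
      simp only [Set.mem_union] at hy this ⊢
      tauto
    · rw [copyEvars_cons]
      intro y hy
      have h8 := @hMV y
      have h9 := @hvc y
      simp only [vars_eq, evars_eq, suppW_add, suppW_cons, Link.vars, Set.empty_union,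
        Set.mem_union] at hy h8 h9 ⊢
      grind


/-! ### Exchanging the absorbing boxes within a net -/

theorem Multiset.le_of_add_eq_add {α : Type*} [DecidableEq α] {X Δ P O : Multiset α}
    (h : X + Δ = P + O) (hX : ∀ a ∈ X, a ∉ O) : X ≤ P := by
  refine Multiset.le_iff_count.2 fun a => ?_
  by_cases ha : a ∈ X
  · have h1 := congrArg (Multiset.count a) h
    simp only [Multiset.count_add, Multiset.count_eq_zero_of_notMem (hX a ha)] at h1
    omega
  · simp [Multiset.count_eq_zero_of_notMem ha]

/-- A box `b` may be replaced by a box `b'` if the doors `X` of `b` that disappear are conclusions of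
the net and the doors `W` that disappear are introduced by weakening. -/
theorem Simple.exchange_box {T : Net d} (hT : Simple T) {b b' : Box (Con d)}
    {X W R Y Δ : Multiset Occ} {G : Multiset (Occ × Weight)} {L : Multiset (Link (Con d) × Weight)}
    {E V : Set ℕ} (hc : T.concl = X + Δ) (hF : T.forms = atUnit X + G)
    (hL : T.links = (Link.box b, unit) ::ₘ L) (h₁ : b.outer = X + W + R) (h₂ : b'.outer = R + Y)
    (hb : SimpleBox b → (b'.outer.map Occ.id).Nodup → Simple (leafNet (Link.box b')))
    (hW : ∀ o ∈ W, ∃ A, o.fml = Fm.quest A) (hYn : (Y.map Occ.id).Nodup)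
    (hY : Disjoint (supp oid Y) T.ids)
    (hev : Con.evars d b'.content ⊆ Con.evars d b.content ∪ E) (hE : Disjoint E (Net.vars T))
    (hva : Con.vars d b'.content ⊆ Con.vars d b.content ∪ V) (hYV : supp ovar Y ⊆ V)
    (hV : Disjoint V (Net.evars T)) :
    Simple (⟨atUnit Y + G, (Link.box b', unit) ::ₘ (atUnit (W.map Link.weak) + L),
      Y + Δ⟩ : Net d) := by
  obtain ⟨S, K, P, O, F₂, L₂, ⟨hb₀, rfl⟩, hS, hole⟩ := hT.hole (.box b) (by simp [hL])
  have hL₂ : L = L₂ := by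
    have := hole.links
    rw [hL, leafNet_box, Multiset.singleton_add, Multiset.cons_inj_right] at this
    exact this
  have hG : G = atUnit W + atUnit R + F₂ := by
    have := hole.forms
    rw [hF, leafNet_box, h₁, atUnit_add, atUnit_add, add_assoc, add_assoc, add_right_inj] at this
    rw [this, add_assoc]
  -- The doors `X` are conclusions of `T` and vertices of the box, so the context around the box
  -- keeps them all.
  have hXP : X ≤ P := Multiset.le_of_add_eq_add (hc.symm.trans hole.concl_out) fun a ha =>
    hole.not_mem_out (w := unit) (mem_atUnit.2 ⟨by
      change a ∈ b.outer
      rw [h₁]; simp [ha], rfl⟩)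
  obtain ⟨P, rfl⟩ := Multiset.le_iff_exists_add.1 hXP
  have hΔ : Δ = P + O := by
    have := hc.symm.trans hole.concl_out
    rwa [add_assoc, add_right_inj] at this
  have hK : W + R = K + P := by
    have : b.outer = K + (X + P) := hole.concl_in
    rw [h₁, add_assoc, add_left_comm K, add_right_inj] at this
    exact this
  have hnd := hT.wf.nodup
  rw [hF, hG, nodup_add_iff, nodup_add_iff, nodup_add_iff] at hnd
  obtain ⟨-, ⟨⟨hWn, hRn, hWR⟩, -, -⟩, -⟩ := hnd
  have hTid : fids T.forms = supp oid X ∪ (supp oid W ∪ supp oid R ∪ fids F₂) := by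
    rw [hF, hG]; simp only [suppW_add, suppW_atUnit]
  rw [ids_eq, hTid] at hY
  simp only [Set.disjoint_union_right] at hY
  have hn' : (b'.outer.map Occ.id).Nodup := by
    have h3 : ((atUnit R + atUnit Y).map fun f => f.1.id).Nodup := by
      rw [nodup_add_iff]
      refine ⟨hRn, by simpa [atUnit] using hYn, ?_⟩
      simpa only [suppW_atUnit] using hY.2.1.2.symm
    rw [h₂]
    rw [← atUnit_add] at h3
    simpa [atUnit] using h3
  -- Weakening directly below the new box restores `W`, which the context may consume.
  have hW' : Simple (weakNet W (leafNet (Link.box b'))) := by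
    refine (hb hb₀ hn').weaken hW (by simpa [atUnit] using hWn) ?_ ?_
    · rw [ids_eq, leafNet_box, h₂]
      simp only [suppW_atUnit, supp_add, Set.disjoint_union_right] at hWR ⊢
      exact ⟨hWR, hY.2.1.1.symm⟩
    · rw [leafNet_box_evars]
      have h3 : supp ovar W ⊆ Net.vars T := by
        rw [vars_eq, hF, hG]; simp only [suppW_add, suppW_atUnit]
        intro n; simp +contextual only [Set.mem_union, true_or, or_true, or_imp, implies_true, and_self]
      refine Disjoint.mono_right hev ?_
      rw [Set.disjoint_union_right]
      refine ⟨?_, (hE.mono_right h3).symm⟩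
      have h4 := hS.wf.concl_ev
      rw [← evars_eq, leafNet_box_evars] at h4
      refine h4.mono_left ?_
      change _ ⊆ supp ovar b.outer
      rw [h₁]; simp only [supp_add]
      intro n; simp +contextual only [Set.mem_union, true_or, or_true, or_imp, implies_true, and_self]
  have hF₂ : fvars F₂ ∪ lvars L₂ ⊆ Net.vars T := by
    rw [vars_eq, hF, hG, hL, hL₂]; simp only [suppW_add, suppW_cons]
    intro n; simp +contextual only [Set.mem_union, true_or, or_true, or_imp, implies_true, and_self]
  have hL₂ev : lev L₂ ⊆ Net.evars T := by
    rw [evars_eq, hL, hL₂]; simp only [suppW_cons]; exact Set.subset_union_right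
  -- The context kept `X + P` and now keeps `P + Y`: the cut doors are exchanged for the new ones
  -- without touching the rules below.
  have := hole.plug (weakNet W (leafNet (Link.box b'))) (P + Y) hW' (by
      change W + b'.outer = _
      rw [h₂, ← add_assoc, hK, add_assoc])
    ⟨by
      have := hole.ids
      rw [← ids_eq, weakNet_ids, ids_eq]
      simp only [leafNet_box, h₁, h₂, suppW_atUnit, supp_add, Set.disjoint_union_left] at this ⊢
      exact ⟨this.1.2, this.2, hY.2.2⟩, by
      rw [← eigenweights_eq, weakNet_eigenweights, eigenweights_eq, leafNet_box_eigenweights]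
      exact Set.empty_disjoint _, by
      rw [← evars_eq, weakNet_evars, leafNet_box_evars]
      refine Disjoint.mono_left hev ?_
      rw [Set.disjoint_union_left]
      refine ⟨?_, hE.mono_right hF₂⟩
      have := hole.ev
      rwa [← evars_eq, leafNet_box_evars] at this, by
      intro v hv hv'
      have hvV : v ∉ V := fun h => Set.disjoint_left.1 hV h (hL₂ev hv)
      rw [weakNet_vars, leafNet_box_vars, h₂] at hv'
      rw [leafNet_box_vars, h₁]
      simp only [supp_add, Set.mem_union] at hv' ⊢
      have h3 := @hva v
      have h4 := @hYV v
      simp only [Set.mem_union] at h3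
      grind⟩ (by
      have := hole.concl_ev
      simp only [supp_add, Set.disjoint_union_left] at this ⊢
      exact ⟨this.2, hV.mono hYV hL₂ev⟩)
  rw [hL₂, hG, hΔ]
  convert this using 2
  · simp only [weakNet, leafNet_box, h₂, atUnit_add]; abel
  · simp only [weakNet, leafNet_box, ← Multiset.singleton_add]; abel
  · abel

theorem exchange_box_subset {T : Net d} {b b' : Box (Con d)} {X W Y Γ : Multiset Occ}
    {G : Multiset (Occ × Weight)} {L : Multiset (Link (Con d) × Weight)} {E V : Set ℕ}
    (hF : T.forms = atUnit X + G) (hL : T.links = (Link.box b, unit) ::ₘ L)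
    (hev : Con.evars d b'.content ⊆ Con.evars d b.content ∪ E)
    (hva : Con.vars d b'.content ⊆ Con.vars d b.content ∪ V) (hYV : supp ovar Y ⊆ V) :
    Net.evars (⟨atUnit Y + G, (Link.box b', unit) ::ₘ (atUnit (W.map Link.weak) + L), Γ⟩ : Net d) ⊆
        Net.evars T ∪ E ∧
      Net.vars (⟨atUnit Y + G, (Link.box b', unit) ::ₘ (atUnit (W.map Link.weak) + L), Γ⟩ : Net d) ⊆
        Net.vars T ∪ V := by
  simp only [evars_eq, vars_eq, hF, hL, suppW_cons, suppW_add, suppW_atUnit, supp_weak, Link.evars,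
    Link.vars, Set.empty_union]
  constructor
  · intro x; have := @hev x; simp only [Set.mem_union] at *; tauto
  · intro x; have := @hva x; have := @hYV x; simp only [Set.mem_union] at *; tauto

theorem Absorb.le_doors {Θ₀ Θ Θ' : Net d} {r₀ : ℕ} {t₀ : PTree} {a₀ : Occ}
    {aux aux' : Multiset (ℕ × PTree)} {X W : Multiset Occ} {cs : List (Copy d)}
    (h : Absorb Θ₀ r₀ t₀ a₀ Θ aux X Θ' aux' W cs) : X + W ≤ doors aux := by
  induction h with
  | nil => simp
  | keep r t h ih => rw [doors_cons]; exact ih.trans (Multiset.le_add_left _ _)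
  | fake r t x u A h hchain hJ hdoors ih =>
    rw [doors_cons, hdoors, add_add_add_comm, Multiset.add_cons]
    exact add_le_add (Multiset.le_cons_self _ _) ih
  | nonfake r t x u A door i w e h hchain hdoors hcopy hfix hid hew ih =>
    rw [doors_cons, hdoors, add_add_add_comm]
    exact add_le_add_right ih _

theorem Box.outer_eq {β : Type} (k : Kind) (N : β) (aux : Multiset (ℕ × PTree))
    (main : Multiset (Occ × ℕ)) : Box.outer ⟨k, N, aux, main⟩ =
      doors aux + main.map fun q => ⟨q.2, k.app q.1.fml⟩ := rfl

theorem supp_newDoors (cs : List (Copy d)) (t : PTree) :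
    supp ovar (newDoors cs t.doors) ⊆ t.fml.vars := by
  rw [← PTree.supp_doors]
  induction cs with
  | nil => simp
  | cons q cs ih =>
    rw [newDoors_cons, supp_add]
    refine Set.union_subset ?_ ih
    rintro x ⟨o, ho, hx⟩
    obtain ⟨o', ho', rfl⟩ := Multiset.mem_map.1 ho
    exact ⟨o', ho', hx⟩

/-- The other links form the context of this box, and their conclusions lie on vertices of the
context. -/
theorem Simple.box_disjoint {T : Net d} (hT : Simple T) {b b' : Box (Con d)} {w : Weight}
    {L : Multiset (Link (Con d) × Weight)} (hL : T.links = (Link.box b, unit) ::ₘ L)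
    (hb : (Link.box b', w) ∈ L) : ∀ o ∈ b.outer, o ∉ b'.outer := by
  obtain ⟨S, K, P, O, F₂, L₂, ⟨hb₀, rfl⟩, hS, hole⟩ := hT.hole (.box b) (by simp [hL])
  have hL₂ : L = L₂ := by
    have := hole.links
    rw [hL, leafNet_box, Multiset.singleton_add, Multiset.cons_inj_right] at this
    exact this
  intro o ho ho'
  obtain ⟨v, hv⟩ := hole.concls (.box b', w) (hL₂ ▸ hb) o ho'
  exact Set.disjoint_left.1 hole.ids ⟨(o, unit), mem_atUnit.2 ⟨ho, rfl⟩, rfl⟩ ⟨_, hv, rfl⟩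

theorem Multiset.map_fst_rename (main : Multiset (Occ × ℕ)) (j : ℕ → ℕ) :
    (main.map fun q => ((⟨q.1.id, q.1.fml.fsub var⟩ : Occ), j q.2)).map Prod.fst =
      main.map Prod.fst := by
  rw [Multiset.map_map]
  refine Multiset.map_congr rfl fun q _ => ?_
  simp [Fm.fsub_var]

/-- A box of weight `1` may absorb a `!`-box if the new doors are fresh. -/
theorem Absorb.exchange {Θ₀ Θ Θ' : Net d} {r₀ : ℕ} {t₀ : PTree} {a₀ : Occ}
    {aux aux' : Multiset (ℕ × PTree)} {X W : Multiset Occ} {cs : List (Copy d)}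
    (h : Absorb Θ₀ r₀ t₀ a₀ Θ aux X Θ' aux' W cs) (h₀ : Simple Θ₀)
    (hc₀ : Θ₀.concl = {⟨r₀, t₀.fml⟩, a₀}) {k : Kind} {main : Multiset (Occ × ℕ)} {T : Net (d + 1)}
    (hT : Simple T) {Δ : Multiset Occ} {G : Multiset (Occ × Weight)}
    {L : Multiset (Link (Con (d + 1)) × Weight)} (hc : T.concl = X + Δ)
    (hF : T.forms = atUnit X + G) (hL : T.links = (Link.box ⟨k, Θ, aux, main⟩, unit) ::ₘ L)
    (hX : ∀ x ∈ X, x.fml = Fm.quest a₀.fml.neg) (hev₀ : Disjoint (Net.evars T) (Net.vars Θ₀))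
    (hcs : Disjoint (copyEvars cs) (Net.vars T)) (hcs₀ : Disjoint (copyEvars cs) (Net.vars Θ₀))
    (hpw : cs.Pairwise fun q q' => Disjoint (Net.evars q.net) (Net.evars q'.net)) {j : ℕ → ℕ}
    (hj : ∀ o ∈ Box.outer (⟨k, Θ, aux, main⟩ : Box (Con (d + 1))), o ∉ X → j o.id = o.id)
    (hYn : (((newDoors cs t₀.doors).map (Occ.map j var)).map Occ.id).Nodup)
    (hY : Disjoint (supp oid ((newDoors cs t₀.doors).map (Occ.map j var))) T.ids) :
    ∃ T' : Net (d + 1), Simple T' ∧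
      T'.forms = atUnit ((newDoors cs t₀.doors).map (Occ.map j var)) + G ∧
      T'.links = (Link.box (Box.map j var id (⟨k, Θ', aux', main⟩ : Box (Con (d + 1)))), unit) ::ₘ
        (atUnit (W.map Link.weak) + L) ∧
      T'.concl = (newDoors cs t₀.doors).map (Occ.map j var) + Δ ∧
      Net.evars T' ⊆ Net.evars T ∪ copyEvars cs ∧
      Net.vars T' ⊆ Net.vars T ∪ Net.vars Θ₀ ∪ copyEvars cs := by
  have hbT : (Link.box ⟨k, Θ, aux, main⟩, unit) ∈ T.links :=
    hL ▸ Multiset.mem_cons_self _ _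
  have hb := hT.boxes _ _ hbT
  have heT : Net.evars Θ ⊆ Net.evars T := fun x hx => ⟨_, hbT, hx⟩
  have hvT : Net.vars Θ ⊆ Net.vars T := fun x hx => Or.inr ⟨_, hbT, hx⟩
  cases hb with | mk _ _ _ hΘ hΘc hk hnd => ?_
  obtain ⟨h1, h2, h3, ⟨R, h4, h5⟩, h6, h7⟩ := h.simple h₀ hc₀ hΘ (hev₀.mono_left heT) hΘc hX
    (hcs.mono_right hvT) hcs₀ hpw
  have hout := Box.outer_eq k Θ aux main
  -- Surviving doors are doors of the old box outside `X`, so `j` does not move them; only doors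
  -- from copies are displaced.
  have hfix : ∀ o ∈ R + main.map (fun q => ⟨q.2, k.app q.1.fml⟩), o.map j var = o := by
    intro o ho
    refine Occ.rename_self (hj o ?_ ?_)
    · change o ∈ Box.outer ⟨k, Θ, aux, main⟩
      rw [hout, h4, add_assoc]
      exact Multiset.mem_add.2 (Or.inr ho)
    · intro hoX
      replace hnd : ((Box.outer ⟨k, Θ, aux, main⟩).map Occ.id).Nodup := hnd
      rw [hout, h4, add_assoc, add_assoc, Multiset.map_add, Multiset.nodup_add] at hnd
      exact Multiset.disjoint_left.1 hnd.2.2 (Multiset.mem_map_of_mem _ hoX)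
        (Multiset.mem_map_of_mem _ (Multiset.mem_add.2 (Or.inr ho)))
  have hout' : (Box.map j var id (⟨k, Θ', aux', main⟩ : Box (Con (d + 1)))).outer =
      (R + main.map (fun q => ⟨q.2, k.app q.1.fml⟩)) +
        (newDoors cs t₀.doors).map (Occ.map j var) := by
    refine (Box.map_outer j var id _).trans ?_
    refine (congrArg _ (Box.outer_eq k Θ' aux' main)).trans ?_
    rw [h5, add_right_comm, Multiset.map_add, Multiset.map_congr rfl hfix, Multiset.map_id']
  have hdT : Disjoint (Net.evars T) (Net.vars Θ₀ ∪ copyEvars cs) :=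
    Set.disjoint_union_right.2 ⟨hev₀, (hcs.mono_right (Net.evars_subset_vars T)).symm⟩
  have hva : Net.vars Θ' ⊆ Net.vars Θ ∪ (Net.vars Θ₀ ∪ copyEvars cs) := by
    rw [← Set.union_assoc]; exact h7
  have hYV : supp ovar ((newDoors cs t₀.doors).map (Occ.map j var)) ⊆
      Net.vars Θ₀ ∪ copyEvars cs := by
    rintro x ⟨o, ho, hx⟩
    obtain ⟨o', ho', rfl⟩ := Multiset.mem_map.1 ho
    left
    have h8 : x ∈ ovar o' := by simpa [ovar, Occ.map, Fm.fsub_var] using hx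
    refine Or.inl (h₀.wf.conclVars_subset (hc₀ ▸ ?_))
    exact ⟨⟨r₀, t₀.fml⟩, by simp, supp_newDoors cs t₀ ⟨o', ho', h8⟩⟩
  refine ⟨_, hT.exchange_box (E := copyEvars cs) (V := Net.vars Θ₀ ∪ copyEvars cs)
    (b' := Box.map j var id (⟨k, Θ', aux', main⟩ : Box (Con (d + 1)))) hc hF hL (W := W)
    (R := R + main.map (fun q => ⟨q.2, k.app q.1.fml⟩)) (hout.trans (by rw [h4]; abel))
    hout' ?_ ?_ hYn hY h6 hcs hva hYV hdT.symm, rfl, rfl, rfl, ?_⟩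
  · intro _ hn
    refine Simple.box k _ _ h1 ?_ ?_ hn
    · refine h2.trans ?_
      refine congrArg₂ (· + ·) ?_ (Multiset.map_fst_rename main j).symm
      simp [roots, PTree.map_fml, Fm.fsub_var]
    · intro h
      obtain ⟨ha, hm⟩ := hk h
      exact ⟨by rw [Multiset.card_map, h3, ha], by rw [Multiset.card_map, hm]⟩
  · intro o ho
    have : o ∈ doors aux := by rw [h4]; simp [ho]
    obtain ⟨q, -, hq⟩ := Multiset.mem_bind.1 this
    exact PTree.exists_quest hq
  · rw [Set.union_assoc]
    exact exchange_box_subset hF hL h6 hva hYV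

theorem AbsorbAll.le_outer {Θ₀ : Net d} {r₀ : ℕ} {t₀ : PTree} {a₀ : Occ}
    {bs bs' : List (Box (Con (d + 1)))} {xs W : Multiset Occ} {cs : List (Copy d)}
    (h : AbsorbAll Θ₀ r₀ t₀ a₀ bs xs bs' W cs) : ∀ x ∈ xs + W, ∃ b ∈ bs, x ∈ b.outer := by
  induction h with
  | nil => simp
  | @cons bs bs' Xs Ws X W css cs Θ Θ' aux aux' k main h hb hX ih =>
    intro x hx
    rw [add_add_add_comm] at hx
    rcases Multiset.mem_add.1 hx with hx | hx
    · exact ⟨_, List.mem_cons_self, Multiset.mem_add.2 (Or.inl (Multiset.mem_of_le hb.le_doors hx))⟩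
    · obtain ⟨b, hb, hxb⟩ := ih x hx
      exact ⟨b, List.mem_cons_of_mem _ hb, hxb⟩

/-- Boxes of weight `1` may absorb a `!`-box if the new doors are fresh. -/
theorem AbsorbAll.exchange {Θ₀ : Net d} {r₀ : ℕ} {t₀ : PTree} {a₀ : Occ}
    {bs bs' : List (Box (Con (d + 1)))} {xs W : Multiset Occ} {cs : List (Copy d)}
    (h : AbsorbAll Θ₀ r₀ t₀ a₀ bs xs bs' W cs) (h₀ : Simple Θ₀)
    (hc₀ : Θ₀.concl = {⟨r₀, t₀.fml⟩, a₀}) {T : Net (d + 1)}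
    (hT : Simple T) {Δ : Multiset Occ} {G : Multiset (Occ × Weight)}
    {L : Multiset (Link (Con (d + 1)) × Weight)} (hc : T.concl = xs + Δ)
    (hF : T.forms = atUnit xs + G)
    (hL : T.links = atUnit ((bs : Multiset (Box (Con (d + 1)))).map Link.box) + L)
    (hX : ∀ x ∈ xs, x.fml = Fm.quest a₀.fml.neg) (hev₀ : Disjoint (Net.evars T) (Net.vars Θ₀))
    (hcs : Disjoint (copyEvars cs) (Net.vars T)) (hcs₀ : Disjoint (copyEvars cs) (Net.vars Θ₀))
    (hpw : cs.Pairwise fun q q' => Disjoint (Net.evars q.net) (Net.evars q'.net)) {j : ℕ → ℕ}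
    (hj : ∀ b ∈ bs, ∀ o ∈ b.outer, o ∉ xs → j o.id = o.id)
    (hYn : (((newDoors cs t₀.doors).map (Occ.map j var)).map Occ.id).Nodup)
    (hY : Disjoint (supp oid ((newDoors cs t₀.doors).map (Occ.map j var))) T.ids) :
    ∃ T' : Net (d + 1), Simple T' ∧
      T'.forms = atUnit ((newDoors cs t₀.doors).map (Occ.map j var)) + G ∧
      T'.links = atUnit ((bs' : Multiset (Box (Con (d + 1)))).map
        (fun b => Link.box (b.map j var id))) + atUnit (W.map Link.weak) + L ∧
      T'.concl = (newDoors cs t₀.doors).map (Occ.map j var) + Δ ∧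
      Net.evars T' ⊆ Net.evars T ∪ copyEvars cs ∧
      Net.vars T' ⊆ Net.vars T ∪ Net.vars Θ₀ ∪ copyEvars cs := by
  induction h generalizing T Δ G L with
  | nil =>
    exact ⟨T, hT, by simpa using hF, by simpa using hL, by simpa using hc, Set.subset_union_left,
      fun x hx => Or.inl (Or.inl hx)⟩
  | @cons bs bs' Xs Ws X W css cs Θ Θ' aux aux' k main hAll hb hX0 ih =>
    rw [copyEvars_append, Set.disjoint_union_left] at hcs hcs₀
    rw [List.pairwise_append] at hpw
    rw [newDoors_append, Multiset.map_add] at hYn hY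
    rw [Multiset.map_add, Multiset.nodup_add] at hYn
    rw [supp_add, Set.disjoint_union_left] at hY
    have hL' : T.links = (Link.box ⟨k, Θ, aux, main⟩, unit) ::ₘ
        (atUnit ((bs : Multiset (Box (Con (d + 1)))).map Link.box) + L) := by
      rw [hL, ← Multiset.cons_coe, Multiset.map_cons, atUnit_cons, Multiset.cons_add]; rfl
    have hdis : ∀ b ∈ bs, ∀ o ∈ Box.outer (⟨k, Θ, aux, main⟩ : Box (Con (d + 1))), o ∉ b.outer :=
      fun b hb => hT.box_disjoint hL' (w := unit)
        (Multiset.mem_add.2 (Or.inl (mem_atUnit.2 ⟨Multiset.mem_map_of_mem _ hb, rfl⟩)))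
    have hXb : ∀ x ∈ X, x ∈ Box.outer (⟨k, Θ, aux, main⟩ : Box (Con (d + 1))) := fun x hx =>
      Multiset.mem_add.2 (Or.inl (Multiset.mem_of_le hb.le_doors (Multiset.mem_add.2 (Or.inl hx))))
    -- The other boxes are exchanged first; the cut doors of the present box meanwhile count as
    -- ordinary conclusions.
    obtain ⟨T₁, hT₁, hF₁, hL₁, hc₁, he₁, hv₁⟩ := ih hT (Δ := X + Δ) (G := atUnit X + G)
      (L := (Link.box ⟨k, Θ, aux, main⟩, unit) ::ₘ L) (by rw [hc]; abel)
      (by rw [hF, atUnit_add]; abel) (by rw [hL', Multiset.add_cons]; rfl)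
      (fun x hx => hX x (Multiset.mem_add.2 (Or.inr hx))) hev₀ hcs.2 hcs₀.2 hpw.2.1
      (fun b hb o ho ho' => hj b (List.mem_cons_of_mem _ hb) o ho fun h => by
        rcases Multiset.mem_add.1 h with h | h
        · exact hdis b hb o (hXb o h) ho
        · exact ho' h) hYn.2.1 hY.2
    have hpd : Disjoint (copyEvars cs) (copyEvars css) :=
      Set.disjoint_left.2 fun y ⟨q, hq, hy⟩ ⟨q', hq', hy'⟩ =>
        Set.disjoint_left.1 (hpw.2.2 q hq q' hq') hy hy'
    obtain ⟨T₂, hT₂, hF₂, hL₂, hc₂, he₂, hv₂⟩ := hb.exchange h₀ hc₀ hT₁ (k := k) (main := main)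
      (Δ := (newDoors css t₀.doors).map (Occ.map j var) + Δ)
      (G := atUnit ((newDoors css t₀.doors).map (Occ.map j var)) + G) (j := j)
      (L := atUnit ((bs' : Multiset (Box (Con (d + 1)))).map
        (fun b => Link.box (b.map j var id))) + atUnit (Ws.map Link.weak) + L)
      (by rw [hc₁]; abel) (by rw [hF₁]; abel) (by rw [hL₁, Multiset.add_cons]; rfl)
      (fun x hx => hX x (Multiset.mem_add.2 (Or.inl hx)))
      (Disjoint.mono_left he₁ (Set.disjoint_union_left.2 ⟨hev₀, hcs₀.2⟩))
      (Disjoint.mono_right hv₁ (Set.disjoint_union_right.2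
        ⟨Set.disjoint_union_right.2 ⟨hcs.1, hcs₀.1⟩, hpd⟩)) hcs₀.1 hpw.1
      (fun o ho ho' => hj _ List.mem_cons_self o ho fun h => by
        rcases Multiset.mem_add.1 h with h | h
        · exact ho' h
        · obtain ⟨b, hb, hob⟩ := hAll.le_outer o (Multiset.mem_add.2 (Or.inl h))
          exact hdis b hb o ho hob) hYn.1 (by
        rw [ids_eq, hF₁]
        rw [ids_eq, hF, atUnit_add] at hY
        simp only [suppW_add, suppW_atUnit, Set.disjoint_union_right] at hY ⊢
        refine ⟨?_, hY.1.1.1, hY.1.2⟩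
        refine Set.disjoint_left.2 ?_
        rintro n ⟨o, ho, rfl⟩ ⟨o', ho', hn⟩
        exact Multiset.disjoint_left.1 hYn.2.2 (Multiset.mem_map_of_mem _ ho)
          (Multiset.mem_map.2 ⟨o', ho', hn.symm⟩))
    refine ⟨T₂, hT₂, ?_, ?_, ?_, ?_, ?_⟩
    · simp only [hF₂, newDoors_append, Multiset.map_add, atUnit_add]; abel
    · refine hL₂.trans ?_
      simp only [← Multiset.cons_coe, Multiset.map_cons, Multiset.map_add, atUnit_add, atUnit_cons,
        Multiset.cons_add]
      congr 1
      abel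
    · simp only [hc₂, newDoors_append, Multiset.map_add]; abel
    · rw [copyEvars_append, Set.union_comm (copyEvars cs), ← Set.union_assoc]
      exact he₂.trans (Set.union_subset_union_left _ he₁)
    · rw [copyEvars_append, Set.union_comm (copyEvars cs), ← Set.union_assoc]
      exact hv₂.trans (Set.union_subset_union_left _
        (Set.union_subset hv₁ fun x hx => Or.inl (Or.inr hx)))


/-! ### Clashes between new doors and doors not yet removed -/

/-- A finite set of natural numbers can be moved away from another by an involution. -/
theorem exists_involutive (s t : Multiset ℕ) : ∃ j : ℕ → ℕ, Function.Involutive j ∧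
    (∀ n ∈ s, j n ∉ t) ∧ ∀ n ∈ t, n ∉ s → j n = n := by
  -- `B` exceeds every element of both multisets, so swapping `n` with `n + B` for `n` in `s` is
  -- well defined and leads out of `t`.
  set B := (s + t).sup + 1 with hB
  have hlt : ∀ n ∈ s + t, n < B := fun n hn => Nat.lt_succ_of_le (Multiset.le_sup hn)
  have hs : ∀ n ∈ s, n < B := fun n hn => hlt n (Multiset.mem_add.2 (Or.inl hn))
  have ht : ∀ n ∈ t, n < B := fun n hn => hlt n (Multiset.mem_add.2 (Or.inr hn))
  refine ⟨fun n => if n ∈ s then n + B else if B ≤ n ∧ n - B ∈ s then n - B else n, ?_, ?_, ?_⟩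
  · intro n
    by_cases h1 : n ∈ s
    · have : n + B ∉ s := fun h => absurd (hs _ h) (by omega)
      simp [h1, this]
    · by_cases h2 : B ≤ n ∧ n - B ∈ s
      · simp only [h1, h2, if_false, and_self, if_true]; omega
      · simp only [h1, h2, if_false]
  · intro n hn h
    simp only [hn, if_true] at h
    exact absurd (ht _ h) (by omega)
  · intro n hn hns
    have : ¬ (B ≤ n) := by have := ht n hn; omega
    simp [hns, this]

theorem PTree.map_map_involutive {j : ℕ → ℕ} (hj : Function.Involutive j) (t : PTree) :
    (t.map j var).map j var = t := by
  induction t with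
  | leaf x A => simp [PTree.map, hj x, Fm.fsub_var]
  | node l r hl hr => simp [PTree.map, hl, hr]

theorem Box.map_map_involutive {β : Type} {j : ℕ → ℕ} (hj : Function.Involutive j) (b : Box β)
    {g : β → β} (hg : g b.content = b.content) : (b.map j var id).map j var g = b := by
  rcases b with ⟨k, N, aux, main⟩
  simp only [Box.map, Box.mk.injEq, true_and, Multiset.map_map]
  refine ⟨hg, ?_, ?_⟩
  · exact (Multiset.map_congr rfl fun q _ => by
      simp [PTree.map_map_involutive hj]).trans (Multiset.map_id' _)
  · exact (Multiset.map_congr rfl fun q _ => by simp [Fm.fsub_var, hj q.2]).trans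
      (Multiset.map_id' _)

theorem Occ.map_map_involutive {j : ℕ → ℕ} (hj : Function.Involutive j) (o : Occ) :
    (o.map j var).map j var = o := by
  simp [Occ.map, Fm.fsub_var, hj o.id]

/-- Boxes of weight `1` may absorb a `!`-box. -/
theorem AbsorbAll.replace {Θ₀ : Net d} {r₀ : ℕ} {t₀ : PTree} {a₀ : Occ}
    {bs bs' : List (Box (Con (d + 1)))} {xs W : Multiset Occ} {cs : List (Copy d)}
    (h : AbsorbAll Θ₀ r₀ t₀ a₀ bs xs bs' W cs) (h₀ : Simple Θ₀)
    (hc₀ : Θ₀.concl = {⟨r₀, t₀.fml⟩, a₀}) {T : Net (d + 1)}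
    (hT : Simple T) {Δ : Multiset Occ} {G : Multiset (Occ × Weight)}
    {L : Multiset (Link (Con (d + 1)) × Weight)} (hc : T.concl = xs + Δ)
    (hF : T.forms = atUnit xs + G)
    (hL : T.links = atUnit ((bs : Multiset (Box (Con (d + 1)))).map Link.box) + L)
    (hX : ∀ x ∈ xs, x.fml = Fm.quest a₀.fml.neg) (hev₀ : Disjoint (Net.evars T) (Net.vars Θ₀))
    (hcs : Disjoint (copyEvars cs) (Net.vars T)) (hcs₀ : Disjoint (copyEvars cs) (Net.vars Θ₀))
    (hpw : cs.Pairwise fun q q' => Disjoint (Net.evars q.net) (Net.evars q'.net))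
    (hYn : ((newDoors cs t₀.doors).map Occ.id).Nodup)
    (hY : Disjoint (supp oid (newDoors cs t₀.doors)) (fids G)) :
    ∃ T' : Net (d + 1), Simple T' ∧ T'.forms = atUnit (newDoors cs t₀.doors) + G ∧
      T'.links = atUnit ((bs' : Multiset (Box (Con (d + 1)))).map Link.box) +
        atUnit (W.map Link.weak) + L ∧
      T'.concl = newDoors cs t₀.doors + Δ ∧ Net.evars T' ⊆ Net.evars T ∪ copyEvars cs ∧
      Net.vars T' ⊆ Net.vars T ∪ Net.vars Θ₀ ∪ copyEvars cs := by
  -- The new doors may reuse vertices of cut doors, and these are still present while the boxes are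
  -- exchanged one after the other. So the new doors are displaced by `j`, and a second application
  -- of `j` to the final net puts them where they belong.
  obtain ⟨j, hj, hj1, hj2⟩ := exists_involutive ((newDoors cs t₀.doors).map Occ.id)
    (T.forms.map fun f => f.1.id)
  have hbs : ∀ b ∈ bs, (Link.box b, unit) ∈ T.links := fun b hb => by
    rw [hL]
    exact Multiset.mem_add.2 (Or.inl (mem_atUnit.2 ⟨Multiset.mem_map_of_mem _ hb, rfl⟩))
  have hfixG : ∀ f ∈ G, j f.1.id = f.1.id := fun f hf => by
    refine hj2 _ (Multiset.mem_map.2 ⟨f, by rw [hF]; simp [hf], rfl⟩) fun h => ?_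
    obtain ⟨o, ho, ho'⟩ := Multiset.mem_map.1 h
    exact Set.disjoint_left.1 hY ⟨o, ho, rfl⟩ ⟨f, hf, ho'⟩
  obtain ⟨T₁, hT₁, hF₁, hL₁, hc₁, he₁, hv₁⟩ := h.exchange h₀ hc₀ hT hc hF hL hX hev₀ hcs hcs₀ hpw
    (j := j) (fun b hb o ho hox => by
      obtain ⟨w, hw⟩ := hT.wf.occ_mem _ (hbs b hb) o (Multiset.mem_add.2 (Or.inr ho))
      rw [hF] at hw
      exact hfixG (o, w) ((Multiset.mem_add.1 hw).resolve_left fun h => hox (mem_atUnit.1 h).1))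
    (by
      have := hYn.map hj.injective
      rw [Multiset.map_map] at this ⊢
      exact this)
    (by
      refine Set.disjoint_left.2 ?_
      rintro n ⟨o, ho, rfl⟩ ⟨f, hf, hf'⟩
      obtain ⟨o', ho', rfl⟩ := Multiset.mem_map.1 ho
      exact hj1 o'.id (Multiset.mem_map_of_mem _ ho') (Multiset.mem_map.2 ⟨f, hf, hf'⟩))
  -- Displaced doors avoid all vertices of `T`, so an occurrence of both nets lies in `G`, where `j`
  -- is the identity. The second application of `j` hence changes nothing but the doors from copies.
  have hfix : ∀ o : Occ, (∃ w, (o, w) ∈ T.forms) → (∃ w, (o, w) ∈ T₁.forms) → j o.id = o.id := by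
    rintro o ⟨w, hw⟩ ⟨w', hw'⟩
    rw [hF₁] at hw'
    rcases Multiset.mem_add.1 hw' with h | h
    · obtain ⟨o', ho', rfl⟩ := Multiset.mem_map.1 (mem_atUnit.1 h).1
      exact absurd (Multiset.mem_map.2 ⟨_, hw, rfl⟩) (hj1 o'.id (Multiset.mem_map_of_mem _ ho'))
    · exact hfixG _ h
  refine ⟨T₁.map j id id var, hT₁.rename hj.injective.injOn Function.injective_id.injOn, ?_, ?_,
    ?_, ?_, ?_⟩
  · rw [Net.map_eq, hF₁, Multiset.map_add]
    refine congrArg₂ (· + ·) ?_ ?_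
    · rw [atUnit, Multiset.map_map, Multiset.map_map]
      refine Multiset.map_congr rfl fun o _ => ?_
      simp [fmap, Occ.map_map_involutive hj]
    · exact (Multiset.map_congr rfl fun f hf =>
        fmap_self (Occ.rename_self (hfixG f hf))).trans (Multiset.map_id _)
  · have hl : ∀ l ∈ atUnit (W.map Link.weak) + L, lmap j id id var l = l := by
      intro l hl
      refine lmap_self_var fun o ho => hfix o ?_ ?_
      · rcases Multiset.mem_add.1 hl with h' | h'
        · obtain ⟨o', ho', h''⟩ := Multiset.mem_map.1 (mem_atUnit.1 h').1
          rw [← h''] at ho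
          obtain rfl : o = o' := by simpa [Link.occs, Link.prems, Link.concls] using ho
          obtain ⟨b, hb, hob⟩ := h.le_outer o (Multiset.mem_add.2 (Or.inr ho'))
          exact hT.wf.occ_mem _ (hbs b hb) o (Multiset.mem_add.2 (Or.inr hob))
        · exact hT.wf.occ_mem l (by rw [hL]; exact Multiset.mem_add.2 (Or.inr h')) o ho
      · exact hT₁.wf.occ_mem l (by
          rw [hL₁, add_assoc]; exact Multiset.mem_add.2 (Or.inr hl)) o ho
    rw [Net.map_eq, hL₁, add_assoc, Multiset.map_add, Multiset.map_congr rfl hl, Multiset.map_id',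
      add_assoc]
    refine congrArg (· + _) ?_
    rw [atUnit, atUnit, Multiset.map_map, Multiset.map_map, Multiset.map_map]
    refine Multiset.map_congr rfl fun b _ => ?_
    exact Prod.ext (congrArg Link.box (Box.map_map_involutive hj b
      (Con.map_self_var (d + 1) b.content))) (weight_map_id _)
  · rw [Net.map_eq, hc₁, Multiset.map_add, Multiset.map_map]
    refine congrArg₂ (· + ·) ?_ ?_
    · exact (Multiset.map_congr rfl fun o _ => Occ.map_map_involutive hj o).trans
        (Multiset.map_id' _)
    · refine (Multiset.map_congr rfl fun o ho => Occ.rename_self (hfix o ?_ ?_)).trans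
        (Multiset.map_id' _)
      · exact ⟨unit, hT.wf.mem_forms (by rw [hc]; simp [ho])⟩
      · exact ⟨unit, hT₁.wf.mem_forms (by rw [hc₁]; simp [ho])⟩
  · rw [Net.rename_evars]; exact he₁
  · exact (Net.rename_vars _ _ _).trans hv₁

/-! ### Contracting the new doors to the old ones -/

/-- The net `T'` arises from `T` by rules that introduce no eigenweights and no eigenvariables, and no
variables besides those of `V`. -/
structure Tame (T T' : Net d) (V : Set ℕ) : Prop where
  evars : Net.evars T' = Net.evars T
  vars : Net.vars T' ⊆ Net.vars T ∪ V
  eigenweights : T'.eigenweights = T.eigenweights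

theorem Tame.refl (T : Net d) (V : Set ℕ) : Tame T T V := ⟨rfl, Set.subset_union_left, rfl⟩

theorem Tame.trans {T T' T'' : Net d} {V V' : Set ℕ} (h : Tame T T' V) (h' : Tame T' T'' V') :
    Tame T T'' (V ∪ V') :=
  ⟨h'.evars.trans h.evars, h'.vars.trans (by
    rw [← Set.union_assoc]; exact Set.union_subset_union_left _ h.vars),
    h'.eigenweights.trans h.eigenweights⟩

theorem Tame.mono {T T' : Net d} {V V' : Set ℕ} (h : Tame T T' V) (hV : V ⊆ V') : Tame T T' V' :=
  ⟨h.evars, h.vars.trans (Set.union_subset_union_right _ hV), h.eigenweights⟩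

theorem Tame.extend {T : Net d} {l : Link (Con d)} (c : Occ) (Γ : Multiset Occ)
    (h1 : l.evars (Con.evars d) = ∅) (h2 : l.vars (Con.vars d) = ∅) (h3 : l.eigenweights = ∅) :
    Tame T (T.extend l c Γ) (ovar c) := by
  refine ⟨?_, ?_, ?_⟩
  · rw [Net.extend_evars, h1, Set.empty_union]
  · rw [Net.extend_vars, h2, Set.union_empty, Set.union_comm]; rfl
  · simp only [eigenweights_eq, PreNet.extend, suppW_cons, h3, Set.empty_union]

theorem Gather.atUnit_le {xs : Multiset Occ} {z : Occ} {L : Multiset (Link (Con d) × Weight)}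
    {F : Multiset (Occ × Weight)} (h : Gather xs z L F) : atUnit xs ≤ F ∧ (z, unit) ∈ F := by
  cases h with
  | none => simp
  | single => simp
  | many _ _ h => exact ⟨Multiset.le_cons_self _ _, Multiset.mem_cons_self _ _⟩

/-- The three cases are a weakening rule, no rule at all, and a contraction rule. -/
theorem Gather.simple {xs : Multiset Occ} {z : Occ} {L : Multiset (Link (Con d) × Weight)}
    {F : Multiset (Occ × Weight)} (h : Gather xs z L F) {T : Net d} (hT : Simple T)
    {Δ : Multiset Occ} {G : Multiset (Occ × Weight)} (hc : T.concl = xs + Δ)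
    (hF : T.forms = atUnit xs + G) {A : Formula} (hz : z.fml = Fm.quest A)
    (hxs : ∀ x ∈ xs, x.fml = z.fml) (hn : ((F + G).map fun f => f.1.id).Nodup)
    (hev : Disjoint (ovar z) (Net.evars T)) :
    ∃ T' : Net d, Simple T' ∧ T'.forms = F + G ∧ T'.links = L + T.links ∧ T'.concl = z ::ₘ Δ ∧
      Tame T T' (ovar z) := by
  cases h with
  | none =>
    refine ⟨_, Simple.weak z A hT ⟨?_, hev⟩ hz, ?_, rfl, ?_, Tame.extend z T.concl rfl rfl rfl⟩
    · rw [Multiset.singleton_add, nodup_cons_iff] at hn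
      rw [ids_eq, hF]
      simpa using hn.1
    · simp [PreNet.extend, hF]
    · simp [PreNet.extend, hc]
  | single =>
    exact ⟨T, hT, by simpa using hF, by simp, by simpa using hc, Tame.refl _ _⟩
  | many _ _ h2 =>
    refine ⟨_, Simple.contr xs z A hT hc h2 (fun x hx => (hxs x hx).trans hz) hz ⟨?_, hev⟩, ?_, ?_,
      rfl, Tame.extend z Δ rfl rfl rfl⟩
    · rw [Multiset.cons_add, nodup_cons_iff, ← hF] at hn
      rw [ids_eq]; exact hn.1
    · simp [PreNet.extend, hF, Multiset.cons_add]
    · simp [PreNet.extend]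

theorem newDoors_zero (cs : List (Copy d)) : newDoors cs 0 = 0 := by
  induction cs with
  | nil => simp
  | cons q cs ih => rw [newDoors_cons, ih]; simp

theorem newDoors_cons_right (cs : List (Copy d)) (z : Occ) (ds : Multiset Occ) :
    newDoors cs (z ::ₘ ds) =
      ((cs.map fun q => (⟨q.door z.id, z.fml⟩ : Occ)) : Multiset Occ) + newDoors cs ds := by
  induction cs with
  | nil => simp
  | cons q cs ih =>
    rw [newDoors_cons, newDoors_cons, ih]
    simp only [Multiset.map_add, Multiset.map_singleton, List.map_cons, ← Multiset.cons_coe,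
      ← Multiset.singleton_add]
    abel

/-- Thus the distinctness of vertices assumed of the final net already holds for the doors of the
copies. -/
theorem Merge.atUnit_le {cs : List (Copy d)} {zs : List Occ}
    {L : Multiset (Link (Con (d + 1)) × Weight)} {F : Multiset (Occ × Weight)}
    (h : Merge cs zs L F) : atUnit (newDoors cs zs) ≤ F := by
  induction h with
  | nil => simp [newDoors_zero]
  | cons z ws h hws hg ih =>
    rw [← Multiset.cons_coe, newDoors_cons_right, atUnit_add]
    refine add_le_add (le_trans ?_ hg.atUnit_le.1) ih
    exact atUnit_mono (Multiset.le_add_right _ _)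

theorem Merge.simple {cs : List (Copy d)} {zs : List Occ}
    {L : Multiset (Link (Con (d + 1)) × Weight)} {F : Multiset (Occ × Weight)}
    (h : Merge cs zs L F) {T : Net (d + 1)} (hT : Simple T) {Δ : Multiset Occ}
    {G : Multiset (Occ × Weight)} (hc : T.concl = newDoors cs zs + Δ)
    (hF : T.forms = atUnit (newDoors cs zs) + G) (hq : ∀ z ∈ zs, ∃ A, z.fml = Fm.quest A)
    (hn : ((F + G).map fun f => f.1.id).Nodup)
    (hev : Disjoint (supp ovar (zs : Multiset Occ)) (Net.evars T)) :
    ∃ T' : Net (d + 1), Simple T' ∧ T'.forms = F + G ∧ T'.links = L + T.links ∧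
      T'.concl = zs + Δ ∧ Tame T T' (supp ovar (zs : Multiset Occ)) := by
  induction h generalizing Δ G with
  | nil =>
    exact ⟨T, hT, by simpa [newDoors_zero] using hF, by simp, by simpa [newDoors_zero] using hc,
      Tame.refl _ _⟩
  | @cons zs L L₁ F F₁ z ws h hws hg ih =>
    obtain ⟨A, hA⟩ := hq z List.mem_cons_self
    rw [← Multiset.cons_coe, newDoors_cons_right] at hc hF
    rw [← Multiset.cons_coe, supp_cons, Set.disjoint_union_left] at hev
    generalize hD : ((cs.map fun q => (⟨q.door z.id, z.fml⟩ : Occ)) : Multiset Occ) = D at *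
    have hDz : ∀ x ∈ D + ws, x.fml = z.fml := by
      intro x hx
      rcases Multiset.mem_add.1 hx with hx | hx
      · rw [← hD] at hx
        obtain ⟨q, -, rfl⟩ := List.mem_map.1 (Multiset.mem_coe.1 hx)
        rfl
      · exact hws x hx
    obtain ⟨F₂, hF₂⟩ := Multiset.le_iff_exists_add.1 hg.atUnit_le.1
    -- Every occurrence of the intermediate nets survives as a premise of a contraction or as `z`
    -- itself. So the freshness needed on the way follows from that of the final net.
    have hn' : (((F + (atUnit D + G)) + atUnit ws).map fun f => f.1.id).Nodup := by
      refine Multiset.nodup_of_le (Multiset.map_le_map ?_) hn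
      rw [hF₂, atUnit_add]
      refine Multiset.le_iff_exists_add.2 ⟨F₂, ?_⟩
      abel
    obtain ⟨T₁, hT₁, hF₁, hL₁, hc₁, ht₁⟩ := ih (Δ := D + Δ) (G := atUnit D + G)
      (by rw [hc]; abel) (by rw [hF, atUnit_add]; abel)
      (fun z hz => hq z (List.mem_cons_of_mem _ hz)) (nodup_add_iff.1 hn').1 hev.2
    have hov : supp ovar ws ⊆ ovar z := by
      rintro x ⟨o, ho, hx⟩
      rw [ovar, ← hws o ho]; exact hx
    rw [← hF₁, nodup_add_iff] at hn'
    have hT₂ : Simple (weakNet ws T₁) := by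
      refine hT₁.weaken (fun o ho => ⟨A, (hws o ho).trans hA⟩) (by simpa [atUnit] using hn'.2.1) ?_ ?_
      · rw [ids_eq]
        have := hn'.2.2.symm
        simpa only [suppW_atUnit] using this
      · rw [ht₁.evars]; exact hev.1.mono_left hov
    have ht₂ : Tame T₁ (weakNet ws T₁) (ovar z) :=
      ⟨weakNet_evars _ _, by
        rw [weakNet_vars, Set.union_comm]; exact Set.union_subset_union_right _ hov,
        weakNet_eigenweights _ _⟩
    obtain ⟨T₃, hT₃, hF₃, hL₃, hc₃, ht₃⟩ := hg.simple hT₂ (Δ := zs + Δ) (G := F + G)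
      (by simp only [weakNet, hc₁]; abel) (by simp only [weakNet, hF₁, atUnit_add]; abel) hA hDz
      (by rw [← add_assoc]; exact hn) (by rw [weakNet_evars, ht₁.evars]; exact hev.1)
    refine ⟨T₃, hT₃, by rw [hF₃, add_assoc], ?_, ?_, ((ht₁.trans ht₂).trans ht₃).mono ?_⟩
    · rw [hL₃]; simp only [weakNet, hL₁]; abel
    · rw [hc₃, ← Multiset.cons_coe, Multiset.cons_add]
    · rw [← Multiset.cons_coe, supp_cons]
      intro x hx
      simp only [Set.mem_union] at hx ⊢; tauto


/-! ### The contraction step -/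

/-- The net on the side of the contraction in a ready cut between a box and a contraction. -/
theorem Simple.ready_gather {N : Net d} (hN : Simple N) {k l : Link (Con d)} {u z : Occ}
    {xs : Multiset Occ} {Lz L : Multiset (Link (Con d) × Weight)} {Fz : Multiset (Occ × Weight)}
    (hr : Ready N k u z) (hxs : xs ≠ 0) (hz : Gather xs z Lz Fz)
    (hL : N.links = (k, unit) ::ₘ (l, unit) ::ₘ (Lz + L)) (hu : u ∈ l.concls) :
    ∃ (S T S₂ : Net d) (Γ Δ K P O : Multiset Occ) (F₂ G : Multiset (Occ × Weight))
      (L₂ : Multiset (Link (Con d) × Weight)), LastRule S l ∧ Simple S ∧ Simple T ∧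
        Net.Apart S T ∧ S.concl = u ::ₘ Γ ∧ T.concl = xs + Δ ∧ (∀ x ∈ xs, x.fml = z.fml) ∧
          z.fml = u.fml.neg ∧ T.forms = atUnit xs + G ∧ S₂.forms = Fz + G ∧
            S₂.links = Lz + T.links ∧ Tame T S₂ (ovar z) ∧ Net.vars T ⊆ Net.vars S₂ ∧
              Hole N (cutNet k S S₂ Γ Δ) K P O F₂ L₂ := by
  cases hz with
  | none => exact absurd rfl hxs
  | single =>
    obtain ⟨S, T, Γ, Δ, K, P, O, F, L, hlast, hS, hT, hap, hcS, hcT, hf, hole⟩ :=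
      hN.ready_left hr (l := l) (by simp [hL]) hu
    obtain ⟨G, hG⟩ := Multiset.exists_cons_of_mem
      (hT.wf.mem_forms (by rw [hcT]; simp : z ∈ T.concl))
    exact ⟨S, T, T, Γ, Δ, K, P, O, F, G, L, hlast, hS, hT, hap, hcS, by simpa using hcT, by simp,
      hf, by simpa using hG, by simpa using hG, by simp, Tame.refl _ _, subset_rfl, hole⟩
  | many _ _ h2 =>
    obtain ⟨S, S₂, Γ, Δ, K, P, O, F, L, hlast, h₂, hS, hS₂, hap, hcS, hcz, hf, hole⟩ :=
      hN.ready hr (l₁ := l) (l₂ := .contr xs z) (by simp [hL]) hu (by simp [hL])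
        (by simp [Link.concls])
    obtain ⟨T, Γ₂, A, hT, hcT, -, hA, hzA, hzT, rfl⟩ := h₂
    obtain rfl : Γ₂ = Δ := by simpa [PreNet.extend] using hcz
    obtain ⟨G, hG⟩ := Multiset.le_iff_exists_add.1
      (le_trans (atUnit_mono (hcT ▸ Multiset.le_add_right xs Γ₂)) hT.wf.concl_le)
    have hv : Net.vars T ⊆ Net.vars (T.extend (.contr xs z) z Γ₂) := by
      rw [Net.extend_vars]; exact Set.subset_union_right
    refine ⟨S, T, _, Γ, Γ₂, K, P, O, F, G, L, hlast, hS, hT, ?_, hcS, hcT,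
      fun x hx => (hA x hx).trans hzA.symm, hf, hG, ?_, ?_, Tame.extend z Γ₂ rfl rfl rfl, hv, hole⟩
    · refine hap.symm.of_subset ?_ ?_ ?_ hv |>.symm
      all_goals
        simp only [PreNet.extend, suppW_cons]; exact Set.subset_union_right
    · simp [PreNet.extend, hG, Multiset.cons_add]
    · simp [PreNet.extend]

/-- Each absorbing box owns a cut door; this is what places the boxes on the contraction side of the
cut. -/
theorem AbsorbAll.exists_mem {Θ₀ : Net d} {r₀ : ℕ} {t₀ : PTree} {a₀ : Occ}
    {bs bs' : List (Box (Con (d + 1)))} {xs W : Multiset Occ} {cs : List (Copy d)}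
    (h : AbsorbAll Θ₀ r₀ t₀ a₀ bs xs bs' W cs) : ∀ b ∈ bs, ∃ x ∈ xs, x ∈ b.outer := by
  induction h with
  | nil => simp
  | @cons bs bs' Xs Ws X W css cs Θ Θ' aux aux' k main h hb hX ih =>
    intro b hb'
    rcases List.mem_cons.1 hb' with rfl | hb'
    · obtain ⟨x, hx⟩ := Multiset.exists_mem_of_ne_zero hX
      exact ⟨x, Multiset.mem_add.2 (Or.inl hx), Multiset.mem_add.2 (Or.inl
        (Multiset.mem_of_le hb.le_doors (Multiset.mem_add.2 (Or.inl hx))))⟩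
    · obtain ⟨x, hx, hxb⟩ := ih b hb'
      exact ⟨x, Multiset.mem_add.2 (Or.inr hx), hxb⟩

/-- On the contraction side of the cut, the net `T` above the contraction has all cut doors as
conclusions. Its boxes absorb the `!`-box, exchanging these doors for doors of copies, and merging
gives back the auxiliary doors of the `!`-box. The outcome has the conclusions of the original cut
and goes into its context. The bound on variables is recorded for reduction inside boxes. -/
theorem Simple.step_contr {N : Net (d + 1)} (hN : Simple N) {F Fz F' : Multiset (Occ × Weight)}
    {L Lz L' : Multiset (Link (Con (d + 1)) × Weight)} {k : Link (Con (d + 1))} {Θ₀ : Net d}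
    {r₀ : ℕ} {t₀ : PTree} {a₀ : Occ} {c : ℕ} {z : Occ} {xs W : Multiset Occ}
    {bs bs' : List (Box (Con (d + 1)))} {cs : List (Copy d)}
    (hr : Ready N k ⟨c, Fm.bang a₀.fml⟩ z) (hxs : xs ≠ 0) (hz : Gather xs z Lz Fz)
    (hF : N.forms = (⟨c, Fm.bang a₀.fml⟩, unit) ::ₘ (Fz + atUnit (t₀.doors : Multiset Occ) + F))
    (hL : N.links = (k, unit) ::ₘ
      (Link.box ⟨Kind.bang, Θ₀, {(r₀, t₀)}, {(a₀, c)}⟩, unit) ::ₘ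
        (Lz + atUnit ((bs : Multiset (Box (Con (d + 1)))).map Link.box) + L))
    (habs : AbsorbAll Θ₀ r₀ t₀ a₀ bs xs bs' W cs) (hmerge : Merge cs t₀.doors L' F')
    (hid : ((F' + F).map fun f => f.1.id).Nodup)
    (hev : ∀ q ∈ cs, Disjoint (Net.evars q.net) (Net.vars N))
    (hevs : cs.Pairwise fun q q' => Disjoint (Net.evars q.net) (Net.evars q'.net)) :
    Simple (⟨F' + F, atUnit ((bs' : Multiset (Box (Con (d + 1)))).map Link.box) +
      atUnit (W.map Link.weak) + L' + L, N.concl⟩ : Net (d + 1)) ∧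
    Net.vars (⟨F' + F, atUnit ((bs' : Multiset (Box (Con (d + 1)))).map Link.box) +
      atUnit (W.map Link.weak) + L' + L, N.concl⟩ : Net (d + 1)) ⊆ Net.vars N ∪ copyEvars cs := by
  have hout := Box.outer_bang (β := Con (d + 1)) Θ₀ r₀ t₀ a₀ c
  have hL' : N.links = (k, unit) ::ₘ
      (Link.box ⟨Kind.bang, Θ₀, {(r₀, t₀)}, {(a₀, c)}⟩, unit) ::ₘ
        (Lz + (atUnit ((bs : Multiset (Box (Con (d + 1)))).map Link.box) + L)) := by
    rw [hL, add_assoc]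
  obtain ⟨S, T, S₂, Γ, Δ, K, P, O, F₂, G, L₂, ⟨hb, rfl⟩, hS, hT, hap, hcS, hcT, hxz, hzf, hTF, hSF,
    hSL, htame, hTv, hole⟩ := hN.ready_gather hr hxs hz hL' (by
      change _ ∈ Box.outer _
      rw [hout]; exact Multiset.mem_cons_self _ _)
  have hΓ : Γ = t₀.doors := (Multiset.cons_inj_right _).1 (hcS.symm.trans hout)
  subst hΓ
  have hFG : F = G + F₂ := by
    have := hF.symm.trans hole.forms
    simp only [cutNet, leafNet_box, hSF] at this
    rw [hout, atUnit_cons, Multiset.cons_add, Multiset.cons_add, Multiset.cons_inj_right] at this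
    rw [← add_right_inj (Fz + atUnit (t₀.doors : Multiset Occ)), this]
    abel
  have hLL : T.links + L₂ = atUnit ((bs : Multiset (Box (Con (d + 1)))).map Link.box) + L := by
    have := hL'.symm.trans hole.links
    simp only [cutNet, leafNet_box, hSL] at this
    rw [Multiset.singleton_add, Multiset.cons_add, Multiset.cons_add, Multiset.cons_inj_right,
      Multiset.cons_inj_right, add_assoc, add_right_inj] at this
    exact this.symm
  -- The given list of links does not say which are in `T` and which in the context. An absorbing
  -- box cannot be in the context: one of its doors is a cut door, a vertex inside the cut, whereas
  -- links of the context conclude only vertices outside.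
  obtain ⟨L₁, hL₁, rfl⟩ : ∃ L₁, T.links =
      atUnit ((bs : Multiset (Box (Con (d + 1)))).map Link.box) + L₁ ∧ L = L₁ + L₂ := by
    classical
    obtain ⟨w, x, y, y', h1, h2, h3, h4⟩ := Multiset.riesz hLL
    have hy : y = 0 := by
      refine Multiset.eq_zero_of_forall_notMem fun l hl => ?_
      have hl' : l ∈ atUnit ((bs : Multiset (Box (Con (d + 1)))).map Link.box) := by
        rw [h3]; exact Multiset.mem_add.2 (Or.inr hl)
      obtain ⟨b, hb', hbl⟩ := Multiset.mem_map.1 (mem_atUnit.1 hl').1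
      obtain ⟨o, ho, hob⟩ := habs.exists_mem b hb'
      obtain ⟨v, hv⟩ := hole.concls l (by rw [h2]; exact Multiset.mem_add.2 (Or.inl hl)) o
        (by rw [← hbl]; exact hob)
      have ho' : (o, unit) ∈ S₂.forms := by
        rw [hSF]
        exact Multiset.mem_add.2
          (Or.inl (Multiset.mem_of_le hz.atUnit_le.1 (mem_atUnit.2 ⟨ho, rfl⟩)))
      exact Set.disjoint_left.1 hole.ids ⟨_, Multiset.mem_add.2 (Or.inr ho'), rfl⟩ ⟨_, hv, rfl⟩
    subst hy
    rw [add_zero] at h3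
    rw [zero_add] at h2
    exact ⟨x, by rw [h1, h3], by rw [h4, h2]⟩
  subst hFG
  have hd₀ := hap.2.2
  rw [leafNet_box_evars, leafNet_box_vars] at hd₀
  have hd : Disjoint (Net.evars T) (supp ovar (t₀.doors : Multiset Occ) ∪ Net.vars Θ₀) := by
    refine (hd₀.2.symm).mono_right (Set.union_subset_union_left _ ?_)
    rw [hout, supp_cons]
    exact Set.subset_union_right
  rw [Set.disjoint_union_right] at hd
  have hSN : Net.vars (cutNet k (leafNet (Link.box ⟨Kind.bang, Θ₀, {(r₀, t₀)}, {(a₀, c)}⟩)) S₂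
      (t₀.doors : Multiset Occ) Δ) ⊆ Net.vars N := by
    rw [vars_eq, vars_eq, hole.forms, hole.links]
    simp only [suppW_add]
    exact Set.union_subset_union Set.subset_union_left Set.subset_union_left
  rw [cutNet_vars hr.1, leafNet_box_vars] at hSN
  have hΘN : Net.vars Θ₀ ⊆ Net.vars N := fun x hx => hSN (Or.inl (Or.inr hx))
  have hTN : Net.vars T ⊆ Net.vars N := fun x hx => hSN (Or.inr (hTv hx))
  have hce : Disjoint (copyEvars cs) (Net.vars N) :=
    Set.disjoint_left.2 fun x ⟨q, hq, hx⟩ hx' => Set.disjoint_left.1 (hev q hq) hx hx'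
  -- Distinctness is assumed only for the reduct, which contains the new doors but no longer the cut
  -- doors.
  have hnY : ((atUnit (newDoors cs t₀.doors) + (G + F₂)).map fun f => f.1.id).Nodup :=
    Multiset.nodup_of_le (Multiset.map_le_map (add_le_add_left hmerge.atUnit_le _)) hid
  rw [nodup_add_iff] at hnY
  rw [← add_assoc, nodup_add_iff] at hid
  cases hb with | mk _ _ _ hΘ hΘc _ _ => ?_
  obtain ⟨T₁, hT₁, hF₁, hL₁', hc₁, he₁, hv₁⟩ := habs.replace hΘ (hΘc.trans (by
      simp [Box.inner, Multiset.insert_eq_cons, ← Multiset.singleton_add])) hT hcT hTF hL₁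
    (fun x hx => (hxz x hx).trans hzf) hd.2 (hce.mono_right hTN) (hce.mono_right hΘN) hevs
    (by simpa [atUnit] using hnY.1)
    (by
      have := hnY.2.2
      simp only [suppW_atUnit, suppW_add, Set.disjoint_union_right] at this
      exact this.1)
  have hdN : supp ovar (t₀.doors : Multiset Occ) ⊆ Net.vars N := by
    refine Set.Subset.trans ?_ ((Set.subset_union_left.trans Set.subset_union_left).trans hSN)
    rw [hout, supp_cons]
    exact Set.subset_union_right
  obtain ⟨T₂, hT₂, hF₂, hL₂', hc₂, ht₂⟩ := hmerge.simple hT₁ hc₁ hF₁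
    (fun o ho => PTree.exists_quest ho) hid.1 (by
      refine Disjoint.mono_right he₁ (Set.disjoint_union_right.2 ⟨hd.1.symm, ?_⟩)
      exact (hce.mono_right hdN).symm)
  have hFLN : fvars F₂ ∪ lvars L₂ ⊆ Net.vars N := by
    rw [vars_eq, hole.forms, hole.links]
    simp only [suppW_add]
    exact Set.union_subset_union Set.subset_union_right Set.subset_union_right
  have hT₂N : Net.vars T₂ ⊆ Net.vars N ∪ copyEvars cs := by
    refine ht₂.vars.trans (Set.union_subset (hv₁.trans ?_) (hdN.trans Set.subset_union_left))
    exact Set.union_subset_union_left _ (Set.union_subset hTN hΘN)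
  -- Compatibility holds because the only names new to the context are the vertices, separated by
  -- `hid`, and the fresh eigenvariables of the copies.
  have := hole.replace hT₂ (by rw [hc₂]; rfl) ⟨by rw [hF₂]; exact hid.2.2, ?_, ?_, ?_⟩
  · have hlinks : T₂.links + L₂ = atUnit ((bs' : Multiset (Box (Con (d + 1)))).map Link.box) +
        atUnit (W.map Link.weak) + L' + (L₁ + L₂) := by
      rw [hL₂', hL₁']; abel
    rw [hF₂, add_assoc, hlinks] at this
    refine ⟨this, ?_⟩
    rw [← add_assoc, ← hF₂, ← hlinks, vars_eq]
    simp only [suppW_add]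
    rintro x ((h | h) | (h | h))
    · exact hT₂N (Or.inl h)
    · exact Or.inl (hFLN (Or.inl h))
    · exact hT₂N (Or.inr h)
    · exact Or.inl (hFLN (Or.inr h))
  · refine hole.ew.mono_left ?_
    rw [← eigenweights_eq, ht₂.eigenweights, eigenweights_eq, hL₁']
    have hbs : supp Link.eigenweights ((bs' : Multiset (Box (Con (d + 1)))).map Link.box) = ∅ := by
      ext x; simp [supp, Link.eigenweights]
    simp only [cutNet, hSL, hL₁, suppW_cons, suppW_add, suppW_atUnit, supp_weak, hbs,
      Set.empty_union]
    exact fun x hx => Or.inr (Or.inr (Or.inr (Or.inr hx)))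
  · rw [← evars_eq, ht₂.evars]
    refine Disjoint.mono_left he₁ (Set.disjoint_union_left.2 ⟨?_, hce.mono_right hFLN⟩)
    refine hole.ev.mono_left ?_
    rw [← evars_eq, cutNet_evars hr.1, htame.evars]
    exact Set.subset_union_right
  · intro v hv hv'
    have hvc : v ∉ copyEvars cs := fun h =>
      Set.disjoint_left.1 hce h (hFLN (Or.inr (lev_subset_lvars _ hv)))
    rw [cutNet_vars hr.1, leafNet_box_vars]
    rcases ht₂.vars hv' with h | h
    · rcases hv₁ h with (h | h) | h
      · exact Or.inr (hTv h)
      · exact Or.inl (Or.inr h)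
      · exact absurd h hvc
    · refine Or.inl (Or.inl ?_)
      rw [hout, supp_cons]
      exact Or.inr h


/-! ### All steps together -/

theorem Chain.lev_eq {t : PTree} {r x u : ℕ} {A : Formula} {F : Multiset (Occ × Weight)}
    {L : Multiset (Link (Con d) × Weight)} (h : Chain t r x A u L F) : lev L = ∅ := by
  induction h with
  | leaf => simp
  | left r h ih => simp only [suppW_cons, ih]; simp [Link.evars]
  | right r h ih => simp only [suppW_cons, ih]; simp [Link.evars]

/-- Once inserted, a copy stays: what is removed afterwards is a `⊕`-chain, which binds no variable.
So new variables brought by copies are eigenvariables of the reduct. -/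
theorem Absorb.copyEvars_subset {Θ₀ Θ Θ' : Net d} {r₀ : ℕ} {t₀ : PTree} {a₀ : Occ}
    {aux aux' : Multiset (ℕ × PTree)} {X W : Multiset Occ} {cs : List (Copy d)}
    (h : Absorb Θ₀ r₀ t₀ a₀ Θ aux X Θ' aux' W cs) : copyEvars cs ⊆ Net.evars Θ' := by
  induction h with
  | nil => simp
  | keep r t h ih => exact ih
  | fake r t x u A h hchain hJ hdoors ih =>
    simp only [evars_eq, suppW_add, hchain.lev_eq, Set.empty_union] at ih ⊢
    exact ih
  | nonfake r t x u A door i w e h hchain hdoors hcopy hfix hid hew ih =>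
    simp only [evars_eq, copyEvars_cons, suppW_cons, suppW_add, hchain.lev_eq,
      Set.empty_union] at ih ⊢
    exact Set.union_subset (fun x hx => Or.inr (Or.inr hx)) fun x hx => Or.inr (Or.inl (ih hx))

theorem AbsorbAll.copyEvars_subset {Θ₀ : Net d} {r₀ : ℕ} {t₀ : PTree} {a₀ : Occ}
    {bs bs' : List (Box (Con (d + 1)))} {xs W : Multiset Occ} {cs : List (Copy d)}
    (h : AbsorbAll Θ₀ r₀ t₀ a₀ bs xs bs' W cs) :
    copyEvars cs ⊆ supp (Link.evars (Con.evars (d + 1)))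
      ((bs' : Multiset (Box (Con (d + 1)))).map Link.box) := by
  induction h with
  | nil => simp
  | @cons bs bs' Xs Ws X W css cs Θ Θ' aux aux' k main h hb hX ih =>
    rw [copyEvars_append, ← Multiset.cons_coe, Multiset.map_cons, supp_cons]
    exact Set.union_subset_union hb.copyEvars_subset ih

theorem suppW_restrict_subset {α : Type} (g : α → Set ℕ) (q : ℕ × Bool)
    (s : Multiset (α × Weight)) : suppW g (restrict q s) ⊆ suppW g s := by
  rintro x ⟨a, ha, hx⟩
  obtain ⟨a', ha', rfl⟩ := Multiset.mem_map.1 ha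
  exact ⟨a', Multiset.mem_of_mem_filter ha', hx⟩

theorem lvars_moveLinks (m n : ℕ) (L : Multiset (Link (Con d) × Weight)) :
    lvars (moveLinks m n L) ⊆ lvars L := by
  rw [moveLinks_eq]
  refine (lvars_map _ _ _ _ L).trans ?_
  rw [bvars_var, Set.image_id]
  exact Set.union_subset subset_rfl (lev_subset_lvars L)

/-- A step preserves simple proof nets and their conclusions, and the new variables are
eigenvariables. -/
theorem LazyStep.simple {N N' : Net d} (h : LazyStep N N') (hN : Simple N) :
    Simple N' ∧ N'.concl = N.concl ∧ Net.vars N' ⊆ Net.vars N ∪ Net.evars N' := by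
  -- The two additional claims are needed only in the case of a box: equal conclusions allow the box
  -- to be closed again, and new variables that are eigenvariables are fresh for the surroundings by
  -- the side condition of that rule.
  induction h with
  | ax k l x y z hl hxz hr =>
    refine ⟨hN.step_ax hl hxz hr, rfl, Set.subset_union_of_subset_left ?_ _⟩
    simp only [vars_eq, suppW_cons]
    exact Set.union_subset_union (fun n h => Or.inr (Or.inr h))
      fun n h => Or.inr (Or.inr (lvars_moveLinks _ _ _ h))
  | unit k c z hr hF hL =>
    refine ⟨hN.step_unit hr hF hL, rfl, Set.subset_union_of_subset_left ?_ _⟩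
    simp only [vars_eq, hF, hL, suppW_cons, Link.vars, Set.empty_union]
    intro n; simp +contextual only [Set.mem_union, true_or, or_true, or_imp, implies_true, and_self]
  | tensor k a b c x y z hr hF hL =>
    refine ⟨hN.step_tensor hr hF hL, rfl, Set.subset_union_of_subset_left ?_ _⟩
    simp only [vars_eq, hF, hL, suppW_cons, Link.vars, Set.empty_union]
    intro n; simp +contextual only [Set.mem_union, true_or, or_true, or_imp, implies_true, and_self]
  | plus₁ k p a b c x z hr hF hL =>
    refine ⟨hN.step_plus₁ hr hF hL, rfl, Set.subset_union_of_subset_left ?_ _⟩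
    simp only [vars_eq, hF, hL, suppW_cons, Link.vars, Set.empty_union]
    exact Set.union_subset_union (fun n h => Or.inr (Or.inr (suppW_restrict_subset _ _ _ h)))
      fun n h => Or.inr (suppW_restrict_subset _ _ _ h)
  | plus₂ k p a b c x z hr hF hL =>
    refine ⟨hN.step_plus₂ hr hF hL, rfl, Set.subset_union_of_subset_left ?_ _⟩
    simp only [vars_eq, hF, hL, suppW_cons, Link.vars, Set.empty_union]
    exact Set.union_subset_union (fun n h => Or.inr (Or.inr (suppW_restrict_subset _ _ _ h)))
      fun n h => Or.inr (suppW_restrict_subset _ _ _ h)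
  | @quant d N F L k v B a c x z hr hF hL =>
    obtain ⟨h1, h2⟩ := hN.step_quant hr hF hL
    refine ⟨h1, h2, ?_⟩
    -- The witness is recorded in the `∃`-link, so substituting it introduces no variable that `N`
    -- lacked.
    have hB : B.vars ⊆ Net.vars N := fun y hy =>
      Or.inr ⟨(Link.ex B x z, LLL.unit), by rw [hL]; simp, hy⟩
    have hsub : Net.vars (⟨F, (Link.cut a x, LLL.unit) ::ₘ L, N.concl⟩ : Net d) ⊆ Net.vars N := by
      simp only [vars_eq, hF, hL, suppW_cons, Link.vars, Set.empty_union]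
      intro n; simp +contextual only [Set.mem_union, true_or, or_true, or_imp, implies_true, and_self]
    rw [Net.map_evars, Set.image_id]
    refine (Net.map_vars _ _ _ _ _).trans ?_
    rw [Set.image_id]
    refine Set.union_subset_union_left _ ?_
    rintro n ⟨m, hm, hn⟩
    by_cases hmv : m = v
    · subst hmv
      rw [Function.update_self] at hn
      exact hB hn
    · rw [Function.update_of_ne hmv] at hn
      obtain rfl : n = m := hn
      exact hsub hm
  | neutral k Θ₁ Θ₂ Θ₃ aux₁ aux₂ main₁ main₂ a x c z Γ₁ Γ₂ i w hr hF hL h₁ h₂ h₃ hid hew =>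
    refine ⟨hN.step_neutral i w hr hF hL h₁ h₂ h₃ hid hew, rfl,
      Set.subset_union_of_subset_left ?_ _⟩
    have hv₃ : Net.vars Θ₃ ⊆ Net.vars Θ₂ := h₃ ▸ Net.rename_vars _ _ _
    rintro n (⟨f, hf, hn⟩ | ⟨l, hl, hn⟩)
    · exact Or.inl ⟨f, by rw [hF]; simp [show f ∈ _ from hf], hn⟩
    · rcases Multiset.mem_cons.1 hl with rfl | hl
      · rw [vars_eq, hL]
        right
        simp only [suppW_cons]
        have : n ∈ Net.vars (cutNet (Link.cut a ⟨i x.id, x.fml⟩) Θ₁ Θ₃ Γ₁ Γ₂) := hn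
        rw [cutNet_vars (Or.inl rfl)] at this
        rcases this with h | h
        · exact Or.inr (Or.inl h)
        · exact Or.inr (Or.inr (Or.inl (hv₃ h)))
      · exact Or.inr ⟨l, hL ▸ Multiset.mem_cons_of_mem
          (Multiset.mem_cons_of_mem (Multiset.mem_cons_of_mem hl)), hn⟩
  | weak k Θ₀ r₀ t₀ a₀ c z hr hF hL =>
    refine ⟨hN.step_weak hr hF hL, rfl, Set.subset_union_of_subset_left ?_ _⟩
    simp only [vars_eq, hF, hL, suppW_cons, suppW_add, suppW_atUnit, supp_weak, Set.empty_union]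
    intro n; simp +contextual only [Set.mem_union, true_or, or_true, or_imp, implies_true, and_self]
  | contr k Θ₀ r₀ t₀ a₀ c z xs W bs bs' cs hr hxs hz hF hL habs hmerge hid hev hevs =>
    obtain ⟨h1, h2⟩ := hN.step_contr hr hxs hz hF hL habs hmerge hid hev hevs
    refine ⟨h1, rfl, h2.trans (Set.union_subset_union_right _ (habs.copyEvars_subset.trans ?_))⟩
    simp only [evars_eq, suppW_add, suppW_atUnit]
    exact fun x hx => Or.inl (Or.inl (Or.inl hx))
  | fusion w x c xs ys hx hF hL =>
    refine ⟨hN.step_fusion hx hF hL, rfl, Set.subset_union_of_subset_left ?_ _⟩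
    simp only [vars_eq, hF, hL, suppW_cons, Link.vars, Set.empty_union]
    intro n; simp +contextual only [Set.mem_union, true_or, or_true, or_imp, implies_true, and_self]
  | cw w x c xs hx hF hL hxs =>
    refine ⟨hN.step_cw hx hF hL hxs, rfl, Set.subset_union_of_subset_left ?_ _⟩
    simp only [vars_eq, hF, hL, suppW_cons, Link.vars, Set.empty_union]
    intro n; simp +contextual only [Set.mem_union, true_or, or_true, or_imp, implies_true, and_self]
  | cw₁ w x y c hx hF hL =>
    refine ⟨hN.step_cw₁ hx hF hL, rfl, Set.subset_union_of_subset_left ?_ _⟩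
    simp only [vars_eq, hF, hL, suppW_cons, Link.vars, Set.empty_union]
    exact Set.union_subset_union (fun n h => Or.inr (Or.inr h)) (lvars_moveLinks _ _ _)
  | @box d N Θ Θ' L k aux main w hL h hev ih =>
    have hb := hN.boxes _ _ (hL ▸ Multiset.mem_cons_self _ _)
    have hΘ : Simple Θ := by cases hb; assumption
    obtain ⟨h1, h2, h3⟩ := ih hΘ
    refine ⟨hN.replace_box hL rfl ?_ hev h3, rfl, ?_⟩
    · intro hb
      cases hb with | mk _ _ _ hΘ h hk hid => ?_
      exact Simple.box k aux main h1 (h2.trans h) hk hid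
    · rintro n (hn | ⟨l, hl, hn⟩)
      · exact Or.inl (Or.inl hn)
      · rcases Multiset.mem_cons.1 hl with rfl | hl
        · rcases h3 hn with hn | hn
          · exact Or.inl (Or.inr ⟨(Link.box ⟨k, Θ, aux, main⟩, w), hL ▸ Multiset.mem_cons_self _ _, hn⟩)
          · exact Or.inr ⟨(Link.box ⟨k, Θ', aux, main⟩, w), Multiset.mem_cons_self _ _, hn⟩
        · exact Or.inl (Or.inr ⟨l, hL ▸ Multiset.mem_cons_of_mem hl, hn⟩)

end LLL

theorem mainTheorem6 {d : ℕ} (Θ₁ Θ₂ : LLL.Net d) (h₁ : LLL.Simple Θ₁)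
    (h₂ : LLL.LazyStep Θ₁ Θ₂) : LLL.Simple Θ₂ := by
  exact (h₂.simple h₁).1
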